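/- **Model.** An AMPC algorithm with $R$ rounds, $P$ machines and $O(S)$ words of memory per machine works on distributed hash tables $\mathcal D_0,\dots,\mathcal D_R$; a key and a value consist of $O(1)$ words, several values may be stored under one key (in arbitrary order, accessed by key and index), and $\mathcal D_0$ is the input. In round $t$ each machine draws at most $S$ private random words, makes at most $S$ adaptive queries to $\mathcal D_{t-1}$, performs arbitrary local computation, and writes at most $S$ key-value pairs to $\mathcal D_t$. The total memory is $P\cdot S$ words. **Degree-weighted trees.** A degree-weighted tree $T=(V,E,W)$ is a rooted tree on $n$ vertices (given by parent pointers) in which each vertex $v$ has a weight vector $W(v)$ of dimension $\widetilde O(\deg v)$, i.e. at most $\kappa(\deg(v)+1)(\lfloor\log_2 n\rfloor+1)^{k_0}$. The vector $W(v)$ stores a nonempty rooted tree of nodes (a component; a single node in the simplest case) and, for $v$ with parent $p$, the data of the edge from the root node of the component of $v$ to some node of the component of $p$. Joining all components along these edges gives one rooted tree $\widehat T$. Each node $x$ of $\widehat T$ has integer constants $a_x,b_x$, and each edge $(u,x)$ of $\widehat T$, $u$ a child of $x$, has four weights $\omega_1,\dots,\omega_4\in\mathbb Z\cup\{-\infty\}$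 (both ends, only the parent $x$, only the child $u$, neither end is matched along the edge). All finite numbers are at most $M$ in absolute value. With $Ch_x$ the children of $x$ in $\widehat T$ and $$c_{x,u}=\max\{\omega_3(u,x)+c'_u,\ \omega_4(u,x)+c_u\},\qquad m_{x,u}=\max\{\omega_1(u,x)+c'_u,\ \omega_2(u,x)+c_u\},$$ the matching table is defined from the leaves up by $$c'_x=b_x+\sum_{u\in Ch_x}c_{x,u},$$ $$c_x=b_x+\max\Big\{\sum_{u\in Ch_x}c_{x,u},\ \ a_x+\sum_{u\in Ch_x}c_{x,u},\ \ \max_{u\in Ch_x}\Big(m_{x,u}+\sum_{y\in Ch_x\setminus\{u\}}c_{x,y}\Big)\Big\}.$$ For a vertex $v$ of $T$, $c_v$ and $c'_v$ are the values at the root node of its component. The value of the maximum weighted matching of $T$ is $c_r$ for the root $r$ of $T$. **Lemma.** (1) There is an absolute constant $c_0$ such that for every $0<\epsilon<1$ and all $\kappa,k_0,\gamma\in\mathbb N$ there are constants $C,k$ such that for all $n,M$ there is an AMPC algorithm with - at most $c_0/\epsilon^3$ rounds, that is, $O(1/\epsilon^3)$, - $S\le C n^\epsilon$, that is, $O(n^\epsilon)$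 memory per machine, - $P\cdot S\le C\,n(\lfloor\log_2 n\rfloor+1)^k$, that is, $\widetilde O(n)$ total memory, - words that are integers of absolute value at most $(n+M+1)^C$, or $-\infty$ (that is, words of $O(\log(n+M+1))$ bits), which for every degree-weighted tree $T$ on $n$ vertices as above, with probability at least $1-(n+1)^{-\gamma}$, outputs $c_v$ and $c'_v$ for all vertices $v$ of $T$; in particular it outputs the value $c_r$ of the maximum weighted matching. (2) For an ordinary rooted tree with integer edge weights $w$, encoded by one-node components with $a=b=0$ and $\omega=(w,-\infty,-\infty,0)$ on every edge, $c_v$ is the maximum weight of a matching in the maximal subtree $T_v$ rooted at $v$, and $c'_v$ is the maximum weight of a matching in $T_v$ that leaves $v$ unmatched. -/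

import Mathlib

/-! ### The AMPC model -/

/-- A word: an integer, or the symbol `-∞` (which is `⊥`). -/
abbrev Word := WithBot ℤ

/-- The word `w` fits the word size given by `B`: its integer value, if any, lies in `[-B, B]`. -/
def Word.Fits (B : ℕ) (w : Word) : Prop := ∀ z : ℤ, w = (z : WithBot ℤ) → |z| ≤ (B : ℤ)

/-- A key of a distributed hash table consists of three words. -/
abbrev Key := ℕ × ℕ × ℕ

/-- A distributed hash table. Several values may be stored under one key; they are then accessed
by the key together with an index. -/
abbrev Table := Key → List Word

/-- The random words that one machine draws in one round: `S` of them, independent and uniform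
in `{0, …, B}`. -/
abbrev Coins (S B : ℕ) := Fin S → Fin (B + 1)

/-- A (randomized) AMPC algorithm with `R` rounds, `P` machines, `S` words of memory per machine
(up to a constant factor) and word bound `B`. In each round each machine draws `S` private random
words, makes `S` queries, each one chosen adaptively from the random words and the answers received
so far, and finally writes at most `S` key-value pairs that are a function of the random words and
of all the answers. The list of the answers is the content of the memory of the machine; local
computation is arbitrary, as usual in this model. -/
structure AMPC (R P S B : ℕ) where
  /-- the next query (a key and an index) -/
  query : Fin R → Fin P → Coins S B → List (Option Word) → Key × ℕ
  /-- the key-value pairs written at the end of the round -/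
  write : Fin R → Fin P → Coins S B → List (Option Word) → List (Key × Word)
  write_length : ∀ t i ρ l, (write t i ρ l).length ≤ S
  write_fits : ∀ t i ρ l, ∀ e ∈ write t i ρ l,
    e.1.1 ≤ B ∧ e.1.2.1 ≤ B ∧ e.1.2.2 ≤ B ∧ e.2.Fits B

namespace AMPC

variable {R P S B : ℕ}

/-- All random choices of a run: for each round and each machine, its private random words. -/
abbrev Rand (R P S B : ℕ) := Fin R → Fin P → Coins S B

/-- The answers that machine `i` has received in round `t` after `q` queries to the table `D`. A
query to an index under which the table holds nothing is answered by `none`. -/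
def answers (A : AMPC R P S B) (t : Fin R) (i : Fin P) (ρ : Coins S B) (D : Table) :
    ℕ → List (Option Word)
  | 0 => []
  | q + 1 =>
    let l := A.answers t i ρ D q
    let x := A.query t i ρ l
    l ++ [(D x.1)[x.2]?]

/-- The multiset of the values that all machines together write under the key `k` in round `t`,
when they read from the table `D`. -/
def written (A : AMPC R P S B) (t : Fin R) (ρ : Fin P → Coins S B) (D : Table) (k : Key) :
    Multiset Word :=
  ∑ i : Fin P,
    ((((A.write t i (ρ i) (A.answers t i (ρ i) D S)).filter (fun e => e.1 = k)).map Prod.snd :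
      List Word) : Multiset Word)

/-- `D 0, …, D R` is a run on the input table `D₀` with random choices `ρ`: in round `t` all
machines read only from `D t` and write only to `D (t + 1)`; the values written under the same key
are stored in an arbitrary order. -/
def IsRun (A : AMPC R P S B) (D₀ : Table) (ρ : Rand R P S B) (D : ℕ → Table) : Prop :=
  D 0 = D₀ ∧ ∀ t : Fin R, ∀ k : Key,
    ((D (t + 1) k : List Word) : Multiset Word) = A.written t (ρ t) (D t) k

/-- The run(s) with random choices `ρ` end in a table with property `Q`, in whatever order values
under equal keys are stored. -/
def Succeeds (A : AMPC R P S B) (D₀ : Table) (Q : Table → Prop) (ρ : Rand R P S B) : Prop :=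
  ∀ D : ℕ → Table, A.IsRun D₀ ρ D → Q (D R)

/-- The probability, over the random words, that the algorithm ends in a table with
property `Q`. -/
noncomputable def prob (A : AMPC R P S B) (D₀ : Table) (Q : Table → Prop) : ℝ :=
  (Nat.card {ρ : Rand R P S B // A.Succeeds D₀ Q ρ} : ℝ) / Nat.card (Rand R P S B)

end AMPC

/-! ### Degree-weighted trees and the matching table -/

/-- A rooted tree with vertex set `Fin n`, given by its parent pointers (the one of the root points
to the root itself). -/
structure RTree (n : ℕ) where
  root : Fin n
  par : Fin n → Fin n
  par_root : par root = root
  acyclic : ∃ h : Fin n → ℕ, ∀ v, v ≠ root → h (par v) < h v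

/-- The underlying graph of a rooted tree. -/
def RTree.graph {n : ℕ} (T : RTree n) : SimpleGraph (Fin n) :=
  SimpleGraph.fromRel (fun u v => T.par u = v)

/-- `u` is a vertex of the maximal subtree rooted at `v`. -/
def RTree.InSubtree {n : ℕ} (T : RTree n) (v u : Fin n) : Prop := ∃ k : ℕ, T.par^[k] u = v

/-- One coordinate of a weight vector: one node of the component that the vector stores. -/
structure Coord where
  /-- Where the edge from this node to its parent node ends. For the nodes other than the first one
  this is the position of the parent node in the same vector; for the first node (the root of the
  component) of a vertex with parent `p` it is a position in the vector of `p`. -/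
  up : ℕ
  /-- the vertex constant `a` -/
  a : ℤ
  /-- the vertex constant `b` -/
  b : ℤ
  /-- The four weights of the edge from this node to its parent node, `ω 0, …, ω 3` for
  `ω₁, …, ω₄`: both ends, only the parent, only the child, none of them matched along the edge. -/
  ω : Fin 4 → WithBot ℤ

/-- A degree-weighted tree for maximum weighted matching: a rooted tree whose vertices `v` carry
weight vectors `W v`. The vector `W v` is a rooted component, its first coordinate being the root,
together with the data of the edge from `v` to the parent of `v`. (For the root of the tree, the
fields `up` and `ω` of the first coordinate are not used.) A component with one node is an
ordinary vertex. -/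
structure DWTree (n : ℕ) extends RTree n where
  W : Fin n → List Coord
  nonempty : ∀ v, 0 < (W v).length
  up_inner : ∀ v, ∀ i : Fin (W v).length, 0 < i.val → ((W v).get i).up < (W v).length
  up_outer : ∀ v, ((W v).get ⟨0, nonempty v⟩).up < (W (par v)).length
  acyclic_inner : ∀ v, ∃ h : ℕ → ℕ,
    ∀ i : Fin (W v).length, 0 < i.val → h ((W v).get i).up < h i.val

namespace DWTree

variable {n : ℕ}

/-- The degree of a vertex. -/
noncomputable def deg (T : DWTree n) (v : Fin n) : ℕ := (T.graph.neighborSet v).ncard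

/-- The dimension of each weight vector is at most `κ (deg v + 1) (log n + 1) ^ k₀`. -/
def DimLE (T : DWTree n) (κ k₀ : ℕ) : Prop :=
  ∀ v, (T.W v).length ≤ κ * (T.deg v + 1) * (Nat.log 2 n + 1) ^ k₀

/-- All numbers in the weight vectors are at most `M` in absolute value (or are `-∞`). -/
def WeightLE (T : DWTree n) (M : ℕ) : Prop :=
  ∀ v, ∀ d ∈ T.W v, |d.a| ≤ (M : ℤ) ∧ |d.b| ≤ (M : ℤ) ∧ ∀ q, Word.Fits M (d.ω q)

/-- The nodes of all components. -/
abbrev Node (T : DWTree n) := (v : Fin n) × Fin (T.W v).length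

/-- The data of a node. -/
def data (T : DWTree n) (x : T.Node) : Coord := (T.W x.1).get x.2

/-- The root node of the component of a vertex. -/
def top (T : DWTree n) (v : Fin n) : T.Node := ⟨v, ⟨0, T.nonempty v⟩⟩

/-- `y` is a child node of `x`. -/
def IsChild (T : DWTree n) (x y : T.Node) : Prop :=
  (0 < y.2.val ∧ x.1 = y.1 ∧ x.2.val = (T.data y).up) ∨
  (y.2.val = 0 ∧ y.1 ≠ T.root ∧ x.1 = T.par y.1 ∧ x.2.val = (T.data y).up)

open scoped Classical in
/-- The child nodes of a node. -/
noncomputable def children (T : DWTree n) (x : T.Node) : Finset T.Node :=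
  Finset.univ.filter (fun y => T.IsChild x y)

/-- `max (ω₃ + c'_u, ω₄ + c_u)`, the contribution of the child `u` to its parent when the parent is
not matched along the edge between them. -/
def free (T : DWTree n) (c c' : T.Node → WithBot ℤ) (u : T.Node) : WithBot ℤ :=
  max ((T.data u).ω 2 + c' u) ((T.data u).ω 3 + c u)

/-- `max (ω₁ + c'_u, ω₂ + c_u)`, the contribution of the child `u` to its parent when the parent is
matched along the edge between them. -/
def used (T : DWTree n) (c c' : T.Node → WithBot ℤ) (u : T.Node) : WithBot ℤ :=
  max ((T.data u).ω 0 + c' u) ((T.data u).ω 1 + c u)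

/-- `c` and `c'` solve the maximum weighted matching dynamic program: for each node `x`,
`c' x = b_x + ∑_u free u` and
`c x = b_x + max {∑_u free u, a_x + ∑_u free u, max_u (used u + ∑_{y ≠ u} free y)}`,
where `u` and `y` range over the child nodes of `x`. -/
def IsTable (T : DWTree n) (c c' : T.Node → WithBot ℤ) : Prop :=
  ∀ x : T.Node,
    c' x = ((T.data x).b : WithBot ℤ) + ∑ u ∈ T.children x, T.free c c' u ∧
    c x = ((T.data x).b : WithBot ℤ) +
      max (max (∑ u ∈ T.children x, T.free c c' u)
          (((T.data x).a : WithBot ℤ) + ∑ u ∈ T.children x, T.free c c' u))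
        ((T.children x).sup (fun u =>
          T.used c c' u + ∑ y ∈ (T.children x).erase u, T.free c c' y))

/-- The input table. Under the keys `(tag, v, i)`, for vertices `v` and positions `i` in `W v`, it
holds the parent of `v` (tag 0), the dimension of `W v` (tag 1), and the fields `up`, `a`, `b`,
`ω 0`, …, `ω 3` of the coordinate `i` of `W v` (tags 2 to 8). -/
noncomputable def input (T : DWTree n) : Table := fun k =>
  if hv : k.2.1 < n then
    let v : Fin n := ⟨k.2.1, hv⟩
    if k.1 = 0 ∧ k.2.2 = 0 then [(((T.par v : ℕ) : ℤ) : WithBot ℤ)]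
    else if k.1 = 1 ∧ k.2.2 = 0 then [(((T.W v).length : ℤ) : WithBot ℤ)]
    else if hi : k.2.2 < (T.W v).length then
      let d := (T.W v).get ⟨k.2.2, hi⟩
      if k.1 = 2 then [((d.up : ℤ) : WithBot ℤ)]
      else if k.1 = 3 then [(d.a : WithBot ℤ)]
      else if k.1 = 4 then [(d.b : WithBot ℤ)]
      else if k.1 = 5 then [d.ω 0]
      else if k.1 = 6 then [d.ω 1]
      else if k.1 = 7 then [d.ω 2]
      else if k.1 = 8 then [d.ω 3]
      else []
    else []
  else []

/-- The table `D` contains the solution of the dynamic program: under the keys `(0, v, 0)` and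
`(1, v, 0)` it holds the values `c_v` and `c'_v`, for all vertices `v`. -/
def Solved (T : DWTree n) (D : Table) : Prop :=
  ∃ c c' : T.Node → WithBot ℤ, T.IsTable c c' ∧
    ∀ v : Fin n, D (0, v, 0) = [c (T.top v)] ∧ D (1, v, 0) = [c' (T.top v)]

end DWTree

/-! ### Ordinary maximum weighted matching -/

/-- The degree-weighted tree of a rooted tree with edge weights (`w u` is the weight of the edge
from `u` to its parent): `a = b = 0` and `ω = (w, -∞, -∞, 0)`. -/
def RTree.toDW {n : ℕ} (T : RTree n) (w : Fin n → ℤ) : DWTree n where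
  toRTree := T
  W := fun v => [⟨0, 0, 0, ![(w v : WithBot ℤ), ⊥, ⊥, 0]⟩]
  nonempty := by intro v; simp
  up_inner := by intro v i hi; simp
  up_outer := by intro v; simp
  acyclic_inner := by
    intro v
    refine ⟨id, fun i hi => ?_⟩
    have h1 : i.val < 1 := i.isLt
    omega

open scoped Classical in
/-- The weight of a subgraph of a rooted tree with edge weights. -/
noncomputable def RTree.weight {n : ℕ} (T : RTree n) (w : Fin n → ℤ) (H : T.graph.Subgraph) : ℤ :=
  ∑ u ∈ Finset.univ.filter (fun u => H.Adj u (T.par u)), w u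

/-! A pair `(F, G)` of max-plus numbers records what a set of children contributes when the parent
uses none of their edges, or exactly one. Such pairs multiply like polynomials `F + G t` with `t ^ 2
= 0`. The matching table says that the pair `(c, c')` of a node is a 2 × 2 max-plus matrix applied
to the product, over the children `u`, of an edge matrix applied to `(c_u, c'_u)` (`Gain.prod_eq`,
`DWTree.isTable_gainAt`). A product with all factors but one fixed is linear in the remaining
factor. Hence a connected part of the tree with one open end acts as a single matrix and can be
contracted. Norms only add up in the process, so all words stay polynomially bounded.

Unbounded degrees are removed by binary tries: the children of `x` become leaves addressed by their
`D`-bit codes, and a node `y` accounts for the path from its leaf to the root of the trie. These `D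
+ 2` cells depend only on `y` and its parent, so each coordinate of a weight vector can be
translated in isolation (`Net.treeFact_tree`, `Net.val_node`). To spread the coordinates over the
machines, every vertex picks random coordinates of its own vector and of the vector of its parent. A
vector is thereby served in proportion to the number of children, and a coupon collector estimate
(`card_not_hit_le`) shows that with high probability no coordinate is missed.

The binary tree is contracted along its Euler tour. Each machine samples one position among those of
its `s` nodes; with high probability all gaps between samples have length at most `L`, which is
about `s log n`. The walk from one sample to the next passes a lowest common ancestor at its middle
visit, and this can be recognised from the walk alone (`turn`). The sampled nodes, these ancestors
and the root cut the tree into parts of at most `L` nodes, each with at most one topmost marked node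
beneath it (`BT.closed_marks`, `BT.clean_marks`). Replacing the parts by matrices leaves at most `3
(N / s + 1)` of `N` nodes. Since `s` exceeds `n ^ (ε / 2)`, after `K = ⌈2 / ε⌉` levels one machine
can finish, and the values are propagated back level by level. This takes `4 K + 3` rounds.

Correctness is tracked by invariants that fail only for a small fraction of the random words
(`Triple`, `Chain`), and the fractions add up. `exists_cfg` chooses the sizes so that the sum is at
most `(n + 1) ^ (-γ)`.

For ordinary matchings, a matching is identified with the set of vertices that are matched to their
parents. Induction over the tree shows that no such set beats the recursion and that some set
attains it (`RTree.IsMatchingTable.weightBelow_le`, `RTree.IsMatchingTable.exists_matchingSet`). -/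

/-! ### Query programs and algorithms made of rounds -/

/-- The first value stored under each key of a table. -/
abbrev Heads := Key → Option Word

/-- A decision tree that queries the first values under keys. -/
inductive Prog (α : Type) : Type
  | ret (a : α) : Prog α
  | ask (k : Key) (f : Option Word → Prog α) : Prog α

namespace Prog

variable {α β ι : Type}

/-- The result of a program on given answers. -/
def run (H : Heads) : Prog α → α
  | ret a => a
  | ask k f => (f (H k)).run H

/-- The number of queries of a program on given answers. -/
def cost (H : Heads) : Prog α → ℕ
  | ret _ => 0
  | ask k f => (f (H k)).cost H + 1

/-- Sequential composition. -/
def bind : Prog α → (α → Prog β) → Prog β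
  | ret a, g => g a
  | ask k f, g => ask k fun x => (f x).bind g

/-- The concatenation of the results of a family of programs. -/
def collect (f : ι → Prog (List β)) : List ι → Prog (List β)
  | [] => ret []
  | i :: l => (f i).bind fun a => (collect f l).bind fun b => ret (a ++ b)

@[simp] theorem run_ret (H : Heads) (a : α) : (ret a).run H = a := rfl
@[simp] theorem run_ask (H : Heads) (k : Key) (f : Option Word → Prog α) :
    (ask k f).run H = (f (H k)).run H := rfl
@[simp] theorem cost_ret (H : Heads) (a : α) : (ret a).cost H = 0 := rfl
@[simp] theorem cost_ask (H : Heads) (k : Key) (f : Option Word → Prog α) :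
    (ask k f).cost H = (f (H k)).cost H + 1 := rfl

@[simp] theorem run_bind (H : Heads) (p : Prog α) (g : α → Prog β) :
    (p.bind g).run H = (g (p.run H)).run H := by
  induction p with
  | ret a => rfl
  | ask k f ih => exact ih _

@[simp] theorem cost_bind (H : Heads) (p : Prog α) (g : α → Prog β) :
    (p.bind g).cost H = p.cost H + (g (p.run H)).cost H := by
  induction p with
  | ret a => simp [bind]
  | ask k f ih =>
    simp only [bind, cost_ask, run_ask, ih]
    omega

theorem run_collect (H : Heads) (f : ι → Prog (List β)) (l : List ι) :
    (collect f l).run H = l.flatMap fun i => (f i).run H := by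
  induction l with
  | nil => rfl
  | cons i l ih => simp [collect, ih]

@[simp] theorem mem_run_collect (H : Heads) (f : ι → Prog (List β)) (l : List ι) (b : β) :
    b ∈ (collect f l).run H ↔ ∃ i ∈ l, b ∈ (f i).run H := by
  simp [run_collect]

theorem cost_collect_le (H : Heads) (f : ι → Prog (List β)) (c : ℕ) (l : List ι)
    (h : ∀ i ∈ l, (f i).cost H ≤ c) : (collect f l).cost H ≤ l.length * c := by
  induction l with
  | nil => simp [collect]
  | cons i l ih =>
    have h1 := h i (by simp)
    have h2 := ih fun j hj => h j (by simp [hj])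
    simp only [collect, cost_bind, cost_ret, List.length_cons, Nat.succ_mul]
    omega

theorem length_run_collect_le (H : Heads) (f : ι → Prog (List β)) (c : ℕ) (l : List ι)
    (h : ∀ i ∈ l, ((f i).run H).length ≤ c) : ((collect f l).run H).length ≤ l.length * c := by
  induction l with
  | nil => simp [collect]
  | cons i l ih =>
    have h1 := h i (by simp)
    have h2 := ih fun j hj => h j (by simp [hj])
    simp only [collect, run_bind, run_ret, List.length_append, List.length_cons, Nat.succ_mul]
    omega

/-- The program that remains after a list of answers. -/
def feed : Prog α → List (Option Word) → Prog α
  | p, [] => p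
  | ret a, _ :: _ => ret a
  | ask _ f, x :: l => (f x).feed l

/-- The next query. -/
def next : Prog α → Key × ℕ
  | ret _ => ((0, 0, 0), 0)
  | ask k _ => (k, 0)

/-- The program that remains after one query. -/
def adv (H : Heads) : Prog α → Prog α
  | ret a => ret a
  | ask k f => f (H k)

theorem feed_append (p : Prog α) (l l' : List (Option Word)) :
    p.feed (l ++ l') = (p.feed l).feed l' := by
  induction l generalizing p with
  | nil => cases p <;> rfl
  | cons x l ih =>
    cases p with
    | ret a => cases l' <;> rfl
    | ask k f => exact ih _

/-- A finished program is a fixed point of `adv`, so surplus queries are harmless. This matters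
because the model makes every machine ask exactly `S` queries. -/
theorem adv_iterate_of_cost_le (H : Heads) (p : Prog α) (q : ℕ) (h : p.cost H ≤ q) :
    (adv H)^[q] p = ret (p.run H) := by
  induction q generalizing p with
  | zero =>
    cases p with
    | ret a => rfl
    | ask k f => simp at h
  | succ q ih =>
    rw [Function.iterate_succ_apply]
    cases p with
    | ret a => exact ih (ret a) (Nat.zero_le _)
    | ask k f => exact ih (f (H k)) (by simpa using h)

end Prog

/-! ### Rounds as maps between contents of tables. -/

/-- The machine programs of one round. -/
abbrev Round (P S B : ℕ) := Fin P → Coins S B → Prog (List (Key × Word))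

/-- A key-value pair respects the word size. -/
def EntryFits (B : ℕ) (e : Key × Word) : Prop :=
  e.1.1 ≤ B ∧ e.1.2.1 ≤ B ∧ e.1.2.2 ≤ B ∧ e.2.Fits B

open scoped Classical in
/-- The entries that a machine writes when its program has stopped. -/
noncomputable def finish (S B : ℕ) : Prog (List (Key × Word)) → List (Key × Word)
  | .ret l => (l.filter (fun e => EntryFits B e)).take S
  | .ask _ _ => []

/-- Filtering and truncation in `finish` make the bounds of the model hold unconditionally. For the
actual programs both are inactive. -/
theorem finish_ret {S B : ℕ} {l : List (Key × Word)} (h1 : l.length ≤ S)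
    (h2 : ∀ e ∈ l, EntryFits B e) : finish S B (.ret l) = l := by
  classical
  have : l.filter (fun e => decide (EntryFits B e)) = l := by
    rw [List.filter_eq_self]
    simpa using h2
  simp only [finish]
  rw [this, List.take_of_length_le h1]

theorem finish_length (S B : ℕ) (p : Prog (List (Key × Word))) : (finish S B p).length ≤ S := by
  cases p <;> simp [finish]

theorem finish_fits (S B : ℕ) (p : Prog (List (Key × Word))) :
    ∀ e ∈ finish S B p, EntryFits B e := by
  classical
  intro e he
  cases p with
  | ret a =>
    have h := (List.mem_filter.1 (List.mem_of_mem_take he)).2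
    exact of_decide_eq_true h
  | ask k f => simp [finish] at he

/-- The multisets of values stored under the keys. -/
abbrev Content := Key → Multiset Word

namespace Round

variable {P S B : ℕ}

/-- What machine `i` writes. -/
noncomputable def out (r : Round P S B) (H : Heads) (ρ : Fin P → Coins S B) (i : Fin P) :
    List (Key × Word) :=
  finish S B ((Prog.adv H)^[S] (r i (ρ i)))

/-- What all machines together write. -/
noncomputable def result (r : Round P S B) (H : Heads) (ρ : Fin P → Coins S B) : Content := fun k =>
  ∑ i : Fin P, ((((r.out H ρ i).filter (fun e => e.1 = k)).map Prod.snd : List Word) :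
    Multiset Word)

/-- Up to the output round only membership counts: several machines may write the same pair, and a
reader of first values does not notice multiplicities. -/
theorem mem_result (r : Round P S B) (H : Heads) (ρ : Fin P → Coins S B) (k : Key) (w : Word) :
    w ∈ r.result H ρ k ↔ ∃ i, (k, w) ∈ r.out H ρ i := by
  simp [result, Multiset.mem_sum]

theorem out_eq (r : Round P S B) (H : Heads) (ρ : Fin P → Coins S B) (i : Fin P)
    (h1 : (r i (ρ i)).cost H ≤ S) (h2 : ((r i (ρ i)).run H).length ≤ S)
    (h3 : ∀ e ∈ (r i (ρ i)).run H, EntryFits B e) : r.out H ρ i = (r i (ρ i)).run H := by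
  rw [out, Prog.adv_iterate_of_cost_le _ _ _ h1, finish_ret h2 h3]

end Round

/-- The first values in a table. -/
def heads (D : Table) : Heads := fun k => (D k)[0]?

/-- The content of a table. -/
def content (D : Table) : Content := fun k => (D k : Multiset Word)

/-- All values under the same key are equal. -/
def Consistent (M : Content) : Prop := ∀ k, ∀ a ∈ M k, ∀ b ∈ M k, a = b

open scoped Classical in
/-- Some value under each key. -/
noncomputable def pick (M : Content) : Heads := fun k =>
  if h : ∃ w, w ∈ M k then some h.choose else none

theorem pick_eq_some {M : Content} (hM : Consistent M) (k : Key) (w : Word) :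
    pick M k = some w ↔ w ∈ M k := by
  unfold pick
  split_ifs with h
  · constructor
    · rintro h'
      cases h'
      exact h.choose_spec
    · intro hw
      rw [hM k _ h.choose_spec _ hw]
  · constructor
    · simp
    · intro hw
      exact absurd ⟨w, hw⟩ h

/-- With equal values under each key, their arbitrary order cannot influence an answer. This makes a
round a function of the content and the random words. -/
theorem heads_eq_pick {D : Table} (h : Consistent (content D)) : heads D = pick (content D) := by
  funext k
  ext w
  rw [pick_eq_some h]
  simp only [heads, content, Multiset.mem_coe]
  constructor
  · intro h'
    exact List.mem_of_getElem? h'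
  · intro hw
    cases hD : D k with
    | nil => simp [hD] at hw
    | cons a l =>
      have : a = w := h k a (by simp [content, hD]) w (by simpa [content] using hw)
      simp [this]

variable {P S B : ℕ}

/-- The algorithm with given rounds. -/
noncomputable def AMPC.ofRounds (rs : List (Round P S B)) : AMPC rs.length P S B where
  query t i ρ l := ((rs.get t i ρ).feed l).next
  write t i ρ l := finish S B ((rs.get t i ρ).feed l)
  write_length _ _ _ _ := finish_length _ _ _
  write_fits _ _ _ _ := finish_fits _ _ _

/-- The remaining decision tree is the state of the machine; feeding it the recorded answers and
advancing it on the table stay in step. -/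
theorem AMPC.feed_answers (rs : List (Round P S B)) (t : Fin rs.length) (i : Fin P)
    (ρ : Coins S B) (D : Table) (q : ℕ) :
    (rs.get t i ρ).feed ((AMPC.ofRounds rs).answers t i ρ D q) =
      (Prog.adv (heads D))^[q] (rs.get t i ρ) := by
  induction q with
  | zero => cases rs.get t i ρ <;> rfl
  | succ q ih =>
    rw [Function.iterate_succ_apply', ← ih]
    simp only [AMPC.answers, Prog.feed_append]
    change ((rs.get t i ρ).feed _).feed [(D ((rs.get t i ρ).feed _).next.1)[
      ((rs.get t i ρ).feed _).next.2]?] = _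
    cases (rs.get t i ρ).feed ((AMPC.ofRounds rs).answers t i ρ D q) with
    | ret a => rfl
    | ask k f => simp only [Prog.feed, Prog.adv, Prog.next, heads]

theorem AMPC.written_ofRounds (rs : List (Round P S B)) (t : Fin rs.length)
    (ρ : Fin P → Coins S B) (D : Table) (k : Key) :
    (AMPC.ofRounds rs).written t ρ D k = (rs.get t).result (heads D) ρ k := by
  unfold AMPC.written Round.result Round.out
  refine Finset.sum_congr rfl fun i _ => ?_
  rw [← AMPC.feed_answers]
  rfl

/-! ### Invariants that hold with high probability. -/

/-- From each content with property `I`, the round leads to a content with property `J`, except for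
a fraction `η` of the random choices. -/
def Triple (I : Content → Prop) (r : Round P S B) (J : Content → Prop) (η : ℝ) : Prop :=
  ∀ M, I M → (Nat.card {ρ : Fin P → Coins S B // ¬ J (r.result (pick M) ρ)} : ℝ) ≤
    η * Nat.card (Fin P → Coins S B)

/-- The same for a sequence of rounds. -/
def Chain : List (Round P S B) → (Content → Prop) → (Content → Prop) → ℝ → Prop
  | [], I, J, η => (∀ M, I M → J M) ∧ 0 ≤ η
  | r :: rs, I, J, η => ∃ K η₁ η₂, Triple I r K η₁ ∧ 0 ≤ η₁ ∧ Chain rs K J η₂ ∧ η₁ + η₂ ≤ η ∧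
      ∀ M, I M → Consistent M

theorem Chain.nonneg {rs : List (Round P S B)} {I J : Content → Prop} {η : ℝ}
    (h : Chain rs I J η) : 0 ≤ η := by
  induction rs generalizing I η with
  | nil => exact h.2
  | cons r rs ih =>
    obtain ⟨K, η₁, η₂, -, h1, h2, h3, -⟩ := h
    have := ih h2
    linarith

theorem Chain.weaken {rs : List (Round P S B)} {I I' J : Content → Prop} {η η' : ℝ}
    (h : Chain rs I J η) (hI : ∀ M, I' M → I M) (hη : η ≤ η') : Chain rs I' J η' := by
  cases rs with
  | nil => exact ⟨fun M hM => h.1 M (hI M hM), h.2.trans hη⟩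
  | cons r rs =>
    obtain ⟨K, η₁, η₂, h0, h1, h2, h3, h4⟩ := h
    exact ⟨K, η₁, η₂, fun M hM => h0 M (hI M hM), h1, h2, h3.trans hη, fun M hM => h4 M (hI M hM)⟩

theorem Chain.append {rs rs' : List (Round P S B)} {I J K : Content → Prop} {η η' : ℝ}
    (h : Chain rs I J η) (h' : Chain rs' J K η') : Chain (rs ++ rs') I K (η + η') := by
  induction rs generalizing I η with
  | nil => exact h'.weaken h.1 (by linarith [h.2])
  | cons r rs ih =>
    obtain ⟨K', η₁, η₂, h0, h1, h2, h3, h4⟩ := h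
    exact ⟨K', η₁, η₂ + η', h0, h1, ih h2, by linarith, h4⟩

theorem Chain.single {r : Round P S B} {I J : Content → Prop} {η : ℝ} (h : Triple I r J η)
    (h0 : 0 ≤ η) (hI : ∀ M, I M → Consistent M) : Chain [r] I J η :=
  ⟨J, η, 0, h, h0, ⟨fun _ h => h, le_rfl⟩, by simp, hI⟩

/-- All contents in the run are consistent, and the last one has property `J`. -/
def GoodRun (J : Content → Prop) : (rs : List (Round P S B)) → Content →
    (Fin rs.length → Fin P → Coins S B) → Prop
  | [], M, _ => J M
  | r :: rs, M, ρ => Consistent M ∧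
      GoodRun J rs (r.result (pick M) (ρ ⟨0, Nat.succ_pos _⟩)) (fun t => ρ t.succ)

/-- Consistency in every round replaces `heads` by `pick`, so each run, whatever the order of the
values, agrees with the evaluation in which a content determines the next one. -/
theorem GoodRun.property {J : Content → Prop} (rs : List (Round P S B)) (D : ℕ → Table)
    (ρ : Fin rs.length → Fin P → Coins S B)
    (hD : ∀ t : Fin rs.length, ∀ k, content (D (t + 1)) k =
      (rs.get t).result (heads (D t)) (ρ t) k)
    (h : GoodRun J rs (content (D 0)) ρ) : J (content (D rs.length)) := by
  induction rs generalizing D with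
  | nil => exact h
  | cons r rs ih =>
    obtain ⟨h1, h2⟩ := h
    have h3 : content (D 1) = r.result (pick (content (D 0))) (ρ ⟨0, Nat.succ_pos _⟩) := by
      funext k
      rw [← heads_eq_pick h1]
      exact hD ⟨0, Nat.succ_pos _⟩ k
    rw [← h3] at h2
    exact ih (fun t => D (t + 1)) (fun t => ρ t.succ) (fun t k => hD t.succ k) h2

/-- Union bound for a two-stage experiment: a bad first coordinate costs at most its whole fibre, a
good one at most the fraction `η₂` of it. -/
theorem card_prod_bad {X Y : Type*} [Finite X] [Finite Y] (K : X → Prop) (G : X → Y → Prop)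
    (η₁ η₂ : ℝ) (h2 : 0 ≤ η₂) (hK : (Nat.card {x // ¬ K x} : ℝ) ≤ η₁ * Nat.card X)
    (hG : ∀ x, K x → (Nat.card {y // ¬ G x y} : ℝ) ≤ η₂ * Nat.card Y) :
    (Nat.card {p : X × Y // ¬ G p.1 p.2} : ℝ) ≤ (η₁ + η₂) * Nat.card (X × Y) := by
  classical
  have := Fintype.ofFinite X
  have := Fintype.ofFinite Y
  have e : {p : X × Y // ¬ G p.1 p.2} ≃ (x : X) × {y // ¬ G x y} :=
    { toFun := fun p => ⟨p.1.1, p.1.2, p.2⟩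
      invFun := fun q => ⟨(q.1, q.2.1), q.2.2⟩
      left_inv := fun _ => rfl
      right_inv := fun _ => rfl }
  rw [Nat.card_congr e, Nat.card_sigma, Nat.cast_sum]
  have h1 : ∀ x ∈ Finset.univ, (Nat.card {y // ¬ G x y} : ℝ) ≤
      (if ¬ K x then (Nat.card Y : ℝ) else 0) + η₂ * Nat.card Y := by
    intro x _
    by_cases hx : K x
    · simpa [hx] using hG x hx
    · have : (Nat.card {y // ¬ G x y} : ℝ) ≤ Nat.card Y := by
        exact_mod_cast Nat.card_le_card_of_injective _ Subtype.val_injective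
      have : 0 ≤ η₂ * Nat.card Y := by positivity
      simp only [hx, not_false_eq_true, if_true]
      linarith
  refine (Finset.sum_le_sum h1).trans ?_
  rw [Finset.sum_add_distrib, ← Finset.sum_filter, Finset.sum_const, Finset.sum_const,
    nsmul_eq_mul, nsmul_eq_mul]
  have h3 : ((Finset.univ.filter fun x => ¬ K x).card : ℝ) = Nat.card {x // ¬ K x} := by
    rw [Nat.card_eq_fintype_card, Fintype.card_subtype]
  rw [h3, Nat.card_prod, Finset.card_univ, ← Nat.card_eq_fintype_card]
  push_cast
  have : (0 : ℝ) ≤ Nat.card Y := by positivity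
  nlinarith

/-- The random words of different rounds are independent, that is, the sample space is a product.
The first factor is split off and `card_prod_bad` is applied with the failure of `K` in the first
stage. -/
theorem Chain.card_bad {rs : List (Round P S B)} {I J : Content → Prop} {η : ℝ}
    (h : Chain rs I J η) (M : Content) (hM : I M) :
    (Nat.card {ρ : Fin rs.length → Fin P → Coins S B // ¬ GoodRun J rs M ρ} : ℝ) ≤
      η * Nat.card (Fin rs.length → Fin P → Coins S B) := by
  induction rs generalizing I M η with
  | nil =>
    have h1 : IsEmpty {ρ : Fin ([] : List (Round P S B)).length → Fin P → Coins S B //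
        ¬ GoodRun J [] M ρ} := ⟨fun ρ => ρ.2 (h.1 M hM)⟩
    rw [Nat.card_of_isEmpty]
    have := h.2
    simp only [Nat.cast_zero]
    positivity
  | cons r rs ih =>
    obtain ⟨K, η₁, η₂, h0, h1, h2, h3, h4⟩ := h
    let e := Fin.consEquiv (fun _ : Fin (rs.length + 1) => Fin P → Coins S B)
    have e' : {ρ : Fin (r :: rs).length → Fin P → Coins S B // ¬ GoodRun J (r :: rs) M ρ} ≃
        {p : (Fin P → Coins S B) × (Fin rs.length → Fin P → Coins S B) //
          ¬ GoodRun J rs (r.result (pick M) p.1) p.2} := by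
      refine (e.symm.subtypeEquiv fun ρ => ?_)
      simp only [GoodRun, h4 M hM, true_and]
      rfl
    rw [Nat.card_congr e', show Nat.card (Fin (r :: rs).length → Fin P → Coins S B) =
      Nat.card ((Fin P → Coins S B) × (Fin rs.length → Fin P → Coins S B)) from
        Nat.card_congr e.symm]
    refine (card_prod_bad (fun x => K (r.result (pick M) x))
      (fun x y => GoodRun J rs (r.result (pick M) x) y) η₁ η₂ h2.nonneg (h0 M hM)
      fun x hx => ih h2 _ hx).trans ?_
    gcongr

/-- An algorithm whose rounds preserve invariants with high probability succeeds with high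
probability. -/
theorem Chain.le_prob {rs : List (Round P S B)} {I J : Content → Prop} {η : ℝ}
    (h : Chain rs I J η) (D₀ : Table) (hD : I (content D₀)) (Q : Table → Prop)
    (hQ : ∀ D, J (content D) → Q D) : 1 - η ≤ (AMPC.ofRounds rs).prob D₀ Q := by
  classical
  have hbad := h.card_bad _ hD
  unfold AMPC.prob
  have hpos : (0 : ℝ) < Nat.card (AMPC.Rand rs.length P S B) := by
    have : 0 < Nat.card (AMPC.Rand rs.length P S B) := Nat.card_pos
    exact_mod_cast this
  rw [le_div_iff₀ hpos]
  have h1 : Nat.card {ρ : AMPC.Rand rs.length P S B // GoodRun J rs (content D₀) ρ} ≤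
      Nat.card {ρ : AMPC.Rand rs.length P S B // (AMPC.ofRounds rs).Succeeds D₀ Q ρ} := by
    refine Nat.card_le_card_of_injective (Subtype.map id ?_) (Subtype.map_injective _
      Function.injective_id)
    intro ρ hρ D hrun
    refine hQ _ (GoodRun.property rs D ρ (fun t k => ?_) (by rw [hrun.1]; exact hρ))
    rw [← AMPC.written_ofRounds]
    exact hrun.2 t k
  have h2 : Nat.card {ρ : AMPC.Rand rs.length P S B // GoodRun J rs (content D₀) ρ} +
      Nat.card {ρ : AMPC.Rand rs.length P S B // ¬ GoodRun J rs (content D₀) ρ} =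
      Nat.card (AMPC.Rand rs.length P S B) := by
    simp only [Nat.card_eq_fintype_card]
    exact Fintype.card_subtype_compl (GoodRun J rs (content D₀)) ▸
      Nat.add_sub_cancel' (Fintype.card_subtype_le _)
  have h3 : (Nat.card {ρ : AMPC.Rand rs.length P S B // GoodRun J rs (content D₀) ρ} : ℝ) +
      Nat.card {ρ : AMPC.Rand rs.length P S B // ¬ GoodRun J rs (content D₀) ρ} =
      Nat.card (AMPC.Rand rs.length P S B) := by exact_mod_cast h2
  have h4 : (Nat.card {ρ : AMPC.Rand rs.length P S B // GoodRun J rs (content D₀) ρ} : ℝ) ≤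
      Nat.card {ρ : AMPC.Rand rs.length P S B // (AMPC.ofRounds rs).Succeeds D₀ Q ρ} := by
    exact_mod_cast h1
  change (Nat.card {ρ : AMPC.Rand rs.length P S B // ¬ GoodRun J rs (content D₀) ρ} : ℝ) ≤
    η * Nat.card (AMPC.Rand rs.length P S B) at hbad
  linarith

/-! ### Independent random words -/

/-- By independence the fraction is the product of the factors `1 - |A i j| / (B + 1)`, each of
which is at most `exp (-|A i j| / (B + 1))`. -/
theorem card_avoid_le {P S B : ℕ} (A : Fin P → Fin S → Finset (Fin (B + 1))) :
    (Nat.card {ρ : Fin P → Coins S B // ∀ i j, ρ i j ∉ A i j} : ℝ) ≤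
      Real.exp (-((∑ i, ∑ j, (A i j).card : ℕ) / (B + 1 : ℝ))) *
        Nat.card (Fin P → Coins S B) := by
  classical
  have h1 : Nat.card {ρ : Fin P → Coins S B // ∀ i j, ρ i j ∉ A i j} =
      ∏ i, ∏ j, (B + 1 - (A i j).card) := by
    rw [Nat.card_eq_fintype_card, Fintype.card_subtype]
    have : (Finset.univ.filter fun ρ : Fin P → Coins S B => ∀ i j, ρ i j ∉ A i j) =
        Fintype.piFinset fun i => Fintype.piFinset fun j => (A i j)ᶜ := by
      ext ρ
      simp [Fintype.mem_piFinset]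
    rw [this, Fintype.card_piFinset]
    refine Finset.prod_congr rfl fun i _ => ?_
    rw [Fintype.card_piFinset]
    refine Finset.prod_congr rfl fun j _ => ?_
    rw [Finset.card_compl, Fintype.card_fin]
  have h2 : Nat.card (Fin P → Coins S B) = ∏ _i : Fin P, ∏ _j : Fin S, (B + 1) := by
    simp [Nat.card_eq_fintype_card, Coins]
  have hB : (0 : ℝ) < B + 1 := by positivity
  rw [h1, h2]
  push_cast
  rw [Finset.sum_div, ← Finset.sum_neg_distrib, Real.exp_sum, ← Finset.prod_mul_distrib]
  refine Finset.prod_le_prod (fun i _ => by positivity) fun i _ => ?_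
  rw [Finset.sum_div, ← Finset.sum_neg_distrib, Real.exp_sum, ← Finset.prod_mul_distrib]
  refine Finset.prod_le_prod (fun j _ => by positivity) fun j _ => ?_
  have hc : (A i j).card ≤ B + 1 := by simpa using Finset.card_le_univ (A i j)
  rw [Nat.cast_sub hc]
  push_cast
  have h3 := Real.add_one_le_exp (-(((A i j).card : ℝ) / (B + 1)))
  calc ((B : ℝ) + 1 - (A i j).card) = (-(((A i j).card : ℝ) / (B + 1)) + 1) * (B + 1) := by
        field_simp
        ring
    _ ≤ _ := mul_le_mul_of_nonneg_right h3 hB.le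

theorem card_not_forall_le {Ω X : Type*} [Finite Ω] (s : Finset X) (G : X → Ω → Prop) (c : ℝ)
    (h : ∀ x ∈ s, (Nat.card {ω // ¬ G x ω} : ℝ) ≤ c) :
    (Nat.card {ω // ¬ ∀ x ∈ s, G x ω} : ℝ) ≤ s.card * c := by
  classical
  have := Fintype.ofFinite Ω
  have h1 : Nat.card {ω // ¬ ∀ x ∈ s, G x ω} ≤ ∑ x ∈ s, Nat.card {ω // ¬ G x ω} := by
    simp only [Nat.card_eq_fintype_card, Fintype.card_subtype]
    refine le_trans (Finset.card_le_card ?_) Finset.card_biUnion_le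
    intro ω
    simp
  calc (Nat.card {ω // ¬ ∀ x ∈ s, G x ω} : ℝ) ≤ ∑ x ∈ s, (Nat.card {ω // ¬ G x ω} : ℝ) := by
        exact_mod_cast h1
    _ ≤ ∑ _x ∈ s, c := Finset.sum_le_sum h
    _ = _ := by simp

/-- If each of finitely many events is that one of many random words is in a given set, they happen
simultaneously with high probability. -/
theorem card_not_hit_le {X : Type*} {P S B : ℕ} (s : Finset X)
    (A : X → Fin P → Fin S → Finset (Fin (B + 1))) (μ : ℕ)
    (hA : ∀ x ∈ s, μ * (B + 1) ≤ ∑ i, ∑ j, (A x i j).card) :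
    (Nat.card {ρ : Fin P → Coins S B // ¬ ∀ x ∈ s, ∃ i j, ρ i j ∈ A x i j} : ℝ) ≤
      s.card * (1 / 2 ^ μ) * Nat.card (Fin P → Coins S B) := by
  rw [mul_assoc]
  refine card_not_forall_le s _ _ fun x hx => ?_
  push Not
  refine (card_avoid_le (A x)).trans ?_
  have hB : (0 : ℝ) < B + 1 := by positivity
  have h1 : (μ : ℝ) ≤ (∑ i, ∑ j, (A x i j).card : ℕ) / (B + 1 : ℝ) := by
    rw [le_div_iff₀ hB]
    exact_mod_cast hA x hx
  have h2 : Real.exp (-((∑ i, ∑ j, (A x i j).card : ℕ) / (B + 1 : ℝ))) ≤ 1 / 2 ^ μ := by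
    rw [Real.exp_neg, ← one_div]
    refine one_div_le_one_div_of_le (by positivity) ?_
    -- The expected number of hits is at least `μ`; only `2 ≤ e` is used to pass to a power of two.
    calc (2 : ℝ) ^ μ ≤ Real.exp 1 ^ μ := by
          gcongr
          have := Real.add_one_le_exp (1 : ℝ)
          linarith
      _ = Real.exp μ := by rw [← Real.exp_nat_mul, mul_one]
      _ ≤ _ := Real.exp_le_exp.2 h1
  gcongr

/-- The words whose residue modulo `m` lies in `R`. -/
def residueSet (B m : ℕ) (R : Finset ℕ) : Finset (Fin (B + 1)) :=
  Finset.univ.filter fun r => r.val % m ∈ R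

theorem mem_residueSet {B m : ℕ} {R : Finset ℕ} {r : Fin (B + 1)} :
    r ∈ residueSet B m R ↔ r.val % m ∈ R := by simp [residueSet]

/-- A uniform word reduced modulo `m` is not exactly uniform. Still, each residue has at least `⌊(B
+ 1) / m⌋` preimages, and since `m ≤ B + 1` this is at least half of `(B + 1) / m`; hence the factor
2. -/
theorem card_residueSet (B m : ℕ) (R : Finset ℕ) (hR : ∀ a ∈ R, a < m) (hm : m ≤ B + 1) :
    (B + 1) * R.card ≤ 2 * m * (residueSet B m R).card := by
  rcases Nat.eq_zero_or_pos m with rfl | hm0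
  · have : R = ∅ := Finset.eq_empty_of_forall_notMem fun a ha => by simpa using hR a ha
    simp [this]
  have h1 : R.card * ((B + 1) / m) ≤ (residueSet B m R).card := by
    rw [← Finset.card_range ((B + 1) / m), ← Finset.card_product]
    have hlt : ∀ p ∈ R ×ˢ Finset.range ((B + 1) / m), m * p.2 + p.1 < B + 1 := by
      intro p hp
      simp only [Finset.mem_product, Finset.mem_range] at hp
      have h2 := hR _ hp.1
      have h3 : m * (p.2 + 1) ≤ B + 1 :=
        (Nat.mul_le_mul_left m hp.2).trans (Nat.mul_div_le _ _)
      rw [Nat.mul_succ] at h3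
      omega
    refine Finset.card_le_card_of_injOn
      (fun p => (Fin.ofNat (B + 1) (m * p.2 + p.1))) ?_ ?_
    · intro p hp
      have hp' := hlt p hp
      simp only [Finset.coe_product, Set.mem_prod, Finset.mem_coe] at hp
      simp only [Finset.mem_coe, mem_residueSet, Fin.val_ofNat, Nat.mod_eq_of_lt hp']
      rw [Nat.mul_add_mod, Nat.mod_eq_of_lt (hR _ hp.1)]
      exact hp.1
    · intro p hp p' hp' h
      have e1 := hlt p hp
      have e2 := hlt p' hp'
      simp only [Finset.coe_product, Set.mem_prod, Finset.mem_coe] at hp hp'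
      have h4 := congrArg Fin.val h
      simp only [Fin.val_ofNat, Nat.mod_eq_of_lt e1, Nat.mod_eq_of_lt e2] at h4
      have l1 := hR _ hp.1
      have l2 := hR _ hp'.1
      have h5 := congrArg (· % m) h4
      have h6 := congrArg (· / m) h4
      simp only [Nat.mul_add_mod, Nat.mod_eq_of_lt l1, Nat.mod_eq_of_lt l2] at h5
      simp only [Nat.mul_add_div hm0, Nat.div_eq_of_lt l1, Nat.div_eq_of_lt l2] at h6
      exact Prod.ext h5 (by simpa using h6)
  have h2 : B + 1 ≤ 2 * m * ((B + 1) / m) := by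
    have h3 := Nat.div_add_mod (B + 1) m
    have h4 := Nat.mod_lt (B + 1) hm0
    have h5 : 1 ≤ (B + 1) / m := Nat.div_pos hm hm0
    have h6 : m * 1 ≤ m * ((B + 1) / m) := Nat.mul_le_mul_left m h5
    rw [mul_assoc]
    omega
  calc (B + 1) * R.card ≤ 2 * m * ((B + 1) / m) * R.card := Nat.mul_le_mul_right _ h2
    _ = 2 * m * (R.card * ((B + 1) / m)) := by ring
    _ ≤ _ := Nat.mul_le_mul_left _ h1

/-! ### Max-plus algebra -/

/-- A pair `(F, G)`: the best values of a set of children when the parent is not matched to any of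
them, and when it is matched to one of them. -/
@[ext] structure Gain where
  free : Word
  used : Word

namespace Gain

/-- The product is that of `F + G t` modulo `t ^ 2` over the max-plus semiring: a parent can be
matched to at most one child. The empty set of children gives `0` and `-∞`. -/
instance : CommMonoid Gain where
  mul x y := ⟨x.free + y.free, max (x.free + y.used) (x.used + y.free)⟩
  one := ⟨0, ⊥⟩
  mul_assoc x y z := by
    change Gain.mk _ _ = Gain.mk _ _
    simp only [HMul.hMul]
    ext1
    · exact add_assoc _ _ _
    · simp only [← max_add_add_left, ← max_add_add_right, add_assoc, max_assoc]
  one_mul x := by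
    change Gain.mk (0 + x.free) (max (0 + x.used) (⊥ + x.free)) = x
    ext1 <;> simp
  mul_one x := by
    change Gain.mk (x.free + 0) (max (x.free + ⊥) (x.used + 0)) = x
    ext1 <;> simp
  mul_comm x y := by
    change Gain.mk _ _ = Gain.mk _ _
    ext1
    · exact add_comm _ _
    · simp only [max_comm (x.free + y.used), add_comm]

theorem mul_def (x y : Gain) :
    x * y = ⟨x.free + y.free, max (x.free + y.used) (x.used + y.free)⟩ := rfl

/-- Expansion of the truncated product: the constant coefficient takes the free value everywhere,
the coefficient of `t` selects the one child that is used. These are the two expressions in the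
matching table. -/
theorem prod_eq {ι : Type*} [DecidableEq ι] (s : Finset ι) (f : ι → Gain) :
    ∏ u ∈ s, f u = ⟨∑ u ∈ s, (f u).free,
      s.sup fun u => (f u).used + ∑ y ∈ s.erase u, (f y).free⟩ := by
  induction s using Finset.induction_on with
  | empty => rfl
  | insert a s ha ih =>
    rw [Finset.prod_insert ha, ih, mul_def]
    ext1
    · simp [Finset.sum_insert ha]
    · simp only [Finset.sup_insert, Finset.erase_insert ha]
      rw [max_comm]
      congr 1
      have h1 : ∀ u ∈ s, (f u).used + ∑ y ∈ (insert a s).erase u, (f y).free =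
          (f a).free + ((f u).used + ∑ y ∈ s.erase u, (f y).free) := by
        intro u hu
        have hau : a ≠ u := fun h => ha (h ▸ hu)
        rw [Finset.erase_insert_of_ne hau, Finset.sum_insert (by simp [ha])]
        exact add_left_comm _ _ _
      rw [Finset.sup_congr rfl h1]
      -- Adding a fixed word commutes with `sup`, also over the empty set because `⊥` absorbs.
      have h2 := Finset.apply_sup_eq_sup_comp (s := s)
        (f := fun u => (f u).used + ∑ y ∈ s.erase u, (f y).free)
        (fun w : Word => (f a).free + w) (fun x y => (max_add_add_left _ _ _).symm) (by simp)
      exact h2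

end Gain

/-- A `2 × 2` matrix over the max-plus semiring. -/
@[ext] structure Mat where
  (a b c d : Word)

namespace Mat

instance : One Mat := ⟨⟨0, ⊥, ⊥, 0⟩⟩

instance : Mul Mat := ⟨fun M N =>
  ⟨max (M.a + N.a) (M.b + N.c), max (M.a + N.b) (M.b + N.d),
   max (M.c + N.a) (M.d + N.c), max (M.c + N.b) (M.d + N.d)⟩⟩

theorem one_def : (1 : Mat) = ⟨0, ⊥, ⊥, 0⟩ := rfl

theorem mul_def (M N : Mat) : M * N =
  ⟨max (M.a + N.a) (M.b + N.c), max (M.a + N.b) (M.b + N.d),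
   max (M.c + N.a) (M.d + N.c), max (M.c + N.b) (M.d + N.d)⟩ := rfl

/-- The linear map given by a matrix. -/
def act (M : Mat) (v : Gain) : Gain :=
  ⟨max (M.a + v.free) (M.b + v.used), max (M.c + v.free) (M.d + v.used)⟩

/-- The matrix of the multiplication by `v`. -/
def ofGain (v : Gain) : Mat := ⟨v.free, ⊥, v.used, v.free⟩

@[simp] theorem one_act (v : Gain) : (1 : Mat).act v = v := by
  ext1 <;> simp [act, one_def]

theorem mul_act (M N : Mat) (v : Gain) : (M * N).act v = M.act (N.act v) := by
  ext1 <;>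
  · simp only [act, mul_def, ← max_add_add_left, ← max_add_add_right, add_assoc]
    exact max_max_max_comm _ _ _ _

@[simp] theorem ofGain_act (v w : Gain) : (ofGain v).act w = v * w := by
  rw [Gain.mul_def]
  ext1
  · simp [act, ofGain]
  · simp only [act, ofGain]
    exact max_comm _ _

end Mat

/-- The absolute value of a word, `0` for `-∞`. -/
def wordNorm : Word → ℕ
  | ⊥ => 0
  | (z : ℤ) => z.natAbs

@[simp] theorem wordNorm_bot : wordNorm ⊥ = 0 := rfl
@[simp] theorem wordNorm_coe (z : ℤ) : wordNorm (z : WithBot ℤ) = z.natAbs := rfl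
@[simp] theorem wordNorm_zero : wordNorm 0 = 0 := rfl

theorem Word.Fits.wordNorm_le {B : ℕ} {w : Word} (h : w.Fits B) : wordNorm w ≤ B := by
  induction w using WithBot.recBotCoe with
  | bot => simp
  | coe z =>
    have := h z rfl
    rw [wordNorm_coe]
    zify
    exact this

theorem wordNorm_max_le (v w : Word) : wordNorm (max v w) ≤ max (wordNorm v) (wordNorm w) := by
  rcases max_choice v w with h | h <;> rw [h] <;> simp

theorem wordNorm_add_le (v w : Word) : wordNorm (v + w) ≤ wordNorm v + wordNorm w := by
  induction v using WithBot.recBotCoe with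
  | bot => simp
  | coe v =>
    induction w using WithBot.recBotCoe with
    | bot => simp
    | coe w =>
      rw [← WithBot.coe_add]
      exact Int.natAbs_add_le _ _

/-- A maximum costs nothing and a sum adds the bounds, so in max-plus products the sizes of the
entries grow only additively. -/
theorem wordNorm_max_add_le {u v w x : Word} {m n : ℕ} (hu : wordNorm u ≤ m)
    (hv : wordNorm v ≤ n) (hw : wordNorm w ≤ m) (hx : wordNorm x ≤ n) :
    wordNorm (max (u + v) (w + x)) ≤ m + n := by
  refine (wordNorm_max_le _ _).trans (max_le ?_ ?_)
  · exact (wordNorm_add_le _ _).trans (by omega)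
  · exact (wordNorm_add_le _ _).trans (by omega)

/-- The largest absolute value of a component. -/
def Gain.norm (v : Gain) : ℕ := max (wordNorm v.free) (wordNorm v.used)

/-- The largest absolute value of an entry. -/
def Mat.norm (M : Mat) : ℕ :=
  max (max (wordNorm M.a) (wordNorm M.b)) (max (wordNorm M.c) (wordNorm M.d))

theorem Gain.norm_le {v : Gain} {m : ℕ} :
    v.norm ≤ m ↔ wordNorm v.free ≤ m ∧ wordNorm v.used ≤ m := by simp [Gain.norm]

theorem Mat.norm_le {M : Mat} {m : ℕ} : M.norm ≤ m ↔ (wordNorm M.a ≤ m ∧ wordNorm M.b ≤ m) ∧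
    wordNorm M.c ≤ m ∧ wordNorm M.d ≤ m := by simp [Mat.norm, and_assoc]

@[simp] theorem Gain.norm_one : (1 : Gain).norm = 0 := rfl
@[simp] theorem Mat.norm_one : (1 : Mat).norm = 0 := rfl

theorem Gain.norm_mul_le (v w : Gain) : (v * w).norm ≤ v.norm + w.norm := by
  obtain ⟨h1, h2⟩ := Gain.norm_le.1 (le_refl v.norm)
  obtain ⟨h3, h4⟩ := Gain.norm_le.1 (le_refl w.norm)
  exact Gain.norm_le.2 ⟨(wordNorm_add_le _ _).trans (by omega), wordNorm_max_add_le h1 h4 h2 h3⟩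

theorem Mat.norm_act_le (M : Mat) (v : Gain) : (M.act v).norm ≤ M.norm + v.norm := by
  obtain ⟨⟨h1, h2⟩, h3, h4⟩ := Mat.norm_le.1 (le_refl M.norm)
  obtain ⟨h5, h6⟩ := Gain.norm_le.1 (le_refl v.norm)
  exact Gain.norm_le.2 ⟨wordNorm_max_add_le h1 h5 h2 h6, wordNorm_max_add_le h3 h5 h4 h6⟩

theorem Mat.norm_mul_le (M N : Mat) : (M * N).norm ≤ M.norm + N.norm := by
  obtain ⟨⟨h1, h2⟩, h3, h4⟩ := Mat.norm_le.1 (le_refl M.norm)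
  obtain ⟨⟨h5, h6⟩, h7, h8⟩ := Mat.norm_le.1 (le_refl N.norm)
  exact Mat.norm_le.2 ⟨⟨wordNorm_max_add_le h1 h5 h2 h7, wordNorm_max_add_le h1 h6 h2 h8⟩,
    wordNorm_max_add_le h3 h5 h4 h7, wordNorm_max_add_le h3 h6 h4 h8⟩

@[simp] theorem Mat.norm_ofGain (v : Gain) : (Mat.ofGain v).norm = v.norm := by
  simp only [Mat.norm, Mat.ofGain, Gain.norm, wordNorm_bot]
  omega

/-! ### Storing several words in one -/

/-- An injective code of words. -/
def wordCode : Word → ℕ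
  | ⊥ => 0
  | (z : ℤ) => if 0 ≤ z then 2 * z.natAbs + 1 else 2 * z.natAbs

theorem wordCode_injective : Function.Injective wordCode := by
  intro v w h
  induction v using WithBot.recBotCoe <;> induction w using WithBot.recBotCoe
  · rfl
  · rename_i z
    have h' : (0 : ℕ) = if 0 ≤ z then 2 * z.natAbs + 1 else 2 * z.natAbs := h
    split_ifs at h'
    omega
  · rename_i z
    have h' : (if 0 ≤ z then 2 * z.natAbs + 1 else 2 * z.natAbs) = (0 : ℕ) := h
    split_ifs at h'
    omega
  · rename_i y z
    have h' : (if 0 ≤ y then 2 * y.natAbs + 1 else 2 * y.natAbs) =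
      if 0 ≤ z then 2 * z.natAbs + 1 else 2 * z.natAbs := h
    have : y = z := by split_ifs at h' <;> omega
    rw [this]

theorem wordCode_le (w : Word) : wordCode w ≤ 2 * wordNorm w + 1 := by
  induction w using WithBot.recBotCoe with
  | bot => exact Nat.zero_le _
  | coe z =>
    change (if 0 ≤ z then 2 * z.natAbs + 1 else 2 * z.natAbs) ≤ 2 * z.natAbs + 1
    split_ifs <;> omega

/-- In the form `a + 1 ≤ x` the bound can be iterated: each level of pairing squares `x`. -/
theorem pair_add_one_le {a b x : ℕ} (ha : a + 1 ≤ x) (hb : b + 1 ≤ x) :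
    Nat.pair a b + 1 ≤ x ^ 2 := by
  have h := Nat.pair_lt_max_add_one_sq a b
  have : (max a b + 1) ^ 2 ≤ x ^ 2 := Nat.pow_le_pow_left (by omega) 2
  omega

theorem pair_injective {a b c d : ℕ} (h : Nat.pair a b = Nat.pair c d) : a = c ∧ b = d :=
  Nat.pair_eq_pair.1 h

/-- An injective code of pairs. -/
def Gain.code (v : Gain) : ℕ := Nat.pair (wordCode v.free) (wordCode v.used)

/-- An injective code of matrices. -/
def Mat.code (M : Mat) : ℕ :=
  Nat.pair (Nat.pair (wordCode M.a) (wordCode M.b)) (Nat.pair (wordCode M.c) (wordCode M.d))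

/-- An injective code of two matrices. -/
def pairCode (p : Mat × Mat) : ℕ := Nat.pair p.1.code p.2.code

theorem Gain.code_injective : Function.Injective Gain.code := by
  intro v w h
  obtain ⟨h1, h2⟩ := pair_injective h
  exact Gain.ext (wordCode_injective h1) (wordCode_injective h2)

theorem Mat.code_injective : Function.Injective Mat.code := by
  intro v w h
  obtain ⟨h1, h2⟩ := pair_injective h
  obtain ⟨h3, h4⟩ := pair_injective h1
  obtain ⟨h5, h6⟩ := pair_injective h2
  exact Mat.ext (wordCode_injective h3) (wordCode_injective h4) (wordCode_injective h5)
    (wordCode_injective h6)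

theorem pairCode_injective : Function.Injective pairCode := by
  intro p q h
  obtain ⟨h1, h2⟩ := pair_injective h
  exact Prod.ext (Mat.code_injective h1) (Mat.code_injective h2)

theorem wordCode_add_one_le {w : Word} {m : ℕ} (h : wordNorm w ≤ m) :
    wordCode w + 1 ≤ 2 * m + 2 := by
  have := wordCode_le w
  omega

theorem Gain.code_le {v : Gain} {m : ℕ} (h : v.norm ≤ m) : v.code + 1 ≤ (2 * m + 2) ^ 2 := by
  obtain ⟨h1, h2⟩ := Gain.norm_le.1 h
  exact pair_add_one_le (wordCode_add_one_le h1) (wordCode_add_one_le h2)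

theorem Mat.code_le {M : Mat} {m : ℕ} (h : M.norm ≤ m) :
    M.code + 1 ≤ ((2 * m + 2) ^ 2) ^ 2 := by
  obtain ⟨⟨h1, h2⟩, h3, h4⟩ := Mat.norm_le.1 h
  exact pair_add_one_le (pair_add_one_le (wordCode_add_one_le h1) (wordCode_add_one_le h2))
    (pair_add_one_le (wordCode_add_one_le h3) (wordCode_add_one_le h4))

theorem pairCode_le {p : Mat × Mat} {m : ℕ} (h1 : p.1.norm ≤ m) (h2 : p.2.norm ≤ m) :
    pairCode p + 1 ≤ (((2 * m + 2) ^ 2) ^ 2) ^ 2 :=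
  pair_add_one_le (Mat.code_le h1) (Mat.code_le h2)

instance : Nonempty Gain := ⟨1⟩
instance : Nonempty (Mat × Mat) := ⟨(1, 1)⟩

/-- The pair with a given code. -/
noncomputable def Gain.decode : ℕ → Gain := Function.invFun Gain.code

/-- The two matrices with a given code. -/
noncomputable def pairDecode : ℕ → Mat × Mat := Function.invFun pairCode

@[simp] theorem Gain.decode_code (v : Gain) : Gain.decode v.code = v :=
  Function.leftInverse_invFun Gain.code_injective v

@[simp] theorem pairDecode_code (p : Mat × Mat) : pairDecode (pairCode p) = p :=
  Function.leftInverse_invFun pairCode_injective p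

/-- A natural number as a word. -/
def natWord (m : ℕ) : Word := ((m : ℤ) : WithBot ℤ)

/-- The natural number that a word stores. -/
def wordNat : Word → ℕ
  | ⊥ => 0
  | (z : ℤ) => z.toNat

@[simp] theorem wordNat_natWord (m : ℕ) : wordNat (natWord m) = m := rfl

theorem natWord_injective : Function.Injective natWord := fun a b h => by
  simpa using congrArg wordNat h

theorem natWord_fits {B m : ℕ} (h : m ≤ B) : (natWord m).Fits B := by
  intro z hz
  have : (m : ℤ) = z := WithBot.coe_injective hz
  rw [← this, Nat.abs_cast]
  exact_mod_cast h

/-! ### Binary trees and their contraction -/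

/-- Binary trees whose nodes carry a name and the two matrices that are applied to the values of the
left and of the right subtree. -/
inductive BT : Type
  | nil : BT
  | node (z : ℕ) (P Q : Mat) (l r : BT) : BT

namespace BT

/-- The name of the root. -/
def top : BT → Option ℕ
  | nil => none
  | node z _ _ _ _ => some z

/-- The names of the nodes. -/
def labels : BT → List ℕ
  | nil => []
  | node z _ _ l r => z :: (l.labels ++ r.labels)

/-- The Euler tour: the node `z` is visited in the positions `3 z`, `3 z + 1`, `3 z + 2`. -/
def tour : BT → List ℕ
  | nil => []
  | node z _ _ l r => 3 * z :: (l.tour ++ (3 * z + 1) :: (r.tour ++ [3 * z + 2]))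

/-- The sum of the norms of all matrices. -/
def weight : BT → ℕ
  | nil => 0
  | node _ P Q l r => P.norm + Q.norm + l.weight + r.weight

/-- `s` is a subtree of a tree. -/
def Sub (s : BT) : BT → Prop
  | nil => s = nil
  | node z P Q l r => s = node z P Q l r ∨ Sub s l ∨ Sub s r

theorem Sub.refl (t : BT) : Sub t t := by cases t <;> simp [Sub]

theorem sub_left (z : ℕ) (P Q : Mat) (l r : BT) : Sub l (node z P Q l r) :=
  Or.inr (Or.inl (Sub.refl l))

theorem sub_right (z : ℕ) (P Q : Mat) (l r : BT) : Sub r (node z P Q l r) :=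
  Or.inr (Or.inr (Sub.refl r))

theorem Sub.trans {s t u : BT} (h1 : Sub s t) (h2 : Sub t u) : Sub s u := by
  induction u with
  | nil =>
    cases h2
    exact h1
  | node z P Q l r ihl ihr =>
    rcases h2 with rfl | h2 | h2
    · exact h1
    · exact Or.inr (Or.inl (ihl h2))
    · exact Or.inr (Or.inr (ihr h2))

theorem mem_labels {z : ℕ} {t : BT} :
    z ∈ t.labels ↔ ∃ P Q l r, Sub (node z P Q l r) t := by
  induction t with
  | nil => simp [labels, Sub]
  | node y P Q l r ihl ihr =>
    simp only [labels, List.mem_cons, List.mem_append, ihl, ihr, Sub]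
    constructor
    · rintro (rfl | ⟨P', Q', l', r', h⟩ | ⟨P', Q', l', r', h⟩)
      · exact ⟨P, Q, l, r, Or.inl rfl⟩
      · exact ⟨P', Q', l', r', Or.inr (Or.inl h)⟩
      · exact ⟨P', Q', l', r', Or.inr (Or.inr h)⟩
    · rintro ⟨P', Q', l', r', h | h | h⟩
      · injection h with h
        exact Or.inl h
      · exact Or.inr (Or.inl ⟨_, _, _, _, h⟩)
      · exact Or.inr (Or.inr ⟨_, _, _, _, h⟩)

theorem top_mem_labels {t : BT} {z : ℕ} (h : t.top = some z) : z ∈ t.labels := by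
  cases t with
  | nil => cases h
  | node y P Q l r =>
    cases h
    simp [labels]

theorem top_eq_none {t : BT} : t.top = none ↔ t = nil := by
  cases t <;> simp [top]

theorem Sub.labels_subset {s t : BT} (h : Sub s t) : s.labels ⊆ t.labels := by
  intro z hz
  obtain ⟨P, Q, l, r, h'⟩ := mem_labels.1 hz
  exact mem_labels.2 ⟨P, Q, l, r, h'.trans h⟩

theorem Sub.labels_sublist {s t : BT} (h : Sub s t) : s.labels.Sublist t.labels := by
  induction t with
  | nil => cases h; exact List.Sublist.refl _
  | node z P Q l r ihl ihr =>
    rcases h with rfl | h | h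
    · exact List.Sublist.refl _
    · exact ((ihl h).trans (List.sublist_append_left _ _)).trans (List.sublist_cons_self _ _)
    · exact ((ihr h).trans (List.sublist_append_right _ _)).trans (List.sublist_cons_self _ _)

/-- A subtree occupies a contiguous segment of the Euler tour; bounds on gaps are therefore
inherited by subtrees. -/
theorem Sub.tour_eq {s t : BT} (h : Sub s t) : ∃ a b, t.tour = a ++ (s.tour ++ b) := by
  induction t with
  | nil => cases h; exact ⟨[], [], rfl⟩
  | node z P Q l r ihl ihr =>
    rcases h with rfl | h | h
    · exact ⟨[], [], by simp⟩
    · obtain ⟨a, b, e⟩ := ihl h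
      exact ⟨3 * z :: a, b ++ (3 * z + 1) :: (r.tour ++ [3 * z + 2]), by simp [tour, e]⟩
    · obtain ⟨a, b, e⟩ := ihr h
      exact ⟨3 * z :: (l.tour ++ (3 * z + 1) :: a), b ++ [3 * z + 2], by simp [tour, e]⟩

theorem length_tour (t : BT) : t.tour.length = 3 * t.labels.length := by
  induction t with
  | nil => rfl
  | node z P Q l r ihl ihr =>
    simp only [tour, labels, List.length_cons, List.length_append, ihl, ihr, List.length_nil]
    omega

theorem mem_tour {t : BT} {p : ℕ} : p ∈ t.tour ↔ p / 3 ∈ t.labels := by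
  induction t with
  | nil => simp [tour, labels]
  | node z P Q l r ihl ihr =>
    simp only [tour, labels, List.mem_cons, List.mem_append, ihl, ihr, List.not_mem_nil, or_false]
    have : p / 3 = z ↔ p = 3 * z ∨ p = 3 * z + 1 ∨ p = 3 * z + 2 := by omega
    rw [this]
    tauto

theorem nodup_tour {t : BT} (h : t.labels.Nodup) : t.tour.Nodup := by
  induction t with
  | nil => simp [tour]
  | node z P Q l r ihl ihr =>
    simp only [labels, List.nodup_cons, List.mem_append, not_or, List.nodup_append'] at h
    obtain ⟨⟨h1, h2⟩, h3, h4, h5⟩ := h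
    have e : ∀ p : ℕ, p / 3 ≠ z → p ≠ 3 * z ∧ p ≠ 3 * z + 1 ∧ p ≠ 3 * z + 2 := by
      intro p hp
      refine ⟨?_, ?_, ?_⟩ <;> omega
    have hl : ∀ p ∈ l.tour, p / 3 ≠ z := fun p hp hz => h1 (hz ▸ mem_tour.1 hp)
    have hr : ∀ p ∈ r.tour, p / 3 ≠ z := fun p hp hz => h2 (hz ▸ mem_tour.1 hp)
    have hd : ∀ p ∈ l.tour, p ∉ r.tour := fun p hp hq => h5 (mem_tour.1 hp) (mem_tour.1 hq)
    have n0 : 3 * z ∉ l.tour := fun h => (e _ (hl _ h)).1 rfl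
    have n1 : 3 * z + 1 ∉ l.tour := fun h => (e _ (hl _ h)).2.1 rfl
    have n2 : 3 * z + 2 ∉ l.tour := fun h => (e _ (hl _ h)).2.2 rfl
    have m0 : 3 * z ∉ r.tour := fun h => (e _ (hr _ h)).1 rfl
    have m1 : 3 * z + 1 ∉ r.tour := fun h => (e _ (hr _ h)).2.1 rfl
    have m2 : 3 * z + 2 ∉ r.tour := fun h => (e _ (hr _ h)).2.2 rfl
    simp only [tour, List.nodup_cons, List.nodup_append', List.mem_append, List.mem_cons,
      List.disjoint_left, List.not_mem_nil]
    refine ⟨by simp [n0, m0], ihl h3, ⟨by simp [m1], ihr h4, by simp, ?_⟩, ?_⟩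
    · intro p hp
      have := e p (hr p hp)
      simp [this.2.2]
    · intro p hp
      have := e p (hl p hp)
      simp [this.2.2, this.2.1, hd p hp]

/-- The value of an optional node. -/
def ev (val : ℕ → Gain) : Option ℕ → Gain
  | none => 1
  | some z => val z

/-- The function `val` satisfies the recursion that the tree encodes. -/
def Valued (val : ℕ → Gain) (t : BT) : Prop :=
  ∀ z P Q l r, Sub (node z P Q l r) t →
    val z = P.act (ev val l.top) * Q.act (ev val r.top)

open scoped Classical in
/-- The tree on the nodes in `Y`, together with the matrix that takes the value of its root to the
value of the root of the original tree. -/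
noncomputable def contract (Y : ℕ → Prop) : BT → Mat × BT
  | nil => (1, nil)
  | node z P Q l r =>
    if Y z then (1, node z (P * (contract Y l).1) (Q * (contract Y r).1)
      (contract Y l).2 (contract Y r).2)
    else
      -- A dropped node keeps the side on which a node of `Y` survives. The other side is constant:
      -- its matrix is applied to the value `1` of the empty tree and multiplied in. If both sides
      -- had survivors the left one would be lost, which `Clean` excludes.
      match (contract Y r).2 with
      | nil => (Mat.ofGain ((Q * (contract Y r).1).act 1) * (P * (contract Y l).1),
          (contract Y l).2)
      | node z' P' Q' l' r' => (Mat.ofGain ((P * (contract Y l).1).act 1) *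
          (Q * (contract Y r).1), node z' P' Q' l' r')

/-- No node outside `Y` has nodes in `Y` in both subtrees. -/
def Clean (Y : ℕ → Prop) (t : BT) : Prop :=
  ∀ z P Q l r, Sub (node z P Q l r) t → ¬ Y z →
    (contract Y l).2 = nil ∨ (contract Y r).2 = nil

theorem Clean.mono {Y : ℕ → Prop} {s t : BT} (h : Clean Y t) (hs : Sub s t) : Clean Y s :=
  fun z P Q l r h' => h z P Q l r (h'.trans hs)

theorem contract_node_of_mem {Y : ℕ → Prop} {z : ℕ} (hz : Y z) (P Q : Mat) (l r : BT) :
    contract Y (node z P Q l r) = (1, node z (P * (contract Y l).1) (Q * (contract Y r).1)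
      (contract Y l).2 (contract Y r).2) := by simp [contract, hz]

theorem contract_node_of_right {Y : ℕ → Prop} {z : ℕ} (hz : ¬ Y z) (P Q : Mat) (l r : BT)
    (h : (contract Y r).2 = nil) : contract Y (node z P Q l r) =
      (Mat.ofGain ((Q * (contract Y r).1).act 1) * (P * (contract Y l).1), (contract Y l).2) := by
  simp [contract, hz, h]

theorem contract_node_of_left {Y : ℕ → Prop} {z : ℕ} (hz : ¬ Y z) (P Q : Mat) (l r : BT)
    (h : (contract Y r).2 ≠ nil) : contract Y (node z P Q l r) =
      (Mat.ofGain ((P * (contract Y l).1).act 1) * (Q * (contract Y r).1), (contract Y r).2) := by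
  cases h' : (contract Y r).2 with
  | nil => exact absurd h' h
  | node z' P' Q' l' r' => simp [contract, hz, h']

/-- Contraction is local: a surviving node carries the data obtained by contracting its two original
subtrees. Cleanness plays no role here, since without it nodes can only disappear. -/
theorem sub_contract {Y : ℕ → Prop} {t : BT} {z : ℕ} {P' Q' : Mat} {l' r' : BT}
    (h : Sub (node z P' Q' l' r') (contract Y t).2) :
    ∃ P Q l r, Sub (node z P Q l r) t ∧ Y z ∧ P' = P * (contract Y l).1 ∧
      Q' = Q * (contract Y r).1 ∧ l' = (contract Y l).2 ∧ r' = (contract Y r).2 := by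
  induction t with
  | nil => simp [contract, Sub] at h
  | node y P Q l r ihl ihr =>
    have hl : Sub (node z P' Q' l' r') (contract Y l).2 → ∃ P₁ Q₁ l₁ r₁,
        Sub (node z P₁ Q₁ l₁ r₁) (node y P Q l r) ∧ Y z ∧ P' = P₁ * (contract Y l₁).1 ∧
        Q' = Q₁ * (contract Y r₁).1 ∧ l' = (contract Y l₁).2 ∧ r' = (contract Y r₁).2 := by
      intro h
      obtain ⟨P₁, Q₁, l₁, r₁, h1, h2⟩ := ihl h
      exact ⟨P₁, Q₁, l₁, r₁, Or.inr (Or.inl h1), h2⟩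
    have hr : Sub (node z P' Q' l' r') (contract Y r).2 → ∃ P₁ Q₁ l₁ r₁,
        Sub (node z P₁ Q₁ l₁ r₁) (node y P Q l r) ∧ Y z ∧ P' = P₁ * (contract Y l₁).1 ∧
        Q' = Q₁ * (contract Y r₁).1 ∧ l' = (contract Y l₁).2 ∧ r' = (contract Y r₁).2 := by
      intro h
      obtain ⟨P₁, Q₁, l₁, r₁, h1, h2⟩ := ihr h
      exact ⟨P₁, Q₁, l₁, r₁, Or.inr (Or.inr h1), h2⟩
    by_cases hy : Y y
    · rw [contract_node_of_mem hy] at h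
      rcases h with h | h | h
      · injection h with h1 h2 h3 h4 h5
        subst h1
        exact ⟨P, Q, l, r, Or.inl rfl, hy, h2, h3, h4, h5⟩
      · exact hl h
      · exact hr h
    · by_cases hn : (contract Y r).2 = nil
      · rw [contract_node_of_right hy _ _ _ _ hn] at h
        exact hl h
      · rw [contract_node_of_left hy _ _ _ _ hn] at h
        exact hr h

/-- Cleanness is needed for the converse direction: no node of `Y` is thrown away with a side that
is treated as constant. -/
theorem mem_labels_contract {Y : ℕ → Prop} {t : BT} (h : Clean Y t) {z : ℕ} :
    z ∈ (contract Y t).2.labels ↔ z ∈ t.labels ∧ Y z := by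
  constructor
  · intro hz
    obtain ⟨P', Q', l', r', h'⟩ := mem_labels.1 hz
    obtain ⟨P, Q, l, r, h1, h2, -⟩ := sub_contract h'
    exact ⟨mem_labels.2 ⟨P, Q, l, r, h1⟩, h2⟩
  · induction t with
    | nil => simp [labels]
    | node y P Q l r ihl ihr =>
      have ihl := ihl (h.mono (sub_left y P Q l r))
      have ihr := ihr (h.mono (sub_right y P Q l r))
      rintro ⟨hz, hY⟩
      by_cases hy : Y y
      · rw [contract_node_of_mem hy]
        simp only [labels, List.mem_cons, List.mem_append] at hz ⊢
        rcases hz with hz | hz | hz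
        · exact Or.inl hz
        · exact Or.inr (Or.inl (ihl ⟨hz, hY⟩))
        · exact Or.inr (Or.inr (ihr ⟨hz, hY⟩))
      · simp only [labels, List.mem_cons, List.mem_append] at hz
        have hzy : z ≠ y := fun e => hy (e ▸ hY)
        by_cases hn : (contract Y r).2 = nil
        · rw [contract_node_of_right hy _ _ _ _ hn]
          rcases hz with hz | hz | hz
          · exact absurd hz hzy
          · exact ihl ⟨hz, hY⟩
          · have := ihr ⟨hz, hY⟩
            simp [hn, labels] at this
        · rw [contract_node_of_left hy _ _ _ _ hn]
          have hn' := (h y P Q l r (Sub.refl _) hy).resolve_right hn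
          rcases hz with hz | hz | hz
          · exact absurd hz hzy
          · have := ihl ⟨hz, hY⟩
            simp [hn', labels] at this
          · exact ihr ⟨hz, hY⟩

theorem top_contract {Y : ℕ → Prop} {t : BT} {z : ℕ} (h : (contract Y t).2.top = some z) :
    z ∈ t.labels ∧ Y z := by
  obtain ⟨P', Q', l', r', h'⟩ := mem_labels.1 (top_mem_labels h)
  obtain ⟨P, Q, l, r, h1, h2, -⟩ := sub_contract h'
  exact ⟨mem_labels.2 ⟨P, Q, l, r, h1⟩, h2⟩

theorem labels_contract_sublist (Y : ℕ → Prop) (t : BT) :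
    (contract Y t).2.labels.Sublist t.labels := by
  induction t with
  | nil => simp [contract]
  | node y P Q l r ihl ihr =>
    by_cases hy : Y y
    · rw [contract_node_of_mem hy]
      exact (ihl.append ihr).cons_cons _
    · by_cases hn : (contract Y r).2 = nil
      · rw [contract_node_of_right hy _ _ _ _ hn]
        exact (ihl.trans (List.sublist_append_left _ _)).trans (List.sublist_cons_self _ _)
      · rw [contract_node_of_left hy _ _ _ _ hn]
        exact (ihr.trans (List.sublist_append_right _ _)).trans (List.sublist_cons_self _ _)

/-- Each matrix enters at most one matrix of the result and norms are subadditive. The total weight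
therefore bounds the words on all levels at once. -/
theorem weight_contract_le (Y : ℕ → Prop) (t : BT) :
    (contract Y t).1.norm + (contract Y t).2.weight ≤ t.weight := by
  induction t with
  | nil => simp [contract, weight]
  | node y P Q l r ihl ihr =>
    have h1 := Mat.norm_mul_le P (contract Y l).1
    have h2 := Mat.norm_mul_le Q (contract Y r).1
    by_cases hy : Y y
    · rw [contract_node_of_mem hy]
      simp only [weight, Mat.norm_one]
      omega
    · by_cases hn : (contract Y r).2 = nil
      · rw [contract_node_of_right hy _ _ _ _ hn]
        have h3 := Mat.norm_mul_le (Mat.ofGain ((Q * (contract Y r).1).act 1))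
          (P * (contract Y l).1)
        have h4 := Mat.norm_act_le (Q * (contract Y r).1) 1
        simp only [Mat.norm_ofGain, Gain.norm_one] at h3 h4
        simp only [weight]
        omega
      · rw [contract_node_of_left hy _ _ _ _ hn]
        have h3 := Mat.norm_mul_le (Mat.ofGain ((P * (contract Y l).1).act 1))
          (Q * (contract Y r).1)
        have h4 := Mat.norm_act_le (P * (contract Y l).1) 1
        simp only [Mat.norm_ofGain, Gain.norm_one] at h3 h4
        simp only [weight]
        omega

theorem norm_le_weight {t : BT} {z : ℕ} {P Q : Mat} {l r : BT} (h : Sub (node z P Q l r) t) :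
    P.norm ≤ t.weight ∧ Q.norm ≤ t.weight := by
  induction t with
  | nil => simp [Sub] at h
  | node y P' Q' l' r' ihl ihr =>
    rcases h with h | h | h
    · injection h with h1 h2 h3 h4 h5
      subst h2 h3
      simp only [weight]
      omega
    · have := ihl h
      simp only [weight]
      omega
    · have := ihr h
      simp only [weight]
      omega

theorem Valued.mono {val : ℕ → Gain} {s t : BT} (h : Valued val t) (hs : Sub s t) :
    Valued val s := fun z P Q l r h' => h z P Q l r (h'.trans hs)

/-- At a dropped node one factor of the recursion is known, and the product with it is linear in the
other factor. Composing these linear maps down to the first surviving node gives the matrix of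
`contract`. -/
theorem ev_contract {Y : ℕ → Prop} {val : ℕ → Gain} {t : BT} (hc : Clean Y t)
    (h : Valued val t) : ev val t.top = (contract Y t).1.act (ev val (contract Y t).2.top) := by
  induction t with
  | nil => simp [contract, top]
  | node y P Q l r ihl ihr =>
    have ihl := ihl (hc.mono (sub_left y P Q l r)) (h.mono (sub_left y P Q l r))
    have ihr := ihr (hc.mono (sub_right y P Q l r)) (h.mono (sub_right y P Q l r))
    have hv := h y P Q l r (Sub.refl _)
    by_cases hy : Y y
    · rw [contract_node_of_mem hy]
      simp [top]
    · by_cases hn : (contract Y r).2 = nil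
      · rw [contract_node_of_right hy _ _ _ _ hn]
        have e : ev val (contract Y r).2.top = 1 := by rw [hn]; rfl
        rw [e] at ihr
        rw [Mat.mul_act, Mat.ofGain_act, Mat.mul_act, Mat.mul_act, ← ihl, ← ihr]
        rw [mul_comm]
        exact hv
      · have hn' := (hc y P Q l r (Sub.refl _) hy).resolve_right hn
        rw [contract_node_of_left hy _ _ _ _ hn]
        have e : ev val (contract Y l).2.top = 1 := by rw [hn']; rfl
        rw [e] at ihl
        rw [Mat.mul_act, Mat.ofGain_act, Mat.mul_act, Mat.mul_act, ← ihl, ← ihr]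
        exact hv

theorem Valued.contract {Y : ℕ → Prop} {val : ℕ → Gain} {t : BT} (hc : Clean Y t)
    (h : Valued val t) : Valued val (contract Y t).2 := by
  intro z P' Q' l' r' h'
  obtain ⟨P, Q, l, r, h1, -, rfl, rfl, rfl, rfl⟩ := sub_contract h'
  have hl := (sub_left z P Q l r).trans h1
  have hr := (sub_right z P Q l r).trans h1
  rw [Mat.mul_act, Mat.mul_act, ← ev_contract (hc.mono hl) (h.mono hl),
    ← ev_contract (hc.mono hr) (h.mono hr)]
  exact h z P Q l r h1

end BT

/-! ### The parts between the chosen nodes, as seen by one machine. -/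

/-- A part of a binary tree, cut at nodes (holes) that carry optional data. -/
inductive CutTree : Type
  | nil : CutTree
  | hole (z : ℕ) (v : Option Word) : CutTree
  | node (z : ℕ) (P Q : Mat) (l r : CutTree) : CutTree

namespace CutTree

/-- The number of nodes. -/
def size : CutTree → ℕ
  | nil => 0
  | hole _ _ => 0
  | node _ _ _ l r => l.size + r.size + 1

/-- The linear function that a part with at most one hole encodes, and its hole. -/
noncomputable def summary : CutTree → Mat × Option ℕ
  | nil => (1, none)
  | hole z _ => (1, some z)
  | node _ P Q l r =>
    match r.summary.2 with
    | none => (Mat.ofGain ((Q * r.summary.1).act 1) * (P * l.summary.1), l.summary.2)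
    | some z => (Mat.ofGain ((P * l.summary.1).act 1) * (Q * r.summary.1), some z)

/-- The value of a part whose holes carry the codes of their values. -/
noncomputable def value : CutTree → Gain
  | nil => 1
  | hole _ v => (v.map fun w => Gain.decode (wordNat w)).getD 1
  | node _ P Q l r => P.act l.value * Q.act r.value

/-- The values of all nodes of a part. -/
noncomputable def values : CutTree → List (ℕ × Gain)
  | nil => []
  | hole _ _ => []
  | node z P Q l r => (z, (node z P Q l r).value) :: (l.values ++ r.values)

theorem length_values (s : CutTree) : s.values.length = s.size := by
  induction s with
  | nil => rfl
  | hole z v => rfl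
  | node z P Q l r ihl ihr => simp [values, size, ihl, ihr]

end CutTree

namespace BT

open scoped Classical in
/-- The part of a tree above the nodes in `Y`. -/
noncomputable def cut (Y : ℕ → Prop) (d : ℕ → Option Word) : BT → CutTree
  | nil => .nil
  | node z P Q l r => if Y z then .hole z (d z) else .node z P Q (cut Y d l) (cut Y d r)

/-- At a node of `Y` the matrix of `contract` starts afresh from `1`. Hence the part above the first
nodes of `Y` already determines the matrix and the child pointer, and no machine has to look beyond
it. -/
theorem summary_cut (Y : ℕ → Prop) (d : ℕ → Option Word) (t : BT) :
    (cut Y d t).summary = ((contract Y t).1, (contract Y t).2.top) := by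
  induction t with
  | nil => rfl
  | node z P Q l r ihl ihr =>
    by_cases hz : Y z
    · rw [contract_node_of_mem hz]
      simp [cut, hz, CutTree.summary, top]
    · by_cases hn : (contract Y r).2 = nil
      · rw [contract_node_of_right hz _ _ _ _ hn]
        simp only [cut, hz, if_false, CutTree.summary, ihl, ihr, hn]
        rfl
      · rw [contract_node_of_left hz _ _ _ _ hn]
        cases h' : (contract Y r).2 with
        | nil => exact absurd h' hn
        | node z' P' Q' l' r' =>
          simp only [cut, hz, if_false, CutTree.summary, ihl, ihr, h']
          rfl

/-- The holes supply the values of the nodes of `Y`, so evaluating the part bottom-up follows the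
recursion of `val`. -/
theorem value_cut {Y : ℕ → Prop} {d : ℕ → Option Word} {val : ℕ → Gain} {t : BT}
    (h : Valued val t) (hd : ∀ z ∈ t.labels, Y z → d z = some (natWord (val z).code)) :
    (cut Y d t).value = ev val t.top := by
  induction t with
  | nil => rfl
  | node z P Q l r ihl ihr =>
    have hv := h z P Q l r (Sub.refl _)
    by_cases hz : Y z
    · simp [cut, hz, CutTree.value, hd z (by simp [labels]) hz, top, ev]
    · simp only [cut, hz, if_false, CutTree.value]
      rw [ihl (h.mono (sub_left ..)) fun y hy => hd y ((sub_left z P Q l r).labels_subset hy),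
        ihr (h.mono (sub_right ..)) fun y hy => hd y ((sub_right z P Q l r).labels_subset hy)]
      exact hv.symm

theorem mem_values_cut {Y : ℕ → Prop} {d : ℕ → Option Word} {val : ℕ → Gain} {t : BT}
    (h : Valued val t) (hd : ∀ z ∈ t.labels, Y z → d z = some (natWord (val z).code))
    {e : ℕ × Gain} (he : e ∈ (cut Y d t).values) : e.1 ∈ t.labels ∧ e.2 = val e.1 := by
  induction t with
  | nil => simp [cut, CutTree.values] at he
  | node z P Q l r ihl ihr =>
    by_cases hz : Y z
    · simp [cut, hz, CutTree.values] at he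
    · have hv := value_cut h hd
      simp only [cut, hz, if_false, CutTree.values, List.mem_cons, List.mem_append] at he hv
      rcases he with rfl | he | he
      · exact ⟨by simp [labels], hv⟩
      · have := ihl (h.mono (sub_left ..))
          (fun y hy => hd y ((sub_left z P Q l r).labels_subset hy)) he
        exact ⟨(sub_left z P Q l r).labels_subset this.1, this.2⟩
      · have := ihr (h.mono (sub_right ..))
          (fun y hy => hd y ((sub_right z P Q l r).labels_subset hy)) he
        exact ⟨(sub_right z P Q l r).labels_subset this.1, this.2⟩

/-- Each node that is not in the part of a node in `Y` above it is in `Y` or in a part below a node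
in `Y`. -/
theorem exists_mem_values {Y : ℕ → Prop} (d : ℕ → Option Word) {t : BT} {z : ℕ}
    (hz : z ∈ t.labels) :
    z ∈ (cut Y d t).values.map Prod.fst ∨ Y z ∨
      ∃ y P Q l r, Sub (node y P Q l r) t ∧ Y y ∧
        (z ∈ (cut Y d l).values.map Prod.fst ∨ z ∈ (cut Y d r).values.map Prod.fst) := by
  induction t with
  | nil => simp [labels] at hz
  | node y P Q l r ihl ihr =>
    have key : ∀ s, (s = l ∨ s = r) → z ∈ s.labels →
        (z ∈ (cut Y d s).values.map Prod.fst ∨ Y z ∨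
        ∃ y' P' Q' l' r', Sub (node y' P' Q' l' r') s ∧ Y y' ∧
        (z ∈ (cut Y d l').values.map Prod.fst ∨ z ∈ (cut Y d r').values.map Prod.fst)) := by
      rintro s (rfl | rfl) hs
      · exact ihl hs
      · exact ihr hs
    have up : ∀ s, (s = l ∨ s = r) → Sub s (node y P Q l r) := by
      rintro s (rfl | rfl)
      · exact sub_left ..
      · exact sub_right ..
    have main : ∀ s, (s = l ∨ s = r) → z ∈ s.labels → z ∈ (cut Y d (node y P Q l r)).values.map
        Prod.fst ∨ Y z ∨ ∃ y' P' Q' l' r', Sub (node y' P' Q' l' r') (node y P Q l r) ∧ Y y' ∧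
        (z ∈ (cut Y d l').values.map Prod.fst ∨ z ∈ (cut Y d r').values.map Prod.fst) := by
      intro s hs hz
      rcases key s hs hz with h | h | ⟨y', P', Q', l', r', h1, h2⟩
      · by_cases hy : Y y
        · refine Or.inr (Or.inr ⟨y, P, Q, l, r, Sub.refl _, hy, ?_⟩)
          rcases hs with rfl | rfl
          · exact Or.inl h
          · exact Or.inr h
        · left
          simp only [cut, hy, if_false, CutTree.values, List.map_cons, List.map_append, List.mem_cons,
            List.mem_append]
          rcases hs with rfl | rfl
          · exact Or.inr (Or.inl h)
          · exact Or.inr (Or.inr h)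
      · exact Or.inr (Or.inl h)
      · exact Or.inr (Or.inr ⟨y', P', Q', l', r', h1.trans (up s hs), h2⟩)
    simp only [labels, List.mem_cons, List.mem_append] at hz
    rcases hz with rfl | hz | hz
    · by_cases hy : Y z
      · exact Or.inr (Or.inl hy)
      · left
        simp [cut, hy, CutTree.values]
    · exact main l (Or.inl rfl) hz
    · exact main r (Or.inr rfl) hz

theorem size_cut_le (Y : ℕ → Prop) (d : ℕ → Option Word) (t : BT) :
    (cut Y d t).size ≤ t.labels.length := by
  induction t with
  | nil => simp [cut, CutTree.size]
  | node z P Q l r ihl ihr =>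
    by_cases hz : Y z
    · simp [cut, hz, CutTree.size]
    · simp only [cut, hz, if_false, CutTree.size, labels, List.length_cons, List.length_append]
      omega

end BT

/-! ### Marks from samples of the Euler tour -/

theorem List.exists_last_of_mem {α : Type*} (X : α → Prop) (l : List α) (h : ∃ p ∈ l, X p) :
    ∃ A p B, l = A ++ p :: B ∧ X p ∧ ∀ q ∈ B, ¬ X q := by
  induction l with
  | nil => simp at h
  | cons a l ih =>
    by_cases h' : ∃ p ∈ l, X p
    · obtain ⟨A, p, B, rfl, h1, h2⟩ := ih h'
      exact ⟨a :: A, p, B, rfl, h1, h2⟩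
    · push Not at h'
      obtain ⟨p, hp, hX⟩ := h
      rcases List.mem_cons.1 hp with rfl | hp
      · exact ⟨[], p, l, rfl, hX, h'⟩
      · exact absurd hX (h' p hp)

theorem List.exists_first_of_mem {α : Type*} (X : α → Prop) (l : List α) (h : ∃ p ∈ l, X p) :
    ∃ A p B, l = A ++ p :: B ∧ X p ∧ ∀ q ∈ A, ¬ X q := by
  obtain ⟨A, p, B, h1, h2, h3⟩ := List.exists_last_of_mem X l.reverse (by simpa using h)
  refine ⟨B.reverse, p, A.reverse, ?_, h2, by simpa using h3⟩
  rw [← List.reverse_reverse l, h1]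
  simp

theorem List.Nodup.split_unique {α : Type*} {y : α} {a b a' b' : List α}
    (h : (a ++ y :: b).Nodup) (e : a ++ y :: b = a' ++ y :: b') : a = a' ∧ b = b' := by
  rw [eq_comm, List.append_cons_inj_of_notMem] at e
  · exact ⟨e.1.symm, e.2.2.symm⟩
  · exact (List.nodup_middle.1 (e ▸ h)).notMem ∘ fun h => List.mem_append_left _ h
  · exact (List.nodup_middle.1 (e ▸ h)).notMem ∘ fun h => List.mem_append_right _ h

open scoped Classical in
/-- The walk along `next` from `p` until just before the next position in `X`. -/
noncomputable def walk (next : ℕ → Option ℕ) (X : ℕ → Prop) : ℕ → ℕ → List ℕ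
  | 0, p => [p]
  | f + 1, p =>
    match next p with
    | none => [p]
    | some q => if X q then [p] else p :: walk next X f q

open scoped Classical in
/-- The node at which a walk turns from the left to the right subtree, if there is one; otherwise
the node of the position `p`. -/
noncomputable def turn (p : ℕ) (V : List ℕ) : ℕ :=
  if h : ∃ w, 3 * w + 1 ∈ V ∧ 3 * w ∉ V ∧ 3 * w + 2 ∉ V then h.choose else p / 3

theorem walk_eq {next : ℕ → Option ℕ} {X : ℕ → Prop} (V : List ℕ) {f p q : ℕ} {rest : List ℕ}
    (hc : (p :: (V ++ q :: rest)).IsChain fun a b => next a = some b) (hV : ∀ x ∈ V, ¬ X x)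
    (hq : X q) (hf : V.length ≤ f) : walk next X f p = p :: V := by
  induction V generalizing f p with
  | nil =>
    cases f with
    | zero => rfl
    | succ f =>
      rw [List.nil_append, List.isChain_cons_cons] at hc
      simp [walk, hc.1, hq]
  | cons v V ih =>
    cases f with
    | zero => simp at hf
    | succ f =>
      rw [List.cons_append, List.isChain_cons_cons] at hc
      simp only [walk, hc.1, hV v (by simp), if_false]
      rw [ih hc.2 (fun x hx => hV x (by simp [hx])) (by simpa using hf)]

/-- Whether it ends at an element of `X`, at the end of the tour or for lack of fuel, a walk covers
a contiguous segment of the tour. -/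
theorem walk_prefix {next : ℕ → Option ℕ} {X : ℕ → Prop} (f p : ℕ) (rest : List ℕ)
    (hc : (p :: rest).IsChain fun a b => next a = some b)
    (hl : ∀ a b, p :: rest = a ++ [b] → next b = none) :
    ∃ V rest', walk next X f p = p :: V ∧ rest = V ++ rest' := by
  induction f generalizing p rest with
  | zero => exact ⟨[], rest, rfl, rfl⟩
  | succ f ih =>
    cases rest with
    | nil =>
      have := hl [] p rfl
      exact ⟨[], [], by simp [walk, this], rfl⟩
    | cons q rest =>
      rw [List.isChain_cons_cons] at hc
      by_cases hq : X q
      · exact ⟨[], q :: rest, by simp [walk, hc.1, hq], rfl⟩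
      · obtain ⟨V, rest', h1, h2⟩ := ih q rest hc.2 fun a b h => hl (p :: a) b (by simp [h])
        exact ⟨q :: V, rest', by simp [walk, hc.1, hq, h1], by simp [h2]⟩

namespace BT

/-- The tour of a tree meets `X`. -/
def Hit (X : ℕ → Prop) (t : BT) : Prop := ∃ p ∈ t.tour, X p

theorem Hit.mono {X : ℕ → Prop} {s t : BT} (h : Hit X s) (hs : Sub s t) : Hit X t := by
  obtain ⟨p, hp, hX⟩ := h
  exact ⟨p, mem_tour.2 (hs.labels_subset (mem_tour.1 hp)), hX⟩

/-- The set `Y` contains the nodes of the positions in `X` and the lowest common ancestors, and only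
nodes above positions in `X`. -/
def Closed (X Y : ℕ → Prop) (t : BT) : Prop :=
  ∀ z P Q l r, Sub (node z P Q l r) t → (Hit X l → Hit X r → Y z) ∧
    (∀ p, X p → p / 3 = z → Y z) ∧ (Y z → Hit X (node z P Q l r))

theorem Closed.mono {X Y : ℕ → Prop} {s t : BT} (h : Closed X Y t) (hs : Sub s t) :
    Closed X Y s := fun z P Q l r h' => h z P Q l r (h'.trans hs)

theorem Closed.hit {X Y : ℕ → Prop} {t : BT} (h : Closed X Y t) (hn : (contract Y t).2 ≠ nil) :
    Hit X t := by
  cases h' : (contract Y t).2.top with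
  | none => exact absurd (top_eq_none.1 h') hn
  | some z =>
    obtain ⟨h1, h2⟩ := top_contract h'
    obtain ⟨P, Q, l, r, h3⟩ := mem_labels.1 h1
    exact ((h z P Q l r h3).2.2 h2).mono h3

/-- Survivors on both sides of a node mean elements of `X` in both subtrees, and then closedness
puts the node itself into `Y`. -/
theorem Closed.clean {X Y : ℕ → Prop} {t : BT} (h : Closed X Y t) : Clean Y t := by
  intro z P Q l r hs hz
  by_contra hc
  push Not at hc
  exact hz ((h z P Q l r hs).1 ((h.mono ((sub_left ..).trans hs)).hit hc.1)
    ((h.mono ((sub_right ..).trans hs)).hit hc.2))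

/-- The nodes above the first node of `Y` surround a middle segment `m` of the tour, and their three
positions each lie in the outer segments `a` and `b`. At such a node at most one subtree meets `X`.
If it is the left one, the right subtree goes entirely into `b`; otherwise the left subtree goes
entirely into `a`. -/
theorem Closed.size_cut {X Y : ℕ → Prop} (d : ℕ → Option Word) {t : BT} (h : Closed X Y t)
    (ht : Hit X t) : ∃ a m b, t.tour = a ++ (m ++ b) ∧ (∀ p ∈ a, ¬ X p) ∧ (∀ p ∈ b, ¬ X p) ∧
      3 * (cut Y d t).size ≤ a.length + b.length := by
  induction t with
  | nil => simp [Hit, tour] at ht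
  | node z P Q l r ihl ihr =>
    by_cases hz : Y z
    · exact ⟨[], (node z P Q l r).tour, [], by simp, by simp, by simp, by simp [cut, hz, CutTree.size]⟩
    · obtain ⟨h1, h2, -⟩ := h z P Q l r (Sub.refl _)
      have hX : ∀ p, p / 3 = z → ¬ X p := fun p hp hXp => hz (h2 p hXp hp)
      have hX0 : ¬ X (3 * z) := hX _ (by omega)
      have hX1 : ¬ X (3 * z + 1) := hX _ (by omega)
      have hX2 : ¬ X (3 * z + 2) := hX _ (by omega)
      have sl := size_cut_le Y d l
      have sr := size_cut_le Y d r
      have tl := length_tour l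
      have tr := length_tour r
      by_cases hl : Hit X l
      · have hr : ∀ p ∈ r.tour, ¬ X p := fun p hp hXp => hz (h1 hl ⟨p, hp, hXp⟩)
        obtain ⟨a, m, b, e, ha, hb, hab⟩ := ihl (h.mono (sub_left ..)) hl
        refine ⟨3 * z :: a, m, b ++ (3 * z + 1) :: (r.tour ++ [3 * z + 2]), by simp [tour, e],
          ?_, ?_, ?_⟩
        · simpa [hX0] using ha
        · intro p hp
          simp only [List.mem_append, List.mem_cons, List.not_mem_nil, or_false] at hp
          rcases hp with hp | rfl | hp | rfl
          exacts [hb p hp, hX1, hr p hp, hX2]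
        · simp only [cut, hz, if_false, CutTree.size, List.length_cons, List.length_append,
            List.length_nil]
          omega
      · have hl' : ∀ p ∈ l.tour, ¬ X p := fun p hp hXp => hl ⟨p, hp, hXp⟩
        have hr : Hit X r := by
          obtain ⟨p, hp, hXp⟩ := ht
          simp only [tour, List.mem_cons, List.mem_append, List.not_mem_nil, or_false] at hp
          rcases hp with rfl | hp | rfl | hp | rfl
          exacts [absurd hXp hX0, absurd hXp (hl' _ hp), absurd hXp hX1, ⟨p, hp, hXp⟩,
            absurd hXp hX2]
        obtain ⟨a, m, b, e, ha, hb, hab⟩ := ihr (h.mono (sub_right ..)) hr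
        refine ⟨3 * z :: (l.tour ++ (3 * z + 1) :: a), m, b ++ [3 * z + 2], by simp [tour, e],
          ?_, ?_, ?_⟩
        · intro p hp
          simp only [List.mem_append, List.mem_cons] at hp
          rcases hp with rfl | hp | rfl | hp
          exacts [hX0, hl' p hp, hX1, ha p hp]
        · intro p hp
          simp only [List.mem_append, List.mem_cons, List.not_mem_nil, or_false] at hp
          rcases hp with hp | rfl
          exacts [hb p hp, hX2]
        · simp only [cut, hz, if_false, CutTree.size, List.length_cons, List.length_append,
            List.length_nil]
          omega

/-- Contiguous parts of the tour without elements of `X` have at most `L` elements. -/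
def Gap (X : ℕ → Prop) (L : ℕ) (t : BT) : Prop :=
  ∀ a m b, t.tour = a ++ (m ++ b) → (∀ p ∈ m, ¬ X p) → m.length ≤ L

theorem Gap.mono {X : ℕ → Prop} {L : ℕ} {s t : BT} (h : Gap X L t) (hs : Sub s t) :
    Gap X L s := by
  intro a m b e hm
  obtain ⟨a', b', e'⟩ := hs.tour_eq
  exact h (a' ++ a) m (b ++ b') (by simp [e', e]) hm

/-- Both outer segments are free of `X`, so three positions per node give `3 size ≤ 2 L`. If the
tree is not hit at all, its whole tour is a gap. -/
theorem Closed.size_cut_le {X Y : ℕ → Prop} (d : ℕ → Option Word) {t : BT} {L : ℕ}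
    (h : Closed X Y t) (hg : Gap X L t) : (cut Y d t).size ≤ L := by
  by_cases ht : Hit X t
  · obtain ⟨a, m, b, e, ha, hb, hab⟩ := h.size_cut d ht
    have h1 := hg [] a (m ++ b) (by simpa using e) ha
    have h2 := hg (a ++ m) b [] (by simp [e]) hb
    omega
  · have h1 := hg [] t.tour [] (by simp) fun p hp hX => ht ⟨p, hp, hX⟩
    have h2 := BT.size_cut_le Y d t
    rw [length_tour] at h1
    omega

theorem tour_node_mem {t : BT} {u : ℕ} (h : u ∈ t.labels) :
    ∃ a m m' b, t.tour = a ++ (3 * u :: (m ++ (3 * u + 1) :: (m' ++ (3 * u + 2) :: b))) := by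
  obtain ⟨P, Q, l, r, h⟩ := mem_labels.1 h
  obtain ⟨a, b, e⟩ := h.tour_eq
  exact ⟨a, l.tour, r.tour, b, by simp [e, tour]⟩

/-- The three visits of a node occur in the order `3 u`, `3 u + 1`, `3 u + 2`. This and the
statement for prefixes exclude false candidates for `turn`. -/
theorem mem_suffix_tour {t : BT} (hn : t.labels.Nodup) {A S : List ℕ} (e : t.tour = A ++ S)
    {u : ℕ} (hu : 3 * u + 1 ∈ S) : 3 * u + 2 ∈ S := by
  have hmem : 3 * u + 1 ∈ t.tour := by simp [e, hu]
  have hu' : u ∈ t.labels := by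
    have := mem_tour.1 hmem
    rwa [show (3 * u + 1) / 3 = u by omega] at this
  obtain ⟨a, m, m', b, e'⟩ := tour_node_mem hu'
  obtain ⟨s, s', rfl⟩ := List.append_of_mem hu
  have hnt := nodup_tour hn
  rw [e'] at hnt e
  have h1 : (a ++ 3 * u :: m) ++ (3 * u + 1) :: (m' ++ (3 * u + 2) :: b) =
      (A ++ s) ++ (3 * u + 1) :: s' := by simpa using e
  have := (List.Nodup.split_unique (by simpa using hnt) h1).2
  rw [← this]
  simp

theorem mem_prefix_tour {t : BT} (hn : t.labels.Nodup) {A S : List ℕ} (e : t.tour = A ++ S)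
    {u : ℕ} (hu : 3 * u + 1 ∈ A) : 3 * u ∈ A := by
  have hmem : 3 * u + 1 ∈ t.tour := by simp [e, hu]
  have hu' : u ∈ t.labels := by
    have := mem_tour.1 hmem
    rwa [show (3 * u + 1) / 3 = u by omega] at this
  obtain ⟨a, m, m', b, e'⟩ := tour_node_mem hu'
  obtain ⟨s, s', rfl⟩ := List.append_of_mem hu
  have hnt := nodup_tour hn
  rw [e'] at hnt e
  have h1 : (a ++ 3 * u :: m) ++ (3 * u + 1) :: (m' ++ (3 * u + 2) :: b) =
      s ++ (3 * u + 1) :: (s' ++ S) := by simpa using e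
  have := (List.Nodup.split_unique (by simpa using hnt) h1).1
  rw [← this]
  simp

/-- The marks that the walks from the positions in `X` produce. -/
def marks (next : ℕ → Option ℕ) (X : ℕ → Prop) (f root z : ℕ) : Prop :=
  z = root ∨ ∃ p, X p ∧ (z = p / 3 ∨ z = turn p (walk next X f p))

/-- The walk leaves the left subtree of `w` and enters the right one, so it contains the middle
visit of `w` but neither of the other two. Any other node whose middle visit is on the walk lies in
the left subtree, and then its last visit follows on the walk, or in the right subtree, and then its
first visit precedes on the walk. So the choice in `turn` is forced. -/
theorem turn_eq {p w : ℕ} {l r : BT} {P Q : Mat} {A B C : List ℕ}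
    (hn : (node w P Q l r).labels.Nodup) (hl : ∃ A, l.tour = A ++ p :: B)
    (hr : r.tour = C ++ A) : turn p (p :: (B ++ (3 * w + 1) :: C)) = w := by
  obtain ⟨A', hl⟩ := hl
  have hnt := nodup_tour hn
  have hn' := hn
  simp only [labels, List.nodup_cons, List.mem_append, not_or, List.nodup_append'] at hn'
  obtain ⟨⟨hwl, hwr⟩, hnl, hnr, -⟩ := hn'
  have key : ∀ q, q / 3 = w → q ∈ p :: (B ++ (3 * w + 1) :: C) → q = 3 * w + 1 := by
    intro q hq hmem
    simp only [List.mem_cons, List.mem_append] at hmem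
    have h1 : q ∉ l.tour := fun h => hwl (hq ▸ mem_tour.1 h)
    have h2 : q ∉ r.tour := fun h => hwr (hq ▸ mem_tour.1 h)
    rw [hl] at h1
    rw [hr] at h2
    simp only [List.mem_append, List.mem_cons, not_or] at h1 h2
    tauto
  have hex : ∃ w', 3 * w' + 1 ∈ p :: (B ++ (3 * w + 1) :: C) ∧
      3 * w' ∉ p :: (B ++ (3 * w + 1) :: C) ∧ 3 * w' + 2 ∉ p :: (B ++ (3 * w + 1) :: C) := by
    refine ⟨w, by simp, fun h => ?_, fun h => ?_⟩
    · have := key _ (by omega) h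
      omega
    · have := key _ (by omega) h
      omega
  unfold turn
  rw [dif_pos hex]
  obtain ⟨h1, h2, h3⟩ := hex.choose_spec
  set u := hex.choose
  have h1' : 3 * u + 1 ∈ p :: B ∨ 3 * u + 1 = 3 * w + 1 ∨ 3 * u + 1 ∈ C := by
    simpa only [← List.cons_append, List.mem_append, List.mem_cons (a := 3 * u + 1) (b := 3 * w + 1)]
      using h1
  rcases h1' with h | h | h
  · refine absurd ?_ h3
    have := mem_suffix_tour hnl hl h
    rw [← List.cons_append]
    exact List.mem_append_left _ this
  · omega
  · refine absurd ?_ h2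
    have := mem_prefix_tour hnr hr h
    simp [this]

/-- Consecutive samples suffice to find all lowest common ancestors: if both subtrees of `w` contain
samples, the last on the left and the first on the right are consecutive, unless the middle visit of
`w` is itself a sample, and the walk from the former turns at `w`. Subtrees containing `root` are
excluded because `root` is marked whether or not there are samples. -/
theorem closed_marks {next : ℕ → Option ℕ} {X : ℕ → Prop} {f root : ℕ} {t : BT}
    (hn : t.labels.Nodup) (hc : t.tour.IsChain fun a b => next a = some b)
    (hl : ∀ a b, t.tour = a ++ [b] → next b = none) (hX : ∀ p, X p → p ∈ t.tour)
    (hg : Gap X f t) {s : BT} (hs : Sub s t) (hroot : root ∉ s.labels) :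
    Closed X (marks next X f root) s := by
  intro w P Q l r h
  have hst := h.trans hs
  have hnw : (node w P Q l r).labels.Nodup := hn.sublist hst.labels_sublist
  obtain ⟨a, b, e⟩ := hst.tour_eq
  refine ⟨?_, ?_, ?_⟩
  · intro hitl hitr
    by_cases hX1 : X (3 * w + 1)
    · exact Or.inr ⟨_, hX1, Or.inl (by omega)⟩
    obtain ⟨A, p, B, el, hp, hB⟩ := List.exists_last_of_mem X _ hitl
    obtain ⟨C, q, E, er, hq, hC⟩ := List.exists_first_of_mem X _ hitr
    refine Or.inr ⟨p, hp, Or.inr ?_⟩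
    have et : t.tour = (a ++ 3 * w :: A) ++ (p :: ((B ++ (3 * w + 1) :: C) ++ q ::
        (E ++ (3 * w + 2) :: b))) := by simp [e, tour, el, er]
    have hfree : ∀ x ∈ B ++ (3 * w + 1) :: C, ¬ X x := by
      intro x hx
      simp only [List.mem_append, List.mem_cons] at hx
      rcases hx with hx | rfl | hx
      exacts [hB x hx, hX1, hC x hx]
    have hlen := hg ((a ++ 3 * w :: A) ++ [p]) (B ++ (3 * w + 1) :: C)
      (q :: (E ++ (3 * w + 2) :: b)) (by simp [et]) hfree
    rw [et] at hc
    rw [walk_eq _ hc.right_of_append hfree hq hlen]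
    exact (turn_eq hnw ⟨A, el⟩ er).symm
  · intro p hp hz
    exact Or.inr ⟨p, hp, Or.inl hz.symm⟩
  · rintro (hw | ⟨p, hp, hw | hw⟩)
    · exact absurd (h.labels_subset (by simp [labels, hw])) hroot
    · exact ⟨p, mem_tour.2 (by simp [labels, hw]), hp⟩
    -- A walk that turns at `w` contains `3 * w + 1` but not `3 * w`. Its start `p` thus comes after
    -- the first visit of `w` and not after the second, so `p` lies in the subtree of `w`.
    · obtain ⟨A, E, et⟩ := List.append_of_mem (hX p hp)
      have hc' := hc
      rw [et] at hc'
      obtain ⟨V, E', eV, eE⟩ := walk_prefix (X := X) f p E hc'.right_of_append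
        fun a' b' h' => hl (A ++ a') b' (by simp [et, h'])
      unfold turn at hw
      split_ifs at hw with hex
      · obtain ⟨h1, h2, -⟩ := hex.choose_spec
        rw [← hw, eV] at h1 h2
        obtain ⟨V₁, V₂, eV'⟩ := List.append_of_mem h1
        have hnt := nodup_tour hn
        have e1 : t.tour = (a ++ 3 * w :: l.tour) ++
            (3 * w + 1) :: (r.tour ++ (3 * w + 2) :: b) := by simp [e, tour]
        have e2 : t.tour = (A ++ V₁) ++ (3 * w + 1) :: (V₂ ++ E') := by
          rw [et, eE, ← List.cons_append, eV']
          simp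
        have e3 := (List.Nodup.split_unique (e1 ▸ hnt) (e1.symm.trans e2)).1
        cases V₁ with
        | nil =>
          simp only [List.nil_append, List.cons.injEq] at eV'
          exact ⟨p, by simp [tour, eV'.1], hp⟩
        | cons v V₁ =>
          simp only [List.cons_append, List.cons.injEq] at eV'
          obtain ⟨rfl, eV'⟩ := eV'
          have hmem : 3 * w ∈ A := by
            have : 3 * w ∈ A ++ p :: V₁ := by rw [← e3]; simp
            rw [List.mem_append] at this
            refine this.resolve_right fun h => h2 ?_
            rw [eV', ← List.cons_append]
            exact List.mem_append_left _ h
          obtain ⟨A₁, A₂, rfl⟩ := List.append_of_mem hmem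
          have hnt' : (a ++ 3 * w :: l.tour).Nodup := by
            rw [e1] at hnt
            exact (List.nodup_append'.1 hnt).1
          have e4 := (List.Nodup.split_unique hnt' (b' := A₂ ++ p :: V₁) (a' := A₁)
            (by rw [e3]; simp)).2
          exact ⟨p, by simp [tour, e4], hp⟩
      · exact ⟨p, mem_tour.2 (by simp [labels, hw]), hp⟩

/-- Since the root is always marked, cleanness has to be checked only at nodes strictly below it,
where `closed_marks` applies. -/
theorem clean_marks {next : ℕ → Option ℕ} {X : ℕ → Prop} {f root : ℕ} {P Q : Mat} {l r : BT}
    (hn : (node root P Q l r).labels.Nodup)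
    (hc : (node root P Q l r).tour.IsChain fun a b => next a = some b)
    (hl : ∀ a b, (node root P Q l r).tour = a ++ [b] → next b = none)
    (hX : ∀ p, X p → p ∈ (node root P Q l r).tour) (hg : Gap X f (node root P Q l r)) :
    Clean (marks next X f root) (node root P Q l r) ∧
      ∀ d, ∀ s, Sub s (node root P Q l r) → root ∉ s.labels →
        (cut (marks next X f root) d s).size ≤ f := by
  constructor
  · intro z P' Q' l' r' h hz
    have hroot : z ≠ root := fun h => hz (Or.inl h)
    have hn' := hn
    simp only [labels, List.nodup_cons, List.mem_append, not_or] at hn'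
    rcases h with h | h | h
    · injection h with h
      exact absurd h hroot
    · exact (closed_marks hn hc hl hX hg (sub_left root P Q l r) hn'.1.1).clean _ _ _ _ _ h hz
    · exact (closed_marks hn hc hl hX hg (sub_right root P Q l r) hn'.1.2).clean _ _ _ _ _ h hz
  · intro d s hs hroot
    exact (closed_marks hn hc hl hX hg hs hroot).size_cut_le d (hg.mono hs)

end BT

/-! ### The rounds of the contraction algorithm

The tables hold, under keys `(tag, level, name)`, the left child (tag 0), the right child (1), the
tour position after the last visit (2) and the matrices (3) of the nodes of a tree, whether a node
belongs to the next tree (4), the values of the nodes (5), lists of the nodes (6), the sampled tour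
positions (7) and a list of them (8). -/

/-- The sizes that occur in the algorithm: `s` items per machine and level, levels `0, …, K`, walks
of length `L`, names of nodes up to `Z`, norms up to `W`, and at most `N k` items of level `k`. The
nodes in `out` are those whose values are wanted. -/
structure Cfg where
  (P S B s K L Z W root : ℕ)
  N : ℕ → ℕ
  out : ℕ → Prop

/-- The relations between the sizes. -/
structure Cfg.Ok (c : Cfg) (μ : ℕ) : Prop where
  P_pos : 0 < c.P
  s_pos : 0 < c.s
  -- Copying an item costs seven queries, for the list entry and the tags 0 to 5, on each of `K + 1`
  -- levels. The rest is three visits of cost `12 L + 8`.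
  S_ge : 7 * (c.K + 1) * c.s + 36 * c.L + 24 ≤ c.S
  N_le : ∀ k, c.N k ≤ c.P * c.s
  -- Machines with samples have numbers up to `N k / s`, and each owns a block of three items of the
  -- next level.
  N_succ : ∀ k, 3 * (c.N k / c.s + 1) ≤ c.N (k + 1)
  N_block : ∀ k, c.N (k + 1) ≤ 3 * c.P
  -- The last tree is small enough to be explored by a single machine.
  N_last : c.N c.K ≤ c.L
  s_le : 3 * c.s ≤ c.B + 1
  -- A machine chooses among `3 s` positions, and reduction modulo `3 s` may lose a factor 2. A
  -- segment longer than `L` thus receives at least `μ` samples in expectation.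
  le_L : μ * (6 * c.s) ≤ c.L
  tag_le : 8 ≤ c.B
  K_le : c.K + 1 ≤ c.B
  items_le : c.P * c.s ≤ c.B
  P_le : 3 * c.P ≤ c.B
  Z_le : 3 * c.Z + 2 ≤ c.B
  -- Two matrices have eight entries; three levels of pairing put them into one word.
  W_le : (((2 * c.W + 2) ^ 2) ^ 2) ^ 2 ≤ c.B

namespace Prog

/-- A query whose answer is read as a natural number. -/
def askNat {α : Type} (k : Key) (f : Option ℕ → Prog α) : Prog α := ask k fun w => f (w.map wordNat)

@[simp] theorem run_askNat {α : Type} (H : Heads) (k : Key) (f : Option ℕ → Prog α) :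
    (askNat k f).run H = (f ((H k).map wordNat)).run H := rfl

@[simp] theorem cost_askNat {α : Type} (H : Heads) (k : Key) (f : Option ℕ → Prog α) :
    (askNat k f).cost H = (f ((H k).map wordNat)).cost H + 1 := rfl

/-- A program for an optional argument, with empty output if there is none. -/
def onSome {α β : Type} (f : α → Prog (List β)) : Option α → Prog (List β)
  | none => ret []
  | some a => f a

@[simp] theorem onSome_none {α β : Type} (f : α → Prog (List β)) : onSome f none = ret [] := rfl
@[simp] theorem onSome_some {α β : Type} (f : α → Prog (List β)) (a : α) :
    onSome f (some a) = f a := rfl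

/-- Copies one entry. -/
def copyKey (κ : Key) : Prog (List (Key × Word)) := ask κ (onSome fun v => ret [(κ, v)])

/-- Copies everything about one item of level `k`. -/
def copyItem (k j : ℕ) : Prog (List (Key × Word)) :=
  ask (6, k, j) (onSome fun w =>
    (collect (fun tag => copyKey (tag, k, wordNat w)) (List.range 6)).bind fun l =>
      ret (((6, k, j), w) :: l))

/-- Copies all items of machine `i`. -/
def copyAll (K s i : ℕ) : Prog (List (Key × Word)) :=
  collect (fun k => collect (fun j => copyItem k (i * s + j)) (List.range s)) (List.range (K + 1))

theorem mem_run_copyKey (H : Heads) (κ : Key) (e : Key × Word) :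
    e ∈ (copyKey κ).run H ↔ e.1 = κ ∧ H κ = some e.2 := by
  cases h : H κ <;> simp [copyKey, h, Prod.ext_iff, eq_comm]

theorem mem_run_copyItem (H : Heads) (k j : ℕ) (e : Key × Word) :
    e ∈ (copyItem k j).run H ↔ ∃ w, H (6, k, j) = some w ∧
      (e = ((6, k, j), w) ∨ ∃ tag < 6, e.1 = (tag, k, wordNat w) ∧ H e.1 = some e.2) := by
  cases h : H (6, k, j) with
  | none => simp [copyItem, h]
  | some w =>
    simp only [copyItem, run_ask, h, onSome_some, run_bind, run_ret, List.mem_cons,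
      mem_run_collect, List.mem_range, mem_run_copyKey, Option.some.injEq]
    constructor
    · rintro (h' | ⟨tag, ht, h1, h2⟩)
      · exact ⟨w, rfl, Or.inl h'⟩
      · exact ⟨w, rfl, Or.inr ⟨tag, ht, h1, h1 ▸ h2⟩⟩
    · rintro ⟨w', rfl, h' | ⟨tag, ht, h1, h2⟩⟩
      · exact Or.inl h'
      · exact Or.inr ⟨tag, ht, h1, h1 ▸ h2⟩

theorem copyItem_bounds (H : Heads) (k j : ℕ) :
    (copyItem k j).cost H ≤ 7 ∧ ((copyItem k j).run H).length ≤ 7 := by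
  have hk : ∀ κ, (copyKey κ).cost H ≤ 1 ∧ ((copyKey κ).run H).length ≤ 1 := by
    intro κ
    cases h : H κ <;> simp [copyKey, h]
  cases h : H (6, k, j) with
  | none => simp [copyItem, h]
  | some w =>
    have h1 := cost_collect_le H (fun tag => copyKey (tag, k, wordNat w)) 1 (List.range 6)
      fun _ _ => (hk _).1
    have h2 := length_run_collect_le H (fun tag => copyKey (tag, k, wordNat w)) 1 (List.range 6)
      fun _ _ => (hk _).2
    simp only [List.length_range] at h1 h2
    simp only [copyItem, run_ask, cost_ask, h, onSome_some, cost_bind, run_bind, run_ret, cost_ret,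
      List.length_cons]
    omega

theorem copyAll_bounds (H : Heads) (K s i : ℕ) :
    (copyAll K s i).cost H ≤ 7 * (K + 1) * s ∧
      ((copyAll K s i).run H).length ≤ 7 * (K + 1) * s := by
  have h1 : ∀ k, (collect (fun j => copyItem k (i * s + j)) (List.range s)).cost H ≤ s * 7 := by
    intro k
    have := cost_collect_le H (fun j => copyItem k (i * s + j)) 7 (List.range s)
      fun _ _ => (copyItem_bounds H _ _).1
    simpa using this
  have h2 : ∀ k, ((collect (fun j => copyItem k (i * s + j)) (List.range s)).run H).length ≤
      s * 7 := by
    intro k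
    have := length_run_collect_le H (fun j => copyItem k (i * s + j)) 7 (List.range s)
      fun _ _ => (copyItem_bounds H _ _).2
    simpa using this
  have h3 := cost_collect_le H (fun k => collect (fun j => copyItem k (i * s + j)) (List.range s))
    (s * 7) (List.range (K + 1)) fun k _ => h1 k
  have h4 := length_run_collect_le H
    (fun k => collect (fun j => copyItem k (i * s + j)) (List.range s))
    (s * 7) (List.range (K + 1)) fun k _ => h2 k
  simp only [List.length_range] at h3 h4
  have e : 7 * (K + 1) * s = (K + 1) * (s * 7) := by ring
  rw [e]
  exact ⟨h3, h4⟩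

end Prog

/-- The round in which each machine copies its items and runs the program `new`. -/
def copyRound (c : Cfg) (new : ℕ → Coins c.S c.B → Prog (List (Key × Word))) :
    Round c.P c.S c.B := fun i ρ =>
  (Prog.copyAll c.K c.s i).bind fun a => (new i ρ).bind fun b => .ret (a ++ b)

/-- The keys that are copied. -/
def Kept (K : ℕ) (H : Heads) (κ : Key) : Prop :=
  κ.2.1 ≤ K ∧ (κ.1 = 6 ∨ κ.1 < 6 ∧ ∃ j w, H (6, κ.2.1, j) = some w ∧ wordNat w = κ.2.2)

/-- `H'` arises from `H` by copying and by writing the entries in `New`. -/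
def Step (K : ℕ) (H H' : Heads) (New : Key → Word → Prop) : Prop :=
  ∀ κ w, H' κ = some w ↔ (Kept K H κ ∧ H κ = some w) ∨ New κ w

/-- All entries respect the word size. -/
def HeadsFit (B : ℕ) (H : Heads) : Prop := ∀ κ w, H κ = some w → EntryFits B (κ, w)

/-- Each round writes a fresh table, so whatever is needed later must be copied; samples (tags 7 and
8) are deliberately left behind. Items are owned in blocks of length `s`, so item `j` is copied by
machine `j / s`. New keys were empty before, hence new entries never collide with copies, and
consistency survives. -/
theorem copyRound_step (c : Cfg) {μ : ℕ} (ok : c.Ok μ)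
    (new : ℕ → Coins c.S c.B → Prog (List (Key × Word))) (H : Heads)
    (ρ : Fin c.P → Coins c.S c.B) (hfit : HeadsFit c.B H)
    (hitem : ∀ k ≤ c.K, ∀ j w, H (6, k, j) = some w → j < c.P * c.s)
    (hcost : ∀ i : Fin c.P, (new i (ρ i)).cost H ≤ 36 * c.L + 24)
    (hlen : ∀ i : Fin c.P, ((new i (ρ i)).run H).length ≤ 36 * c.L + 24)
    (hnew : ∀ i : Fin c.P, ∀ e ∈ (new i (ρ i)).run H, EntryFits c.B e ∧ H e.1 = none)
    (hfun : ∀ i i' : Fin c.P, ∀ κ w w', (κ, w) ∈ (new i (ρ i)).run H →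
      (κ, w') ∈ (new i' (ρ i')).run H → w = w') :
    Consistent ((copyRound c new).result H ρ) ∧
    HeadsFit c.B (pick ((copyRound c new).result H ρ)) ∧
    Step c.K H (pick ((copyRound c new).result H ρ))
      (fun κ w => ∃ i : Fin c.P, (κ, w) ∈ (new i (ρ i)).run H) := by
  have hcopy : ∀ i, ∀ e ∈ (Prog.copyAll c.K c.s i).run H, Kept c.K H e.1 ∧ H e.1 = some e.2 := by
    intro i e he
    simp only [Prog.copyAll, Prog.mem_run_collect, Prog.mem_run_copyItem, List.mem_range] at he
    obtain ⟨k, hk, j, -, w, h1, h2⟩ := he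
    rcases h2 with rfl | ⟨tag, ht, h3, h4⟩
    · exact ⟨⟨by simp only; omega, Or.inl rfl⟩, h1⟩
    · refine ⟨⟨by rw [h3]; simp only; omega, Or.inr ⟨by rw [h3]; exact ht, i * c.s + j, w, ?_, ?_⟩⟩,
          h4⟩
      · rw [h3]
        exact h1
      · rw [h3]
  have hout : ∀ i, (copyRound c new).out H ρ i =
      (Prog.copyAll c.K c.s i).run H ++ (new i (ρ i)).run H := by
    intro i
    have hb := Prog.copyAll_bounds H c.K c.s i
    have h1 := hcost i
    have h2 := hlen i
    have h3 := ok.S_ge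
    have hrun : (copyRound c new i (ρ i)).run H =
        (Prog.copyAll c.K c.s i).run H ++ (new i (ρ i)).run H := by simp [copyRound]
    rw [← hrun]
    refine Round.out_eq _ _ _ _ ?_ ?_ ?_
    · simp only [copyRound, Prog.cost_bind, Prog.cost_ret]
      omega
    · rw [hrun, List.length_append]
      omega
    · rw [hrun]
      intro e he
      rcases List.mem_append.1 he with he | he
      · exact hfit _ _ (hcopy i e he).2
      · exact (hnew i e he).1
  have hmem : ∀ κ w, w ∈ (copyRound c new).result H ρ κ ↔
      (Kept c.K H κ ∧ H κ = some w) ∨ ∃ i : Fin c.P, (κ, w) ∈ (new i (ρ i)).run H := by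
    intro κ w
    rw [Round.mem_result]
    constructor
    · rintro ⟨i, hi⟩
      rw [hout, List.mem_append] at hi
      rcases hi with hi | hi
      · exact Or.inl (hcopy i _ hi)
      · exact Or.inr ⟨i, hi⟩
    · rintro (⟨⟨hk, h⟩, hw⟩ | ⟨i, hi⟩)
      · have key : ∀ j v, H (6, κ.2.1, j) = some v →
            ((κ, w) = ((6, κ.2.1, j), v) ∨ ∃ tag < 6, κ = (tag, κ.2.1, wordNat v)) →
            ∃ i, (κ, w) ∈ (copyRound c new).out H ρ i := by
          intro j v hj hv
          have hlt := hitem _ hk _ _ hj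
          have hi : j / c.s < c.P := (Nat.div_lt_iff_lt_mul ok.s_pos).2 hlt
          refine ⟨⟨j / c.s, hi⟩, ?_⟩
          rw [hout, List.mem_append]
          left
          simp only [Prog.copyAll, Prog.mem_run_collect, Prog.mem_run_copyItem, List.mem_range]
          refine ⟨κ.2.1, by omega, j % c.s, Nat.mod_lt _ ok.s_pos, v, ?_, ?_⟩
          · rw [Nat.div_add_mod']
            exact hj
          · rw [Nat.div_add_mod']
            rcases hv with hv | ⟨tag, ht, hv⟩
            · exact Or.inl hv
            · exact Or.inr ⟨tag, ht, hv, hw⟩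
        rcases h with h6 | ⟨h6, j, v, hj, hv⟩
        · have e : κ = (6, κ.2.1, κ.2.2) := by rw [← h6]
          exact key κ.2.2 w (by rw [← e]; exact hw) (Or.inl (by rw [← e]))
        · exact key j v hj (Or.inr ⟨κ.1, h6, by rw [hv]⟩)
      · exact ⟨i, by rw [hout, List.mem_append]; exact Or.inr hi⟩
  have hcons : Consistent ((copyRound c new).result H ρ) := by
    intro κ a ha b hb
    rw [hmem] at ha hb
    rcases ha with ⟨-, ha⟩ | ⟨i, ha⟩ <;> rcases hb with ⟨-, hb⟩ | ⟨j, hb⟩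
    · exact Option.some.inj (ha.symm.trans hb)
    · have := (hnew j _ hb).2
      simp [ha] at this
    · have := (hnew i _ ha).2
      simp [hb] at this
    · exact hfun i j κ a b ha hb
  have hstep : Step c.K H (pick ((copyRound c new).result H ρ))
      (fun κ w => ∃ i : Fin c.P, (κ, w) ∈ (new i (ρ i)).run H) := by
    intro κ w
    rw [pick_eq_some hcons, hmem]
  refine ⟨hcons, fun κ w h => ?_, hstep⟩
  rcases (hstep κ w).1 h with ⟨-, h⟩ | ⟨i, h⟩
  · exact hfit κ w h
  · exact (hnew i _ h).1

/-! ### Reading a tree from a table -/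

/-- The table holds the tree `t` at level `k`. -/
def Stores (H : Heads) (k : ℕ) (t : BT) : Prop :=
  ∀ z P Q l r, BT.Sub (.node z P Q l r) t →
    H (0, k, z) = l.top.map natWord ∧ H (1, k, z) = r.top.map natWord ∧
    H (3, k, z) = some (natWord (pairCode (P, Q))) ∧
    (∀ y, l.top = some y → H (2, k, y) = some (natWord (3 * z + 1))) ∧
    (∀ y, r.top = some y → H (2, k, y) = some (natWord (3 * z + 2)))

theorem Stores.mono {H : Heads} {k : ℕ} {s t : BT} (h : Stores H k t) (hs : BT.Sub s t) : Stores H k s :=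
  fun z P Q l r h' => h z P Q l r (h'.trans hs)

/-- The position after `p` in the tour. -/
def nextPos (H : Heads) (k p : ℕ) : Option ℕ :=
  if p % 3 = 0 then some (((H (0, k, p / 3)).map fun w => 3 * wordNat w).getD (p + 1))
  else if p % 3 = 1 then some (((H (1, k, p / 3)).map fun w => 3 * wordNat w).getD (p + 1))
  else (H (2, k, p / 3)).map wordNat

theorem nextPos_zero (H : Heads) (k z : ℕ) : nextPos H k (3 * z) =
    some (((H (0, k, z)).map fun w => 3 * wordNat w).getD (3 * z + 1)) := by
  have h1 : 3 * z % 3 = 0 := by omega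
  have h2 : 3 * z / 3 = z := by omega
  simp [nextPos, h1, h2]

theorem nextPos_one (H : Heads) (k z : ℕ) : nextPos H k (3 * z + 1) =
    some (((H (1, k, z)).map fun w => 3 * wordNat w).getD (3 * z + 2)) := by
  have h1 : (3 * z + 1) % 3 = 1 := by omega
  have h2 : (3 * z + 1) / 3 = z := by omega
  simp [nextPos, h1, h2]

theorem nextPos_two (H : Heads) (k z : ℕ) :
    nextPos H k (3 * z + 2) = (H (2, k, z)).map wordNat := by
  have h1 : (3 * z + 2) % 3 = 2 := by omega
  have h2 : (3 * z + 2) / 3 = z := by omega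
  simp [nextPos, h1, h2]

/-- The positions `a` before and `b` after the tour are included so that the induction can enter and
leave a subtree: an absent child leads straight to `b`, and the last visit of the top node returns
to `b` through its up pointer. -/
theorem Stores.isChain_append {H : Heads} {k : ℕ} {t : BT} (h : Stores H k t) (a b : ℕ) (rest : List ℕ)
    (ha : nextPos H k a = some ((t.top.map fun z => 3 * z).getD b))
    (hb : ∀ z, t.top = some z → nextPos H k (3 * z + 2) = some b)
    (hrest : (b :: rest).IsChain fun p q => nextPos H k p = some q) :
    (a :: (t.tour ++ b :: rest)).IsChain fun p q => nextPos H k p = some q := by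
  induction t generalizing a b rest with
  | nil =>
    rw [BT.tour, List.nil_append, List.isChain_cons_cons]
    exact ⟨ha, hrest⟩
  | node z P Q l r ihl ihr =>
    obtain ⟨h0, h1, -, h3, h4⟩ := h z P Q l r (BT.Sub.refl _)
    have e : a :: ((BT.node z P Q l r).tour ++ b :: rest) = a :: 3 * z :: (l.tour ++
        (3 * z + 1) :: (r.tour ++ (3 * z + 2) :: b :: rest)) := by simp [BT.tour]
    rw [e, List.isChain_cons_cons]
    refine ⟨ha, ihl (h.mono (BT.sub_left ..)) _ _ _ ?_ ?_ ?_⟩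
    · rw [nextPos_zero, h0]
      cases l.top <;> simp
    · intro y hy
      rw [nextPos_two, h3 y hy]
      simp
    · refine ihr (h.mono (BT.sub_right ..)) _ _ _ ?_ ?_ ?_
      · rw [nextPos_one, h1]
        cases r.top <;> simp
      · intro y hy
        rw [nextPos_two, h4 y hy]
        simp
      · rw [List.isChain_cons_cons]
        exact ⟨hb z rfl, hrest⟩

theorem Stores.isChain {H : Heads} {k : ℕ} {t : BT} (h : Stores H k t) :
    t.tour.IsChain fun p q => nextPos H k p = some q := by
  cases t with
  | nil => simp [BT.tour]
  | node z P Q l r =>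
    obtain ⟨h0, h1, -, h3, h4⟩ := h z P Q l r (BT.Sub.refl _)
    refine (h.mono (BT.sub_left ..)).isChain_append _ _ _ ?_ ?_ ?_
    · rw [nextPos_zero, h0]
      cases l.top <;> simp
    · intro y hy
      rw [nextPos_two, h3 y hy]
      simp
    · refine (h.mono (BT.sub_right ..)).isChain_append _ _ _ ?_ ?_ ?_
      · rw [nextPos_one, h1]
        cases r.top <;> simp
      · intro y hy
        rw [nextPos_two, h4 y hy]
        simp
      · simp

/-- The root has no up pointer, which is how a walk notices the end of the tour. -/
theorem Stores.last {H : Heads} {k : ℕ} {t : BT} (h : ∀ z, t.top = some z → H (2, k, z) = none)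
    (a : List ℕ) (b : ℕ) (e : t.tour = a ++ [b]) : nextPos H k b = none := by
  cases t with
  | nil => simp [BT.tour] at e
  | node z P Q l r =>
    have e' : (3 * z :: (l.tour ++ (3 * z + 1) :: r.tour)) ++ [3 * z + 2] = a ++ [b] := by
      rw [← e]
      simp [BT.tour]
    have := (List.append_inj' e' rfl).2
    simp only [List.cons.injEq, and_true] at this
    rw [← this, nextPos_two, h z rfl]
    rfl

/-- The matrices stored in a word. -/
noncomputable def optDecode (w : Option ℕ) : Mat × Mat := (w.map pairDecode).getD (1, 1)

/-- Explores the tree of level `k` below a node, down to the marked nodes. -/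
noncomputable def explore (k : ℕ) : ℕ → Option ℕ → Prog CutTree
  | _, none => .ret .nil
  | 0, some _ => .ret .nil
  | d + 1, some z => .ask (4, k, z) fun m =>
    match m with
    | some _ => .ask (5, k + 1, z) fun v => .ret (.hole z v)
    | none => .askNat (0, k, z) fun l => .askNat (1, k, z) fun r => .askNat (3, k, z) fun f =>
        (explore k d l).bind fun l' => (explore k d r).bind fun r' =>
          .ret (.node z (optDecode f).1 (optDecode f).2 l' r')

/-- The marked nodes. -/
def Marked (H : Heads) (k z : ℕ) : Prop := (H (4, k, z)).isSome

theorem map_natWord (o : Option ℕ) : (o.map natWord).map wordNat = o := by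
  cases o <;> simp

/-- The number of nodes bounds the depth, hence it is sufficient fuel. A node of the part costs four
queries and a hole two; `m` nodes of a binary tree leave room for at most `m + 1` holes, which gives
`4 m + 2 (m + 1)`. -/
theorem explore_spec {H : Heads} {k : ℕ} {t : BT} (h : Stores H k t) (d : ℕ)
    (hd : t.labels.length ≤ d) :
    (explore k d t.top).run H = t.cut (Marked H k) (fun z => H (5, k + 1, z)) ∧
    (explore k d t.top).cost H ≤ 6 * (t.cut (Marked H k) (fun z => H (5, k + 1, z))).size + 2 := by
  induction t generalizing d with
  | nil => cases d <;> simp [BT.top, explore, BT.cut]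
  | node z P Q l r ihl ihr =>
    cases d with
    | zero => simp [BT.labels] at hd
    | succ d =>
      obtain ⟨h0, h1, h2, -⟩ := h z P Q l r (BT.Sub.refl _)
      simp only [BT.labels, List.length_cons, List.length_append] at hd
      obtain ⟨el, cl⟩ := ihl (h.mono (BT.sub_left ..)) d (by omega)
      obtain ⟨er, cr⟩ := ihr (h.mono (BT.sub_right ..)) d (by omega)
      cases hm : H (4, k, z) with
      | some m => simp [BT.top, explore, hm, BT.cut, Marked, CutTree.size]
      | none =>
        have hM : ¬ Marked H k z := by simp [Marked, hm]
        rw [show (BT.node z P Q l r).top = some z from rfl]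
        simp only [explore, Prog.run_ask, Prog.cost_ask, hm, Prog.run_askNat,
          Prog.cost_askNat, h0, h1, h2, map_natWord, Prog.run_bind, Prog.cost_bind, el, er,
          BT.cut, hM, if_false, Prog.run_ret, Prog.cost_ret, CutTree.size]
        constructor
        · simp [optDecode]
        · omega

/-- Explores the tree below both children of a node and computes the output from the result. -/
noncomputable def visit (k d : ℕ) (g : ℕ → Mat × Mat → CutTree → CutTree → List (Key × Word))
    (z : ℕ) : Prog (List (Key × Word)) :=
  .askNat (0, k, z) fun l => .askNat (1, k, z) fun r => .askNat (3, k, z) fun f =>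
    (explore k d l).bind fun l' => (explore k d r).bind fun r' => .ret (g z (optDecode f) l' r')

theorem visit_spec {H : Heads} {k d L z : ℕ} {t l r : BT} {P Q : Mat} (h : Stores H k t)
    (hs : BT.Sub (.node z P Q l r) t) (hd : t.labels.length ≤ d)
    (g : ℕ → Mat × Mat → CutTree → CutTree → List (Key × Word))
    (hl : (l.cut (Marked H k) (fun z => H (5, k + 1, z))).size ≤ L)
    (hr : (r.cut (Marked H k) (fun z => H (5, k + 1, z))).size ≤ L) :
    (visit k d g z).run H = g z (P, Q) (l.cut (Marked H k) (fun z => H (5, k + 1, z)))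
      (r.cut (Marked H k) (fun z => H (5, k + 1, z))) ∧ (visit k d g z).cost H ≤ 12 * L + 7 := by
  obtain ⟨h0, h1, h2, -⟩ := h z P Q l r hs
  have hd' := hs.labels_sublist.length_le
  simp only [BT.labels, List.length_cons, List.length_append] at hd'
  obtain ⟨el, cl⟩ := explore_spec (h.mono ((BT.sub_left ..).trans hs)) d (by omega)
  obtain ⟨er, cr⟩ := explore_spec (h.mono ((BT.sub_right ..).trans hs)) d (by omega)
  simp only [visit, Prog.run_askNat, Prog.cost_askNat, h0, h1, h2, map_natWord, Prog.run_bind,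
    Prog.cost_bind, el, er, Prog.run_ret, Prog.cost_ret]
  constructor
  · simp [optDecode]
  · omega

/-- The program for `nextPos`. -/
def nextProg (k p : ℕ) : Prog (Option ℕ) :=
  if p % 3 = 0 then .ask (0, k, p / 3) fun w =>
    .ret (some ((w.map fun w => 3 * wordNat w).getD (p + 1)))
  else if p % 3 = 1 then .ask (1, k, p / 3) fun w =>
    .ret (some ((w.map fun w => 3 * wordNat w).getD (p + 1)))
  else .ask (2, k, p / 3) fun w => .ret (w.map wordNat)

theorem nextProg_spec (H : Heads) (k p : ℕ) :
    (nextProg k p).run H = nextPos H k p ∧ (nextProg k p).cost H = 1 := by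
  unfold nextProg nextPos
  split_ifs <;> simp

/-- The sampled positions. -/
def Sampled (H : Heads) (k p : ℕ) : Prop := (H (7, k, p)).isSome

/-- The program for `walk`. -/
def walkProg (k : ℕ) : ℕ → ℕ → Prog (List ℕ)
  | 0, p => .ret [p]
  | f + 1, p => (nextProg k p).bind fun q =>
    match q with
    | none => .ret [p]
    | some q => .ask (7, k, q) fun m =>
      if m.isSome then .ret [p] else (walkProg k f q).bind fun V => .ret (p :: V)

theorem walkProg_spec (H : Heads) (k f p : ℕ) :
    (walkProg k f p).run H = walk (nextPos H k) (Sampled H k) f p ∧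
      (walkProg k f p).cost H ≤ 2 * f := by
  induction f generalizing p with
  | zero => simp [walkProg, walk]
  | succ f ih =>
    obtain ⟨h1, h2⟩ := nextProg_spec H k p
    simp only [walkProg, walk, Prog.run_bind, Prog.cost_bind, h1, h2]
    cases nextPos H k p with
    | none => simp; omega
    | some q =>
      obtain ⟨h3, h4⟩ := ih q
      simp only [Prog.run_ask, Prog.cost_ask, Sampled]
      by_cases h : (H (7, k, q)).isSome = true
      · simp [h]
      · simp only [if_neg h, Prog.run_bind, Prog.cost_bind, Prog.run_ret, Prog.cost_ret, h3]
        exact ⟨(if_neg h).symm, by omega⟩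

/-! ### Invariants -/

/-- The table holds the tree `t` at level `k`, with a list of its nodes. -/
structure Level (c : Cfg) (val : ℕ → Gain) (H : Heads) (k : ℕ) (t : BT) : Prop where
  top : t.top = some c.root
  nodup : t.labels.Nodup
  stores : Stores H k t
  up_root : H (2, k, c.root) = none
  valued : BT.Valued val t
  weight : t.weight ≤ c.W
  le_Z : ∀ z ∈ t.labels, z ≤ c.Z
  cover : ∀ z ∈ t.labels, ∃ j, H (6, k, j) = some (natWord z)
  item : ∀ j w, H (6, k, j) = some w → j < c.N k ∧ ∃ z ∈ t.labels, w = natWord z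
  out : k = 0 → ∀ z, c.out z → z ∈ t.labels

/-- The marks at level `k` form a set to which the tree `t` can be contracted. -/
structure GoodMarks (c : Cfg) (H : Heads) (k : ℕ) (t : BT) : Prop where
  clean : t.Clean (Marked H k)
  root : Marked H k c.root
  mem : ∀ z, Marked H k z → z ∈ t.labels
  size : ∀ d s, BT.Sub s t → c.root ∉ s.labels → (BT.cut (Marked H k) d s).size ≤ c.L

/-- The trees of the levels up to `m` are stored in the table; `A` describes the tags and levels for
which there are entries. -/
structure Stage (c : Cfg) (val : ℕ → Gain) (A : ℕ → ℕ → Prop) (m : ℕ) (H : Heads) (t : ℕ → BT) :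
    Prop where
  fits : HeadsFit c.B H
  allowed : ∀ tag k z w, H (tag, k, z) = some w → A tag k
  item_lt : ∀ k ≤ c.K, ∀ j w, H (6, k, j) = some w → j < c.P * c.s
  levels : ∀ k ≤ m, Level c val H k (t k)
  marks : ∀ k < m, GoodMarks c H k (t k)
  links : ∀ k < m, t (k + 1) = ((t k).contract (Marked H k)).2

theorem Step.eq_of_kept {K : ℕ} {H H' : Heads} {New : Key → Word → Prop} (h : Step K H H' New)
    {κ : Key} (hk : Kept K H κ) (hn : ∀ w, ¬ New κ w) : H' κ = H κ := by
  ext w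
  rw [h κ w]
  simp [hk, hn w]

theorem Step.of_new {K : ℕ} {H H' : Heads} {New : Key → Word → Prop} (h : Step K H H' New)
    {κ : Key} (hk : ¬ Kept K H κ ∨ H κ = none) (w : Word) : H' κ = some w ↔ New κ w := by
  rw [h κ w]
  rcases hk with hk | hk <;> simp [hk]

/-- Every node of the tree occurs in the list of items, so all its entries are copied. The
hypothesis on `New` ensures that nothing is added to them. -/
theorem Level.step {c : Cfg} {val : ℕ → Gain} {H H' : Heads} {k : ℕ} {t : BT}
    {New : Key → Word → Prop} (hl : Level c val H k t) (h : Step c.K H H' New) (hk : k ≤ c.K)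
    (hn : ∀ tag z w, tag < 4 ∨ tag = 6 → ¬ New (tag, k, z) w) : Level c val H' k t := by
  have h6 : ∀ j, H' (6, k, j) = H (6, k, j) := fun j =>
    h.eq_of_kept ⟨hk, Or.inl rfl⟩ fun w => hn 6 j w (Or.inr rfl)
  have he : ∀ tag < 4, ∀ z ∈ t.labels, H' (tag, k, z) = H (tag, k, z) := by
    intro tag ht z hz
    obtain ⟨j, hj⟩ := hl.cover z hz
    exact h.eq_of_kept ⟨hk, Or.inr ⟨by simp only; omega, j, _, hj, by simp⟩⟩
      fun w => hn tag z w (Or.inl ht)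
  refine ⟨hl.top, hl.nodup, ?_, ?_, hl.valued, hl.weight, hl.le_Z, ?_, ?_, hl.out⟩
  · intro z P Q l r hs
    have hz : z ∈ t.labels := BT.mem_labels.2 ⟨P, Q, l, r, hs⟩
    obtain ⟨h0, h1, h2, h3, h4⟩ := hl.stores z P Q l r hs
    rw [he 0 (by omega) z hz, he 1 (by omega) z hz, he 3 (by omega) z hz]
    refine ⟨h0, h1, h2, fun y hy => ?_, fun y hy => ?_⟩
    · rw [he 2 (by omega) y (((BT.sub_left ..).trans hs).labels_subset (BT.top_mem_labels hy))]
      exact h3 y hy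
    · rw [he 2 (by omega) y (((BT.sub_right ..).trans hs).labels_subset (BT.top_mem_labels hy))]
      exact h4 y hy
  · rw [he 2 (by omega) _ (BT.top_mem_labels hl.top)]
    exact hl.up_root
  · intro z hz
    obtain ⟨j, hj⟩ := hl.cover z hz
    exact ⟨j, by rw [h6, hj]⟩
  · intro j w hj
    rw [h6] at hj
    exact hl.item j w hj

/-- Marks lie on nodes of the tree; they are therefore copied together with the items. -/
theorem Level.marked_step {c : Cfg} {val : ℕ → Gain} {H H' : Heads} {k : ℕ} {t : BT}
    {New : Key → Word → Prop} (hl : Level c val H k t) (hm : GoodMarks c H k t)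
    (h : Step c.K H H' New) (hk : k ≤ c.K) (hn : ∀ z w, ¬ New (4, k, z) w) :
    Marked H' k = Marked H k := by
  funext z
  apply propext
  constructor
  · intro hz
    obtain ⟨w, hw⟩ := Option.isSome_iff_exists.1 hz
    rcases (h _ _).1 hw with ⟨-, h'⟩ | h'
    · exact Option.isSome_iff_exists.2 ⟨w, h'⟩
    · exact absurd h' (hn z w)
  · intro hz
    obtain ⟨j, hj⟩ := hl.cover z (hm.mem z hz)
    unfold Marked
    rw [h.eq_of_kept ⟨hk, Or.inr ⟨by simp, j, _, hj, by simp⟩⟩ (hn z)]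
    exact hz

theorem GoodMarks.congr {c : Cfg} {H H' : Heads} {k : ℕ} {t : BT} (h : GoodMarks c H k t)
    (e : Marked H' k = Marked H k) : GoodMarks c H' k t := by
  obtain ⟨h1, h2, h3, h4⟩ := h
  constructor <;> rw [e] <;> assumption

/-- The tags and levels of the entries when the trees up to level `m` have been built. -/
def upKeys (m tag k : ℕ) : Prop := (tag < 4 ∨ tag = 6) ∧ k ≤ m ∨ tag = 4 ∧ k < m

/-- Frame rule for all rounds: new entries outside the finished levels leave trees, marks and links
unchanged. The passage from `A` to `A'` is required only for tags up to 6 because the other tags are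
not copied. -/
theorem Stage.step {c : Cfg} {val : ℕ → Gain} {A A' : ℕ → ℕ → Prop} {m : ℕ} {H H' : Heads}
    {t : ℕ → BT} {New : Key → Word → Prop} (hs : Stage c val A m H t) (h : Step c.K H H' New)
    (hfit : HeadsFit c.B H') (hm : m ≤ c.K)
    (hn : ∀ tag k z w, New (tag, k, z) w → ¬ upKeys m tag k ∧ A' tag k)
    (hA : ∀ tag k, tag ≤ 6 → A tag k → A' tag k)
    (hnj : ∀ k j w, New (6, k, j) w → j < c.P * c.s) : Stage c val A' m H' t := by
  have hn1 : ∀ k ≤ m, ∀ tag z w, tag < 4 ∨ tag = 6 → ¬ New (tag, k, z) w :=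
    fun k hk tag z w ht hN => (hn tag k z w hN).1 (Or.inl ⟨ht, hk⟩)
  have hn2 : ∀ k < m, ∀ z w, ¬ New (4, k, z) w :=
    fun k hk z w hN => (hn 4 k z w hN).1 (Or.inr ⟨rfl, hk⟩)
  have hmk : ∀ k < m, Marked H' k = Marked H k := fun k hk =>
    (hs.levels k hk.le).marked_step (hs.marks k hk) h (by omega) (hn2 k hk)
  refine ⟨hfit, ?_, ?_, ?_, ?_, ?_⟩
  · intro tag k z w hw
    rcases (h _ _).1 hw with ⟨⟨-, hk⟩, h'⟩ | h'
    · refine hA tag k ?_ (hs.allowed tag k z w h')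
      rcases hk with hk | hk
      · exact le_of_eq hk
      · exact hk.1.le
    · exact (hn tag k z w h').2
  · intro k hk j w hw
    rcases (h _ _).1 hw with ⟨-, h'⟩ | h'
    · exact hs.item_lt k hk j w h'
    · exact hnj k j w h'
  · intro k hk
    exact (hs.levels k hk).step h (by omega) (hn1 k hk)
  · intro k hk
    exact (hs.marks k hk).congr (hmk k hk)
  · intro k hk
    rw [hmk k hk]
    exact hs.links k hk

theorem Stage.none_of_not {c : Cfg} {val : ℕ → Gain} {A : ℕ → ℕ → Prop} {m : ℕ} {H : Heads}
    {t : ℕ → BT} (hs : Stage c val A m H t) {κ : Key} (hA : ¬ A κ.1 κ.2.1) : H κ = none := by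
  cases h : H κ with
  | none => rfl
  | some w => exact absurd (hs.allowed _ _ _ w h) hA

theorem Level.length_le {c : Cfg} {val : ℕ → Gain} {H : Heads} {k : ℕ} {t : BT}
    (hl : Level c val H k t) : t.labels.length ≤ c.N k := by
  classical
  rw [← List.toFinset_card_of_nodup hl.nodup, ← Finset.card_range (c.N k)]
  refine Finset.card_le_card_of_surjOn (fun j => ((H (6, k, j)).map wordNat).getD 0) ?_
  intro z hz
  obtain ⟨j, hj⟩ := hl.cover z (by simpa using hz)
  exact ⟨j, by simpa using (hl.item j _ hj).1, by simp [hj]⟩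

theorem Triple.of_hit {P S B : ℕ} {I J : Content → Prop} {r : Round P S B} {η : ℝ}
    (h : ∀ M, I M → ∃ G : (Fin P → Coins S B) → Prop,
      (Nat.card {ρ // ¬ G ρ} : ℝ) ≤ η * Nat.card (Fin P → Coins S B) ∧
      ∀ ρ, G ρ → J (r.result (pick M) ρ)) : Triple I r J η := by
  intro M hM
  obtain ⟨G, h1, h2⟩ := h M hM
  refine le_trans ?_ h1
  have : Nat.card {ρ // ¬ J (r.result (pick M) ρ)} ≤ Nat.card {ρ // ¬ G ρ} :=
    Nat.card_le_card_of_injective (Subtype.map id fun ρ hρ hG => hρ (h2 ρ hG))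
      (Subtype.map_injective _ Function.injective_id)
  exact_mod_cast this

theorem Triple.of_forall {P S B : ℕ} {I J : Content → Prop} {r : Round P S B}
    (h : ∀ M, I M → ∀ ρ, J (r.result (pick M) ρ)) : Triple I r J 0 :=
  Triple.of_hit fun M hM => ⟨fun _ => True, by simp, fun ρ _ => h M hM ρ⟩

/-- The contents whose values satisfy `I`. -/
def OnHeads (I : Heads → Prop) (M : Content) : Prop := Consistent M ∧ I (pick M)

/-- The random word with number `e`. -/
def coin {S B : ℕ} (ρ : Coins S B) (e : ℕ) : ℕ := if h : e < S then (ρ ⟨e, h⟩).val else 0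

/-! ### Sampling -/

/-- Machine `i` samples a tour position of one of its items, using the random word `r`. -/
def sampleProg (c : Cfg) (k i r : ℕ) : Prog (List (Key × Word)) :=
  .ask (6, k, i * c.s + r % (3 * c.s) / 3) (Prog.onSome fun w =>
    .ret [((7, k, 3 * wordNat w + r % (3 * c.s) % 3), natWord 0),
      ((8, k, i), natWord (3 * wordNat w + r % (3 * c.s) % 3))])

/-- The tags and levels of the entries after sampling at level `m`. -/
def sampleKeys (m tag k : ℕ) : Prop := upKeys m tag k ∨ (tag = 7 ∨ tag = 8) ∧ k = m

/-- The trees up to level `m` have been built. -/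
def UpInv (c : Cfg) (val : ℕ → Gain) (m : ℕ) (H : Heads) : Prop :=
  ∃ t, Stage c val (upKeys m) m H t

/-- Positions have been sampled at level `m`. -/
def SampleInv (c : Cfg) (val : ℕ → Gain) (m : ℕ) (H : Heads) : Prop :=
  ∃ t, Stage c val (sampleKeys m) m H t ∧ BT.Gap (Sampled H m) c.L (t m) ∧
    (∀ p, Sampled H m p → p ∈ (t m).tour ∧ ∃ i : Fin c.P, H (8, m, i) = some (natWord p)) ∧
    (∀ i w, H (8, m, i) = some w → i < c.N m / c.s + 1 ∧ ∃ p, w = natWord p ∧ Sampled H m p)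

theorem mem_run_sampleProg (c : Cfg) (H : Heads) (k i r : ℕ) (e : Key × Word) :
    e ∈ (sampleProg c k i r).run H ↔ ∃ w, H (6, k, i * c.s + r % (3 * c.s) / 3) = some w ∧
      (e = ((7, k, 3 * wordNat w + r % (3 * c.s) % 3), natWord 0) ∨
        e = ((8, k, i), natWord (3 * wordNat w + r % (3 * c.s) % 3))) := by
  cases h : H (6, k, i * c.s + r % (3 * c.s) / 3) <;> simp [sampleProg, h]

theorem sampleProg_bounds (c : Cfg) (H : Heads) (k i r : ℕ) :
    (sampleProg c k i r).cost H ≤ 24 ∧ ((sampleProg c k i r).run H).length ≤ 24 := by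
  cases h : H (6, k, i * c.s + r % (3 * c.s) / 3) <;> simp [sampleProg, h]

/-- The residues for which machine `i` samples a position in `m`. -/
noncomputable def hitResidues (c : Cfg) (H : Heads) (k i : ℕ) (m : List ℕ) : Finset ℕ := by
  classical
  exact (Finset.range (3 * c.s)).filter fun r =>
    ∃ z, H (6, k, i * c.s + r / 3) = some (natWord z) ∧ 3 * z + r % 3 ∈ m

theorem mem_hitResidues {c : Cfg} {H : Heads} {k i r : ℕ} {m : List ℕ} :
    r ∈ hitResidues c H k i m ↔ r < 3 * c.s ∧
      ∃ z, H (6, k, i * c.s + r / 3) = some (natWord z) ∧ 3 * z + r % 3 ∈ m := by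
  simp [hitResidues]

/-- A tour position `p` is hit by the machine owning an item `j` for the node `p / 3`, with residue
`3 (j % s) + p % 3`. A node may be listed several times, which only increases the count. -/
theorem Level.card_hitResidues {c : Cfg} {μ : ℕ} (ok : c.Ok μ) {val : ℕ → Gain} {H : Heads}
    {k : ℕ} {t : BT} (hl : Level c val H k t) {m : List ℕ} (hm : m.Nodup) (hmt : m ⊆ t.tour) :
    m.length ≤ ∑ i : Fin c.P, (hitResidues c H k i m).card := by
  classical
  rw [← List.toFinset_card_of_nodup hm, ← Finset.card_sigma]
  refine Finset.card_le_card_of_surjOn (fun x : (_ : Fin c.P) × ℕ =>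
    3 * ((H (6, k, x.1 * c.s + x.2 / 3)).map wordNat).getD 0 + x.2 % 3) ?_
  intro p hp
  have hp' : p ∈ m := by simpa using hp
  obtain ⟨j, hj⟩ := hl.cover _ (BT.mem_tour.1 (hmt hp'))
  have hlt : j < c.P * c.s := (hl.item j _ hj).1.trans_le (ok.N_le k)
  have hdiv : j / c.s < c.P := (Nat.div_lt_iff_lt_mul ok.s_pos).2 hlt
  have hmod := Nat.mod_lt j ok.s_pos
  have e1 : (3 * (j % c.s) + p % 3) / 3 = j % c.s := by omega
  have e2 : (3 * (j % c.s) + p % 3) % 3 = p % 3 := by omega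
  have e3 : 3 * (p / 3) + p % 3 = p := Nat.div_add_mod p 3
  have hj' : H (6, k, j / c.s * c.s + (3 * (j % c.s) + p % 3) / 3) = some (natWord (p / 3)) := by
    rw [e1, Nat.div_add_mod', hj]
  refine ⟨⟨⟨j / c.s, hdiv⟩, 3 * (j % c.s) + p % 3⟩, ?_, ?_⟩
  · simp only [Finset.coe_sigma, Set.mem_sigma_iff, Finset.mem_coe, Finset.mem_univ, true_and,
      mem_hitResidues]
    refine ⟨by omega, p / 3, hj', ?_⟩
    rw [e2, e3]
    exact hp'
  · simp only [hj', Option.map_some, wordNat_natWord, Option.getD_some]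
    rw [e2, e3]

/-- A gap longer than `L` would contain one of the segments `seg x`. There are at most `3 P s` of
these, and each is missed for at most the fraction `2 ^ (-μ)` of the random words. -/
theorem sample_triple (c : Cfg) {μ : ℕ} (ok : c.Ok μ) (val : ℕ → Gain) (k : ℕ) (hk : k ≤ c.K) :
    Triple (OnHeads (UpInv c val k)) (copyRound c fun i ρ => sampleProg c k i (coin ρ 0))
      (OnHeads (SampleInv c val k)) (3 * (c.P * c.s) * (1 / 2 ^ μ)) := by
  classical
  refine Triple.of_hit fun M ⟨hcons, t, hs⟩ => ?_
  set H := pick M with hH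
  have hl := hs.levels k le_rfl
  have hS0 : 0 < c.S := by have := ok.S_ge; omega
  let seg : ℕ → List ℕ := fun x => ((t k).tour.drop x).take (c.L + 1)
  have hnt := BT.nodup_tour hl.nodup
  have hlen := BT.length_tour (t k)
  have hlab := hl.length_le.trans (ok.N_le k)
  have hhit := card_not_hit_le (P := c.P) (S := c.S) (B := c.B)
    (Finset.range ((t k).tour.length - c.L))
    (fun x i j => if j.val = 0 then residueSet c.B (3 * c.s) (hitResidues c H k i (seg x)) else ∅) μ
    (by
      intro x hx
      have hx' : x + (c.L + 1) ≤ (t k).tour.length := by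
        have := Finset.mem_range.1 hx
        omega
      have h1 : (seg x).length = c.L + 1 := by
        simp only [seg, List.length_take, List.length_drop]
        omega
      have h2 : (seg x).Nodup := hnt.sublist
        ((List.take_sublist _ _).trans (List.drop_sublist _ _))
      have h3 : seg x ⊆ (t k).tour :=
        ((List.take_sublist _ _).trans (List.drop_sublist _ _)).subset
      have h4 := hl.card_hitResidues ok h2 h3
      have h5 : ∀ i : Fin c.P, (c.B + 1) * (hitResidues c H k i (seg x)).card ≤ 2 * (3 * c.s) *
          (residueSet c.B (3 * c.s) (hitResidues c H k i (seg x))).card := fun i =>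
        card_residueSet _ _ _ (fun a ha => (mem_hitResidues.1 ha).1) ok.s_le
      -- Only the random word with number 0 is used for sampling; the sets for the other words are
      -- empty.
      have h6 : ∀ i : Fin c.P, (∑ j : Fin c.S, (if j.val = 0 then
          residueSet c.B (3 * c.s) (hitResidues c H k i (seg x)) else ∅).card) =
          (residueSet c.B (3 * c.s) (hitResidues c H k i (seg x))).card := by
        intro i
        rw [Finset.sum_eq_single (⟨0, hS0⟩ : Fin c.S)]
        · simp
        · intro j _ hj
          have : j.val ≠ 0 := fun h => hj (Fin.ext h)
          simp [this]
        · simp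
      simp only [h6]
      have h7 : (c.B + 1) * (seg x).length ≤ 2 * (3 * c.s) *
          ∑ i : Fin c.P, (residueSet c.B (3 * c.s) (hitResidues c H k i (seg x))).card := by
        refine (Nat.mul_le_mul_left _ h4).trans ?_
        rw [Finset.mul_sum, Finset.mul_sum]
        exact Finset.sum_le_sum fun i _ => h5 i
      have h8 : 0 < 2 * (3 * c.s) := by have := ok.s_pos; omega
      refine Nat.le_of_mul_le_mul_left ?_ h8
      refine le_trans ?_ h7
      rw [h1]
      have h9 := ok.le_L
      calc 2 * (3 * c.s) * (μ * (c.B + 1)) = (c.B + 1) * (μ * (6 * c.s)) := by ring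
        _ ≤ _ := Nat.mul_le_mul_left _ (by omega))
  refine ⟨_, hhit.trans ?_, ?_⟩
  · gcongr
    rw [Finset.card_range]
    have : (t k).tour.length - c.L ≤ 3 * (c.P * c.s) := by omega
    exact_mod_cast this
  intro ρ hρ
  have hno : ∀ tag z, (tag = 7 ∨ tag = 8) → H (tag, k, z) = none := by
    intro tag z ht
    refine hs.none_of_not ?_
    simp only [upKeys]
    omega
  have hw : ∀ i w, H (6, k, i) = some w → wordNat w ∈ (t k).labels ∧ i < c.N k := by
    intro i w hw
    obtain ⟨h1, z, h2, rfl⟩ := hl.item _ _ hw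
    exact ⟨by simpa using h2, h1⟩
  obtain ⟨hc', hf', hst⟩ := copyRound_step c ok (fun i ρ => sampleProg c k i (coin ρ 0)) H ρ
    hs.fits hs.item_lt (fun i => (sampleProg_bounds ..).1.trans (by omega))
    (fun i => (sampleProg_bounds ..).2.trans (by omega))
    (by
      intro i e he
      rw [mem_run_sampleProg] at he
      obtain ⟨w, h1, h2⟩ := he
      obtain ⟨h3, h3'⟩ := hw _ _ h1
      have h4 := hl.le_Z _ h3
      have h5 := ok.Z_le
      have h6 := ok.tag_le
      have h7 := ok.K_le
      have h8 := ok.P_le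
      have h9 := i.isLt
      rcases h2 with rfl | rfl
      · exact ⟨⟨by simp only; omega, by simp only; omega, by simp only; omega,
          natWord_fits (by omega)⟩, hno _ _ (Or.inl rfl)⟩
      · exact ⟨⟨by simp only; omega, by simp only; omega, by simp only; omega,
          natWord_fits (by omega)⟩, hno _ _ (Or.inr rfl)⟩)
    (by
      intro i i' κ w w' h h'
      rw [mem_run_sampleProg] at h h'
      obtain ⟨v, h1, h2⟩ := h
      obtain ⟨v', h1', h2'⟩ := h'
      simp only [Prod.mk.injEq] at h2 h2'
      rcases h2 with ⟨rfl, rfl⟩ | ⟨rfl, rfl⟩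
      · rcases h2' with ⟨-, rfl⟩ | ⟨h3, -⟩
        · rfl
        · simp at h3
      · rcases h2' with ⟨h3, -⟩ | ⟨h3, rfl⟩
        · simp at h3
        · simp only [Prod.mk.injEq, true_and] at h3
          have : i = i' := Fin.ext h3
          subst this
          rw [h1] at h1'
          cases h1'
          rfl)
  set H' := pick ((copyRound c fun i ρ => sampleProg c k i (coin ρ 0)).result H ρ) with hH'
  have hnew : ∀ tag z w, (tag = 7 ∨ tag = 8) → (H' (tag, k, z) = some w ↔
      ∃ i : Fin c.P, ((tag, k, z), w) ∈ (sampleProg c k i (coin (ρ i) 0)).run H) :=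
    fun tag z w ht => hst.of_new (Or.inr (hno tag z ht)) w
  have hsam : ∀ (i : Fin c.P) w, H (6, k, i * c.s + coin (ρ i) 0 % (3 * c.s) / 3) = some w →
      Sampled H' k (3 * wordNat w + coin (ρ i) 0 % (3 * c.s) % 3) := by
    intro i w hw
    refine Option.isSome_iff_exists.2 ⟨natWord 0, ?_⟩
    rw [hnew 7 _ _ (Or.inl rfl)]
    exact ⟨i, (mem_run_sampleProg ..).2 ⟨w, hw, Or.inl rfl⟩⟩
  refine ⟨hc', t, hs.step hst hf' hk ?_ (fun _ _ _ h => Or.inl h) ?_, ?_, ?_, ?_⟩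
  · rintro tag k' z w ⟨i, hi⟩
    rw [mem_run_sampleProg] at hi
    obtain ⟨v, -, h2⟩ := hi
    simp only [Prod.mk.injEq] at h2
    simp only [sampleKeys, upKeys]
    omega
  · rintro k' j w ⟨i, hi⟩
    rw [mem_run_sampleProg] at hi
    obtain ⟨v, -, h2⟩ := hi
    simp at h2
  · intro a m b e hm
    by_contra hlt
    push Not at hlt
    have hx : a.length ∈ Finset.range ((t k).tour.length - c.L) := by
      rw [Finset.mem_range, e]
      simp only [List.length_append]
      omega
    obtain ⟨i, j, hij⟩ := hρ _ hx
    split_ifs at hij with hj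
    · rw [mem_residueSet, mem_hitResidues] at hij
      obtain ⟨-, z, hz, hmem⟩ := hij
      have hcoin : coin (ρ i) 0 = (ρ i j).val := by
        have : j = ⟨0, hS0⟩ := Fin.ext hj
        simp [coin, hS0, this]
      have h1 := hsam i (natWord z) (by rw [hcoin]; exact hz)
      refine hm _ ?_ h1
      rw [hcoin, wordNat_natWord]
      have h2 : seg a.length = m.take (c.L + 1) := by
        simp only [seg, e, List.drop_left]
        exact List.take_append_of_le_length (by omega)
      rw [h2] at hmem
      exact List.mem_of_mem_take hmem
    · simp at hij
  · intro p hp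
    obtain ⟨w, hp⟩ := Option.isSome_iff_exists.1 hp
    rw [hnew 7 _ _ (Or.inl rfl)] at hp
    obtain ⟨i, hi⟩ := hp
    rw [mem_run_sampleProg] at hi
    obtain ⟨v, h1, h2⟩ := hi
    simp only [Prod.mk.injEq] at h2
    have hp : p = 3 * wordNat v + coin (ρ i) 0 % (3 * c.s) % 3 := by omega
    refine ⟨?_, i, ?_⟩
    · rw [BT.mem_tour, hp, show (3 * wordNat v + coin (ρ i) 0 % (3 * c.s) % 3) / 3 = wordNat v by
        omega]
      exact (hw _ _ h1).1
    · rw [hnew 8 _ _ (Or.inr rfl)]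
      exact ⟨i, (mem_run_sampleProg ..).2 ⟨v, h1, Or.inr (by rw [hp])⟩⟩
  · intro i w hi
    rw [hnew 8 _ _ (Or.inr rfl)] at hi
    obtain ⟨i', hi⟩ := hi
    rw [mem_run_sampleProg] at hi
    obtain ⟨v, h1, h2⟩ := hi
    simp only [Prod.mk.injEq] at h2
    obtain ⟨rfl, rfl⟩ : i = i'.val ∧
      w = natWord (3 * wordNat v + coin (ρ i') 0 % (3 * c.s) % 3) := by
      rcases h2 with ⟨⟨h, -⟩, -⟩ | h
      · omega
      · exact ⟨h.1.2.2, h.2⟩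
    refine ⟨?_, _, rfl, hsam i' v h1⟩
    -- A machine can sample only if its block starts below `N k`.
    have h3 := (hw _ _ h1).2
    have h4 : i'.val * c.s < c.N k := by omega
    have h5 : i'.val ≤ c.N k / c.s := (Nat.le_div_iff_mul_le ok.s_pos).2 h4.le
    omega

/-! ### Marking -/

/-- The entries for a marked node `z` that becomes item `j` of level `k + 1`. -/
def markEntries (k j z : ℕ) : List (Key × Word) :=
  [((4, k, z), natWord 0), ((6, k + 1, j), natWord z)]

/-- Machine `i` walks from its sampled position to the next one and marks the node of the sampled
position and the node at which the walk turns; machine `0` marks the root. -/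
noncomputable def markProg (c : Cfg) (k i : ℕ) : Prog (List (Key × Word)) :=
  (Prog.ask (8, k, i) (Prog.onSome fun w => (walkProg k c.L (wordNat w)).bind fun V =>
    .ret (markEntries k (3 * i) (wordNat w / 3) ++
      markEntries k (3 * i + 1) (turn (wordNat w) V)))).bind fun l =>
    .ret (l ++ if i = 0 then markEntries k 2 c.root else [])

/-- The tags and levels of the entries after marking at level `m`. -/
def markKeys (m tag k : ℕ) : Prop := upKeys m tag k ∨ tag = 4 ∧ k = m ∨ tag = 6 ∧ k = m + 1

/-- The nodes of level `m + 1` have been marked at level `m`. -/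
def MarkInv (c : Cfg) (val : ℕ → Gain) (m : ℕ) (H : Heads) : Prop :=
  ∃ t, Stage c val (markKeys m) m H t ∧ GoodMarks c H m (t m) ∧
    (∀ z, Marked H m z → ∃ j, H (6, m + 1, j) = some (natWord z)) ∧
    (∀ j w, H (6, m + 1, j) = some w → j < c.N (m + 1) ∧ ∃ z, Marked H m z ∧ w = natWord z)

/-- `z` is the node that machine `i` stores as item `j`. -/
def MarkItem (c : Cfg) (H : Heads) (k i j z : ℕ) : Prop :=
  (∃ p, H (8, k, i) = some (natWord p) ∧ (j = 3 * i ∧ z = p / 3 ∨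
    j = 3 * i + 1 ∧ z = turn p (walk (nextPos H k) (Sampled H k) c.L p))) ∨
  i = 0 ∧ j = 2 ∧ z = c.root

/-- Machine `i` uses the slots `3 i` and `3 i + 1`; the slot `2` of machine 0 remains free for the
root. So the slot determines the machine and the kind of mark. -/
theorem MarkItem.unique {c : Cfg} {H : Heads} {k i i' j z z' : ℕ} (h : MarkItem c H k i j z)
    (h' : MarkItem c H k i' j z') : z = z' := by
  rcases h with ⟨p, hp, h⟩ | ⟨hi, hj, hz⟩ <;> rcases h' with ⟨p', hp', h'⟩ | ⟨hi', hj', hz'⟩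
  · have : i = i' := by omega
    subst this
    have : p = p' := natWord_injective (Option.some.inj (hp.symm.trans hp'))
    subst this
    rcases h with ⟨h1, rfl⟩ | ⟨h1, rfl⟩ <;> rcases h' with ⟨h2, rfl⟩ | ⟨h2, rfl⟩
    · rfl
    · omega
    · omega
    · rfl
  · omega
  · omega
  · omega

theorem mem_run_markProg (c : Cfg) (H : Heads) (k i : ℕ)
    (h8 : ∀ w, H (8, k, i) = some w → ∃ p, w = natWord p) (e : Key × Word) :
    e ∈ (markProg c k i).run H ↔ ∃ j z, MarkItem c H k i j z ∧ e ∈ markEntries k j z := by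
  have h1 : e ∈ (if i = 0 then markEntries k 2 c.root else []) ↔
      i = 0 ∧ e ∈ markEntries k 2 c.root := by
    split_ifs with h <;> simp [h]
  cases h : H (8, k, i) with
  | none =>
    simp only [markProg, Prog.run_bind, Prog.run_ask, h, Prog.onSome_none, Prog.run_ret,
      List.nil_append, h1, MarkItem]
    constructor
    · rintro ⟨rfl, h'⟩
      exact ⟨2, c.root, Or.inr ⟨rfl, rfl, rfl⟩, h'⟩
    · rintro ⟨j, z, ⟨p, hp, -⟩ | ⟨rfl, rfl, rfl⟩, h'⟩
      · cases hp
      · exact ⟨rfl, h'⟩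
  | some w =>
    obtain ⟨p, rfl⟩ := h8 w h
    simp only [markProg, Prog.run_bind, Prog.run_ask, h, Prog.onSome_some, Prog.run_ret,
      List.mem_append, h1, MarkItem, (walkProg_spec H k c.L _).1, wordNat_natWord]
    constructor
    · rintro ((h' | h') | ⟨rfl, h'⟩)
      · exact ⟨_, _, Or.inl ⟨p, rfl, Or.inl ⟨rfl, rfl⟩⟩, h'⟩
      · exact ⟨_, _, Or.inl ⟨p, rfl, Or.inr ⟨rfl, rfl⟩⟩, h'⟩
      · exact ⟨2, c.root, Or.inr ⟨rfl, rfl, rfl⟩, h'⟩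
    · rintro ⟨j, z, ⟨p', hp, ⟨rfl, rfl⟩ | ⟨rfl, rfl⟩⟩ | ⟨rfl, rfl, rfl⟩, h'⟩
      · have := natWord_injective (Option.some.inj hp)
        subst this
        exact Or.inl (Or.inl h')
      · have := natWord_injective (Option.some.inj hp)
        subst this
        exact Or.inl (Or.inr h')
      · exact Or.inr ⟨rfl, h'⟩

theorem markProg_bounds (c : Cfg) (H : Heads) (k i : ℕ) :
    (markProg c k i).cost H ≤ 2 * c.L + 1 ∧ ((markProg c k i).run H).length ≤ 6 := by
  have h1 : (if i = 0 then markEntries k 2 c.root else []).length ≤ 2 := by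
    split_ifs <;> simp [markEntries]
  cases h : H (8, k, i) with
  | none =>
    simp only [markProg, Prog.run_bind, Prog.run_ask, h, Prog.onSome_none, Prog.run_ret,
      Prog.cost_bind, Prog.cost_ask, Prog.cost_ret, List.nil_append]
    omega
  | some w =>
    have h2 := (walkProg_spec H k c.L (wordNat w)).2
    simp only [markProg, Prog.run_bind, Prog.run_ask, h, Prog.onSome_some, Prog.run_ret,
      Prog.cost_bind, Prog.cost_ask, Prog.cost_ret, List.length_append, markEntries,
      List.length_cons, List.length_nil]
    simp only [markEntries] at h1
    omega

/-- Walks stay inside the tour, so a node at which one turns belongs to the tree. -/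
theorem Level.turn_mem {c : Cfg} {val : ℕ → Gain} {H : Heads} {k : ℕ} {t : BT}
    (hl : Level c val H k t) (X : ℕ → Prop) (f : ℕ) {p : ℕ} (hp : p ∈ t.tour) :
    turn p (walk (nextPos H k) X f p) ∈ t.labels := by
  unfold turn
  split_ifs with hex
  · obtain ⟨h1, -⟩ := hex.choose_spec
    generalize hex.choose = u at h1 ⊢
    obtain ⟨A, E, et⟩ := List.append_of_mem hp
    have hc := hl.stores.isChain
    rw [et] at hc
    obtain ⟨V, E', eV, eE⟩ := walk_prefix (X := X) f p E hc.right_of_append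
      fun a b h => Stores.last (t := t) (k := k) (H := H) (fun z hz => by
        have := hl.top.symm.trans hz
        cases this
        exact hl.up_root) (A ++ a) b (by simp [et, h])
    have h2 : 3 * u + 1 ∈ t.tour := by
      rw [et, eE, ← List.cons_append]
      exact List.mem_append_right _ (List.mem_append_left _ (eV ▸ h1))
    have h3 := BT.mem_tour.1 h2
    rwa [show (3 * u + 1) / 3 = u by omega] at h3
  · exact BT.mem_tour.1 hp

/-- Once the samples have small gaps, no randomness is left: the marks in the table are the set
`BT.marks`, and the combinatorics is that of `BT.clean_marks`. A node may become several items,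
which is harmless since they all name the same node. -/
theorem mark_triple (c : Cfg) {μ : ℕ} (ok : c.Ok μ) (val : ℕ → Gain) (k : ℕ) (hk : k < c.K) :
    Triple (OnHeads (SampleInv c val k)) (copyRound c fun i _ => markProg c k i)
      (OnHeads (MarkInv c val k)) 0 := by
  refine Triple.of_forall fun M ⟨hcons, t, hs, hgap, hsam, hlist⟩ ρ => ?_
  set H := pick M with hH
  have hl := hs.levels k le_rfl
  have hroot : c.root ∈ (t k).labels := BT.top_mem_labels hl.top
  have h8 : ∀ i w, H (8, k, i) = some w → ∃ p, w = natWord p := fun i w hw => by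
    obtain ⟨-, p, h, -⟩ := hlist i w hw
    exact ⟨p, h⟩
  have hitem : ∀ i j z, MarkItem c H k i j z →
      z ∈ (t k).labels ∧ j < c.N (k + 1) := by
    intro i j z h
    have hN := ok.N_succ k
    have hN0 : 0 ≤ c.N k / c.s := Nat.zero_le _
    rcases h with ⟨p, hp, h⟩ | ⟨rfl, rfl, rfl⟩
    · obtain ⟨h1, p', h2, h3⟩ := hlist i _ hp
      have := natWord_injective h2
      subst this
      have h4 := (hsam p h3).1
      rcases h with ⟨rfl, rfl⟩ | ⟨rfl, rfl⟩
      · exact ⟨BT.mem_tour.1 h4, by omega⟩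
      · exact ⟨hl.turn_mem _ _ h4, by omega⟩
    · exact ⟨hroot, by omega⟩
  have hno4 : ∀ z, H (4, k, z) = none := fun z => hs.none_of_not (by
    simp only [sampleKeys, upKeys]
    omega)
  have hno6 : ∀ z, H (6, k + 1, z) = none := fun z => hs.none_of_not (by
    simp only [sampleKeys, upKeys]
    omega)
  obtain ⟨hc', hf', hst⟩ := copyRound_step c ok (fun i _ => markProg c k i) H ρ
    hs.fits hs.item_lt (fun i => (markProg_bounds ..).1.trans (by omega))
    (fun i => (markProg_bounds ..).2.trans (by omega))
    (by
      intro i e he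
      rw [mem_run_markProg _ _ _ _ (h8 i)] at he
      obtain ⟨j, z, h1, h2⟩ := he
      obtain ⟨h3, h4⟩ := hitem _ _ _ h1
      have h5 := hl.le_Z _ h3
      have h6 := ok.Z_le
      have h7 := ok.K_le
      have h8 := ok.tag_le
      have h9 := ok.N_block k
      have h10 := ok.P_le
      simp only [markEntries, List.mem_cons, List.not_mem_nil, or_false] at h2
      rcases h2 with rfl | rfl
      · exact ⟨⟨by simp only; omega, by simp only; omega, by simp only; omega,
          natWord_fits (by omega)⟩, hno4 _⟩
      · exact ⟨⟨by simp only; omega, by simp only; omega, by simp only; omega,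
          natWord_fits (by omega)⟩, hno6 _⟩)
    (by
      intro i i' κ w w' h h'
      rw [mem_run_markProg _ _ _ _ (h8 _)] at h h'
      obtain ⟨j, z, h1, h2⟩ := h
      obtain ⟨j', z', h1', h2'⟩ := h'
      simp only [markEntries, List.mem_cons, List.not_mem_nil, or_false, Prod.mk.injEq] at h2 h2'
      rcases h2 with ⟨rfl, rfl⟩ | ⟨rfl, rfl⟩
      · rcases h2' with ⟨-, rfl⟩ | ⟨h3, -⟩
        · rfl
        · simp at h3
      · rcases h2' with ⟨h3, -⟩ | ⟨h3, rfl⟩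
        · simp at h3
        · simp only [Prod.mk.injEq, true_and] at h3
          subst h3
          rw [h1.unique h1'])
  set H' := pick ((copyRound c fun i _ => markProg c k i).result H ρ) with hH'
  have hnew4 : ∀ z, Marked H' k z ↔ ∃ i : Fin c.P, ∃ j, MarkItem c H k i j z := by
    intro z
    unfold Marked
    rw [Option.isSome_iff_exists]
    constructor
    · rintro ⟨w, hw⟩
      rw [hst.of_new (Or.inr (hno4 z))] at hw
      obtain ⟨i, hi⟩ := hw
      rw [mem_run_markProg _ _ _ _ (h8 _)] at hi
      obtain ⟨j, z', h1, h2⟩ := hi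
      simp only [markEntries, List.mem_cons, List.not_mem_nil, or_false, Prod.mk.injEq,
        true_and] at h2
      rcases h2 with ⟨rfl, -⟩ | h2
      · exact ⟨i, j, h1⟩
      · simp at h2
    · rintro ⟨i, j, h⟩
      refine ⟨natWord 0, (hst.of_new (Or.inr (hno4 z)) _).2 ⟨i, ?_⟩⟩
      rw [mem_run_markProg _ _ _ _ (h8 _)]
      exact ⟨j, z, h, by simp [markEntries]⟩
  have hnew6 : ∀ j w, H' (6, k + 1, j) = some w ↔
      ∃ i : Fin c.P, ∃ z, MarkItem c H k i j z ∧ w = natWord z := by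
    intro j w
    rw [hst.of_new (Or.inr (hno6 j))]
    constructor
    · rintro ⟨i, hi⟩
      rw [mem_run_markProg _ _ _ _ (h8 _)] at hi
      obtain ⟨j', z, h1, h2⟩ := hi
      simp only [markEntries, List.mem_cons, List.not_mem_nil, or_false, Prod.mk.injEq,
        true_and] at h2
      rcases h2 with h2 | ⟨rfl, rfl⟩
      · simp at h2
      · exact ⟨i, z, h1, rfl⟩
    · rintro ⟨i, z, h, rfl⟩
      refine ⟨i, ?_⟩
      rw [mem_run_markProg _ _ _ _ (h8 _)]
      exact ⟨j, z, h, by simp [markEntries]⟩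
  have hmarks : Marked H' k = BT.marks (nextPos H k) (Sampled H k) c.L c.root := by
    funext z
    apply propext
    rw [hnew4]
    constructor
    · rintro ⟨i, j, ⟨p, hp, h⟩ | ⟨-, -, rfl⟩⟩
      · obtain ⟨h1, p', h2, h3⟩ := hlist i _ hp
        have := natWord_injective h2
        subst this
        refine Or.inr ⟨p, h3, ?_⟩
        rcases h with ⟨-, h⟩ | ⟨-, h⟩
        · exact Or.inl h
        · exact Or.inr h
      · exact Or.inl rfl
    · rintro (rfl | ⟨p, hp, h⟩)
      · exact ⟨⟨0, ok.P_pos⟩, 2, Or.inr ⟨rfl, rfl, rfl⟩⟩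
      · obtain ⟨-, i, hi⟩ := hsam p hp
        rcases h with h | h
        · exact ⟨i, _, Or.inl ⟨p, hi, Or.inl ⟨rfl, h⟩⟩⟩
        · exact ⟨i, _, Or.inl ⟨p, hi, Or.inr ⟨rfl, h⟩⟩⟩
  refine ⟨hc', t, hs.step hst hf' hk.le ?_ ?_ ?_, ?_, ?_, ?_⟩
  · rintro tag k' z w ⟨i, hi⟩
    rw [mem_run_markProg _ _ _ _ (h8 _)] at hi
    obtain ⟨j, z', -, h2⟩ := hi
    simp only [markEntries, List.mem_cons, List.not_mem_nil, or_false, Prod.mk.injEq] at h2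
    simp only [markKeys, upKeys]
    omega
  · intro tag k' ht hA
    rcases hA with hA | ⟨h7, -⟩
    · exact Or.inl hA
    · omega
  · rintro k' j w ⟨i, hi⟩
    rw [mem_run_markProg _ _ _ _ (h8 _)] at hi
    obtain ⟨j', z', h1, h2⟩ := hi
    simp only [markEntries, List.mem_cons, List.not_mem_nil, or_false, Prod.mk.injEq] at h2
    have h3 := (hitem _ _ _ h1).2
    have h4 := ok.N_le (k + 1)
    omega
  -- The tree has the form `node root …`, the shape for which `BT.clean_marks` is stated.
  · have htop := hl.top
    have hcl := hl.nodup
    have hch := hl.stores.isChain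
    have hlast := Stores.last (t := t k) (k := k) (H := H) (fun z hz => by
        have := hl.top.symm.trans hz
        cases this
        exact hl.up_root)
    have hmem := fun p hp => (hsam p hp).1
    cases htk : t k with
    | nil => simp [htk, BT.top] at htop
    | node z P Q l r =>
      rw [htk] at htop hcl hch hlast hmem hgap
      cases htop
      obtain ⟨h1, h2⟩ := BT.clean_marks hcl hch hlast hmem hgap
      refine ⟨by rw [hmarks]; exact h1, by rw [hmarks]; exact Or.inl rfl, ?_, ?_⟩
      · intro z hz
        obtain ⟨i, j, h⟩ := (hnew4 z).1 hz
        rw [← htk]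
        exact (hitem _ _ _ h).1
      · rw [hmarks]
        exact h2
  · intro z hz
    obtain ⟨i, j, h⟩ := (hnew4 z).1 hz
    exact ⟨j, (hnew6 _ _).2 ⟨i, z, h, rfl⟩⟩
  · intro j w hw
    obtain ⟨i, z, h, rfl⟩ := (hnew6 _ _).1 hw
    exact ⟨(hitem _ _ _ h).2, z, (hnew4 z).2 ⟨i, j, h⟩, rfl⟩

/-! ### Entries for the nodes of a tree -/

namespace BT

theorem Sub.node_unique {t : BT} (hn : t.labels.Nodup) {z : ℕ} {P P' Q Q' : Mat}
    {l l' r r' : BT} (h : Sub (node z P Q l r) t) (h' : Sub (node z P' Q' l' r') t) :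
    P = P' ∧ Q = Q' ∧ l = l' ∧ r = r' := by
  induction t with
  | nil => simp [Sub] at h
  | node y P₀ Q₀ l₀ r₀ ihl ihr =>
    simp only [labels, List.nodup_cons, List.mem_append, not_or, List.nodup_append'] at hn
    obtain ⟨⟨h1, h2⟩, h3, h4, h5⟩ := hn
    have hm : ∀ {P Q l r s}, Sub (node z P Q l r) s → z ∈ s.labels := fun h =>
      mem_labels.2 ⟨_, _, _, _, h⟩
    rcases h with h | h | h <;> rcases h' with h' | h' | h'
    · injection h.trans h'.symm with h1 h2 h3 h4 h5
      exact ⟨h2, h3, h4, h5⟩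
    · injection h with h
      exact absurd (h ▸ hm h') h1
    · injection h with h
      exact absurd (h ▸ hm h') h2
    · injection h' with h'
      exact absurd (h' ▸ hm h) h1
    · exact ihl h3 h h'
    · exact absurd (hm h') (h5 (hm h))
    · injection h' with h'
      exact absurd (h' ▸ hm h) h2
    · exact absurd (hm h) (h5 (hm h'))
    · exact ihr h4 h h'

/-- The size bound for parts excludes subtrees that contain the root; the subtrees of any node
satisfy this because names occur only once. -/
theorem root_notMem {t : BT} (hn : t.labels.Nodup) {x z : ℕ} {P Q : Mat} {l r : BT}
    (hx : t.top = some x) (h : Sub (node z P Q l r) t) : x ∉ l.labels ∧ x ∉ r.labels := by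
  cases t with
  | nil => cases hx
  | node y P₀ Q₀ l₀ r₀ =>
    cases hx
    simp only [labels, List.nodup_cons, List.mem_append, not_or] at hn
    obtain ⟨⟨h1, h2⟩, -⟩ := hn
    rcases h with h | h | h
    · injection h with e1 e2 e3 e4 e5
      subst e4 e5
      exact ⟨h1, h2⟩
    · exact ⟨fun h' => h1 (((sub_left ..).trans h).labels_subset h'),
        fun h' => h1 (((sub_right ..).trans h).labels_subset h')⟩
    · exact ⟨fun h' => h2 (((sub_left ..).trans h).labels_subset h'),
        fun h' => h2 (((sub_right ..).trans h).labels_subset h')⟩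

/-- The node `y` is the left (`b = 0`) or right (`b = 1`) child of `z`. -/
def IsChild (t : BT) (b z y : ℕ) : Prop :=
  ∃ P Q l r, Sub (node z P Q l r) t ∧ (b = 0 ∧ l.top = some y ∨ b = 1 ∧ r.top = some y)

theorem IsChild.mem {t : BT} {b z y : ℕ} (h : IsChild t b z y) :
    y ∈ t.labels ∧ ∀ x, t.labels.Nodup → t.top = some x → y ≠ x := by
  obtain ⟨P, Q, l, r, hs, ⟨-, h⟩ | ⟨-, h⟩⟩ := h
  · refine ⟨((sub_left ..).trans hs).labels_subset (top_mem_labels h), ?_⟩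
    rintro x hn hx rfl
    exact (root_notMem hn hx hs).1 (top_mem_labels h)
  · refine ⟨((sub_right ..).trans hs).labels_subset (top_mem_labels h), ?_⟩
    rintro x hn hx rfl
    exact (root_notMem hn hx hs).2 (top_mem_labels h)

theorem isChild_node {b z y x : ℕ} {P Q : Mat} {l r : BT} : IsChild (node x P Q l r) b z y ↔
    (z = x ∧ (b = 0 ∧ l.top = some y ∨ b = 1 ∧ r.top = some y)) ∨ IsChild l b z y ∨
      IsChild r b z y := by
  constructor
  · rintro ⟨P', Q', l', r', h | h | h, h'⟩
    · injection h with e1 e2 e3 e4 e5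
      subst e4 e5
      exact Or.inl ⟨e1, h'⟩
    · exact Or.inr (Or.inl ⟨_, _, _, _, h, h'⟩)
    · exact Or.inr (Or.inr ⟨_, _, _, _, h, h'⟩)
  · rintro (⟨rfl, h⟩ | ⟨P', Q', l', r', h, h'⟩ | ⟨P', Q', l', r', h, h'⟩)
    · exact ⟨P, Q, l, r, Sub.refl _, h⟩
    · exact ⟨_, _, _, _, Or.inr (Or.inl h), h'⟩
    · exact ⟨_, _, _, _, Or.inr (Or.inr h), h'⟩

theorem IsChild.unique {t : BT} (hn : t.labels.Nodup) {b b' z z' y : ℕ} (h : IsChild t b z y)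
    (h' : IsChild t b' z' y) : b = b' ∧ z = z' := by
  induction t with
  | nil => obtain ⟨P, Q, l, r, h, -⟩ := h; simp [Sub] at h
  | node x P Q l r ihl ihr =>
    simp only [labels, List.nodup_cons, List.mem_append, not_or, List.nodup_append'] at hn
    obtain ⟨-, h3, h4, h5⟩ := hn
    have hd : y ∈ l.labels → y ∈ r.labels → False := fun ha hb => h5 ha hb
    rw [isChild_node] at h h'
    have key : ∀ {b z b' z'}, (z = x ∧ (b = 0 ∧ l.top = some y ∨ b = 1 ∧ r.top = some y)) →
        IsChild l b' z' y ∨ IsChild r b' z' y → False := by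
      rintro b z b' z' ⟨-, ⟨-, h⟩ | ⟨-, h⟩⟩ (h' | h')
      · exact h'.mem.2 y h3 h rfl
      · exact hd (top_mem_labels h) h'.mem.1
      · exact hd h'.mem.1 (top_mem_labels h)
      · exact h'.mem.2 y h4 h rfl
    rcases h with h | h
    · rcases h' with h' | h'
      · obtain ⟨rfl, h⟩ := h
        obtain ⟨rfl, h'⟩ := h'
        refine ⟨?_, rfl⟩
        rcases h with ⟨rfl, h⟩ | ⟨rfl, h⟩ <;> rcases h' with ⟨rfl, h'⟩ | ⟨rfl, h'⟩
        · rfl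
        · exact (hd (top_mem_labels h) (top_mem_labels h')).elim
        · exact (hd (top_mem_labels h') (top_mem_labels h)).elim
        · rfl
      · exact (key h h').elim
    · rcases h' with h' | h'
      · exact (key h' h).elim
      · rcases h with h | h <;> rcases h' with h' | h'
        · exact ihl h3 h h'
        · exact (hd h.mem.1 h'.mem.1).elim
        · exact (hd h'.mem.1 h.mem.1).elim
        · exact ihr h4 h h'

end BT

/-- The entries for a child of a node. -/
def childEntries (k z b : ℕ) : Option ℕ → List (Key × Word)
  | none => []
  | some y => [((b, k, z), natWord y), ((2, k, y), natWord (3 * z + 1 + b))]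

/-- The entries for a node of a tree. -/
def nodeEntries (k z : ℕ) (F : Mat × Mat) (l r : Option ℕ) : List (Key × Word) :=
  ((3, k, z), natWord (pairCode F)) :: (childEntries k z 0 l ++ childEntries k z 1 r)

theorem mem_childEntries {k z b : ℕ} {o : Option ℕ} {e : Key × Word} :
    e ∈ childEntries k z b o ↔ ∃ y, o = some y ∧
      (e = ((b, k, z), natWord y) ∨ e = ((2, k, y), natWord (3 * z + 1 + b))) := by
  cases o <;> simp [childEntries]

theorem length_nodeEntries (k z : ℕ) (F : Mat × Mat) (l r : Option ℕ) :
    (nodeEntries k z F l r).length ≤ 5 := by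
  cases l <;> cases r <;> simp [nodeEntries, childEntries]

/-- The entries for the nodes of a tree. -/
def TreeFact (t : BT) (k : ℕ) (e : Key × Word) : Prop :=
  ∃ z P Q l r, BT.Sub (.node z P Q l r) t ∧ e ∈ nodeEntries k z (P, Q) l.top r.top

theorem treeFact_iff {t : BT} {k : ℕ} {e : Key × Word} : TreeFact t k e ↔
    (∃ z P Q l r, BT.Sub (.node z P Q l r) t ∧ e = ((3, k, z), natWord (pairCode (P, Q)))) ∨
    ∃ b z y, BT.IsChild t b z y ∧
      (e = ((b, k, z), natWord y) ∨ e = ((2, k, y), natWord (3 * z + 1 + b))) := by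
  simp only [TreeFact, nodeEntries, List.mem_cons, List.mem_append, mem_childEntries]
  constructor
  · rintro ⟨z, P, Q, l, r, h, h' | ⟨y, h', h''⟩ | ⟨y, h', h''⟩⟩
    · exact Or.inl ⟨z, P, Q, l, r, h, h'⟩
    · exact Or.inr ⟨0, z, y, ⟨P, Q, l, r, h, Or.inl ⟨rfl, h'⟩⟩, h''⟩
    · exact Or.inr ⟨1, z, y, ⟨P, Q, l, r, h, Or.inr ⟨rfl, h'⟩⟩, h''⟩
  · rintro (⟨z, P, Q, l, r, h, h'⟩ | ⟨b, z, y, ⟨P, Q, l, r, h, ⟨rfl, h'⟩ | ⟨rfl, h'⟩⟩, h''⟩)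
    · exact ⟨z, P, Q, l, r, h, Or.inl h'⟩
    · exact ⟨z, P, Q, l, r, h, Or.inr (Or.inl ⟨y, h', h''⟩)⟩
    · exact ⟨z, P, Q, l, r, h, Or.inr (Or.inr ⟨y, h', h''⟩)⟩

theorem BT.IsChild.lt {t : BT} {b z y : ℕ} (h : BT.IsChild t b z y) : b < 2 := by
  obtain ⟨P, Q, l, r, h, ⟨rfl, -⟩ | ⟨rfl, -⟩⟩ := h <;> simp

theorem TreeFact.key {t : BT} {k : ℕ} {e : Key × Word} (h : TreeFact t k e) :
    e.1.1 < 4 ∧ e.1.2.1 = k := by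
  rw [treeFact_iff] at h
  rcases h with ⟨z, P, Q, l, r, h, rfl⟩ | ⟨b, z, y, h, rfl | rfl⟩
  · exact ⟨by simp, rfl⟩
  · exact ⟨by have := h.lt; simp only; omega, rfl⟩
  · exact ⟨by simp, rfl⟩

/-- Names are distinct, so a key belongs to one node or to one link. Several machines may therefore
write the facts of the same node without conflict. -/
theorem TreeFact.unique {t : BT} (hn : t.labels.Nodup) {k : ℕ} {κ : Key} {w w' : Word}
    (h : TreeFact t k (κ, w)) (h' : TreeFact t k (κ, w')) : w = w' := by
  rw [treeFact_iff] at h h'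
  simp only [Prod.mk.injEq] at h h'
  rcases h with ⟨z, P, Q, l, r, h, rfl, rfl⟩ | ⟨b, z, y, h, ⟨rfl, rfl⟩ | ⟨rfl, rfl⟩⟩
  · rcases h' with ⟨z', P', Q', l', r', h', e, rfl⟩ | ⟨b', z', y', h', ⟨e, rfl⟩ | ⟨e, rfl⟩⟩
    · simp only [Prod.mk.injEq, true_and] at e
      subst e
      obtain ⟨rfl, rfl, -, -⟩ := h.node_unique hn h'
      rfl
    · have := h'.lt
      simp only [Prod.mk.injEq] at e
      omega
    · simp at e
  · have hb := h.lt
    rcases h' with ⟨z', P', Q', l', r', h', e, rfl⟩ | ⟨b', z', y', h', ⟨e, rfl⟩ | ⟨e, rfl⟩⟩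
    · simp only [Prod.mk.injEq] at e
      omega
    · simp only [Prod.mk.injEq, true_and] at e
      obtain ⟨rfl, rfl⟩ := e
      obtain ⟨P, Q, l, r, hs, h⟩ := h
      obtain ⟨P', Q', l', r', hs', h'⟩ := h'
      obtain ⟨-, -, rfl, rfl⟩ := hs.node_unique hn hs'
      have : y = y' := by
        rcases h with ⟨rfl, h⟩ | ⟨rfl, h⟩ <;> rcases h' with ⟨e, h'⟩ | ⟨e, h'⟩
        · exact Option.some.inj (h.symm.trans h')
        · cases e
        · cases e
        · exact Option.some.inj (h.symm.trans h')
      rw [this]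
    · simp only [Prod.mk.injEq] at e
      omega
  · rcases h' with ⟨z', P', Q', l', r', h', e, rfl⟩ | ⟨b', z', y', h', ⟨e, rfl⟩ | ⟨e, rfl⟩⟩
    · simp at e
    · have := h'.lt
      simp only [Prod.mk.injEq] at e
      omega
    · simp only [Prod.mk.injEq, true_and] at e
      subst e
      obtain ⟨rfl, rfl⟩ := h.unique hn h'
      rfl

/-- A table that holds the entries for the nodes of a tree stores the tree. -/
theorem Stores.of_treeFact {H : Heads} {k : ℕ} {t : BT} (hn : t.labels.Nodup)
    (h : ∀ tag < 4, ∀ z w, H (tag, k, z) = some w ↔ TreeFact t k ((tag, k, z), w)) :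
    Stores H k t := by
  intro z P Q l r hs
  have hc : ∀ b, b < 2 → ∀ o : Option ℕ,
      (∀ y, o = some y ↔ b = 0 ∧ l.top = some y ∨ b = 1 ∧ r.top = some y) →
      H (b, k, z) = o.map natWord := by
    intro b hb o ho
    have key : ∀ y, BT.IsChild t b z y → o = some y := by
      rintro y ⟨P', Q', l', r', hs', h'⟩
      obtain ⟨-, -, rfl, rfl⟩ := hs.node_unique hn hs'
      exact (ho y).2 h'
    ext w
    rw [h b (by omega), treeFact_iff, Option.map_eq_some_iff]
    constructor
    · rintro (⟨z', P', Q', l', r', -, e⟩ | ⟨b', z', y, h', e | e⟩)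
      · simp only [Prod.mk.injEq] at e
        omega
      · simp only [Prod.mk.injEq, true_and] at e
        obtain ⟨⟨rfl, rfl⟩, rfl⟩ := e
        exact ⟨y, key y h', rfl⟩
      · simp only [Prod.mk.injEq] at e
        omega
    · rintro ⟨y, hy, rfl⟩
      exact Or.inr ⟨b, z, y, ⟨P, Q, l, r, hs, (ho y).1 hy⟩, Or.inl rfl⟩
  refine ⟨hc 0 (by omega) _ (by simp), hc 1 (by omega) _ (by simp), ?_, fun y hy => ?_,
    fun y hy => ?_⟩
  · rw [h 3 (by omega), treeFact_iff]
    exact Or.inl ⟨z, P, Q, l, r, hs, rfl⟩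
  · rw [h 2 (by omega), treeFact_iff]
    exact Or.inr ⟨0, z, y, ⟨P, Q, l, r, hs, Or.inl ⟨rfl, hy⟩⟩, Or.inr rfl⟩
  · rw [h 2 (by omega), treeFact_iff]
    exact Or.inr ⟨1, z, y, ⟨P, Q, l, r, hs, Or.inr ⟨rfl, hy⟩⟩, Or.inr rfl⟩

theorem TreeFact.up_root {H : Heads} {k x : ℕ} {t : BT} (hn : t.labels.Nodup)
    (hx : t.top = some x) (h : ∀ w, H (2, k, x) = some w → TreeFact t k ((2, k, x), w)) :
    H (2, k, x) = none := by
  cases e : H (2, k, x) with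
  | none => rfl
  | some w =>
    have := h w e
    rw [treeFact_iff] at this
    rcases this with ⟨z', P', Q', l', r', -, e⟩ | ⟨b', z', y, h', e | e⟩
    · simp at e
    · have := h'.lt
      simp only [Prod.mk.injEq] at e
      omega
    · simp only [Prod.mk.injEq, true_and] at e
      exact absurd e.1.symm (h'.mem.2 x hn hx)

theorem TreeFact.fits {c : Cfg} {μ : ℕ} (ok : c.Ok μ) {k : ℕ} (hk : k ≤ c.K) {t : BT}
    (hZ : ∀ z ∈ t.labels, z ≤ c.Z) (hW : t.weight ≤ c.W) {e : Key × Word} (h : TreeFact t k e) :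
    EntryFits c.B e := by
  have h1 := ok.Z_le
  have h2 := ok.tag_le
  have h3 := ok.K_le
  have h4 := ok.W_le
  have hm : ∀ {z P Q l r}, BT.Sub (.node z P Q l r) t → z ≤ c.Z := fun h =>
    hZ _ (BT.mem_labels.2 ⟨_, _, _, _, h⟩)
  rw [treeFact_iff] at h
  rcases h with ⟨z, P, Q, l, r, h, rfl⟩ | ⟨b, z, y, h, h'⟩
  · obtain ⟨h5, h6⟩ := BT.norm_le_weight h
    have h7 := pairCode_le (p := (P, Q)) (h5.trans hW) (h6.trans hW)
    have h8 := hm h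
    exact ⟨by simp only; omega, by simp only; omega, by simp only; omega,
      natWord_fits (by omega)⟩
  · have h5 := h.lt
    have h6 := hZ _ h.mem.1
    obtain ⟨P, Q, l, r, hs, -⟩ := h
    have h7 := hm hs
    rcases h' with rfl | rfl
    · exact ⟨by simp only; omega, by simp only; omega, by simp only; omega,
        natWord_fits (by omega)⟩
    · exact ⟨by simp only; omega, by simp only; omega, by simp only; omega,
        natWord_fits (by omega)⟩

/-! ### Contraction -/

theorem BT.sub_contract_of_mem {Y : ℕ → Prop} {t : BT} (hn : t.labels.Nodup)
    (hc : BT.Clean Y t) {z : ℕ} (hY : Y z) {P Q : Mat} {l r : BT}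
    (h : BT.Sub (.node z P Q l r) t) :
    BT.Sub (.node z (P * (contract Y l).1) (Q * (contract Y r).1) (contract Y l).2
      (contract Y r).2) (contract Y t).2 := by
  obtain ⟨P', Q', l', r', h'⟩ := mem_labels.1
    ((mem_labels_contract hc).2 ⟨mem_labels.2 ⟨P, Q, l, r, h⟩, hY⟩)
  obtain ⟨P₁, Q₁, l₁, r₁, h1, -, rfl, rfl, rfl, rfl⟩ := sub_contract h'
  obtain ⟨rfl, rfl, rfl, rfl⟩ := h.node_unique hn h1
  exact h'

/-- The entries for the node `z` of the contracted tree. -/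
noncomputable def contractOut (k z : ℕ) (F : Mat × Mat) (L R : CutTree) : List (Key × Word) :=
  nodeEntries (k + 1) z (F.1 * L.summary.1, F.2 * R.summary.1) L.summary.2 R.summary.2

/-- Runs a program for the nodes of level `k + 1` that belong to machine `i`. -/
noncomputable def visitItems (c : Cfg) (k i : ℕ)
    (g : ℕ → Mat × Mat → CutTree → CutTree → List (Key × Word)) : Prog (List (Key × Word)) :=
  Prog.collect (fun j => .askNat (6, k + 1, 3 * i + j) (Prog.onSome (visit k (c.P * c.s) g)))
    (List.range 3)

theorem mem_run_visitItems (c : Cfg) (H : Heads) (k i : ℕ)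
    (g : ℕ → Mat × Mat → CutTree → CutTree → List (Key × Word)) (e : Key × Word) :
    e ∈ (visitItems c k i g).run H ↔ ∃ j < 3, ∃ w, H (6, k + 1, 3 * i + j) = some w ∧
      e ∈ (visit k (c.P * c.s) g (wordNat w)).run H := by
  simp only [visitItems, Prog.mem_run_collect, List.mem_range, Prog.run_askNat]
  refine exists_congr fun j => and_congr_right fun _ => ?_
  cases H (6, k + 1, 3 * i + j) <;> simp

theorem visitItems_bounds (c : Cfg) (H : Heads) (k i b : ℕ)
    (g : ℕ → Mat × Mat → CutTree → CutTree → List (Key × Word))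
    (h : ∀ j w, H (6, k + 1, j) = some w →
      (visit k (c.P * c.s) g (wordNat w)).cost H ≤ 12 * c.L + 7 ∧
      ((visit k (c.P * c.s) g (wordNat w)).run H).length ≤ b) :
    (visitItems c k i g).cost H ≤ 36 * c.L + 24 ∧
      ((visitItems c k i g).run H).length ≤ 3 * b := by
  have key : ∀ j, (Prog.askNat (6, k + 1, 3 * i + j)
      (Prog.onSome (visit k (c.P * c.s) g))).cost H ≤ 12 * c.L + 8 ∧
      ((Prog.askNat (6, k + 1, 3 * i + j)
      (Prog.onSome (visit k (c.P * c.s) g))).run H).length ≤ b := by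
    intro j
    cases e : H (6, k + 1, 3 * i + j) with
    | none => simp [e]
    | some w =>
      have := h _ w e
      simp only [Prog.cost_askNat, Prog.run_askNat, e, Option.map_some, Prog.onSome_some]
      omega
  have h1 := Prog.cost_collect_le H _ _ (List.range 3) fun j _ => (key j).1
  have h2 := Prog.length_run_collect_le H _ _ (List.range 3) fun j _ => (key j).2
  simp only [List.length_range] at h1 h2
  unfold visitItems
  omega

/-- The machine owning an item for a marked node explores both sides down to the next marks, and by
`BT.summary_cut` this yields the matrices and children of that node in the contracted tree. Together
the machines write exactly the facts of this tree. -/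
theorem contract_triple (c : Cfg) {μ : ℕ} (ok : c.Ok μ) (val : ℕ → Gain) (k : ℕ) (hk : k < c.K) :
    Triple (OnHeads (MarkInv c val k)) (copyRound c fun i _ => visitItems c k i (contractOut k))
      (OnHeads (UpInv c val (k + 1))) 0 := by
  refine Triple.of_forall fun M ⟨hcons, t, hs, hgood, hitem, hmark⟩ ρ => ?_
  set H := pick M with hH
  have hl := hs.levels k le_rfl
  set t' := (BT.contract (Marked H k) (t k)).2 with ht'
  have hsub : t'.labels.Sublist (t k).labels := BT.labels_contract_sublist _ _
  have hn' : t'.labels.Nodup := hl.nodup.sublist hsub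
  -- Contraction neither invents names nor increases the weight, so the word bounds persist over all
  -- levels.
  have hZ' : ∀ z ∈ t'.labels, z ≤ c.Z := fun z hz => hl.le_Z z (hsub.subset hz)
  have hW' : t'.weight ≤ c.W :=
    (Nat.le_of_add_left_le (BT.weight_contract_le (Marked H k) (t k))).trans hl.weight
  have hvisit : ∀ {z P Q l r}, BT.Sub (.node z P Q l r) (t k) → Marked H k z →
      (visit k (c.P * c.s) (contractOut k) z).run H = nodeEntries (k + 1) z
        (P * (BT.contract (Marked H k) l).1, Q * (BT.contract (Marked H k) r).1)
        (BT.contract (Marked H k) l).2.top (BT.contract (Marked H k) r).2.top ∧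
      (visit k (c.P * c.s) (contractOut k) z).cost H ≤ 12 * c.L + 7 := by
    intro z P Q l r hz hY
    obtain ⟨h1, h2⟩ := BT.root_notMem hl.nodup hl.top hz
    obtain ⟨h3, h4⟩ := visit_spec (L := c.L) hl.stores hz (hl.length_le.trans (ok.N_le k))
      (contractOut k) (hgood.size _ _ ((BT.sub_left ..).trans hz) h1)
      (hgood.size _ _ ((BT.sub_right ..).trans hz) h2)
    refine ⟨?_, h4⟩
    rw [h3]
    simp only [contractOut, BT.summary_cut]
  have hmem : ∀ j w, H (6, k + 1, j) = some w → ∃ z P Q l r, w = natWord z ∧ Marked H k z ∧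
      BT.Sub (.node z P Q l r) (t k) := by
    intro j w hw
    obtain ⟨-, z, hz, rfl⟩ := hmark j w hw
    obtain ⟨P, Q, l, r, h⟩ := BT.mem_labels.1 (hgood.mem z hz)
    exact ⟨z, P, Q, l, r, rfl, hz, h⟩
  have hrun : ∀ e, (∃ i : Fin c.P, e ∈ (visitItems c k i (contractOut k)).run H) ↔
      TreeFact t' (k + 1) e := by
    intro e
    simp only [mem_run_visitItems]
    constructor
    · rintro ⟨i, j, -, w, hw, he⟩
      obtain ⟨z, P, Q, l, r, rfl, hz, h⟩ := hmem _ _ hw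
      rw [wordNat_natWord, (hvisit h hz).1] at he
      exact ⟨z, _, _, _, _, BT.sub_contract_of_mem hl.nodup hgood.clean hz h, he⟩
    · rintro ⟨z, P', Q', l', r', h', he⟩
      obtain ⟨P, Q, l, r, h, hz, rfl, rfl, rfl, rfl⟩ := BT.sub_contract h'
      obtain ⟨j, hj⟩ := hitem z hz
      -- Items of the new level are owned in blocks of three, so item `j` belongs to machine `j /
      -- 3`.
      have hlt := (hmark j _ hj).1.trans_le (ok.N_block k)
      refine ⟨⟨j / 3, by omega⟩, j % 3, Nat.mod_lt _ (by omega), natWord z, ?_, ?_⟩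
      · rw [show 3 * (j / 3) + j % 3 = j by omega]
        exact hj
      · rw [wordNat_natWord, (hvisit h hz).1]
        exact he
  have hbound : ∀ i, (visitItems c k i (contractOut k)).cost H ≤ 36 * c.L + 24 ∧
      ((visitItems c k i (contractOut k)).run H).length ≤ 3 * 5 := by
    intro i
    refine visitItems_bounds c H k i 5 _ fun j w hw => ?_
    obtain ⟨z, P, Q, l, r, rfl, hz, h⟩ := hmem _ _ hw
    rw [wordNat_natWord, (hvisit h hz).1]
    exact ⟨(hvisit h hz).2, length_nodeEntries ..⟩
  have hnone : ∀ tag < 4, ∀ z, H (tag, k + 1, z) = none := fun tag ht z => hs.none_of_not (by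
    simp only [markKeys, upKeys]
    omega)
  obtain ⟨hc', hf', hst⟩ := copyRound_step c ok (fun i _ => visitItems c k i (contractOut k)) H ρ
    hs.fits hs.item_lt (fun i => (hbound i).1) (fun i => (hbound i).2.trans (by omega))
    (by
      intro i e he
      have h := (hrun e).1 ⟨i, he⟩
      refine ⟨h.fits ok (by omega) hZ' hW', ?_⟩
      obtain ⟨h1, h2⟩ := h.key
      obtain ⟨⟨tag, k', z⟩, w⟩ := e
      simp only at h1 h2
      subst h2
      exact hnone tag h1 z)
    (by
      intro i i' κ w w' h h'
      exact ((hrun _).1 ⟨i, h⟩).unique hn' ((hrun _).1 ⟨i', h'⟩))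
  set H' := pick ((copyRound c fun i _ => visitItems c k i (contractOut k)).result H ρ) with hH'
  have hkey : ∀ {tag k' z w}, (∃ i : Fin c.P, ((tag, k', z), w) ∈
      (visitItems c k i (contractOut k)).run H) → tag < 4 ∧ k' = k + 1 := fun h =>
    ((hrun _).1 h).key
  have h6 : ∀ j, H' (6, k + 1, j) = H (6, k + 1, j) := fun j =>
    hst.eq_of_kept ⟨by simp only; omega, Or.inl rfl⟩ fun w h => by
      have := (hkey h).1
      omega
  have hfacts : ∀ tag < 4, ∀ z w, H' (tag, k + 1, z) = some w ↔
      TreeFact t' (k + 1) ((tag, k + 1, z), w) := fun tag ht z w => by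
    rw [hst.of_new (Or.inr (hnone tag ht z)), hrun]
  have hmk : Marked H' k = Marked H k := hl.marked_step hgood hst hk.le fun z w h => by
    have := (hkey h).1
    omega
  have hs' : Stage c val (upKeys (k + 1)) k H' t := by
    refine hs.step hst hf' hk.le ?_ ?_ ?_
    · intro tag k' z w h
      have := hkey h
      simp only [upKeys]
      omega
    · intro tag k' ht hA
      simp only [markKeys, upKeys] at hA ⊢
      omega
    · intro k' j w h
      have := (hkey h).1
      omega
  have htop : t'.top = some c.root := by
    have h1 := hl.top
    have h2 := hgood.root
    rw [ht']
    cases htk : t k with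
    | nil => simp [htk, BT.top] at h1
    | node z P Q l r =>
      rw [htk] at h1
      cases h1
      rw [BT.contract_node_of_mem h2]
      rfl
  have hlab : ∀ z, z ∈ t'.labels ↔ Marked H k z := fun z => by
    rw [BT.mem_labels_contract hgood.clean]
    exact ⟨fun h => h.2, fun h => ⟨hgood.mem z h, h⟩⟩
  have hlev : Level c val H' (k + 1) t' := by
    refine ⟨htop, hn', .of_treeFact hn' hfacts,
      TreeFact.up_root hn' htop fun w h => (hfacts 2 (by omega) _ w).1 h,
      hl.valued.contract hgood.clean, hW', hZ', ?_, ?_, by simp⟩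
    · intro z hz
      obtain ⟨j, hj⟩ := hitem z ((hlab z).1 hz)
      exact ⟨j, by rw [h6, hj]⟩
    · intro j w hj
      rw [h6] at hj
      obtain ⟨h1, z, h2, h3⟩ := hmark j w hj
      exact ⟨h1, z, (hlab z).2 h2, h3⟩
  have hne : ∀ {j}, j ≤ k → Function.update t (k + 1) t' j = t j := fun h =>
    Function.update_of_ne (by omega) _ _
  refine ⟨hc', Function.update t (k + 1) t', hs'.fits, hs'.allowed, hs'.item_lt, ?_, ?_, ?_⟩
  · intro j hj
    rcases Nat.lt_or_ge j (k + 1) with h | h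
    · rw [hne (by omega)]
      exact hs'.levels j (by omega)
    · obtain rfl : j = k + 1 := by omega
      rw [Function.update_self]
      exact hlev
  · intro j hj
    rw [hne (by omega)]
    rcases Nat.lt_or_ge j k with h | h
    · exact hs'.marks j h
    · obtain rfl : j = k := by omega
      exact hgood.congr hmk
  · intro j hj
    rw [hne (show j ≤ k by omega)]
    rcases Nat.lt_or_ge j k with h | h
    · rw [hne (by omega)]
      exact hs'.links j h
    · obtain rfl : j = k := by omega
      rw [Function.update_self, hmk]

/-! ### Values of the nodes -/

/-- The tags and levels of the entries when the values of the levels from `m` on are known. -/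
def downKeys (c : Cfg) (m tag k : ℕ) : Prop := upKeys c.K tag k ∨ tag = 5 ∧ m ≤ k

/-- The values of the nodes of the levels from `m` on are known. -/
def DownInv (c : Cfg) (val : ℕ → Gain) (m : ℕ) (H : Heads) : Prop :=
  ∃ t, Stage c val (downKeys c m) c.K H t ∧
    ∀ k, m ≤ k → k ≤ c.K → ∀ z ∈ (t k).labels, H (5, k, z) = some (natWord (val z).code)

/-- The entries for the values of a part of a tree. -/
noncomputable def valueOut (k z : ℕ) (F : Mat × Mat) (L R : CutTree) : List (Key × Word) :=
  (CutTree.node z F.1 F.2 L R).values.map fun e => ((5, k, e.1), natWord e.2.code)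

theorem length_valueOut (k z : ℕ) (F : Mat × Mat) (L R : CutTree) :
    (valueOut k z F L R).length = L.size + R.size + 1 := by
  simp [valueOut, CutTree.length_values, CutTree.size]

theorem mem_valueOut_cut {Y : ℕ → Prop} {d : ℕ → Option Word} {val : ℕ → Gain} {k z : ℕ}
    {P Q : Mat} {l r : BT} (h : BT.Valued val (.node z P Q l r))
    (hd : ∀ y ∈ l.labels ++ r.labels, Y y → d y = some (natWord (val y).code)) (e : Key × Word) :
    e ∈ valueOut k z (P, Q) (l.cut Y d) (r.cut Y d) ↔
      ∃ y, (y = z ∨ y ∈ (l.cut Y d).values.map Prod.fst ∨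
        y ∈ (r.cut Y d).values.map Prod.fst) ∧ e = ((5, k, y), natWord (val y).code) := by
  have hdl : ∀ y ∈ l.labels, Y y → d y = some (natWord (val y).code) := fun y hy =>
    hd y (List.mem_append_left _ hy)
  have hdr : ∀ y ∈ r.labels, Y y → d y = some (natWord (val y).code) := fun y hy =>
    hd y (List.mem_append_right _ hy)
  have hl := h.mono (BT.sub_left ..)
  have hr := h.mono (BT.sub_right ..)
  have hz : (CutTree.node z P Q (l.cut Y d) (r.cut Y d)).value = val z := by
    rw [CutTree.value, BT.value_cut hl hdl, BT.value_cut hr hdr]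
    exact (h z P Q l r (BT.Sub.refl _)).symm
  simp only [valueOut, CutTree.values, List.map_cons, List.map_append, List.mem_cons,
    List.mem_append, List.mem_map, hz]
  constructor
  · rintro (rfl | ⟨x, hx, rfl⟩ | ⟨x, hx, rfl⟩)
    · exact ⟨z, Or.inl rfl, rfl⟩
    · exact ⟨x.1, Or.inr (Or.inl ⟨x, hx, rfl⟩), by rw [(BT.mem_values_cut hl hdl hx).2]⟩
    · exact ⟨x.1, Or.inr (Or.inr ⟨x, hx, rfl⟩), by rw [(BT.mem_values_cut hr hdr hx).2]⟩
  · rintro ⟨y, rfl | ⟨x, hx, rfl⟩ | ⟨x, hx, rfl⟩, rfl⟩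
    · exact Or.inl rfl
    · exact Or.inr (Or.inl ⟨x, hx, by rw [(BT.mem_values_cut hl hdl hx).2]⟩)
    · exact Or.inr (Or.inr ⟨x, hx, by rw [(BT.mem_values_cut hr hdr hx).2]⟩)

/-- Common to the last level and the levels below: if the outputs of the machines are exactly the
values of level `m`, then bookkeeping alone extends the invariant by one level. -/
theorem Stage.down {c : Cfg} {μ : ℕ} (ok : c.Ok μ) {val : ℕ → Gain}
    (hval : ∀ z, (val z).norm ≤ c.W) {A : ℕ → ℕ → Prop} {H : Heads} {t : ℕ → BT} {m : ℕ}
    (hs : Stage c val A c.K H t) (hm : m ≤ c.K) (hA : ∀ tag k, A tag k → downKeys c (m + 1) tag k)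
    (hv : ∀ k, m + 1 ≤ k → k ≤ c.K → ∀ z ∈ (t k).labels,
      H (5, k, z) = some (natWord (val z).code))
    (p : ℕ → Prog (List (Key × Word)))
    (hp : ∀ i, (p i).cost H ≤ 36 * c.L + 24 ∧ ((p i).run H).length ≤ 36 * c.L + 24)
    (hrun : ∀ e, (∃ i : Fin c.P, e ∈ (p i).run H) ↔
      ∃ z ∈ (t m).labels, e = ((5, m, z), natWord (val z).code))
    (ρ : Fin c.P → Coins c.S c.B) :
    OnHeads (DownInv c val m) ((copyRound c fun i _ => p i).result H ρ) := by
  have hnone : ∀ z, H (5, m, z) = none := fun z => hs.none_of_not fun h => by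
    have := hA _ _ h
    simp only [downKeys, upKeys] at this
    omega
  obtain ⟨hc', hf', hst⟩ := copyRound_step c ok (fun i _ => p i) H ρ
    hs.fits hs.item_lt (fun i => (hp i).1) (fun i => (hp i).2)
    (by
      intro i e he
      obtain ⟨z, hz, rfl⟩ := (hrun e).1 ⟨i, he⟩
      have h1 := (hs.levels m hm).le_Z z hz
      have h2 := ok.Z_le
      have h3 := ok.tag_le
      have h4 := ok.K_le
      have h5 := ok.W_le
      have h6 := Gain.code_le (hval z)
      have h7 : (2 * c.W + 2) ^ 2 ≤ (((2 * c.W + 2) ^ 2) ^ 2) ^ 2 := by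
        refine (Nat.le_self_pow two_ne_zero _).trans (Nat.le_self_pow two_ne_zero _)
      exact ⟨⟨by simp only; omega, by simp only; omega, by simp only; omega,
        natWord_fits (by omega)⟩, hnone z⟩)
    (by
      intro i i' κ w w' h h'
      obtain ⟨z, -, e⟩ := (hrun _).1 ⟨i, h⟩
      obtain ⟨z', -, e'⟩ := (hrun _).1 ⟨i', h'⟩
      simp only [Prod.mk.injEq] at e e'
      obtain ⟨rfl, rfl⟩ := e
      obtain ⟨e1, rfl⟩ := e'
      simp only [Prod.mk.injEq, true_and] at e1
      rw [e1])
  have hkey : ∀ {tag k' z w}, (∃ i : Fin c.P, ((tag, k', z), w) ∈ (p i).run H) →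
      tag = 5 ∧ k' = m := fun h => by
    obtain ⟨z, -, e⟩ := (hrun _).1 h
    simp only [Prod.mk.injEq] at e
    exact ⟨e.1.1, e.1.2.1⟩
  refine ⟨hc', t, hs.step hst hf' le_rfl ?_ ?_ ?_, ?_⟩
  · intro tag k' z w h
    have := hkey h
    simp only [upKeys, downKeys]
    omega
  · intro tag k' _ h
    have := hA _ _ h
    simp only [downKeys, upKeys] at this ⊢
    omega
  · intro k' j w h
    have := hkey h
    omega
  · intro k h1 h2 z hz
    rcases Nat.lt_or_ge m k with h | h
    · obtain ⟨j, hj⟩ := (hs.levels k h2).cover z hz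
      rw [hst.eq_of_kept ⟨h2, Or.inr ⟨by simp, j, _, hj, by simp⟩⟩]
      · exact hv k h h2 z hz
      · intro w h'
        have := (hkey h').2
        omega
    · obtain rfl : k = m := by omega
      rw [hst.of_new (Or.inr (hnone z)), hrun]
      exact ⟨z, hz, rfl⟩

/-- Machine `0` computes the values of the last level. -/
noncomputable def topProg (c : Cfg) (i : ℕ) : Prog (List (Key × Word)) :=
  if i = 0 then visit c.K (c.P * c.s) (valueOut c.K) c.root else .ret []

/-- There are no marks on the last level, so the part below the root is the whole tree, and it has
at most `N K ≤ L` nodes. -/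
theorem top_triple (c : Cfg) {μ : ℕ} (ok : c.Ok μ) (val : ℕ → Gain)
    (hval : ∀ z, (val z).norm ≤ c.W) :
    Triple (OnHeads (UpInv c val c.K)) (copyRound c fun i _ => topProg c i)
      (OnHeads (DownInv c val c.K)) 0 := by
  refine Triple.of_forall fun M ⟨hcons, t, hs⟩ ρ => ?_
  set H := pick M with hH
  have hl := hs.levels c.K le_rfl
  have hM : ∀ z, ¬ Marked H c.K z := fun z => by
    unfold Marked
    rw [hs.none_of_not (by simp only [upKeys]; omega)]
    simp
  obtain ⟨P, Q, l, r, ht⟩ : ∃ P Q l r, t c.K = .node c.root P Q l r := by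
    have := hl.top
    cases e : t c.K with
    | nil => simp [e, BT.top] at this
    | node z P Q l r =>
      rw [e] at this
      cases this
      exact ⟨P, Q, l, r, rfl⟩
  have hlen := hl.length_le.trans ok.N_last
  rw [ht, BT.labels, List.length_cons, List.length_append] at hlen
  have hsl := BT.size_cut_le (Marked H c.K) (fun z => H (5, c.K + 1, z)) l
  have hsr := BT.size_cut_le (Marked H c.K) (fun z => H (5, c.K + 1, z)) r
  have hsub : BT.Sub (.node c.root P Q l r) (t c.K) := by
    rw [ht]
    exact BT.Sub.refl _
  obtain ⟨h1, h2⟩ := visit_spec (L := c.L) hl.stores hsub (hl.length_le.trans (ok.N_le _))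
    (valueOut c.K) (by omega) (by omega)
  refine hs.down ok hval le_rfl (fun tag k h => Or.inl h) (fun k h1 h2 => by omega) _ ?_ ?_ ρ
  · intro i
    unfold topProg
    split_ifs
    · rw [h1, length_valueOut]
      omega
    · simp
  · intro e
    have key := mem_valueOut_cut (Y := Marked H c.K) (d := fun z => H (5, c.K + 1, z)) (k := c.K)
      (hl.valued.mono hsub) (fun y _ hy => absurd hy (hM y)) e
    rw [← h1] at key
    have hall : ∀ (s : BT) (y : ℕ), y ∈ (s.cut (Marked H c.K)
        (fun z => H (5, c.K + 1, z))).values.map Prod.fst ↔ y ∈ s.labels := by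
      intro s
      induction s with
      | nil => simp [BT.cut, CutTree.values, BT.labels]
      | node z P Q l r ihl ihr =>
        intro y
        simp only [BT.cut, hM, if_false, CutTree.values, List.map_cons, List.map_append,
          List.mem_cons, List.mem_append, ihl, ihr, BT.labels]
    simp only [hall] at key
    rw [ht]
    simp only [BT.labels, List.mem_cons, List.mem_append, ← key]
    constructor
    · rintro ⟨i, hi⟩
      unfold topProg at hi
      split_ifs at hi with h
      · exact hi
      · simp at hi
    · intro h
      exact ⟨⟨0, ok.P_pos⟩, by simpa [topProg] using h⟩

/-- The root is marked, so each node of level `k` is marked or lies in a part hanging from a marked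
node. The machine that owns this marked node computes the values, with the holes filled from level
`k + 1`. -/
theorem down_triple (c : Cfg) {μ : ℕ} (ok : c.Ok μ) (val : ℕ → Gain)
    (hval : ∀ z, (val z).norm ≤ c.W) (k : ℕ) (hk : k < c.K) :
    Triple (OnHeads (DownInv c val (k + 1))) (copyRound c fun i _ => visitItems c k i (valueOut k))
      (OnHeads (DownInv c val k)) 0 := by
  refine Triple.of_forall fun M ⟨hcons, t, hs, hv⟩ ρ => ?_
  set H := pick M with hH
  have hl := hs.levels k hk.le
  have hg := hs.marks k hk
  have hl' := hs.levels (k + 1) hk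
  have hlab : ∀ z, z ∈ (t (k + 1)).labels ↔ Marked H k z := fun z => by
    rw [hs.links k hk, BT.mem_labels_contract hg.clean]
    exact ⟨fun h => h.2, fun h => ⟨hg.mem z h, h⟩⟩
  have hd : ∀ z, Marked H k z → H (5, k + 1, z) = some (natWord (val z).code) := fun z hz =>
    hv (k + 1) le_rfl hk z ((hlab z).2 hz)
  have hvisit : ∀ {z P Q l r}, BT.Sub (.node z P Q l r) (t k) →
      (visit k (c.P * c.s) (valueOut k) z).cost H ≤ 12 * c.L + 7 ∧
      ((visit k (c.P * c.s) (valueOut k) z).run H).length ≤ 2 * c.L + 1 ∧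
      ∀ e, e ∈ (visit k (c.P * c.s) (valueOut k) z).run H ↔ ∃ y, (y = z ∨
        y ∈ (l.cut (Marked H k) (fun z => H (5, k + 1, z))).values.map Prod.fst ∨
        y ∈ (r.cut (Marked H k) (fun z => H (5, k + 1, z))).values.map Prod.fst) ∧
        e = ((5, k, y), natWord (val y).code) := by
    intro z P Q l r hz
    obtain ⟨h1, h2⟩ := BT.root_notMem hl.nodup hl.top hz
    have h5 := hg.size (fun z => H (5, k + 1, z)) _ ((BT.sub_left ..).trans hz) h1
    have h6 := hg.size (fun z => H (5, k + 1, z)) _ ((BT.sub_right ..).trans hz) h2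
    obtain ⟨h3, h4⟩ := visit_spec (L := c.L) hl.stores hz (hl.length_le.trans (ok.N_le k))
      (valueOut k) h5 h6
    rw [h3, length_valueOut]
    exact ⟨h4, by omega, mem_valueOut_cut (hl.valued.mono hz) fun y _ hy => hd y hy⟩
  have hitem : ∀ j w, H (6, k + 1, j) = some w → ∃ z P Q l r, w = natWord z ∧
      BT.Sub (.node z P Q l r) (t k) := by
    intro j w hw
    obtain ⟨-, z, hz, rfl⟩ := hl'.item j w hw
    obtain ⟨P, Q, l, r, h⟩ := BT.mem_labels.1 (hg.mem z ((hlab z).1 hz))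
    exact ⟨z, P, Q, l, r, rfl, h⟩
  refine hs.down ok hval hk.le (fun _ _ h => h) hv _ (fun i => ?_) ?_ ρ
  · obtain ⟨h1, h2⟩ := visitItems_bounds c H k i (2 * c.L + 1) (valueOut k) fun j w hw => by
      obtain ⟨z, P, Q, l, r, rfl, h⟩ := hitem j w hw
      rw [wordNat_natWord]
      exact ⟨(hvisit h).1, (hvisit h).2.1⟩
    exact ⟨h1, h2.trans (by omega)⟩
  · intro e
    simp only [mem_run_visitItems]
    constructor
    · rintro ⟨i, j, -, w, hw, he⟩
      obtain ⟨z, P, Q, l, r, rfl, h⟩ := hitem _ _ hw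
      rw [wordNat_natWord, (hvisit h).2.2] at he
      obtain ⟨y, hy, rfl⟩ := he
      refine ⟨y, ?_, rfl⟩
      have hsl := (BT.sub_left ..).trans h
      have hsr := (BT.sub_right ..).trans h
      rcases hy with rfl | hy | hy
      · exact BT.mem_labels.2 ⟨_, _, _, _, h⟩
      · obtain ⟨x, hx, rfl⟩ := List.mem_map.1 hy
        exact hsl.labels_subset (BT.mem_values_cut (hl.valued.mono hsl) (fun y _ => hd y) hx).1
      · obtain ⟨x, hx, rfl⟩ := List.mem_map.1 hy
        exact hsr.labels_subset (BT.mem_values_cut (hl.valued.mono hsr) (fun y _ => hd y) hx).1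
    · rintro ⟨y, hy, rfl⟩
      obtain ⟨z, hz, P, Q, l, r, h, hyz⟩ : ∃ z, Marked H k z ∧ ∃ P Q l r,
          BT.Sub (.node z P Q l r) (t k) ∧ (y = z ∨
          y ∈ (l.cut (Marked H k) (fun z => H (5, k + 1, z))).values.map Prod.fst ∨
          y ∈ (r.cut (Marked H k) (fun z => H (5, k + 1, z))).values.map Prod.fst) := by
        rcases BT.exists_mem_values (Y := Marked H k) (fun z => H (5, k + 1, z)) hy with
          h | h | ⟨z, P, Q, l, r, h, hz, h'⟩
        -- The part above all marks is empty because the root itself is marked.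
        · have htop := hl.top
          cases e : t k with
          | nil => simp [e, BT.top] at htop
          | node z P Q l r =>
            rw [e] at h htop
            cases htop
            simp [BT.cut, hg.root, CutTree.values] at h
        · obtain ⟨P, Q, l, r, h'⟩ := BT.mem_labels.1 hy
          exact ⟨y, h, P, Q, l, r, h', Or.inl rfl⟩
        · exact ⟨z, hz, P, Q, l, r, h, Or.inr h'⟩
      obtain ⟨j, hj⟩ := hl'.cover z ((hlab z).2 hz)
      have hlt := (hl'.item j _ hj).1.trans_le (ok.N_block k)
      refine ⟨⟨j / 3, by omega⟩, j % 3, Nat.mod_lt _ (by omega), natWord z, ?_, ?_⟩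
      · rw [show 3 * (j / 3) + j % 3 = j by omega]
        exact hj
      · rw [wordNat_natWord, (hvisit h).2.2]
        exact ⟨y, hyz, rfl⟩

/-! ### The contraction algorithm -/

/-- The three rounds that contract the tree of level `k`. -/
noncomputable def upRounds (c : Cfg) (k : ℕ) : List (Round c.P c.S c.B) :=
  [copyRound c fun i ρ => sampleProg c k i (coin ρ 0), copyRound c fun i _ => markProg c k i,
    copyRound c fun i _ => visitItems c k i (contractOut k)]

/-- Sampling is the only round of the three that can fail. -/
theorem upRounds_chain (c : Cfg) {μ : ℕ} (ok : c.Ok μ) (val : ℕ → Gain) (m : ℕ) (hm : m ≤ c.K) :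
    Chain ((List.range m).flatMap (upRounds c)) (OnHeads (UpInv c val 0))
      (OnHeads (UpInv c val m)) (m * (3 * (c.P * c.s) * (1 / 2 ^ μ))) := by
  induction m with
  | zero => exact ⟨fun _ h => h, by simp⟩
  | succ m ih =>
    rw [List.range_succ, List.flatMap_append]
    have h1 := Chain.single (sample_triple c ok val m (by omega)) (by positivity)
      fun _ h => h.1
    have h2 := Chain.single (mark_triple c ok val m hm) le_rfl fun _ h => h.1
    have h3 := Chain.single (contract_triple c ok val m hm) le_rfl fun _ h => h.1
    have h4 := (ih (by omega)).append (h1.append (h2.append h3))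
    refine Chain.weaken (rs := (List.range m).flatMap (upRounds c) ++ [m].flatMap (upRounds c))
      h4 (fun _ h => h) ?_
    push_cast
    linarith

/-- The rounds that compute the values of the nodes of all levels, from the last level down. -/
noncomputable def downRounds (c : Cfg) : ℕ → List (Round c.P c.S c.B)
  | 0 => []
  | k + 1 => (copyRound c fun i _ => visitItems c k i (valueOut k)) :: downRounds c k

theorem downRounds_chain (c : Cfg) {μ : ℕ} (ok : c.Ok μ) (val : ℕ → Gain)
    (hval : ∀ z, (val z).norm ≤ c.W) (m : ℕ) (hm : m ≤ c.K) :
    Chain (downRounds c m) (OnHeads (DownInv c val m)) (OnHeads (DownInv c val 0)) 0 := by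
  induction m with
  | zero => exact ⟨fun _ h => h, le_rfl⟩
  | succ m ih =>
    have := (Chain.single (down_triple c ok val hval m hm) le_rfl fun _ h => h.1).append
      (ih (by omega))
    simpa [downRounds] using this

/-- All rounds that compute the values of the nodes of a tree. -/
noncomputable def treeRounds (c : Cfg) : List (Round c.P c.S c.B) :=
  (List.range c.K).flatMap (upRounds c) ++
    ((copyRound c fun i _ => topProg c i) :: downRounds c c.K)

theorem length_treeRounds (c : Cfg) : (treeRounds c).length = 4 * c.K + 1 := by
  have h1 : ∀ m, ((List.range m).flatMap (upRounds c)).length = 3 * m := by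
    intro m
    induction m with
    | zero => rfl
    | succ m ih =>
      rw [List.range_succ, List.flatMap_append, List.length_append, ih]
      simp [upRounds]
      omega
  have h2 : ∀ m, (downRounds c m).length = m := by
    intro m
    induction m with
    | zero => rfl
    | succ m ih => simp [downRounds, ih]
  rw [treeRounds, List.length_append, h1, List.length_cons, h2]
  omega

theorem treeRounds_chain (c : Cfg) {μ : ℕ} (ok : c.Ok μ) (val : ℕ → Gain)
    (hval : ∀ z, (val z).norm ≤ c.W) :
    Chain (treeRounds c) (OnHeads (UpInv c val 0)) (OnHeads (DownInv c val 0))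
      (c.K * (3 * (c.P * c.s) * (1 / 2 ^ μ))) := by
  have h1 := Chain.single (top_triple c ok val hval) le_rfl fun _ h => h.1
  have h2 := (upRounds_chain c ok val c.K le_rfl).append
    (h1.append (downRounds_chain c ok val hval c.K le_rfl))
  simpa [treeRounds] using h2

/-! ### Trees from pointers -/

/-- A finite binary tree on a set of cells, given by pointers: `Link b z y` means that `y` is the
left (`b = 0`) or right (`b = 1`) child of `z`. -/
structure Links where
  (IsCell : ℕ → Prop)
  (Link : ℕ → ℕ → ℕ → Prop)
  (root R : ℕ)
  depth : ℕ → ℕ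
  F : ℕ → Mat × Mat
  root_cell : IsCell root
  depth_le : ∀ z, IsCell z → depth z ≤ R
  lt_two : ∀ b z y, Link b z y → b < 2
  depth_lt : ∀ b z y, Link b z y → depth z < depth y
  link_cell : ∀ b z y, Link b z y → IsCell z ∧ IsCell y
  child_unique : ∀ b z y y', Link b z y → Link b z y' → y = y'
  parent_unique : ∀ b b' z z' y, Link b z y → Link b' z' y → b = b' ∧ z = z'
  parent_exists : ∀ y, IsCell y → y = root ∨ ∃ b z, Link b z y

namespace Links

variable (G : Links)

open scoped Classical in
/-- The child of a cell. -/
noncomputable def child (b z : ℕ) : Option ℕ :=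
  if h : ∃ y, G.Link b z y then some h.choose else none

theorem child_eq_some {b z y : ℕ} : G.child b z = some y ↔ G.Link b z y := by
  unfold child
  split_ifs with h
  · constructor
    · intro e
      cases e
      exact h.choose_spec
    · intro h'
      rw [G.child_unique _ _ _ _ h.choose_spec h']
  · simp only [false_iff]
    exact fun h' => h ⟨y, h'⟩

/-- The tree below an optional cell, up to a given depth. -/
noncomputable def build : ℕ → Option ℕ → BT
  | 0, _ => .nil
  | _ + 1, none => .nil
  | d + 1, some z => .node z (G.F z).1 (G.F z).2 (build d (G.child 0 z)) (build d (G.child 1 z))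

/-- The relation of being a child. -/
def Child (z y : ℕ) : Prop := ∃ b, G.Link b z y

theorem child_of_child {b z y : ℕ} (h : G.child b z = some y) : G.Child z y :=
  ⟨b, G.child_eq_some.1 h⟩

theorem reach_of_mem_labels {d : ℕ} {o : Option ℕ} {z : ℕ} (h : z ∈ (G.build d o).labels) :
    ∃ x, o = some x ∧ Relation.ReflTransGen G.Child x z := by
  induction d generalizing o with
  | zero => simp [build, BT.labels] at h
  | succ d ih =>
    cases o with
    | none => simp [build, BT.labels] at h
    | some x =>
      refine ⟨x, rfl, ?_⟩
      simp only [build, BT.labels, List.mem_cons, List.mem_append] at h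
      rcases h with rfl | h | h
      · exact .refl
      · obtain ⟨y, hy, h⟩ := ih h
        exact .head (G.child_of_child hy) h
      · obtain ⟨y, hy, h⟩ := ih h
        exact .head (G.child_of_child hy) h

theorem depth_le_of_reach {x z : ℕ} (h : Relation.ReflTransGen G.Child x z) :
    G.depth x ≤ G.depth z := by
  induction h with
  | refl => exact le_rfl
  | tail _ h ih =>
    obtain ⟨b, h⟩ := h
    exact ih.trans (G.depth_lt _ _ _ h).le

theorem mem_labels_of_reach {x z : ℕ} (h : Relation.ReflTransGen G.Child x z) (hz : G.IsCell z) {d : ℕ}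
    (hd : G.R < G.depth x + d) : z ∈ (G.build d (some x)).labels := by
  induction h using Relation.ReflTransGen.head_induction_on generalizing d with
  | refl =>
    have := G.depth_le z hz
    obtain ⟨d, rfl⟩ : ∃ d', d = d' + 1 := ⟨d - 1, by omega⟩
    simp [build, BT.labels]
  | @head x y h h' ih =>
    obtain ⟨b, h⟩ := h
    have h1 := G.depth_lt _ _ _ h
    have h2 := G.depth_le_of_reach h'
    have h3 := G.depth_le z hz
    obtain ⟨d, rfl⟩ : ∃ d', d = d' + 1 := ⟨d - 1, by omega⟩
    have h4 := ih (d := d) (by omega)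
    have h5 := G.lt_two _ _ _ h
    have h6 := G.child_eq_some.2 h
    simp only [build, BT.labels, List.mem_cons, List.mem_append]
    interval_cases b
    · rw [h6]
      exact Or.inr (Or.inl h4)
    · rw [h6]
      exact Or.inr (Or.inr h4)

/-- Parents are unique, so the ancestors of a node form a chain. If two child subtrees of `x` shared
a node, one child would lie above the other, hence, unless they are equal, above `x`, against the
strict growth of `depth`. Equal children would have the same side. -/
theorem nodup_build (d : ℕ) (o : Option ℕ) : (G.build d o).labels.Nodup := by
  induction d generalizing o with
  | zero => simp [build, BT.labels]
  | succ d ih =>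
    cases o with
    | none => simp [build, BT.labels]
    | some x =>
      have hx : ∀ b, x ∉ (G.build d (G.child b x)).labels := by
        intro b h
        obtain ⟨y, hy, h⟩ := G.reach_of_mem_labels h
        have h1 := G.depth_lt _ _ _ (G.child_eq_some.1 hy)
        have h2 := G.depth_le_of_reach h
        omega
      simp only [build, BT.labels, List.nodup_cons, List.mem_append, not_or, List.nodup_append']
      refine ⟨⟨hx 0, hx 1⟩, ih _, ih _, fun w hl hr => ?_⟩
      obtain ⟨y, hy, h⟩ := G.reach_of_mem_labels hl
      obtain ⟨y', hy', h'⟩ := G.reach_of_mem_labels hr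
      have hy := G.child_eq_some.1 hy
      have hy' := G.child_eq_some.1 hy'
      have huniq : Relator.RightUnique (Function.swap G.Child) := by
        rintro a b c ⟨_, hb⟩ ⟨_, hc⟩
        exact (G.parent_unique _ _ _ _ _ hb hc).2
      have key : ∀ {u v b b'}, G.Link b x u → G.Link b' x v →
          Relation.ReflTransGen G.Child v u → v = u := by
        intro u v b b' hu hv h
        rcases h.cases_tail with h | ⟨p, hp, ⟨b'', hpu⟩⟩
        · exact h.symm
        · obtain ⟨-, rfl⟩ := G.parent_unique _ _ _ _ _ hpu hu
          have h1 := G.depth_lt _ _ _ hv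
          have h2 := G.depth_le_of_reach hp
          omega
      have hyy : y = y' := by
        rcases Relation.ReflTransGen.total_of_right_unique huniq
          (Relation.reflTransGen_swap.2 h) (Relation.reflTransGen_swap.2 h') with h | h
        · exact (key hy hy' (Relation.reflTransGen_swap.1 h)).symm
        · exact key hy' hy (Relation.reflTransGen_swap.1 h)
      subst hyy
      have := (G.parent_unique _ _ _ _ _ hy hy').1
      omega

/-- Depth increases along links and is at most `R`, so the fuel cannot run out at a cell. -/
theorem top_build {d : ℕ} {o : Option ℕ}
    (h : ∀ z, o = some z → G.IsCell z ∧ G.R < G.depth z + d) : (G.build d o).top = o := by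
  cases o with
  | none => cases d <;> rfl
  | some z =>
    obtain ⟨h1, h2⟩ := h z rfl
    have := G.depth_le z h1
    obtain ⟨d, rfl⟩ : ∃ d', d = d' + 1 := ⟨d - 1, by omega⟩
    rfl

theorem sub_build {d x z : ℕ} {P Q : Mat} {l r : BT} (hx : G.IsCell x)
    (hd : G.R < G.depth x + d) (h : BT.Sub (.node z P Q l r) (G.build d (some x))) :
    P = (G.F z).1 ∧ Q = (G.F z).2 ∧ l.top = G.child 0 z ∧ r.top = G.child 1 z := by
  induction d generalizing x with
  | zero => simp [build, BT.Sub] at h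
  | succ d ih =>
    have hc : ∀ b y, G.child b x = some y → G.IsCell y ∧ G.R < G.depth y + d := by
      intro b y hy
      have h1 := G.child_eq_some.1 hy
      have h2 := G.depth_lt _ _ _ h1
      exact ⟨(G.link_cell _ _ _ h1).2, by omega⟩
    have hsub : ∀ b, BT.Sub (.node z P Q l r) (G.build d (G.child b x)) →
        P = (G.F z).1 ∧ Q = (G.F z).2 ∧ l.top = G.child 0 z ∧ r.top = G.child 1 z := by
      intro b h
      cases e : G.child b x with
      | none =>
        rw [e] at h
        cases d <;> simp [build, BT.Sub] at h
      | some y =>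
        rw [e] at h
        exact ih (hc b y e).1 (hc b y e).2 h
    rcases h with h | h | h
    · injection h with e1 e2 e3 e4 e5
      subst e1 e2 e3 e4 e5
      exact ⟨rfl, rfl, G.top_build (hc 0), G.top_build (hc 1)⟩
    · exact hsub 0 h
    · exact hsub 1 h

/-- The tree of all cells. -/
noncomputable def tree : BT := G.build (G.R + 1) (some G.root)

theorem top_tree : G.tree.top = some G.root := rfl

theorem nodup_tree : G.tree.labels.Nodup := G.nodup_build _ _

theorem reach_root {z : ℕ} (hz : G.IsCell z) : Relation.ReflTransGen G.Child G.root z := by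
  induction hd : G.depth z using Nat.strong_induction_on generalizing z with
  | _ d ih =>
    rcases G.parent_exists z hz with rfl | ⟨b, y, h⟩
    · exact .refl
    · exact .tail (ih _ (hd ▸ G.depth_lt _ _ _ h) (G.link_cell _ _ _ h).1 rfl) ⟨b, h⟩

theorem mem_labels_tree {z : ℕ} : z ∈ G.tree.labels ↔ G.IsCell z := by
  constructor
  · intro h
    obtain ⟨x, e, h⟩ := G.reach_of_mem_labels h
    cases e
    rcases h.cases_tail with rfl | ⟨y, -, ⟨b, h⟩⟩
    · exact G.root_cell
    · exact (G.link_cell _ _ _ h).2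
  · intro hz
    exact G.mem_labels_of_reach (G.reach_root hz) hz (by omega)

theorem sub_tree {z : ℕ} {P Q : Mat} {l r : BT} (h : BT.Sub (.node z P Q l r) G.tree) :
    P = (G.F z).1 ∧ Q = (G.F z).2 ∧ l.top = G.child 0 z ∧ r.top = G.child 1 z :=
  G.sub_build G.root_cell (by omega) h

theorem treeFact_tree {k : ℕ} {e : Key × Word} : TreeFact G.tree k e ↔
    (∃ z, G.IsCell z ∧ e = ((3, k, z), natWord (pairCode (G.F z)))) ∨
    ∃ b z y, G.Link b z y ∧ (e = ((b, k, z), natWord y) ∨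
      e = ((2, k, y), natWord (3 * z + 1 + b))) := by
  rw [treeFact_iff]
  refine or_congr ?_ ?_
  · constructor
    · rintro ⟨z, P, Q, l, r, h, rfl⟩
      obtain ⟨rfl, rfl, -, -⟩ := G.sub_tree h
      exact ⟨z, G.mem_labels_tree.1 (BT.mem_labels.2 ⟨_, _, _, _, h⟩), rfl⟩
    · rintro ⟨z, hz, rfl⟩
      obtain ⟨P, Q, l, r, h⟩ := BT.mem_labels.1 (G.mem_labels_tree.2 hz)
      obtain ⟨rfl, rfl, -, -⟩ := G.sub_tree h
      exact ⟨z, _, _, l, r, h, rfl⟩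
  · refine exists_congr fun b => exists_congr fun z => exists_congr fun y => and_congr_left fun _ => ?_
    constructor
    · rintro ⟨P, Q, l, r, h, h'⟩
      obtain ⟨-, -, e1, e2⟩ := G.sub_tree h
      rw [e1, e2, G.child_eq_some, G.child_eq_some] at h'
      rcases h' with ⟨rfl, h'⟩ | ⟨rfl, h'⟩ <;> exact h'
    · intro h'
      obtain ⟨P, Q, l, r, h⟩ := BT.mem_labels.1 (G.mem_labels_tree.2 (G.link_cell _ _ _ h').1)
      obtain ⟨-, -, e1, e2⟩ := G.sub_tree h
      refine ⟨P, Q, l, r, h, ?_⟩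
      rw [e1, e2, G.child_eq_some, G.child_eq_some]
      have := G.lt_two _ _ _ h'
      interval_cases b
      · exact Or.inl ⟨rfl, h'⟩
      · exact Or.inr ⟨rfl, h'⟩

end Links

/-! ### Values of subtrees and their size. -/

namespace BT

/-- The value of a tree. -/
noncomputable def eval : BT → Gain
  | nil => 1
  | node _ P Q l r => P.act l.eval * Q.act r.eval

open scoped Classical in
/-- The value of the subtree with a given root. -/
noncomputable def valAt (t : BT) (z : ℕ) : Gain :=
  if h : ∃ s, Sub s t ∧ s.top = some z then h.choose.eval else 1

/-- Distinct names make the chosen subtree unique, so the choice in `valAt` is immaterial. -/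
theorem valAt_eq {t : BT} (hn : t.labels.Nodup) {s : BT} (hs : Sub s t) :
    ev t.valAt s.top = s.eval := by
  cases s with
  | nil => rfl
  | node z P Q l r =>
    have h : ∃ s, Sub s t ∧ s.top = some z := ⟨_, hs, rfl⟩
    change t.valAt z = _
    unfold valAt
    rw [dif_pos h]
    obtain ⟨h1, h2⟩ := h.choose_spec
    generalize h.choose = s at h1 h2 ⊢
    cases s with
    | nil => cases h2
    | node z' P' Q' l' r' =>
      cases h2
      obtain ⟨rfl, rfl, rfl, rfl⟩ := h1.node_unique hn hs
      rfl

theorem valued_valAt {t : BT} (hn : t.labels.Nodup) : Valued t.valAt t := by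
  intro z P Q l r h
  rw [valAt_eq hn ((sub_left ..).trans h), valAt_eq hn ((sub_right ..).trans h)]
  exact valAt_eq hn h

/-- Evaluation uses each matrix once and the value of the empty tree has norm 0. -/
theorem norm_eval_le (t : BT) : t.eval.norm ≤ t.weight := by
  induction t with
  | nil => simp [eval, weight]
  | node z P Q l r ihl ihr =>
    have h1 := Gain.norm_mul_le (P.act l.eval) (Q.act r.eval)
    have h2 := Mat.norm_act_le P l.eval
    have h3 := Mat.norm_act_le Q r.eval
    simp only [eval, weight]
    omega

theorem Sub.weight_le {s t : BT} (h : Sub s t) : s.weight ≤ t.weight := by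
  induction t with
  | nil => cases h; exact le_rfl
  | node z P Q l r ihl ihr =>
    rcases h with rfl | h | h
    · exact le_rfl
    · have := ihl h
      simp only [weight]
      omega
    · have := ihr h
      simp only [weight]
      omega

theorem norm_valAt_le (t : BT) (z : ℕ) : (t.valAt z).norm ≤ t.weight := by
  unfold valAt
  split_ifs with h
  · exact (norm_eval_le _).trans h.choose_spec.1.weight_le
  · simp

theorem weight_le {t : BT} {m : ℕ}
    (h : ∀ z P Q l r, Sub (node z P Q l r) t → P.norm ≤ m ∧ Q.norm ≤ m) :
    t.weight ≤ t.labels.length * (2 * m) := by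
  induction t with
  | nil => simp [weight]
  | node z P Q l r ihl ihr =>
    have h1 := ihl fun z P Q l' r' h' => h z P Q l' r' (Or.inr (Or.inl h'))
    have h2 := ihr fun z P Q l' r' h' => h z P Q l' r' (Or.inr (Or.inr h'))
    have h3 := h z P Q l r (Sub.refl _)
    simp only [weight, labels, List.length_cons, List.length_append, add_mul]
    omega

end BT

/-! ### Binary trees for trees of unbounded degree -/

/-- The cells of a node `y` with parent `x`: the cell `(y, 0)` of `y`, and the cells of `x` that
form the path from the leaf for `y` to the root of the search tree for the children of `x`. -/
def pathCell (D y x : ℕ) : ℕ → ℕ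
  | 0 => Nat.pair y 0
  | j + 1 => Nat.pair x ((2 ^ D + y) / 2 ^ j)

/-- Whether a cell on the path is a left or a right child. -/
def pathBit (D y : ℕ) : ℕ → ℕ
  | 0 => 0
  | j + 1 => (2 ^ D + y) / 2 ^ j % 2

/-- The matrices of the cells on the path, for the node matrix `H` and the edge matrix `E`. -/
def pathMat (H E : Mat) : ℕ → Mat × Mat
  | 0 => (1, H)
  | 1 => (E, 1)
  | _ => (1, 1)

/-- A rooted tree whose nodes have codes in `{1, …, 2 ^ D - 1}`. The parent of the root is `0`. Each
node `y` has a node matrix and an edge matrix. -/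
structure Net (D : ℕ) where
  IsNode : ℕ → Prop
  (parent depth : ℕ → ℕ)
  R : ℕ
  (H E : ℕ → Mat)
  pos : ∀ y, IsNode y → 0 < y
  lt : ∀ y, IsNode y → y < 2 ^ D
  parent_node : ∀ y, IsNode y → parent y = 0 ∨ IsNode (parent y)
  depth_lt : ∀ y, IsNode y → depth (parent y) < depth y
  depth_le : ∀ y, IsNode y → depth y ≤ R
  root_exists : ∃ y, IsNode y ∧ parent y = 0

namespace Net

variable {D : ℕ} (N : Net D)

/-- The cells of a node. -/
def cell (y j : ℕ) : ℕ := pathCell D y (N.parent y) j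

theorem cell_zero (y : ℕ) : N.cell y 0 = Nat.pair y 0 := rfl

theorem cell_succ (y j : ℕ) : N.cell y (j + 1) = Nat.pair (N.parent y) ((2 ^ D + y) / 2 ^ j) := rfl

/-- Adding `2 ^ D` puts a leading one before the `D` bits of `y`. The prefixes become heap numbers:
prefixes of different lengths differ, children double the number, and `0` stays free for the cell of
the node itself. -/
theorem prefix_bounds {y : ℕ} (hy : N.IsNode y) {j : ℕ} (hj : j ≤ D) :
    1 ≤ (2 ^ D + y) / 2 ^ j ∧ (2 ^ D + y) / 2 ^ j < 2 ^ (D + 1) ∧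
      (0 < j → (2 ^ D + y) / 2 ^ j < 2 ^ D) := by
  have h1 := N.lt y hy
  have h2 : 2 ^ j ≤ 2 ^ D := Nat.pow_le_pow_right (by omega) hj
  have h3 : 0 < 2 ^ j := by positivity
  refine ⟨(Nat.one_le_div_iff h3).2 (by omega), ?_, fun h => ?_⟩
  · have := Nat.div_le_self (2 ^ D + y) (2 ^ j)
    have : 2 ^ (D + 1) = 2 * 2 ^ D := by ring
    omega
  · rw [Nat.div_lt_iff_lt_mul h3]
    have : 2 ^ 1 ≤ 2 ^ j := Nat.pow_le_pow_right (by omega) h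
    nlinarith

theorem prefix_last {y : ℕ} (hy : N.IsNode y) : (2 ^ D + y) / 2 ^ D = 1 := by
  have h1 := N.lt y hy
  rw [Nat.add_div_left _ (by positivity), Nat.div_eq_of_lt h1]

/-- One step above the trie root the prefix is `0`, so the path ends in the own cell of the parent.
This joins the tries into one tree. -/
theorem prefix_beyond {y : ℕ} (hy : N.IsNode y) : (2 ^ D + y) / 2 ^ (D + 1) = 0 := by
  rw [pow_succ, ← Nat.div_div_eq_div_mul, N.prefix_last hy]

theorem prefix_succ (y j : ℕ) : (2 ^ D + y) / 2 ^ (j + 1) = (2 ^ D + y) / 2 ^ j / 2 := by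
  rw [pow_succ, Nat.div_div_eq_div_mul]

/-- The links between the cells. -/
def Link (b z w : ℕ) : Prop :=
  -- The last link of a path is omitted if the parent is the virtual node `0`, which has no cell of
  -- its own.
  ∃ y j, N.IsNode y ∧ j < D + 2 ∧ (j = D + 1 → N.parent y ≠ 0) ∧
    b = pathBit D y j ∧ z = N.cell y (j + 1) ∧ w = N.cell y j

/-- The cells. -/
def IsCell (z : ℕ) : Prop := ∃ y j, N.IsNode y ∧ j < D + 2 ∧ z = N.cell y j

/-- The matrices of the cells. -/
def cellMat (z : ℕ) : Mat × Mat :=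
  if z.unpair.2 = 0 then (1, N.H z.unpair.1)
  else if 2 ^ D ≤ z.unpair.2 then (N.E (z.unpair.2 - 2 ^ D), 1) else (1, 1)

theorem cellMat_cell {y : ℕ} (hy : N.IsNode y) {j : ℕ} (hj : j < D + 2) :
    N.cellMat (N.cell y j) = pathMat (N.H y) (N.E y) j := by
  rcases j with _ | _ | j
  · simp [cellMat, cell_zero, pathMat]
  · have : 0 < 2 ^ D := by positivity
    simp [cellMat, cell_succ, pathMat]
  · obtain ⟨h1, -, h2⟩ := N.prefix_bounds hy (j := j + 1) (by omega)
    have h2 := h2 (by omega)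
    simp only [cellMat, cell_succ, pathMat, Nat.unpair_pair]
    rw [if_neg (by omega), if_neg (by omega)]

theorem link_iff {b z w : ℕ} : N.Link b z w ↔
    (∃ y, N.IsNode y ∧ b = 0 ∧ z = Nat.pair (N.parent y) (2 ^ D + y) ∧ w = Nat.pair y 0) ∨
    ∃ y j, N.IsNode y ∧ j ≤ D ∧ (j = D → N.parent y ≠ 0) ∧ b = (2 ^ D + y) / 2 ^ j % 2 ∧
      z = Nat.pair (N.parent y) ((2 ^ D + y) / 2 ^ j / 2) ∧
      w = Nat.pair (N.parent y) ((2 ^ D + y) / 2 ^ j) := by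
  constructor
  · rintro ⟨y, j, hy, hj, h, rfl, rfl, rfl⟩
    rcases j with _ | j
    · exact Or.inl ⟨y, hy, rfl, by simp [cell_succ], rfl⟩
    · exact Or.inr ⟨y, j, hy, by omega, fun e => h (by omega), rfl,
        by rw [cell_succ, prefix_succ], rfl⟩
  · rintro (⟨y, hy, rfl, rfl, rfl⟩ | ⟨y, j, hy, hj, h, rfl, rfl, rfl⟩)
    · exact ⟨y, 0, hy, by omega, by omega, rfl, by simp [cell_succ], rfl⟩
    · exact ⟨y, j + 1, hy, by omega, fun e => h (by omega), rfl,
        by rw [cell_succ, prefix_succ], rfl⟩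

theorem isCell_iff {z : ℕ} : N.IsCell z ↔ (∃ y, N.IsNode y ∧ z = Nat.pair y 0) ∨
    ∃ y j, N.IsNode y ∧ j ≤ D ∧ z = Nat.pair (N.parent y) ((2 ^ D + y) / 2 ^ j) := by
  constructor
  · rintro ⟨y, j, hy, hj, rfl⟩
    rcases j with _ | j
    · exact Or.inl ⟨y, hy, rfl⟩
    · exact Or.inr ⟨y, j, hy, by omega, rfl⟩
  · rintro (⟨y, hy, rfl⟩ | ⟨y, j, hy, hj, rfl⟩)
    · exact ⟨y, 0, hy, by omega, rfl⟩
    · exact ⟨y, j + 1, hy, by omega, rfl⟩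

/-- The cells and the links between them. -/
def links : Links where
  IsCell := N.IsCell
  Link := N.Link
  -- The root of the trie for the children of the virtual node `0`.
  root := Nat.pair 0 1
  R := N.R * 2 ^ (D + 1) + 2 ^ (D + 1)
  -- Lexicographic in the depth of the owner and the heap number, which grows downwards in a trie
  -- and is below `2 ^ (D + 1)`.
  depth z := N.depth z.unpair.1 * 2 ^ (D + 1) + z.unpair.2
  F := N.cellMat
  root_cell := by
    obtain ⟨y, hy, h⟩ := N.root_exists
    exact ⟨y, D + 1, hy, by omega, by rw [cell_succ, N.prefix_last hy, h]⟩
  depth_le := by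
    intro z hz
    rcases N.isCell_iff.1 hz with ⟨y, hy, rfl⟩ | ⟨y, j, hy, hj, rfl⟩
    · have := Nat.mul_le_mul_right (2 ^ (D + 1)) (N.depth_le y hy)
      simp only [Nat.unpair_pair]
      exact this.trans (Nat.le_add_right _ _)
    · have h1 := (N.prefix_bounds hy hj).2.1
      have h2 := Nat.mul_le_mul_right (2 ^ (D + 1))
        ((N.depth_lt y hy).le.trans (N.depth_le y hy))
      simp only [Nat.unpair_pair]
      omega
  lt_two := by
    intro b z w h
    rcases N.link_iff.1 h with ⟨y, hy, rfl, -⟩ | ⟨y, j, hy, hj, -, rfl, -⟩ <;> omega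
  depth_lt := by
    intro b z w h
    rcases N.link_iff.1 h with ⟨y, hy, -, rfl, rfl⟩ | ⟨y, j, hy, hj, -, -, rfl, rfl⟩
    · have h1 := Nat.mul_le_mul_right (2 ^ (D + 1)) (N.depth_lt y hy)
      have h2 := N.lt y hy
      have h3 : 2 ^ (D + 1) = 2 * 2 ^ D := by ring
      simp only [Nat.unpair_pair]
      rw [Nat.succ_mul] at h1
      omega
    · have := (N.prefix_bounds hy hj).1
      simp only [Nat.unpair_pair]
      omega
  link_cell := by
    rintro b z w ⟨y, j, hy, hj, h, rfl, rfl, rfl⟩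
    refine ⟨?_, y, j, hy, hj, rfl⟩
    rcases Nat.lt_or_ge j (D + 1) with h' | h'
    · exact ⟨y, j + 1, hy, by omega, rfl⟩
    · obtain rfl : j = D + 1 := by omega
      refine ⟨N.parent y, 0, (N.parent_node y hy).resolve_left (h rfl), by omega, ?_⟩
      rw [cell_succ, N.prefix_beyond hy, cell_zero]
  child_unique := by
    intro b z w w' h h'
    rcases N.link_iff.1 h with ⟨y, hy, rfl, rfl, rfl⟩ | ⟨y, j, hy, hj, -, rfl, rfl, rfl⟩ <;>
    rcases N.link_iff.1 h' with ⟨y', hy', e, e', rfl⟩ | ⟨y', j', hy', hj', -, e, e', rfl⟩ <;>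
    obtain ⟨e1, e2⟩ := Nat.pair_eq_pair.1 e'
    · rw [show y = y' by omega]
    · have := (N.prefix_bounds hy' hj').2.1
      have : 2 ^ (D + 1) = 2 * 2 ^ D := by ring
      omega
    · have := (N.prefix_bounds hy hj).2.1
      have : 2 ^ (D + 1) = 2 * 2 ^ D := by ring
      omega
    · rw [e1]
      congr 1
      omega
  parent_unique := by
    intro b b' z z' w h h'
    rcases N.link_iff.1 h with ⟨y, hy, rfl, rfl, rfl⟩ | ⟨y, j, hy, hj, -, rfl, rfl, rfl⟩ <;>
    rcases N.link_iff.1 h' with ⟨y', hy', rfl, rfl, e⟩ | ⟨y', j', hy', hj', -, rfl, rfl, e⟩ <;>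
    obtain ⟨e1, e2⟩ := Nat.pair_eq_pair.1 e
    · rw [e1]
      exact ⟨rfl, rfl⟩
    · have := (N.prefix_bounds hy' hj').1
      omega
    · have := (N.prefix_bounds hy hj).1
      omega
    · rw [e1, e2]
      exact ⟨rfl, rfl⟩
  parent_exists := by
    rintro w ⟨y, j, hy, hj, rfl⟩
    by_cases h : j = D + 1 → N.parent y ≠ 0
    · exact Or.inr ⟨_, _, y, j, hy, hj, h, rfl, rfl, rfl⟩
    · push Not at h
      obtain ⟨rfl, h⟩ := h
      left
      rw [cell_succ, N.prefix_last hy, h]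

/-- The binary tree on the cells. -/
noncomputable def tree : BT := N.links.tree

/-- The entries that a node `y` with parent `x` contributes to the table. -/
def pathEntries (D y x : ℕ) (H E : Mat) : List (Key × Word) :=
  (List.range (D + 2)).flatMap fun j =>
    ((3, 0, pathCell D y x j), natWord (pairCode (pathMat H E j))) ::
      if j = D + 1 ∧ x = 0 then [] else
        [((pathBit D y j, 0, pathCell D y x (j + 1)), natWord (pathCell D y x j)),
          ((2, 0, pathCell D y x j), natWord (3 * pathCell D y x (j + 1) + 1 + pathBit D y j))]

/-- The description of the whole binary tree is a union of contributions that depend only on one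
node, its parent and its matrices. A machine that has read a single coordinate can write its share;
shared trie cells are written repeatedly with equal values. -/
theorem treeFact_tree {e : Key × Word} : TreeFact N.tree 0 e ↔
    ∃ y, N.IsNode y ∧ e ∈ pathEntries D y (N.parent y) (N.H y) (N.E y) := by
  have hmem : ∀ y, e ∈ pathEntries D y (N.parent y) (N.H y) (N.E y) ↔ ∃ j < D + 2,
      e = ((3, 0, N.cell y j), natWord (pairCode (pathMat (N.H y) (N.E y) j))) ∨
      (j = D + 1 → N.parent y ≠ 0) ∧
        (e = ((pathBit D y j, 0, N.cell y (j + 1)), natWord (N.cell y j)) ∨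
          e = ((2, 0, N.cell y j), natWord (3 * N.cell y (j + 1) + 1 + pathBit D y j))) := by
    intro y
    simp only [pathEntries, List.mem_flatMap, List.mem_range, List.mem_cons]
    refine exists_congr fun j => and_congr_right fun _ => or_congr Iff.rfl ?_
    split_ifs with h
    · simp [h.1, h.2]
    · have h' : j = D + 1 → N.parent y ≠ 0 := fun h1 h2 => h ⟨h1, h2⟩
      rw [and_iff_right h']
      simp [cell]
  rw [tree, N.links.treeFact_tree]
  simp only [hmem]
  constructor
  · rintro (⟨z, ⟨y, j, hy, hj, rfl⟩, h⟩ | ⟨b, z, w, ⟨y, j, hy, hj, h, rfl, rfl, rfl⟩, h'⟩)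
    · refine ⟨y, hy, j, hj, Or.inl ?_⟩
      rw [h]
      change _ = ((3, 0, _), natWord (pairCode _))
      rw [← N.cellMat_cell hy hj]
      rfl
    · exact ⟨y, hy, j, hj, Or.inr ⟨h, h'⟩⟩
  · rintro ⟨y, hy, j, hj, h | ⟨h, h'⟩⟩
    · refine Or.inl ⟨N.cell y j, ⟨y, j, hy, hj, rfl⟩, ?_⟩
      rw [h, ← N.cellMat_cell hy hj]
      rfl
    · exact Or.inr ⟨_, _, _, ⟨y, j, hy, hj, h, rfl, rfl, rfl⟩, h'⟩

theorem mem_labels_tree {z : ℕ} : z ∈ N.tree.labels ↔ N.IsCell z := N.links.mem_labels_tree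

theorem nodup_tree : N.tree.labels.Nodup := N.links.nodup_tree

theorem top_tree : N.tree.top = some (Nat.pair 0 1) := N.links.top_tree

theorem cell_le {z : ℕ} (h : N.IsCell z) : z < (2 ^ (D + 1)) ^ 2 := by
  have h3 : 2 ^ (D + 1) = 2 * 2 ^ D := by ring
  have h0 : 0 < 2 ^ D := by positivity
  rcases N.isCell_iff.1 h with ⟨y, hy, rfl⟩ | ⟨y, j, hy, hj, rfl⟩
  · have := N.lt y hy
    exact pair_add_one_le (by omega) (by omega)
  · have h2 := (N.prefix_bounds hy hj).2.1
    refine pair_add_one_le ?_ (by omega)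
    rcases N.parent_node y hy with h | h
    · omega
    · have := N.lt _ h
      omega

theorem weight_tree_le {m : ℕ} (h : ∀ y, N.IsNode y → (N.H y).norm ≤ m ∧ (N.E y).norm ≤ m) :
    N.tree.weight ≤ (2 ^ (D + 1)) ^ 2 * (2 * m) := by
  have h1 : N.tree.labels.length ≤ (2 ^ (D + 1)) ^ 2 := by
    rw [← List.toFinset_card_of_nodup N.nodup_tree, ← Finset.card_range ((2 ^ (D + 1)) ^ 2)]
    refine Finset.card_le_card fun z hz => ?_
    rw [List.mem_toFinset, mem_labels_tree] at hz
    exact Finset.mem_range.2 (N.cell_le hz)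
  refine (BT.weight_le fun z P Q l r hs => ?_).trans (Nat.mul_le_mul_right _ h1)
  obtain ⟨rfl, rfl, -⟩ := N.links.sub_tree hs
  obtain ⟨y, j, hy, hj, rfl⟩ := N.mem_labels_tree.1 (BT.mem_labels.2 ⟨_, _, _, _, hs⟩)
  have e : N.links.F (N.cell y j) = pathMat (N.H y) (N.E y) j := N.cellMat_cell hy hj
  rw [e]
  obtain ⟨h2, h3⟩ := h y hy
  rcases j with _ | _ | j
  · exact ⟨by simp [pathMat], h2⟩
  · exact ⟨h3, by simp [pathMat]⟩
  · simp [pathMat]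

/-- The value of a cell. -/
noncomputable def val (z : ℕ) : Gain := N.tree.valAt z

theorem valued_val : BT.Valued N.val N.tree := BT.valued_valAt N.nodup_tree

theorem val_cell {z : ℕ} (h : N.IsCell z) : N.val z =
    (N.cellMat z).1.act (BT.ev N.val (N.links.child 0 z)) *
      (N.cellMat z).2.act (BT.ev N.val (N.links.child 1 z)) := by
  obtain ⟨P, Q, l, r, hs⟩ := BT.mem_labels.1 (N.mem_labels_tree.2 h)
  have := N.valued_val z P Q l r hs
  obtain ⟨rfl, rfl, e1, e2⟩ := N.links.sub_tree hs
  rw [e1, e2] at this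
  exact this

open scoped Classical in
/-- The children whose leaf lies below a cell that is `j` levels above the leaves. -/
noncomputable def below (x j h : ℕ) : Finset ℕ :=
  (Finset.range (2 ^ D)).filter fun y => N.IsNode y ∧ N.parent y = x ∧ (2 ^ D + y) / 2 ^ j = h

theorem mem_below {x j h y : ℕ} : y ∈ N.below x j h ↔
    N.IsNode y ∧ N.parent y = x ∧ (2 ^ D + y) / 2 ^ j = h := by
  simp only [below, Finset.mem_filter, Finset.mem_range, and_iff_right_iff_imp]
  exact fun h => N.lt y h.1

theorem below_zero {y : ℕ} (hy : N.IsNode y) :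
    N.below (N.parent y) 0 (2 ^ D + y) = {y} := by
  ext z
  rw [mem_below, Finset.mem_singleton]
  constructor
  · rintro ⟨-, -, h⟩
    simpa using h
  · rintro rfl
    exact ⟨hy, rfl, by simp⟩

theorem below_succ (x j h : ℕ) : N.below x (j + 1) h =
    N.below x j (2 * h) ∪ N.below x j (2 * h + 1) := by
  ext z
  rw [Finset.mem_union, mem_below, mem_below, mem_below, prefix_succ]
  have : (2 ^ D + z) / 2 ^ j / 2 = h ↔ (2 ^ D + z) / 2 ^ j = 2 * h ∨
    (2 ^ D + z) / 2 ^ j = 2 * h + 1 := by omega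
  rw [this]
  tauto

theorem disjoint_below (x j h : ℕ) :
    Disjoint (N.below x j (2 * h)) (N.below x j (2 * h + 1)) := by
  rw [Finset.disjoint_left]
  intro z h1 h2
  rw [mem_below] at h1 h2
  omega

/-- The contribution of a node to its parent. -/
noncomputable def gain (y : ℕ) : Gain := (N.E y).act (N.val (Nat.pair y 0))

theorem child_zero_leaf {y : ℕ} (hy : N.IsNode y) :
    N.links.child 0 (Nat.pair (N.parent y) (2 ^ D + y)) = some (Nat.pair y 0) :=
  N.links.child_eq_some.2 (N.link_iff.2 (Or.inl ⟨y, hy, rfl, rfl, rfl⟩))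

theorem child_one_leaf {y : ℕ} (x : ℕ) :
    N.links.child 1 (Nat.pair x (2 ^ D + y)) = none := by
  rw [Option.eq_none_iff_forall_ne_some]
  intro w h
  rcases N.link_iff.1 (N.links.child_eq_some.1 h) with
    ⟨y', hy, e, -⟩ | ⟨y', j, hy, hj, -, -, e, -⟩
  · omega
  · have := (N.prefix_bounds hy hj).2.1
    have : 2 ^ (D + 1) = 2 * 2 ^ D := by ring
    have := (Nat.pair_eq_pair.1 e).2
    omega

/-- The binary length of a prefix determines how many bits were removed. After halving, the length
is still determined; if a prefix is below 2, both are 1. -/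
theorem level_unique {y y' : ℕ} (hy : N.IsNode y) (hy' : N.IsNode y') {j j' : ℕ} (hj : j ≤ D)
    (hj' : j' ≤ D) (h : (2 ^ D + y) / 2 ^ j / 2 = (2 ^ D + y') / 2 ^ j' / 2) : j = j' := by
  have key : ∀ {y j}, N.IsNode y → j ≤ D → Nat.log 2 ((2 ^ D + y) / 2 ^ j) = D - j := by
    intro y j hy hj
    rw [Nat.log_div_base_pow]
    have h1 := N.lt y hy
    have : Nat.log 2 (2 ^ D + y) = D :=
      (Nat.log_eq_iff (Or.inr ⟨by omega, by positivity⟩)).2 ⟨by omega, by rw [pow_succ]; omega⟩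
    rw [this]
  have h1 := key hy hj
  have h2 := key hy' hj'
  have h3 := (N.prefix_bounds hy hj).1
  have h4 := (N.prefix_bounds hy' hj').1
  have h5 : Nat.log 2 ((2 ^ D + y) / 2 ^ j) = Nat.log 2 ((2 ^ D + y') / 2 ^ j') := by
    have h6 := Nat.log_div_base 2 ((2 ^ D + y) / 2 ^ j)
    have h7 := Nat.log_div_base 2 ((2 ^ D + y') / 2 ^ j')
    rcases Nat.lt_or_ge ((2 ^ D + y) / 2 ^ j) 2 with h8 | h8
    · rw [show (2 ^ D + y) / 2 ^ j = (2 ^ D + y') / 2 ^ j' by omega]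
    · have h9 : 0 < Nat.log 2 ((2 ^ D + y) / 2 ^ j) := Nat.log_pos (by omega) h8
      have h10 : 0 < Nat.log 2 ((2 ^ D + y') / 2 ^ j') := Nat.log_pos (by omega) (by omega)
      rw [h] at h6
      omega
  omega

/-- The children of an inner cell. -/
theorem child_inner {x j h b : ℕ} (hx : j = D → x ≠ 0) (hb : b < 2) (hlt : h < 2 ^ D)
    (hj : j ≤ D) (hl : ∀ y j', N.IsNode y → j' ≤ D → (2 ^ D + y) / 2 ^ j' / 2 = h → j' = j) :
    (N.links.child b (Nat.pair x h) = none ∧ N.below x j (2 * h + b) = ∅) ∨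
    N.links.child b (Nat.pair x h) = some (Nat.pair x (2 * h + b)) ∧
      (N.below x j (2 * h + b)).Nonempty := by
  rcases (N.below x j (2 * h + b)).eq_empty_or_nonempty with he | hne
  · left
    refine ⟨?_, he⟩
    rw [Option.eq_none_iff_forall_ne_some]
    intro w hw
    rcases N.link_iff.1 (N.links.child_eq_some.1 hw) with
      ⟨y', hy, -, e, -⟩ | ⟨y', j', hy, hj', hp, hb', e, -⟩
    · have := (Nat.pair_eq_pair.1 e).2
      omega
    · obtain ⟨e1, e2⟩ := Nat.pair_eq_pair.1 e
      obtain rfl := hl y' j' hy hj' e2.symm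
      have : y' ∈ N.below x j' (2 * h + b) := N.mem_below.2 ⟨hy, e1.symm, by omega⟩
      rw [he] at this
      simp at this
  · right
    refine ⟨N.links.child_eq_some.2 (N.link_iff.2 (Or.inr ?_)), hne⟩
    obtain ⟨y, hy⟩ := hne
    obtain ⟨h1, rfl, h2⟩ := N.mem_below.1 hy
    exact ⟨y, j, h1, hj, hx, by omega, by congr 1; omega, by rw [h2]⟩

/-- Trie cells carry identity matrices except for the edge matrix at a leaf, so a trie multiplies
the contributions of its leaves. Cells without leaves do not exist and count as `1`. -/
theorem val_trie {x j h : ℕ} (hj : j ≤ D) (hne : (N.below x j h).Nonempty) :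
    N.val (Nat.pair x h) = ∏ y ∈ N.below x j h, N.gain y := by
  induction j generalizing h with
  | zero =>
    obtain ⟨y, hy⟩ := hne
    obtain ⟨h1, rfl, rfl⟩ := N.mem_below.1 hy
    rw [pow_zero, Nat.div_one, N.below_zero h1, Finset.prod_singleton]
    have hc : N.IsCell (Nat.pair (N.parent y) (2 ^ D + y)) :=
      N.isCell_iff.2 (Or.inr ⟨y, 0, h1, by omega, by simp⟩)
    have hm := N.cellMat_cell h1 (j := 1) (by omega)
    rw [cell_succ, pow_zero, Nat.div_one] at hm
    rw [N.val_cell hc, hm, N.child_zero_leaf h1, N.child_one_leaf]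
    simp [pathMat, BT.ev, gain]
  | succ j ih =>
    obtain ⟨y, hy⟩ := hne
    obtain ⟨h1, rfl, rfl⟩ := N.mem_below.1 hy
    have hc : N.IsCell (Nat.pair (N.parent y) ((2 ^ D + y) / 2 ^ (j + 1))) :=
      N.isCell_iff.2 (Or.inr ⟨y, j + 1, h1, hj, rfl⟩)
    have hm := N.cellMat_cell h1 (j := j + 2) (by omega)
    rw [cell_succ] at hm
    have hev : ∀ b < 2, BT.ev N.val (N.links.child b
        (Nat.pair (N.parent y) ((2 ^ D + y) / 2 ^ (j + 1)))) =
        ∏ z ∈ N.below (N.parent y) j (2 * ((2 ^ D + y) / 2 ^ (j + 1)) + b), N.gain z := by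
      intro b hb
      rcases N.child_inner (x := N.parent y) (j := j) (h := (2 ^ D + y) / 2 ^ (j + 1)) (b := b)
        (by omega) hb ((N.prefix_bounds h1 hj).2.2 (by omega)) (by omega)
        (fun y' j' hy' hj' e => N.level_unique hy' h1 hj' (by omega)
          (by rw [e, prefix_succ])) with ⟨e, e'⟩ | ⟨e, e'⟩
      · rw [e, e']
        rfl
      · rw [e]
        exact ih (by omega) e'
    rw [N.val_cell hc, hm, hev 0 (by omega), hev 1 (by omega), N.below_succ,
      Finset.prod_union (N.disjoint_below ..)]
    simp [pathMat]

/-- The leading bit is one, so the trie hangs as right child of the cell `(x, 0)`, where the node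
matrix is stored, and the left child is missing. -/
theorem val_node {x : ℕ} (hx : N.IsNode x) : N.val (Nat.pair x 0) =
    (N.H x).act (∏ y ∈ N.below x (D + 1) 0, N.gain y) := by
  have hc : N.IsCell (Nat.pair x 0) := N.isCell_iff.2 (Or.inl ⟨x, hx, rfl⟩)
  have hm := N.cellMat_cell hx (j := 0) (by omega)
  rw [cell_zero] at hm
  have hev : ∀ b < 2, BT.ev N.val (N.links.child b (Nat.pair x 0)) =
      ∏ z ∈ N.below x D (2 * 0 + b), N.gain z := by
    intro b hb
    rcases N.child_inner (x := x) (j := D) (h := 0) (b := b)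
      (fun _ => (N.pos x hx).ne') hb (by positivity) le_rfl
      (fun y' j' hy' hj' e => N.level_unique hy' hx hj' le_rfl
        (by rw [e, N.prefix_last hx])) with ⟨e, e'⟩ | ⟨e, e'⟩
    · rw [e, e']
      rfl
    · rw [e]
      exact N.val_trie le_rfl e'
  rw [N.val_cell hc, hm, hev 0 (by omega), hev 1 (by omega), N.below_succ,
    Finset.prod_union (N.disjoint_below ..)]
  have he : N.below x D 0 = ∅ := by
    ext z
    rw [mem_below]
    simp only [Finset.notMem_empty, iff_false]
    rintro ⟨h1, -, h2⟩
    have := (N.prefix_bounds h1 le_rfl).1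
    omega
  simp [pathMat, he]

theorem mem_children {x y : ℕ} : y ∈ N.below x (D + 1) 0 ↔ N.IsNode y ∧ N.parent y = x := by
  rw [mem_below]
  constructor
  · rintro ⟨h1, h2, -⟩
    exact ⟨h1, h2⟩
  · rintro ⟨h1, h2⟩
    exact ⟨h1, h2, N.prefix_beyond h1⟩

end Net

/-! ### The binary tree of a degree-weighted tree -/

namespace DWTree

variable {n : ℕ} (T : DWTree n)

/-- The code of a node. -/
def code (x : T.Node) : ℕ := Nat.pair x.1 x.2 + 1

theorem code_injective : Function.Injective T.code := by
  rintro ⟨v, i⟩ ⟨w, j⟩ h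
  obtain ⟨h1, h2⟩ := Nat.pair_eq_pair.1 (Nat.succ_injective h)
  obtain rfl := Fin.ext h1
  obtain rfl := Fin.ext h2
  rfl

/-- The code of the parent node, or `0`. -/
def parentCode (x : T.Node) : ℕ :=
  if 0 < x.2.val then Nat.pair x.1 (T.data x).up + 1
  else if x.1 = T.root then 0
  else Nat.pair (T.par x.1) (T.data x).up + 1

theorem isChild_iff {x y : T.Node} : T.IsChild x y ↔ T.parentCode y = T.code x := by
  have key : ∀ (v w : Fin n) (i j : ℕ), Nat.pair v i + 1 = Nat.pair w j + 1 ↔ w = v ∧ j = i := by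
    intro v w i j
    rw [Nat.succ_inj, Nat.pair_eq_pair, Fin.val_inj]
    exact and_congr eq_comm eq_comm
  unfold IsChild parentCode code
  split_ifs with h1 h2
  · rw [key]
    constructor
    · rintro (⟨-, h⟩ | ⟨h, -⟩)
      · exact h
      · omega
    · exact fun h => Or.inl ⟨h1, h⟩
  · constructor
    · rintro (⟨h, -⟩ | ⟨-, h, -⟩)
      · omega
      · exact absurd h2 h
    · intro h
      simp at h
  · rw [key]
    constructor
    · rintro (⟨h, -⟩ | ⟨-, -, h⟩)
      · omega
      · exact h
    · exact fun h => Or.inr ⟨by omega, h2, h⟩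

theorem parentCode_eq (x : T.Node) : T.parentCode x = 0 ∨ ∃ z, T.parentCode x = T.code z := by
  obtain ⟨v, i⟩ := x
  unfold parentCode code
  split_ifs with h1 h2
  · exact Or.inr ⟨⟨v, ⟨_, T.up_inner v i h1⟩⟩, rfl⟩
  · exact Or.inl rfl
  · have h3 : i = ⟨0, T.nonempty v⟩ := Fin.ext (by simpa using h1)
    subst h3
    exact Or.inr ⟨⟨T.par v, ⟨_, T.up_outer v⟩⟩, rfl⟩

/-- Lexicographic order of the rank of the vertex in the outer tree and the rank of the node in its
component; `b` exceeds all inner ranks. -/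
theorem exists_rank : ∃ r : T.Node → ℕ, ∀ x y, T.IsChild x y → r x < r y := by
  obtain ⟨h, hh⟩ := T.acyclic
  choose g hg using T.acyclic_inner
  set b := ∑ z : T.Node, g z.1 z.2.val + 1 with hb
  have hlt : ∀ z : T.Node, g z.1 z.2.val < b := fun z =>
    Nat.lt_succ_of_le (Finset.single_le_sum (f := fun z : T.Node => g z.1 z.2.val)
      (fun _ _ => Nat.zero_le _) (Finset.mem_univ z))
  refine ⟨fun z => h z.1 * b + g z.1 z.2.val, ?_⟩
  rintro ⟨v, i⟩ ⟨w, j⟩ (⟨h1, h2, h3⟩ | ⟨h1, h2, h3, h4⟩)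
  · simp only at h1 h2 h3 ⊢
    subst h2
    have := hg v j h1
    rw [h3]
    exact Nat.add_lt_add_left this _
  · simp only at h1 h2 h3 h4 ⊢
    have h5 := hh w h2
    rw [← h3] at h5
    have h6 := Nat.mul_le_mul_right b h5
    rw [Nat.succ_mul] at h6
    have := hlt ⟨v, i⟩
    simp only at this
    omega

end DWTree

/-! ### The matching recursion in matrix form. -/

/-- The matrix that takes the sums over the children of a node to the values of the node. -/
def Coord.nodeMat (d : Coord) : Mat :=
  ⟨max (d.b : Word) ((d.b : Word) + (d.a : Word)), d.b, d.b, ⊥⟩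

/-- The matrix that takes the values of a node to its contributions to its parent. -/
def Coord.edgeMat (d : Coord) : Mat := ⟨d.ω 3, d.ω 2, d.ω 1, d.ω 0⟩

namespace DWTree

variable {n : ℕ} (T : DWTree n)

theorem norm_mats {M : ℕ} (hM : T.WeightLE M) (x : T.Node) :
    (T.data x).nodeMat.norm ≤ 2 * M ∧ (T.data x).edgeMat.norm ≤ 2 * M := by
  obtain ⟨h1, h2, h3⟩ := hM x.1 (T.data x) (List.get_mem _ _)
  have h1 := abs_le.1 h1
  have h2 := abs_le.1 h2
  have ha : wordNorm ((T.data x).a : Word) ≤ M := by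
    rw [wordNorm_coe]
    omega
  have hb : wordNorm ((T.data x).b : Word) ≤ M := by
    rw [wordNorm_coe]
    omega
  have hω := fun q => (h3 q).wordNorm_le
  have hab := wordNorm_add_le ((T.data x).b : Word) ((T.data x).a : Word)
  have hm := wordNorm_max_le ((T.data x).b : Word)
    (((T.data x).b : Word) + ((T.data x).a : Word))
  refine ⟨Mat.norm_le.2 ⟨⟨?_, ?_⟩, ?_, ?_⟩, Mat.norm_le.2 ⟨⟨?_, ?_⟩, ?_, ?_⟩⟩
  · exact hm.trans (by omega)
  · exact hb.trans (by omega)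
  · exact hb.trans (by omega)
  · simp [Coord.nodeMat]
  · exact (hω 3).trans (by omega)
  · exact (hω 2).trans (by omega)
  · exact (hω 1).trans (by omega)
  · exact (hω 0).trans (by omega)

/-- The node with a given code. -/
noncomputable def nodeAt : ℕ → Option T.Node := Function.partialInv T.code

@[simp] theorem nodeAt_code (x : T.Node) : T.nodeAt (T.code x) = some x :=
  Function.partialInv_left T.code_injective x

/-- The tree of all nodes. -/
noncomputable def net (D : ℕ) (hD : ∀ x, T.code x < 2 ^ D) : Net D where
  IsNode y := ∃ x, T.code x = y
  parent y := (T.nodeAt y).elim 0 T.parentCode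
  depth y := (T.nodeAt y).elim 0 fun x => T.exists_rank.choose x + 1
  R := ∑ x, (T.exists_rank.choose x + 1)
  H y := (T.nodeAt y).elim 1 fun x => (T.data x).nodeMat
  E y := (T.nodeAt y).elim 1 fun x => (T.data x).edgeMat
  pos := by
    rintro y ⟨x, rfl⟩
    exact Nat.succ_pos _
  lt := by
    rintro y ⟨x, rfl⟩
    exact hD x
  parent_node := by
    rintro y ⟨x, rfl⟩
    rw [nodeAt_code]
    rcases T.parentCode_eq x with h | ⟨z, h⟩
    · exact Or.inl h
    · exact Or.inr ⟨z, h.symm⟩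
  depth_lt := by
    rintro y ⟨x, rfl⟩
    rw [nodeAt_code]
    simp only [Option.elim_some]
    rcases T.parentCode_eq x with h | ⟨z, h⟩
    · have : T.nodeAt 0 = none := by
        unfold nodeAt Function.partialInv
        rw [dif_neg]
        rintro ⟨a, ha⟩
        exact Nat.succ_ne_zero _ ha
      rw [h, this]
      simp
    · rw [h, nodeAt_code]
      simp only [Option.elim_some]
      have := T.exists_rank.choose_spec _ _ (T.isChild_iff.2 h)
      omega
  depth_le := by
    rintro y ⟨x, rfl⟩
    rw [nodeAt_code]
    exact Finset.single_le_sum (f := fun x => T.exists_rank.choose x + 1)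
      (fun _ _ => Nat.zero_le _) (Finset.mem_univ x)
  root_exists := by
    refine ⟨T.code (T.top T.root), ⟨_, rfl⟩, ?_⟩
    rw [nodeAt_code]
    simp [parentCode, top]

variable {D : ℕ} (hD : ∀ x, T.code x < 2 ^ D)

@[simp] theorem net_parent (x : T.Node) : (T.net D hD).parent (T.code x) = T.parentCode x := by
  simp [net]

@[simp] theorem net_H (x : T.Node) : (T.net D hD).H (T.code x) = (T.data x).nodeMat := by
  simp [net]

@[simp] theorem net_E (x : T.Node) : (T.net D hD).E (T.code x) = (T.data x).edgeMat := by
  simp [net]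

/-- The values `c` and `c'` of a node. -/
noncomputable def gainAt (x : T.Node) : Gain := (T.net D hD).val (Nat.pair (T.code x) 0)

theorem gain_code (x : T.Node) : (T.net D hD).gain (T.code x) =
    ⟨T.free (fun x => (T.gainAt hD x).free) (fun x => (T.gainAt hD x).used) x,
      T.used (fun x => (T.gainAt hD x).free) (fun x => (T.gainAt hD x).used) x⟩ := by
  rw [Net.gain, net_E]
  ext1
  · exact max_comm _ _
  · exact max_comm _ _

/-- Here `free` and `used` of a node hold `c` and `c'`. `Net.val_node` and `Gain.prod_eq` produce
the sum and the maximum over the children; the node matrix adds `b`, offers `a`, and forbids `c'` to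
use an edge to a child. -/
theorem isTable_gainAt : T.IsTable (fun x => (T.gainAt hD x).free)
    (fun x => (T.gainAt hD x).used) := by
  classical
  intro x
  have hb : (T.net D hD).below (T.code x) (D + 1) 0 =
      (T.children x).map ⟨T.code, T.code_injective⟩ := by
    ext y
    rw [Net.mem_children, Finset.mem_map]
    simp only [children, Finset.mem_filter, Finset.mem_univ, true_and, isChild_iff,
      Function.Embedding.coeFn_mk]
    constructor
    · rintro ⟨⟨z, rfl⟩, h⟩
      rw [net_parent] at h
      exact ⟨z, h, rfl⟩
    · rintro ⟨z, h, rfl⟩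
      exact ⟨⟨z, rfl⟩, by rw [net_parent, h]⟩
  have hv : T.gainAt hD x = (T.data x).nodeMat.act (∏ u ∈ T.children x,
      (⟨T.free (fun x => (T.gainAt hD x).free) (fun x => (T.gainAt hD x).used) u,
      T.used (fun x => (T.gainAt hD x).free) (fun x => (T.gainAt hD x).used) u⟩ : Gain)) := by
    have := (T.net D hD).val_node (x := T.code x) ⟨x, rfl⟩
    rw [hb, Finset.prod_map, net_H] at this
    simp only [Function.Embedding.coeFn_mk, gain_code] at this
    exact this
  rw [Gain.prod_eq] at hv
  simp only at hv
  constructor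
  · change (T.gainAt hD x).used = _
    conv_lhs => rw [hv]
    simp [Mat.act, Coord.nodeMat]
  · change (T.gainAt hD x).free = _
    conv_lhs => rw [hv]
    simp only [Mat.act, Coord.nodeMat]
    rw [← max_add_add_left, ← max_add_add_left, ← max_add_add_right, add_assoc]

theorem weight_net_le {M : ℕ} (hM : T.WeightLE M) :
    (T.net D hD).tree.weight ≤ (2 ^ (D + 1)) ^ 2 * (2 * (2 * M)) := by
  refine Net.weight_tree_le _ ?_
  rintro y ⟨x, rfl⟩
  rw [net_H, net_E]
  exact T.norm_mats hM x

end DWTree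

/-! ### Reading the input -/

/-- The integer stored in an optional word. -/
def wordInt : Option Word → ℤ
  | some (z : ℤ) => z
  | _ => 0

/-- Reads the parent pointer of `v` and the coordinate `i` of its weight vector. -/
def coordProg {α : Type} (v i : ℕ) (f : ℕ → Coord → Prog α) : Prog α :=
  .askNat (0, v, 0) fun p => .askNat (2, v, i) fun u => .ask (3, v, i) fun a =>
  .ask (4, v, i) fun b => .ask (5, v, i) fun w₀ => .ask (6, v, i) fun w₁ =>
  .ask (7, v, i) fun w₂ => .ask (8, v, i) fun w₃ =>
    f (p.getD 0) ⟨u.getD 0, wordInt a, wordInt b, ![w₀.getD ⊥, w₁.getD ⊥, w₂.getD ⊥, w₃.getD ⊥]⟩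

/-- The code of the parent node of the node `i` of `v`. -/
def parentOf (v i p : ℕ) (d : Coord) : ℕ :=
  if 0 < i then Nat.pair v d.up + 1 else if p = v then 0 else Nat.pair p d.up + 1

/-- The entries that a machine writes for a node, and its list of cells. -/
def slotEntries (D y x : ℕ) (H E : Mat) (base : ℕ) : List (Key × Word) :=
  Net.pathEntries D y x H E ++
    (List.range (D + 2)).map fun j => ((6, 0, base + j), natWord (pathCell D y x j))

/-- Picks a node of the weight vector of `u`, or of its parent if `side = 1`, using the random word
`r`, and writes its entries. -/
def slotProg (n D u side r base : ℕ) : Prog (List (Key × Word)) :=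
  if u < n then .askNat (0, u, 0) fun p =>
    .askNat (1, if side = 0 then u else p.getD 0, 0) fun len =>
    coordProg (if side = 0 then u else p.getD 0) (r % len.getD 0) fun pv d =>
      .ret (slotEntries D (Nat.pair (if side = 0 then u else p.getD 0) (r % len.getD 0) + 1)
        (parentOf (if side = 0 then u else p.getD 0) (r % len.getD 0) pv d) d.nodeMat d.edgeMat base)
  else .ret []

namespace DWTree

variable {n : ℕ} (T : DWTree n)

theorem par_eq_self {v : Fin n} : T.par v = v ↔ v = T.root := by
  constructor
  · intro h
    by_contra hv
    obtain ⟨g, hg⟩ := T.acyclic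
    have := hg v hv
    rw [h] at this
    exact lt_irrefl _ this
  · rintro rfl
    exact T.par_root

theorem heads_par (v : Fin n) : heads T.input (0, v.val, 0) = some (natWord (T.par v)) := by
  simp [heads, input, natWord]

theorem heads_length (v : Fin n) : heads T.input (1, v.val, 0) = some (natWord (T.W v).length) := by
  simp [heads, input, natWord]

theorem run_coordProg {α : Type} (x : T.Node) (f : ℕ → Coord → Prog α) :
    (coordProg x.1 x.2 f).run (heads T.input) =
      (f (T.par x.1) (T.data x)).run (heads T.input) ∧
    (coordProg x.1 x.2 f).cost (heads T.input) =
      (f (T.par x.1) (T.data x)).cost (heads T.input) + 8 := by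
  obtain ⟨v, i⟩ := x
  have hd : T.data ⟨v, i⟩ = ⟨(T.data ⟨v, i⟩).up, (T.data ⟨v, i⟩).a, (T.data ⟨v, i⟩).b,
      ![(T.data ⟨v, i⟩).ω 0, (T.data ⟨v, i⟩).ω 1, (T.data ⟨v, i⟩).ω 2, (T.data ⟨v, i⟩).ω 3]⟩ := by
    generalize T.data ⟨v, i⟩ = d
    obtain ⟨u, a, b, ω⟩ := d
    congr 1
    funext q
    fin_cases q <;> rfl
  have h : ∀ tag, heads T.input (tag + 2, v.val, i.val) =
      (if tag = 0 then [natWord (T.data ⟨v, i⟩).up]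
      else if tag = 1 then [((T.data ⟨v, i⟩).a : Word)]
      else if tag = 2 then [((T.data ⟨v, i⟩).b : Word)]
      else if tag = 3 then [(T.data ⟨v, i⟩).ω 0]
      else if tag = 4 then [(T.data ⟨v, i⟩).ω 1]
      else if tag = 5 then [(T.data ⟨v, i⟩).ω 2]
      else if tag = 6 then [(T.data ⟨v, i⟩).ω 3] else [])[0]? := by
    intro tag
    simp only [heads, input, v.isLt, i.isLt, dif_pos, Fin.eta]
    rw [if_neg (by omega), if_neg (by omega)]
    simp only [data, Nat.add_eq_right, Nat.reduceEqDiff, natWord]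
  have h2 := h 0
  have h3 := h 1
  have h4 := h 2
  have h5 := h 3
  have h6 := h 4
  have h7 := h 5
  have h8 := h 6
  simp only [Nat.reduceAdd, if_true, OfNat.ofNat_ne_zero, OfNat.ofNat_ne_one, if_false,
    one_ne_zero, Nat.reduceEqDiff, List.getElem?_cons_zero] at h2 h3 h4 h5 h6 h7 h8
  rw [hd]
  simp only [coordProg, Prog.run_askNat, Prog.run_ask, Prog.cost_askNat, Prog.cost_ask, h2, h3, h4,
    h5, h6, h7, h8, heads_par, Option.map_some, wordNat_natWord, Option.getD_some, wordInt]
  trivial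

/-- The vertex whose weight vector a slot uses. -/
def target (u : Fin n) (side : ℕ) : Fin n := if side = 0 then u else T.par u

/-- The node that a slot picks. -/
def picked (u : Fin n) (side r : ℕ) : T.Node :=
  ⟨T.target u side, r % (T.W (T.target u side)).length, Nat.mod_lt _ (T.nonempty _)⟩

/-- The entries for a node. -/
def entriesAt (D : ℕ) (x : T.Node) (base : ℕ) : List (Key × Word) :=
  slotEntries D (T.code x) (T.parentCode x) (T.data x).nodeMat (T.data x).edgeMat base

theorem run_slotProg (D : ℕ) (u : Fin n) (side r base : ℕ) :
    (slotProg n D u side r base).run (heads T.input) = T.entriesAt D (T.picked u side r) base ∧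
    (slotProg n D u side r base).cost (heads T.input) = 10 := by
  have ht : (if side = 0 then u.val else (T.par u).val) = (T.target u side).val := by
    unfold target
    split_ifs <;> rfl
  obtain ⟨h1, h2⟩ := T.run_coordProg (T.picked u side r) fun pv d =>
    .ret (slotEntries D (T.code (T.picked u side r))
      (parentOf (T.picked u side r).1 (T.picked u side r).2 pv d) d.nodeMat d.edgeMat base)
  -- A machine recognises the root by its parent pointer, which points to the root itself.
  have hp : parentOf (T.picked u side r).1 (T.picked u side r).2 (T.par (T.picked u side r).1)
      (T.data (T.picked u side r)) = T.parentCode (T.picked u side r) := by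
    unfold parentOf parentCode
    split_ifs with a b c d
    · rfl
    · rfl
    · exact absurd (T.par_eq_self.1 (Fin.ext b)) c
    · exact absurd (by rw [T.par_eq_self.2 d]) b
    · rfl
  simp only [slotProg, u.isLt, if_true, Prog.run_askNat, Prog.cost_askNat, heads_par,
    Option.map_some, wordNat_natWord, Option.getD_some, ht, heads_length]
  constructor
  · refine h1.trans ?_
    rw [hp]
    rfl
  · have := h2
    rw [Prog.cost_ret] at this
    simpa [picked, code] using this

theorem length_slotEntries (D y x : ℕ) (H E : Mat) (base : ℕ) :
    (slotEntries D y x H E base).length ≤ 4 * (D + 2) := by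
  have : (Net.pathEntries D y x H E).length ≤ (D + 2) * 3 := by
    unfold Net.pathEntries
    rw [List.length_flatMap]
    refine (List.sum_le_card_nsmul _ 3 ?_).trans (by simp)
    intro m hm
    obtain ⟨j, -, rfl⟩ := List.mem_map.1 hm
    split_ifs <;> simp
  simp only [slotEntries, List.length_append, List.length_map, List.length_range]
  omega

theorem mem_entriesAt (D : ℕ) (hD : ∀ x, T.code x < 2 ^ D) (x : T.Node) (base : ℕ)
    (e : Key × Word) : e ∈ T.entriesAt D x base ↔
      e ∈ Net.pathEntries D (T.code x) ((T.net D hD).parent (T.code x)) ((T.net D hD).H (T.code x))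
        ((T.net D hD).E (T.code x)) ∨
      ∃ j < D + 2, e = ((6, 0, base + j), natWord ((T.net D hD).cell (T.code x) j)) := by
  rw [entriesAt, slotEntries, List.mem_append, net_H, net_E, net_parent, List.mem_map]
  refine or_congr Iff.rfl (exists_congr fun j => ?_)
  rw [List.mem_range, Net.cell, net_parent]
  exact and_congr_right fun _ => eq_comm

/-- The degree is at most one more than the number of children, so `deg + 1` is at most twice the
number of children plus one. The first bound is matched against the number of slots serving `v`, the
second against sizes that must not depend on `v`. -/
theorem length_le_of_dimLE {κ k₀ : ℕ} (h : T.DimLE κ k₀) (v : Fin n) :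
    (T.W v).length ≤ 2 * κ * (Nat.log 2 n + 1) ^ k₀ *
      ((Finset.univ.filter fun u => T.par u = v).card + 1) ∧
    (T.W v).length ≤ κ * (n + 1) * (Nat.log 2 n + 1) ^ k₀ := by
  have h1 : T.deg v ≤ (Finset.univ.filter fun u => T.par u = v).card + 1 := by
    have hsub : T.graph.neighborSet v ⊆
        ((insert (T.par v) (Finset.univ.filter fun u => T.par u = v) : Finset (Fin n)) :
          Set (Fin n)) := by
      intro u hu
      have hu' := (SimpleGraph.fromRel_adj _ _ _).1 ((SimpleGraph.mem_neighborSet _ _ _).1 hu)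
      rcases hu'.2 with h | h
      · simp [h]
      · simp [h]
    refine (Set.ncard_le_ncard hsub).trans ?_
    rw [Set.ncard_coe_finset]
    exact Finset.card_insert_le _ _
  have h2 : T.deg v ≤ n := by
    refine (Set.ncard_le_ncard (Set.subset_univ _)).trans ?_
    rw [Set.ncard_univ, Nat.card_fin]
  have h3 := h v
  constructor
  · refine h3.trans ?_
    calc κ * (T.deg v + 1) * (Nat.log 2 n + 1) ^ k₀
        ≤ κ * (2 * ((Finset.univ.filter fun u => T.par u = v).card + 1)) *
          (Nat.log 2 n + 1) ^ k₀ := by gcongr; omega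
      _ = _ := by ring
  · exact h3.trans (by gcongr)

end DWTree

/-! ### Building the binary tree -/

/-- The relations between the sizes that are used to build the binary tree: each machine handles `q`
vertices, each of them with `2 * τ` picks, and the codes of the nodes have `D` bits. -/
structure InitOk (c : Cfg) (n M κ k₀ q τ D μ : ℕ) : Prop where
  -- Each of `q` vertices has `2 * τ` slots, and each slot lists the `D + 2` cells of one node.
  s_eq : c.s = 2 * τ * q * (D + 2)
  -- One machine is spare: it makes room for the extra block when the items of level 0 are
  -- contracted to at most `3 P`.
  n_le : n ≤ (c.P - 1) * q
  root_eq : c.root = Nat.pair 0 1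
  N_zero : (c.P - 1) * c.s ≤ c.N 0
  Z_ge : (2 ^ (D + 1)) ^ 2 ≤ c.Z
  W_ge : (2 ^ (D + 1)) ^ 2 * (2 * (2 * M)) ≤ c.W
  len_le : κ * (n + 1) * (Nat.log 2 n + 1) ^ k₀ ≤ c.B + 1
  code_lt : (n + κ * (n + 1) * (Nat.log 2 n + 1) ^ k₀) ^ 2 < 2 ^ D
  -- A factor 2 comes from `deg + 1` and another from the reduction of random words to residues.
  tau_ge : μ * (4 * κ * (Nat.log 2 n + 1) ^ k₀) ≤ τ
  out : ∀ z, c.out z ↔ ∃ v < n, z = Nat.pair (Nat.pair v 0 + 1) 0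

/-- Each machine picks nodes at its vertices and their parents and writes their entries. -/
def initRound (c : Cfg) (n q τ D : ℕ) : Round c.P c.S c.B := fun i ρ =>
  Prog.collect (fun e => slotProg n D (i * q + e / τ / 2) (e / τ % 2) (coin ρ e)
    ((i * (2 * τ * q) + e) * (D + 2))) (List.range (2 * τ * q))

namespace DWTree

variable {n : ℕ} (T : DWTree n)

theorem consistent_input : Consistent (content T.input) := by
  intro k a ha b hb
  have h : (T.input k).length ≤ 1 := by
    have hi : ∀ (p : Prop) [Decidable p] (a b : List Word), a.length ≤ 1 → b.length ≤ 1 →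
        (if p then a else b).length ≤ 1 := by
      intro p _ a b ha hb
      split_ifs
      · exact ha
      · exact hb
    have hd : ∀ (p : Prop) [Decidable p] (a : p → List Word), (∀ h, (a h).length ≤ 1) →
        (if h : p then a h else []).length ≤ 1 := by
      intro p _ a ha
      split_ifs with h
      · exact ha h
      · simp
    unfold input
    refine hd _ _ fun hv => hi _ _ _ le_rfl (hi _ _ _ le_rfl (hd _ _ fun h => ?_))
    exact hi _ _ _ le_rfl (hi _ _ _ le_rfl (hi _ _ _ le_rfl (hi _ _ _ le_rfl
      (hi _ _ _ le_rfl (hi _ _ _ le_rfl (hi _ _ _ le_rfl (by simp)))))))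
  simp only [content, Multiset.mem_coe] at ha hb
  obtain ⟨x, hx⟩ : ∃ x, T.input k = [x] := by
    rw [← List.length_eq_one_iff]
    have := List.length_pos_of_mem ha
    omega
  rw [hx, List.mem_singleton] at ha hb
  rw [ha, hb]

/-- Slot `j` of machine `i` is used for the vertex `v`. -/
def UsesSlot (q τ : ℕ) (v : Fin n) (i j : ℕ) : Prop :=
  j < 2 * τ * q ∧ ∃ h : i * q + j / τ / 2 < n, T.target ⟨_, h⟩ (j / τ % 2) = v

open scoped Classical in
-- Every vertex reserves `τ` slots for itself and `τ` for its parent, so a vertex is served in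
-- proportion to its number of children. This balances the load without any preprocessing.
theorem card_usesSlot {P S q τ : ℕ} (hn : n ≤ P * q) (hS : 2 * τ * q ≤ S) (v : Fin n) :
    τ * ((Finset.univ.filter fun u => T.par u = v).card + 1) ≤
      (Finset.univ.filter fun p : Fin P × Fin S => T.UsesSlot q τ v p.1 p.2).card := by
  set Q : Finset (ℕ × ℕ) := insert (v.val, 0)
    ((Finset.univ.filter fun u => T.par u = v).map
      ⟨fun u => (u.val, 1), fun a b h => Fin.ext (Prod.mk.inj h).1⟩) with hQ
  have hc : Q.card = (Finset.univ.filter fun u => T.par u = v).card + 1 := by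
    rw [hQ, Finset.card_insert_of_notMem (by
      rw [Finset.mem_map]
      rintro ⟨w, -, h⟩
      exact one_ne_zero (Prod.mk.inj h).2), Finset.card_map]
  rw [← hc, mul_comm]
  nth_rw 1 [← Finset.card_range τ]
  rw [← Finset.card_product]
  refine Finset.card_le_card_of_surjOn
    (fun p => ((p.1.val * q + p.2.val / τ / 2, p.2.val / τ % 2), p.2.val % τ)) ?_
  rintro ⟨⟨u, side⟩, k⟩ h
  simp only [Finset.coe_product, Set.mem_prod, Finset.mem_coe, Finset.mem_range] at h
  obtain ⟨h1, hk⟩ := h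
  have hu : ∃ hu : u < n, side < 2 ∧ T.target ⟨u, hu⟩ side = v := by
    rw [hQ, Finset.mem_insert, Finset.mem_map] at h1
    rcases h1 with h1 | ⟨w, hw, h1⟩
    · obtain ⟨rfl, rfl⟩ := Prod.mk.inj h1
      exact ⟨v.isLt, by omega, by simp [target]⟩
    · obtain ⟨rfl, rfl⟩ := Prod.mk.inj h1
      refine ⟨w.isLt, by omega, ?_⟩
      simpa [target] using hw
  obtain ⟨hu, hs, ht⟩ := hu
  have hq : 0 < q := Nat.pos_of_ne_zero fun h => by simp [h] at hn; omega
  have hmod := Nat.mod_lt u hq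
  have hdiv : u / q < P := (Nat.div_lt_iff_lt_mul hq).2 (by omega)
  have e1 : ((u % q * 2 + side) * τ + k) / τ = u % q * 2 + side := by
    rw [add_comm, Nat.add_mul_div_right _ _ (by omega), Nat.div_eq_of_lt hk, zero_add]
  have e2 : ((u % q * 2 + side) * τ + k) % τ = k := by
    rw [add_comm, Nat.add_mul_mod_self_right, Nat.mod_eq_of_lt hk]
  have e3 : (u % q * 2 + side) / 2 = u % q := by omega
  have e4 : (u % q * 2 + side) % 2 = side := by omega
  have e5 : u / q * q + u % q = u := Nat.div_add_mod' u q
  have hlt : (u % q * 2 + side) * τ + k < 2 * τ * q := by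
    have : (u % q * 2 + side + 1) * τ ≤ 2 * q * τ := Nat.mul_le_mul_right τ (by omega)
    rw [Nat.succ_mul] at this
    have e : 2 * τ * q = 2 * q * τ := by ring
    omega
  refine ⟨(⟨u / q, hdiv⟩, ⟨(u % q * 2 + side) * τ + k, hlt.trans_le hS⟩), ?_, ?_⟩
  · rw [Finset.mem_coe, Finset.mem_filter]
    refine ⟨Finset.mem_univ _, ?_⟩
    simp only [UsesSlot, e1, e3, e4, e5]
    exact ⟨hlt, hu, ht⟩
  · simp only [e1, e2, e3, e4, e5]

/-- The random words make slot `j` of machine `i` pick the node `x`. -/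
def Picks (q τ : ℕ) {P S B : ℕ} (ρ : Fin P → Coins S B) (x : T.Node) : Prop :=
  ∃ (i : Fin P) (j : ℕ), j < 2 * τ * q ∧ ∃ h : i * q + j / τ / 2 < n,
    T.picked ⟨_, h⟩ (j / τ % 2) (coin (ρ i) j) = x

/-- Coupon collecting: with `d` children, a coordinate of `W v` is picked in expectation at least `τ
(d + 1) / (2 |W v|)` times, and by the choice of `τ` this is at least `μ`. -/
theorem card_not_picks_le {c : Cfg} {M κ k₀ q τ D μ : ℕ} (ok : InitOk c n M κ k₀ q τ D μ)
    (hS : 2 * τ * q ≤ c.S) (hT : T.DimLE κ k₀) :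
    (Nat.card {ρ : Fin c.P → Coins c.S c.B // ¬ ∀ x, T.Picks q τ ρ x} : ℝ) ≤
      Fintype.card T.Node * (1 / 2 ^ μ) * Nat.card (Fin c.P → Coins c.S c.B) := by
  classical
  have hhit := card_not_hit_le (P := c.P) (S := c.S) (B := c.B) (Finset.univ : Finset T.Node)
    (fun x i j => if T.UsesSlot q τ x.1 i j then residueSet c.B (T.W x.1).length {x.2.val} else ∅)
    μ (by
      intro x _
      obtain ⟨h1, h2⟩ := T.length_le_of_dimLE hT x.1
      have h3 := T.card_usesSlot (ok.n_le.trans (Nat.mul_le_mul_right q (Nat.sub_le _ _))) hS x.1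
      have h4 := card_residueSet c.B (T.W x.1).length {x.2.val} (by simp) (h2.trans ok.len_le)
      rw [Finset.card_singleton, mul_one] at h4
      have h5 : (∑ i : Fin c.P, ∑ j : Fin c.S, (if T.UsesSlot q τ x.1 i j then
          residueSet c.B (T.W x.1).length {x.2.val} else ∅).card) =
          (Finset.univ.filter fun p : Fin c.P × Fin c.S => T.UsesSlot q τ x.1 p.1 p.2).card *
            (residueSet c.B (T.W x.1).length {x.2.val}).card := by
        rw [← Finset.sum_product', Finset.card_filter, Finset.sum_mul]
        refine Finset.sum_congr rfl fun p _ => ?_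
        split_ifs <;> simp
      rw [h5]
      have h6 : 0 < 2 * (T.W x.1).length := by have := T.nonempty x.1; omega
      refine Nat.le_of_mul_le_mul_left ?_ h6
      set g := (Finset.univ.filter fun p : Fin c.P × Fin c.S =>
        T.UsesSlot q τ x.1 p.1 p.2).card
      set k := (Finset.univ.filter fun u => T.par u = x.1).card
      calc 2 * (T.W x.1).length * (μ * (c.B + 1))
          ≤ 2 * (2 * κ * (Nat.log 2 n + 1) ^ k₀ * (k + 1)) * (μ * (c.B + 1)) := by gcongr
        _ = (μ * (4 * κ * (Nat.log 2 n + 1) ^ k₀)) * (k + 1) * (c.B + 1) := by ring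
        _ ≤ τ * (k + 1) * (c.B + 1) := by gcongr; exact ok.tau_ge
        _ ≤ g * (2 * (T.W x.1).length * (residueSet c.B (T.W x.1).length {x.2.val}).card) :=
          Nat.mul_le_mul h3 h4
        _ = _ := by ring)
  rw [Finset.card_univ] at hhit
  refine le_trans ?_ hhit
  have : Nat.card {ρ : Fin c.P → Coins c.S c.B // ¬ ∀ x, T.Picks q τ ρ x} ≤
      Nat.card {ρ : Fin c.P → Coins c.S c.B // ¬ ∀ x ∈ (Finset.univ : Finset T.Node),
        ∃ (i : Fin c.P) (j : Fin c.S), ρ i j ∈ if T.UsesSlot q τ x.1 i j then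
          residueSet c.B (T.W x.1).length {x.2.val} else ∅} := by
    refine Nat.card_le_card_of_injective (Subtype.map id fun ρ hρ hG => hρ fun x => ?_)
      (Subtype.map_injective _ Function.injective_id)
    obtain ⟨i, j, hij⟩ := hG x (Finset.mem_univ x)
    split_ifs at hij with h
    · obtain ⟨h1, h2, h3⟩ := h
      rw [mem_residueSet, Finset.mem_singleton] at hij
      refine ⟨i, j, h1, h2, ?_⟩
      have hcoin : coin (ρ i) j = (ρ i j).val := by simp [coin]
      obtain ⟨v, w⟩ := x
      simp only at h3 hij
      subst h3
      unfold picked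
      congr 1
      exact Fin.ext (by simp only [hcoin]; exact hij)
    · simp at hij
  exact_mod_cast this

theorem mem_run_initRound {c : Cfg} {q τ D : ℕ} (i : Fin c.P) (ρ : Coins c.S c.B)
    (e : Key × Word) : e ∈ (initRound c n q τ D i ρ).run (heads T.input) ↔
      ∃ j < 2 * τ * q, ∃ h : i * q + j / τ / 2 < n, e ∈ T.entriesAt D
        (T.picked ⟨_, h⟩ (j / τ % 2) (coin ρ j)) ((i * (2 * τ * q) + j) * (D + 2)) := by
  simp only [initRound, Prog.mem_run_collect, List.mem_range]
  refine exists_congr fun j => and_congr_right fun _ => ?_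
  by_cases h : i * q + j / τ / 2 < n
  · rw [(T.run_slotProg D ⟨_, h⟩ (j / τ % 2) (coin ρ j) _).1]
    simp [h]
  · simp [slotProg, h]

theorem initRound_bounds {c : Cfg} {q τ D : ℕ} (i : Fin c.P) (ρ : Coins c.S c.B) :
    (initRound c n q τ D i ρ).cost (heads T.input) ≤ 2 * τ * q * 10 ∧
    ((initRound c n q τ D i ρ).run (heads T.input)).length ≤ 2 * τ * q * (4 * (D + 2)) := by
  have key : ∀ j, (slotProg n D (i * q + j / τ / 2) (j / τ % 2) (coin ρ j)
      ((i * (2 * τ * q) + j) * (D + 2))).cost (heads T.input) ≤ 10 ∧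
      ((slotProg n D (i * q + j / τ / 2) (j / τ % 2) (coin ρ j)
      ((i * (2 * τ * q) + j) * (D + 2))).run (heads T.input)).length ≤ 4 * (D + 2) := by
    intro j
    by_cases h : i * q + j / τ / 2 < n
    · obtain ⟨h1, h2⟩ := T.run_slotProg D ⟨_, h⟩ (j / τ % 2) (coin ρ j)
        ((i * (2 * τ * q) + j) * (D + 2))
      rw [h1, h2]
      exact ⟨le_rfl, length_slotEntries ..⟩
    · simp [slotProg, h]
  have h1 := Prog.cost_collect_le (heads T.input) _ _ (List.range (2 * τ * q))
    fun j _ => (key j).1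
  have h2 := Prog.length_run_collect_le (heads T.input) _ _ (List.range (2 * τ * q))
    fun j _ => (key j).2
  rw [List.length_range] at h1 h2
  exact ⟨h1, h2⟩

theorem code_lt {c : Cfg} {M κ k₀ q τ D μ : ℕ} (ok : InitOk c n M κ k₀ q τ D μ)
    (hT : T.DimLE κ k₀) (x : T.Node) : T.code x < 2 ^ D := by
  refine lt_of_le_of_lt (pair_add_one_le ?_ ?_) ok.code_lt
  · have := x.1.isLt
    omega
  · have h1 := x.2.isLt
    have h2 := (T.length_le_of_dimLE hT x.1).2
    omega

/-- If every node is picked, the union of the written entries describes the whole binary tree. A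
node picked repeatedly gives the same facts each time, and its item numbers are determined by the
slot, so the table is consistent for every choice of the random words. -/
theorem init_triple {c : Cfg} {M κ k₀ q τ D μ ν : ℕ} (hc : c.Ok ν)
    (ok : InitOk c n M κ k₀ q τ D μ) (hT : T.DimLE κ k₀) (hM : T.WeightLE M)
    (hD : ∀ x, T.code x < 2 ^ D) :
    Triple (fun C => C = content T.input) (initRound c n q τ D)
      (OnHeads (UpInv c (T.net D hD).val 0)) (Fintype.card T.Node * (1 / 2 ^ μ)) := by
  set E := 2 * τ * q with hE
  have hs : c.s = E * (D + 2) := ok.s_eq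
  have hSs : 14 * E ≤ c.S ∧ 7 * c.s ≤ c.S := by
    have h1 := hc.S_ge
    have h2 : 7 * c.s ≤ 7 * (c.K + 1) * c.s := by
      rw [mul_assoc]
      exact Nat.mul_le_mul_left _ (Nat.le_mul_of_pos_left _ (by omega))
    have h3 : E * 2 ≤ E * (D + 2) := Nat.mul_le_mul_left _ (by omega)
    omega
  refine Triple.of_hit fun C hC => ⟨fun ρ => ∀ x, T.Picks q τ ρ x,
    T.card_not_picks_le ok (by omega) hT, fun ρ hρ => ?_⟩
  subst hC
  rw [← heads_eq_pick T.consistent_input]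
  set H := heads T.input with hH
  set N := T.net D hD with hN
  have hlab : ∀ z ∈ N.tree.labels, z ≤ c.Z := fun z hz =>
    (N.cell_le (N.mem_labels_tree.1 hz)).le.trans ok.Z_ge
  have hW : N.tree.weight ≤ c.W := (T.weight_net_le hD hM).trans ok.W_ge
  have hnode : ∀ x, N.IsNode (T.code x) := fun x => ⟨x, rfl⟩
  have hentry : ∀ (i : Fin c.P) e, e ∈ (initRound c n q τ D i (ρ i)).run H →
      TreeFact N.tree 0 e ∨ ∃ j < E, ∃ x : T.Node, ∃ a < D + 2,
        (∃ h : i * q + j / τ / 2 < n, T.picked ⟨_, h⟩ (j / τ % 2) (coin (ρ i) j) = x) ∧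
        e = ((6, 0, (i * E + j) * (D + 2) + a), natWord (N.cell (T.code x) a)) := by
    intro i e he
    obtain ⟨j, hj, h, he⟩ := (T.mem_run_initRound i (ρ i) e).1 he
    rcases (T.mem_entriesAt D hD _ _ _).1 he with he | ⟨a, ha, he⟩
    · exact Or.inl (N.treeFact_tree.2 ⟨_, hnode _, he⟩)
    · exact Or.inr ⟨j, hj, _, a, ha, ⟨h, rfl⟩, he⟩
  have hidx : ∀ (i : Fin c.P) j a, j < E → a < D + 2 → i * q + j / τ / 2 < n →
      (i * E + j) * (D + 2) + a < (c.P - 1) * c.s := by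
    intro i j a hj ha hn
    -- The spare machine has no vertex.
    have h0 : i.val < c.P - 1 :=
      Nat.lt_of_mul_lt_mul_right ((Nat.le_add_right _ _).trans_lt (hn.trans_le ok.n_le))
    have h1 : (i.val + 1) * E ≤ (c.P - 1) * E := Nat.mul_le_mul_right _ h0
    have h2 : (i * E + j + 1) * (D + 2) ≤ (c.P - 1) * E * (D + 2) := by
      refine Nat.mul_le_mul_right _ ?_
      rw [Nat.succ_mul] at h1
      omega
    rw [Nat.succ_mul] at h2
    have h3 : (c.P - 1) * c.s = (c.P - 1) * E * (D + 2) := by rw [hs]; ring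
    omega
  have hPs : (c.P - 1) * c.s ≤ c.P * c.s := Nat.mul_le_mul_right _ (Nat.sub_le _ _)
  have hfits : ∀ (i : Fin c.P) e, e ∈ (initRound c n q τ D i (ρ i)).run H → EntryFits c.B e := by
    intro i e he
    rcases hentry i e he with h | ⟨j, hj, x, a, ha, ⟨hl, -⟩, rfl⟩
    · exact h.fits hc (Nat.zero_le _) hlab hW
    · have h1 := hidx i j a hj ha hl
      have h2 := hPs.trans hc.items_le
      have h3 := hc.tag_le
      have h4 := hlab _ (N.mem_labels_tree.2 ⟨_, a, hnode x, ha, rfl⟩)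
      have h5 := hc.Z_le
      exact ⟨by simp only; omega, by simp only; omega, by simp only; omega,
        natWord_fits (by omega)⟩
  have hout : ∀ i, (initRound c n q τ D).out H ρ i = (initRound c n q τ D i (ρ i)).run H := by
    intro i
    obtain ⟨h1, h2⟩ := T.initRound_bounds (q := q) (τ := τ) (D := D) i (ρ i)
    refine Round.out_eq _ _ _ _ (h1.trans (by omega)) (h2.trans ?_) (hfits i)
    have : 2 * τ * q * (4 * (D + 2)) = 4 * c.s := by rw [hs]; ring
    omega
  have hmem : ∀ κ w, w ∈ (initRound c n q τ D).result H ρ κ ↔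
      ∃ i : Fin c.P, (κ, w) ∈ (initRound c n q τ D i (ρ i)).run H := by
    intro κ w
    rw [Round.mem_result]
    simp only [hout]
  have hcons : Consistent ((initRound c n q τ D).result H ρ) := by
    intro κ w hw w' hw'
    obtain ⟨i, hi⟩ := (hmem κ w).1 hw
    obtain ⟨i', hi'⟩ := (hmem κ w').1 hw'
    rcases hentry i _ hi with h | ⟨j, hj, x, a, ha, ⟨hl, hx⟩, h⟩ <;>
    rcases hentry i' _ hi' with h' | ⟨j', hj', x', a', ha', ⟨hl', hx'⟩, h'⟩
    · exact h.unique N.nodup_tree h'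
    · have := h.key.1
      simp only [Prod.mk.injEq] at h'
      rw [h'.1] at this
      simp at this
    · have := h'.key.1
      simp only [Prod.mk.injEq] at h
      rw [h.1] at this
      simp at this
    · obtain ⟨rfl, rfl⟩ := Prod.mk.inj h
      obtain ⟨h1, rfl⟩ := Prod.mk.inj h'
      simp only [Prod.mk.injEq, true_and] at h1
      -- Item numbers are mixed radix numbers with digits machine, slot and cell, so they can be
      -- decoded.
      have e1 : ∀ b a : ℕ, a < D + 2 → (b * (D + 2) + a) / (D + 2) = b := by
        intro b a ha
        rw [add_comm, Nat.add_mul_div_right _ _ (by omega), Nat.div_eq_of_lt ha, zero_add]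
      have e2 : ∀ b a : ℕ, a < E → (b * E + a) / E = b := by
        intro b a ha
        rw [add_comm, Nat.add_mul_div_right _ _ (by omega), Nat.div_eq_of_lt ha, zero_add]
      have h2 : i * E + j = i' * E + j' :=
        (e1 _ a ha).symm.trans ((congrArg (· / (D + 2)) h1).trans (e1 _ a' ha'))
      have h3 : i = i' := Fin.ext
        ((e2 _ j hj).symm.trans ((congrArg (· / E) h2).trans (e2 _ j' hj')))
      subst h3
      have h4 : j = j' := by omega
      subst h4
      have h5 : a = a' := by omega
      subst h5
      rw [← hx, ← hx']
  set H' := pick ((initRound c n q τ D).result H ρ) with hH'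
  have hH'' : ∀ κ w, H' κ = some w ↔
      ∃ i : Fin c.P, (κ, w) ∈ (initRound c n q τ D i (ρ i)).run H := fun κ w => by
    rw [hH', pick_eq_some hcons, hmem]
  have hitem : ∀ k j w, H' (6, k, j) = some w → k = 0 ∧ j < (c.P - 1) * c.s ∧
      ∃ z ∈ N.tree.labels, w = natWord z := by
    intro k j w hw
    obtain ⟨i, hi⟩ := (hH'' _ _).1 hw
    rcases hentry i _ hi with h | ⟨j', hj', x, a, ha, ⟨hl, -⟩, h⟩
    · have := h.key.1
      simp at this
    · simp only [Prod.mk.injEq, true_and] at h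
      obtain ⟨⟨rfl, rfl⟩, rfl⟩ := h
      exact ⟨rfl, hidx i j' a hj' ha hl, _, N.mem_labels_tree.2 ⟨_, a, hnode x, ha, rfl⟩, rfl⟩
  have hfact : ∀ tag < 4, ∀ z w, H' (tag, 0, z) = some w ↔
      TreeFact N.tree 0 ((tag, 0, z), w) := by
    intro tag ht z w
    rw [hH'']
    constructor
    · rintro ⟨i, hi⟩
      rcases hentry i _ hi with h | ⟨j', hj', x, a, ha, -, h⟩
      · exact h
      · simp only [Prod.mk.injEq] at h
        omega
    · intro h
      obtain ⟨y, ⟨x, rfl⟩, hy⟩ := N.treeFact_tree.1 h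
      obtain ⟨i, j, hj, hl, hx⟩ := hρ x
      refine ⟨i, (T.mem_run_initRound i (ρ i) _).2 ⟨j, hj, hl, ?_⟩⟩
      rw [hx, T.mem_entriesAt D hD]
      exact Or.inl hy
  refine ⟨hcons, fun _ => N.tree, ?_, ?_, ?_, ?_, ?_, ?_⟩
  · intro κ w hw
    obtain ⟨i, hi⟩ := (hH'' _ _).1 hw
    exact hfits i _ hi
  · intro tag k z w hw
    obtain ⟨i, hi⟩ := (hH'' _ _).1 hw
    rcases hentry i _ hi with h | ⟨j', hj', x, a, ha, -, h⟩
    · obtain ⟨h1, h2⟩ := h.key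
      simp only at h1 h2
      exact Or.inl ⟨Or.inl h1, h2.le⟩
    · simp only [Prod.mk.injEq] at h
      exact Or.inl ⟨Or.inr h.1.1, h.1.2.1.le⟩
  · intro k _ j w hw
    exact (hitem k j w hw).2.1.trans_le hPs
  · intro k hk
    obtain rfl : k = 0 := by omega
    have htop : N.tree.top = some c.root := by rw [N.top_tree, ok.root_eq]
    refine ⟨htop, N.nodup_tree, .of_treeFact N.nodup_tree hfact,
      TreeFact.up_root N.nodup_tree htop fun w h => (hfact 2 (by omega) _ w).1 h,
      N.valued_val, hW, hlab, ?_, ?_, ?_⟩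
    · intro z hz
      obtain ⟨y, a, ⟨x, rfl⟩, ha, rfl⟩ := N.mem_labels_tree.1 hz
      obtain ⟨i, j, hj, hl, hx⟩ := hρ x
      refine ⟨(i * E + j) * (D + 2) + a, (hH'' _ _).2 ⟨i,
        (T.mem_run_initRound i (ρ i) _).2 ⟨j, hj, hl, ?_⟩⟩⟩
      rw [hx, T.mem_entriesAt D hD]
      exact Or.inr ⟨a, ha, rfl⟩
    · intro j w hw
      obtain ⟨-, h1, h2⟩ := hitem 0 j w hw
      exact ⟨h1.trans_le ok.N_zero, h2⟩
    · intro _ z hz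
      obtain ⟨v, hv, rfl⟩ := (ok.out z).1 hz
      exact N.mem_labels_tree.2 (N.isCell_iff.2 (Or.inl ⟨_, ⟨T.top ⟨v, hv⟩, rfl⟩, rfl⟩))
  · intro k hk
    omega
  · intro k hk
    omega

end DWTree

/-! ### The output -/

/-- The entries for the values of the vertex `u`. -/
def outEntries (u : ℕ) (v : Gain) : List (Key × Word) := [((0, u, 0), v.free), ((1, u, 0), v.used)]

/-- Each machine writes the values of its vertices. -/
noncomputable def outputRound (c : Cfg) (n q : ℕ) : Round c.P c.S c.B := fun i _ =>
  Prog.collect (fun a => if i * q + a < n then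
    .askNat (5, 0, Nat.pair (Nat.pair (i * q + a) 0 + 1) 0) fun g =>
      .ret (outEntries (i * q + a) (Gain.decode (g.getD 0))) else .ret []) (List.range q)

theorem Word.fits_of_wordNorm_le {B : ℕ} {w : Word} (h : wordNorm w ≤ B) : w.Fits B := by
  rintro z rfl
  rw [wordNorm_coe] at h
  rw [Int.abs_eq_natAbs]
  exact_mod_cast h

theorem List.flatMap_eq_singleton {β : Type*} {l : List ℕ} (hl : l.Nodup) {a : ℕ} (ha : a ∈ l)
    (x : β) (f : ℕ → List β) (h1 : f a = [x]) (h2 : ∀ b ≠ a, f b = []) : l.flatMap f = [x] := by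
  induction l with
  | nil => simp at ha
  | cons b l ih =>
    rw [List.flatMap_cons]
    rw [List.nodup_cons] at hl
    by_cases hb : b = a
    · subst hb
      have : l.flatMap f = [] := by
        rw [List.flatMap_eq_nil_iff]
        exact fun y hy => h2 y fun e => hl.1 (e ▸ hy)
      rw [this, h1]
      rfl
    · rw [h2 b hb, List.nil_append]
      exact ih hl.2 ((List.mem_cons.1 ha).resolve_left (Ne.symm hb))

/-- The final table must hold exactly one value per key, so here multiplicities count: only machine
`u / q`, at offset `u % q`, writes for `u`. -/
theorem output_triple {c : Cfg} {n M κ k₀ q τ D μ ν : ℕ} (hc : c.Ok ν)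
    (ok : InitOk c n M κ k₀ q τ D μ) (val : ℕ → Gain) (hval : ∀ z, (val z).norm ≤ c.W) :
    Triple (OnHeads (DownInv c val 0)) (outputRound c n q)
      (fun C => ∀ u < n,
        C (0, u, 0) = {(val (Nat.pair (Nat.pair u 0 + 1) 0)).free} ∧
        C (1, u, 0) = {(val (Nat.pair (Nat.pair u 0 + 1) 0)).used}) 0 := by
  refine Triple.of_forall fun C ⟨hcons, t, hs, hv⟩ ρ => ?_
  set H := pick C with hH
  have hqs : q ≤ c.s ∧ 7 * c.s ≤ c.S := by
    have h1 := hc.S_ge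
    have h2 : 7 * c.s ≤ 7 * (c.K + 1) * c.s := by
      rw [mul_assoc]
      exact Nat.mul_le_mul_left _ (Nat.le_mul_of_pos_left _ (by omega))
    refine ⟨?_, by omega⟩
    have h3 := hc.s_pos
    rw [ok.s_eq] at h3 ⊢
    have h4 : τ ≠ 0 := by
      rintro rfl
      simp at h3
    calc q = 1 * q * 1 := by ring
      _ ≤ 2 * τ * q * (D + 2) := by gcongr <;> omega
  have n_le : n ≤ c.P * q := ok.n_le.trans (Nat.mul_le_mul_right q (Nat.sub_le _ _))
  have hnB : n ≤ c.B := by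
    have h1 := n_le
    have h2 := Nat.mul_le_mul_left c.P hqs.1
    have h3 := hc.items_le
    omega
  set g : ℕ → Gain := fun u => val (Nat.pair (Nat.pair u 0 + 1) 0) with hg
  have hread : ∀ u < n, H (5, 0, Nat.pair (Nat.pair u 0 + 1) 0) = some (natWord (g u).code) :=
    fun u hu => hv 0 le_rfl (Nat.zero_le _) _
      ((hs.levels 0 (Nat.zero_le _)).out rfl _ ((ok.out _).2 ⟨u, hu, rfl⟩))
  have hrun : ∀ i : Fin c.P, (outputRound c n q i (ρ i)).run H = (List.range q).flatMap fun a =>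
      if i * q + a < n then outEntries (i * q + a) (g (i * q + a)) else [] := by
    intro i
    rw [outputRound, Prog.run_collect]
    congr 1
    funext a
    split_ifs with h
    · simp [hread _ h]
    · rfl
  have hout : ∀ i, (outputRound c n q).out H ρ i = (List.range q).flatMap fun a =>
      if i * q + a < n then outEntries (i * q + a) (g (i * q + a)) else [] := by
    intro i
    rw [← hrun]
    refine Round.out_eq _ _ _ _ ?_ ?_ ?_
    · refine (Prog.cost_collect_le H _ 1 (List.range q) fun a _ => ?_).trans ?_
      · split_ifs <;> simp
      · rw [List.length_range]
        omega
    · refine (Prog.length_run_collect_le H _ 2 (List.range q) fun a _ => ?_).trans ?_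
      · split_ifs <;> simp [outEntries]
      · rw [List.length_range]
        omega
    · intro e he
      rw [hrun, List.mem_flatMap] at he
      obtain ⟨a, -, he⟩ := he
      have h1 := hc.tag_le
      split_ifs at he with h
      · obtain ⟨h2, h3⟩ := Gain.norm_le.1 (hval (Nat.pair (Nat.pair (i * q + a) 0 + 1) 0))
        have h4 := hc.W_le
        have h5 : c.W ≤ (((2 * c.W + 2) ^ 2) ^ 2) ^ 2 := by
          have h6 : ∀ x : ℕ, x ≤ x ^ 2 := fun x => Nat.le_self_pow two_ne_zero x
          calc c.W ≤ 2 * c.W + 2 := by omega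
            _ ≤ _ := (h6 _).trans ((h6 _).trans (h6 _))
        simp only [outEntries, List.mem_cons, List.not_mem_nil, or_false] at he
        rcases he with rfl | rfl
        · exact ⟨by simp only; omega, by simp only; omega, by simp only; omega,
            Word.fits_of_wordNorm_le (h2.trans (by omega))⟩
        · exact ⟨by simp only; omega, by simp only; omega, by simp only; omega,
            Word.fits_of_wordNorm_le (h3.trans (by omega))⟩
      · simp at he
  have key : ∀ u < n, ∀ b w, (∀ v, (outEntries v (g v)).filter (fun e => e.1 = (b, u, 0)) =
      if v = u then [((b, u, 0), w)] else []) → (outputRound c n q).result H ρ (b, u, 0) = {w} := by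
    intro u hu b w hb
    have hq : 0 < q := Nat.pos_of_ne_zero fun h => by
      have := n_le
      simp [h] at this
      omega
    have hi : u / q < c.P := (Nat.div_lt_iff_lt_mul hq).2 (hu.trans_le n_le)
    have hdiv : u / q * q + u % q = u := Nat.div_add_mod' u q
    have hfil : ∀ i a : ℕ, (if i * q + a < n then outEntries (i * q + a) (g (i * q + a))
        else []).filter (fun e => e.1 = (b, u, 0)) =
        if i * q + a = u then [((b, u, 0), w)] else [] := by
      intro i a
      split_ifs with h1 h2 h2
      · rw [hb, if_pos h2]
      · rw [hb, if_neg h2]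
      · omega
      · rfl
    unfold Round.result
    simp only [hout, List.filter_flatMap, hfil]
    rw [Finset.sum_eq_single (⟨u / q, hi⟩ : Fin c.P)]
    · rw [List.flatMap_eq_singleton (List.nodup_range) (a := u % q)
        (List.mem_range.2 (Nat.mod_lt _ hq)) ((b, u, 0), w)]
      · rfl
      · simp [hdiv]
      · intro a ha
        rw [if_neg]
        simp only
        omega
    · intro i _ hne
      have : ((List.range q).flatMap fun a => if i * q + a = u then
          [(((b, u, 0), w) : Key × Word)] else []) = [] := by
        rw [List.flatMap_eq_nil_iff]
        intro a ha
        rw [List.mem_range] at ha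
        rw [if_neg]
        rintro rfl
        apply hne
        ext
        simp only
        rw [add_comm, Nat.add_mul_div_right _ _ hq, Nat.div_eq_of_lt ha, zero_add]
      rw [this]
      rfl
    · intro h
      exact absurd (Finset.mem_univ _) h
  intro u hu
  constructor
  · refine key u hu 0 _ fun v => ?_
    by_cases h : v = u
    · subst h
      simp [outEntries, hg]
    · simp [outEntries, h]
  · refine key u hu 1 _ fun v => ?_
    by_cases h : v = u
    · subst h
      simp [outEntries, hg]
    · simp [outEntries, h]

/-- All rounds of the algorithm. -/
noncomputable def matchingRounds (c : Cfg) (n q τ D : ℕ) : List (Round c.P c.S c.B) :=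
  initRound c n q τ D :: (treeRounds c ++ [outputRound c n q])

theorem length_matchingRounds (c : Cfg) (n q τ D : ℕ) :
    (matchingRounds c n q τ D).length = 4 * c.K + 3 := by
  simp [matchingRounds, length_treeRounds]

/-- Only the initial picks and the samplings contribute to the error. A multiset with one element
leaves no freedom for the order of the stored list. -/
theorem DWTree.le_prob_matchingRounds {n : ℕ} (T : DWTree n) {c : Cfg} {M κ k₀ q τ D μ : ℕ}
    (hc : c.Ok μ) (ok : InitOk c n M κ k₀ q τ D μ) (hT : T.DimLE κ k₀) (hM : T.WeightLE M) :
    1 - (Fintype.card T.Node * (1 / 2 ^ μ) + c.K * (3 * (c.P * c.s) * (1 / 2 ^ μ))) ≤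
      (AMPC.ofRounds (matchingRounds c n q τ D)).prob T.input T.Solved := by
  have hD := T.code_lt ok hT
  have hval : ∀ z, ((T.net D hD).val z).norm ≤ c.W := fun z =>
    (BT.norm_valAt_le _ z).trans ((T.weight_net_le hD hM).trans ok.W_ge)
  have h1 := Chain.single (T.init_triple hc ok hT hM hD) (by positivity) (by
    rintro _ rfl
    exact T.consistent_input)
  have h2 := treeRounds_chain c hc (T.net D hD).val hval
  have h3 := Chain.single (output_triple hc ok (T.net D hD).val hval) le_rfl fun _ h => h.1
  have h4 := h1.append (h2.append h3)
  rw [add_zero] at h4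
  refine Chain.le_prob h4 T.input rfl _ fun E hE => ?_
  refine ⟨_, _, T.isTable_gainAt hD, fun v => ?_⟩
  obtain ⟨h5, h6⟩ := hE v v.isLt
  exact ⟨Multiset.coe_eq_singleton.1 h5, Multiset.coe_eq_singleton.1 h6⟩

/-! ### The sizes -/

/-- The number of items of each level. -/
def levelSize (p s : ℕ) : ℕ → ℕ
  | 0 => p * s
  | k + 1 => 3 * (levelSize p s k / s + 1)

theorem levelSize_le {p s : ℕ} (hp : 0 < p) (hs : 6 ≤ s) (k : ℕ) :
    levelSize p s k ≤ p * s ∧ levelSize p s (k + 1) ≤ 3 * (p + 1) := by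
  have key : ∀ k, levelSize p s k ≤ p * s → levelSize p s (k + 1) ≤ 3 * (p + 1) := by
    intro k h
    have : levelSize p s k / s ≤ p := Nat.div_le_of_le_mul (by rwa [mul_comm])
    simp only [levelSize]
    omega
  suffices h : levelSize p s k ≤ p * s from ⟨h, key k h⟩
  induction k with
  | zero => exact le_rfl
  | succ k ih =>
    refine (key k ih).trans ?_
    nlinarith

/-- For `s ≥ 6 q` the recursion halves the size after scaling by `q`: `3 N / s ≤ N / (2 q)`. The
additive term stays bounded because `6 / 2 + 3 ≤ 6`. -/
theorem levelSize_mul_pow_le {p s q : ℕ} (hq : 0 < q) (hs : 6 * q ≤ s) (k : ℕ) :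
    levelSize p s k * q ^ k ≤ p * s + 6 * q ^ k := by
  induction k with
  | zero => simp [levelSize]
  | succ k ih =>
    have h1 : levelSize p s k / s * (6 * q) ≤ levelSize p s k :=
      (Nat.mul_le_mul_left _ hs).trans (Nat.div_mul_le_self _ _)
    have h2 : q ^ k ≤ q ^ (k + 1) := Nat.pow_le_pow_right hq (by omega)
    have h3 := Nat.mul_le_mul_right (q ^ k) h1
    have e : levelSize p s (k + 1) * q ^ (k + 1) =
        3 * (levelSize p s k / s * q * q ^ k) + 3 * q ^ (k + 1) := by
      simp only [levelSize]
      ring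
    have e' : levelSize p s k / s * (6 * q) * q ^ k =
        6 * (levelSize p s k / s * q * q ^ k) := by ring
    rw [e]
    omega

theorem le_pow_self {c X : ℕ} (hX : 2 ≤ X) : c ≤ X ^ c :=
  (Nat.lt_two_pow_self).le.trans (Nat.pow_le_pow_left hX c)

theorem add_le_pow {a b m k X : ℕ} (hX : 2 ≤ X) (ha : a ≤ X ^ m) (hb : b ≤ X ^ k) :
    a + b ≤ X ^ (m + k + 1) := by
  have h1 : X ^ m ≤ X ^ (m + k) := Nat.pow_le_pow_right (by omega) (by omega)
  have h2 : X ^ k ≤ X ^ (m + k) := Nat.pow_le_pow_right (by omega) (by omega)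
  calc a + b ≤ X ^ (m + k) * 2 := by omega
    _ ≤ X ^ (m + k) * X := Nat.mul_le_mul_left _ hX
    _ = _ := (pow_succ ..).symm

theorem mul_le_pow {a b m k X : ℕ} (ha : a ≤ X ^ m) (hb : b ≤ X ^ k) : a * b ≤ X ^ (m + k) := by
  rw [pow_add]
  exact Nat.mul_le_mul ha hb

theorem pow_le_pow_mul {a m k X : ℕ} (ha : a ≤ X ^ m) : a ^ k ≤ X ^ (m * k) := by
  rw [pow_mul]
  exact Nat.pow_le_pow_left ha k

/-- The number of bits of the codes of the nodes. -/
def codeBits (κ k₀ n : ℕ) : ℕ := Nat.log 2 ((n + κ * (n + 1) * (Nat.log 2 n + 1) ^ k₀) ^ 2) + 1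

/-- The base `X` is left open since two are needed: a power of two near `n`, to see that the number
of bits is logarithmic, and `n + M + 1`, to bound words. -/
theorem codeBits_bounds (κ k₀ : ℕ) {n X : ℕ} (hn : 0 < n) (hX : n + 1 ≤ X) :
    κ * (n + 1) * (Nat.log 2 n + 1) ^ k₀ ≤ X ^ (κ + k₀ + 1) ∧
    (n + κ * (n + 1) * (Nat.log 2 n + 1) ^ k₀) ^ 2 < 2 ^ codeBits κ k₀ n ∧
    2 ^ codeBits κ k₀ n ≤ X ^ (2 * (κ + k₀ + 3) + 1) := by
  have hX2 : 2 ≤ X := by omega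
  have hl : Nat.log 2 n + 1 ≤ X ^ 1 := by
    have := Nat.log_le_self 2 n
    rw [pow_one]
    omega
  have h1 : κ * (n + 1) * (Nat.log 2 n + 1) ^ k₀ ≤ X ^ (κ + k₀ + 1) :=
    (mul_le_pow (mul_le_pow (le_pow_self hX2) (show n + 1 ≤ X ^ 1 by simpa using hX))
      (pow_le_pow_mul hl)).trans (Nat.pow_le_pow_right (by omega) (by omega))
  have h2 : n + κ * (n + 1) * (Nat.log 2 n + 1) ^ k₀ ≤ X ^ (κ + k₀ + 3) :=
    (add_le_pow hX2 (show n ≤ X ^ 1 by rw [pow_one]; omega) h1).trans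
      (Nat.pow_le_pow_right (by omega) (by omega))
  refine ⟨h1, Nat.lt_pow_succ_log_self (by omega) _, ?_⟩
  unfold codeBits
  rw [pow_succ]
  have h3 : 2 ^ Nat.log 2 ((n + κ * (n + 1) * (Nat.log 2 n + 1) ^ k₀) ^ 2) ≤
      X ^ (2 * (κ + k₀ + 3)) := by
    refine (Nat.pow_log_le_self 2 (by positivity)).trans ?_
    rw [mul_comm 2, pow_mul]
    exact Nat.pow_le_pow_left h2 2
  refine (Nat.mul_le_mul h3 hX2).trans_eq (pow_succ ..).symm

theorem four_le_pow {X : ℕ} (hX : 2 ≤ X) : 4 ≤ X ^ 2 := Nat.pow_le_pow_left hX 2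

theorem eight_le_pow {X : ℕ} (hX : 2 ≤ X) : 8 ≤ X ^ 4 :=
  (show 8 ≤ 2 ^ 4 by norm_num).trans (Nat.pow_le_pow_left hX 4)

theorem two_mul_sub_le_pow {n p X : ℕ} (hX : n + 1 ≤ X) (hp : p ≤ 2 * n) : p + 1 ≤ X ^ 2 :=
  le_trans (by nlinarith) (Nat.pow_le_pow_left hX 2)

/-- All requirements are met by sizes with `μ` of order `log n`, `s` of order `q` times a power of
`log n`, and `L` of order `μ s`. The constants have to be fixed before `n`. -/
theorem exists_cfg (κ k₀ γ K : ℕ) : ∃ C : ℕ, ∀ n M q C' : ℕ, 0 < n → 0 < q → q ≤ n →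
    n ≤ q ^ K → C ≤ C' → ∃ (c : Cfg) (τ D μ : ℕ), c.Ok μ ∧ InitOk c n M κ k₀ q τ D μ ∧
      c.K = K ∧ c.S ≤ C * (Nat.log 2 n + 1) ^ (k₀ + 3) * q ∧ c.P * q ≤ 3 * n ∧
      c.B = (n + M + 1) ^ C' ∧
      (n + 1) ^ γ * (n * (κ * (n + 1) * (Nat.log 2 n + 1) ^ k₀) + K * (3 * (c.P * c.s))) ≤
        2 ^ μ := by
  obtain ⟨a, ha⟩ : ∃ x, x = κ + k₀ + 3 := ⟨_, rfl⟩
  obtain ⟨c₁, hc₁⟩ : ∃ x, x = 2 * (4 * κ + 1) * (2 * a + 4) := ⟨_, rfl⟩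
  obtain ⟨j, hj⟩ : ∃ x, x = γ + (3 * K + a + c₁ + k₀ + 10) := ⟨_, rfl⟩
  -- The error exponent `A` also enters `s`, and so the number of events that `2 ^ μ` must beat.
  -- With `A = 2 ^ j` it raises the exponent of that polynomial only by `j`, so the circle closes
  -- because `2 j ≤ 2 ^ j`.
  obtain ⟨A, hA⟩ : ∃ x, x = 2 ^ j := ⟨_, rfl⟩
  obtain ⟨cs, hcs⟩ : ∃ x, x = A * c₁ := ⟨_, rfl⟩
  obtain ⟨cS, hcS⟩ : ∃ x, x = (7 * K + 139 + 216 * A) * cs := ⟨_, rfl⟩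
  obtain ⟨C, hC⟩ : ∃ x, x = cS + 32 * a + 200 + cs + k₀ + K := ⟨_, rfl⟩
  have hA1 : 1 ≤ A := hA ▸ Nat.one_le_two_pow
  refine ⟨C, fun n M q C' hn hq hqn hnK hC' => ?_⟩
  obtain ⟨l, hl⟩ : ∃ x, x = Nat.log 2 n + 1 := ⟨_, rfl⟩
  rw [← hl]
  obtain ⟨D, hD⟩ : ∃ x, x = codeBits κ k₀ n := ⟨_, rfl⟩
  obtain ⟨μ, hμ⟩ : ∃ x, x = A * l := ⟨_, rfl⟩
  -- The summand 1 keeps `τ`, and with it `s`, positive when `κ = 0`.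
  obtain ⟨τ, hτ⟩ : ∃ x, x = 4 * κ * A * l ^ (k₀ + 1) + 1 := ⟨_, rfl⟩
  obtain ⟨s, hs⟩ : ∃ x, x = 2 * τ * q * (D + 2) := ⟨_, rfl⟩
  obtain ⟨p, hp⟩ : ∃ x, x = n / q + 1 := ⟨_, rfl⟩
  obtain ⟨Z, hZ⟩ : ∃ x, x = (2 ^ (D + 1)) ^ 2 := ⟨_, rfl⟩
  have hl1 : 1 ≤ l := by omega
  have hX : n + 1 ≤ 2 ^ l := hl ▸ Nat.lt_pow_succ_log_self (by omega) n
  have hlX : l ≤ 2 ^ l := Nat.lt_two_pow_self.le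
  have hX2 : 2 ≤ 2 ^ l := by omega
  have hD1 : 1 ≤ D := by
    rw [hD, codeBits]
    omega
  have hb : ∀ X, n + 1 ≤ X → κ * (n + 1) * l ^ k₀ ≤ X ^ (κ + k₀ + 1) ∧
      (n + κ * (n + 1) * l ^ k₀) ^ 2 < 2 ^ D ∧ 2 ^ D ≤ X ^ (2 * (κ + k₀ + 3) + 1) := by
    rw [hl, hD]
    exact fun X h => codeBits_bounds κ k₀ hn h
  have hDl : D + 2 ≤ (2 * a + 4) * l := by
    have h1 := (hb _ hX).2.2
    rw [← pow_mul, Nat.pow_le_pow_iff_right (by omega)] at h1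
    have e : l * (2 * (κ + k₀ + 3) + 1) + 3 * l = (2 * a + 4) * l := by rw [ha]; ring
    omega
  have hτl : τ ≤ A * (4 * κ + 1) * l ^ (k₀ + 1) := by
    have : 1 ≤ A * l ^ (k₀ + 1) := Nat.mul_pos hA1 (by positivity)
    have e : A * (4 * κ + 1) * l ^ (k₀ + 1) = 4 * κ * A * l ^ (k₀ + 1) + A * l ^ (k₀ + 1) := by
      ring
    omega
  have hsl : s ≤ cs * l ^ (k₀ + 2) * q := by
    calc s ≤ 2 * (A * (4 * κ + 1) * l ^ (k₀ + 1)) * q * ((2 * a + 4) * l) := by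
          rw [hs]
          gcongr
      _ = _ := by rw [hcs, hc₁]; ring
  have hs6 : 6 * q ≤ s := by
    calc 6 * q = 2 * 1 * q * 3 := by ring
      _ ≤ s := by
          rw [hs]
          gcongr <;> omega
  have hp0 : 0 < p := hp ▸ Nat.succ_pos _
  have hs0 : 6 ≤ s := (Nat.le_mul_of_pos_right 6 hq).trans hs6
  have hpq : n ≤ p * q := by
    rw [hp, Nat.succ_mul]
    have := Nat.div_add_mod' n q
    have := Nat.mod_lt n hq
    omega
  have hpq' : (p + 1) * q ≤ 3 * n := by
    have := Nat.div_mul_le_self n q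
    have e : (p + 1) * q = n / q * q + 2 * q := by rw [hp]; ring
    omega
  have hpn : p ≤ 2 * n := by
    have := Nat.div_le_self n q
    omega
  have hS : 7 * (K + 1) * s + 36 * (6 * μ * s + 3 * s) + 24 ≤ cS * l ^ (k₀ + 3) * q := by
    have h1 : 7 * (K + 1) + 36 * (6 * μ + 3) + 24 ≤ (7 * K + 139 + 216 * A) * l := by
      have e1 : (7 * K + 139 + 216 * A) * l = 7 * (K * l) + 139 * l + 216 * (A * l) := by ring
      have e2 : K ≤ K * l := Nat.le_mul_of_pos_right _ (by omega)
      omega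
    have h2 : 24 ≤ 24 * s := by omega
    calc 7 * (K + 1) * s + 36 * (6 * μ * s + 3 * s) + 24
        ≤ 7 * (K + 1) * s + 36 * (6 * μ * s + 3 * s) + 24 * s := Nat.add_le_add_left h2 _
      _ = (7 * (K + 1) + 36 * (6 * μ + 3) + 24) * s := by ring
      _ ≤ ((7 * K + 139 + 216 * A) * l) * (cs * l ^ (k₀ + 2) * q) := Nat.mul_le_mul h1 hsl
      _ = _ := by rw [hcS]; ring
  -- Since `n ≤ q ^ K`, the `K` levels consume the factor `p ≤ 2 n` and leave at most `2 s + 6`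
  -- items.
  have hlast : levelSize p s K ≤ 3 * s := by
    have h1 := levelSize_mul_pow_le (p := p) hq hs6 K
    have h2 : p * s ≤ 2 * s * q ^ K := by
      calc p * s ≤ (2 * q ^ K) * s := Nat.mul_le_mul_right s (by omega)
        _ = _ := by ring
    have h3 : levelSize p s K * q ^ K ≤ (2 * s + 6) * q ^ K := by
      rw [add_mul]
      omega
    have h4 := Nat.le_of_mul_le_mul_right h3 (pow_pos hq K)
    omega
  obtain ⟨Y, hYdef⟩ : ∃ x, x = n + M + 1 := ⟨_, rfl⟩
  rw [← hYdef]
  have hY : n + 1 ≤ Y := by omega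
  have hY2 : 2 ≤ Y := by omega
  have hpow : ∀ {x m : ℕ}, x ≤ Y ^ m → m ≤ C → x ≤ Y ^ C' := fun h hm =>
    h.trans (Nat.pow_le_pow_right (by omega) (hm.trans hC'))
  have hZY : Z ≤ Y ^ (4 * a + 4) := by
    have h1 := (hb _ hY).2.2
    have h2 : 2 ^ (D + 1) ≤ Y ^ (2 * a + 2) := by
      rw [pow_succ]
      refine (Nat.mul_le_mul h1 hY2).trans_eq ?_
      rw [← pow_succ, ← ha]
    calc Z ≤ (Y ^ (2 * a + 2)) ^ 2 := hZ ▸ Nat.pow_le_pow_left h2 2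
      _ = _ := by rw [← pow_mul]; congr 1; ring
  have hZ1 : 1 ≤ Z := hZ ▸ Nat.pow_pos (Nat.two_pow_pos _)
  have hlY : l ≤ Y ^ 1 := by
    have := Nat.log_le_self 2 n
    rw [pow_one]
    omega
  have hsY : s ≤ Y ^ (cs + k₀ + 3) :=
    hsl.trans ((mul_le_pow (mul_le_pow (le_pow_self hY2) (pow_le_pow_mul hlY))
      (show q ≤ Y ^ 1 by rw [pow_one]; omega)).trans
      (Nat.pow_le_pow_right (by omega) (by omega)))
  have hpY : p + 1 ≤ Y ^ 2 := two_mul_sub_le_pow hY hpn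
  have h4Y : 4 ≤ Y ^ 2 := four_le_pow hY2
  have hWY : (((2 * (Z * (2 * (2 * M))) + 2) ^ 2) ^ 2) ^ 2 ≤ Y ^ (32 * a + 80) := by
    have h1 : Z * (2 * (2 * M)) ≤ Y ^ (4 * a + 7) := by
      refine (mul_le_pow hZY (mul_le_pow (show 2 ≤ Y ^ 1 by simpa using hY2)
        (mul_le_pow (show 2 ≤ Y ^ 1 by simpa using hY2)
        (show M ≤ Y ^ 1 by rw [pow_one]; omega)))).trans_eq ?_
      congr 1
    have h2 : 2 * (Z * (2 * (2 * M))) + 2 ≤ Y ^ (4 * a + 10) := by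
      refine (add_le_pow hY2 (mul_le_pow (show 2 ≤ Y ^ 1 by simpa using hY2) h1)
        (show 2 ≤ Y ^ 1 by simpa using hY2)).trans_eq ?_
      congr 1
      ring
    calc _ = (2 * (Z * (2 * (2 * M))) + 2) ^ 8 := by ring
      _ ≤ (Y ^ (4 * a + 10)) ^ 8 := Nat.pow_le_pow_left h2 8
      _ = _ := by rw [← pow_mul]; congr 1; ring
  refine ⟨⟨p + 1, 7 * (K + 1) * s + 36 * (6 * μ * s + 3 * s) + 24, Y ^ C', s, K,
    -- The walk length `L`: the first summand is for the gaps between samples, the second for the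
    -- size of the last level.
    6 * μ * s + 3 * s, Z, Z * (2 * (2 * M)), Nat.pair 0 1, levelSize p s,
    fun z => ∃ v < n, z = Nat.pair (Nat.pair v 0 + 1) 0⟩, τ, D, μ, ?_, ?_, rfl, ?_, hpq', rfl, ?_⟩
  · constructor <;> simp only
    · omega
    · omega
    · exact le_rfl
    · exact fun k => ((levelSize_le hp0 hs0 k).1).trans
        (Nat.mul_le_mul_right _ (by omega))
    · exact fun k => le_rfl
    · exact fun k => (levelSize_le hp0 hs0 k).2
    · exact hlast.trans (by omega)
    · have := hpow (mul_le_pow (show 3 ≤ Y ^ 2 by omega) hsY) (by omega)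
      omega
    · have : μ * (6 * s) = 6 * μ * s := by ring
      omega
    · exact hpow (eight_le_pow hY2) (by omega)
    · exact hpow (le_pow_self hY2) (by omega)
    · exact hpow (mul_le_pow hpY hsY) (by omega)
    · exact hpow (mul_le_pow (show 3 ≤ Y ^ 2 by omega) hpY) (by omega)
    · exact hpow (show 3 * Z + 2 ≤ Y ^ (4 + (4 * a + 4)) from
        le_trans (by omega) (mul_le_pow (eight_le_pow hY2) hZY)) (by omega)
    · exact hpow hWY (by omega)
  · constructor <;> try simp only
    · exact hs
    · exact hpq
    · exact le_rfl
    · exact hZ.ge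
    · rw [hZ]
    · rw [← hl]
      exact (hpow (hb _ hY).1 (by omega)).trans (Nat.le_succ _)
    · rw [← hl]
      exact (hb _ hY).2.1
    · rw [← hl]
      rw [hμ, hτ, pow_succ]
      refine le_trans (le_of_eq ?_) (Nat.le_succ _)
      ring
    · exact fun _ => trivial
  · refine hS.trans ?_
    gcongr
    omega
  · have h1 : n * (κ * (n + 1) * l ^ k₀) ≤ (2 ^ l) ^ (1 + (κ + k₀ + 1)) :=
      mul_le_pow (by rw [pow_one]; omega) (hb _ hX).1
    have h2 : s ≤ (2 ^ l) ^ (j + c₁ + (k₀ + 2) + 1) := by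
      refine hsl.trans (mul_le_pow (mul_le_pow (hcs ▸ mul_le_pow ?_ (le_pow_self hX2)) ?_) ?_)
      · exact hA ▸ Nat.pow_le_pow_left hX2 j
      · exact Nat.pow_le_pow_left hlX _
      · rw [pow_one]
        omega
    have h3 : p + 1 ≤ (2 ^ l) ^ 2 := two_mul_sub_le_pow hX hpn
    have h4 : K * (3 * ((p + 1) * s)) ≤
        (2 ^ l) ^ (K + (2 + (2 + (j + c₁ + (k₀ + 2) + 1)))) :=
      mul_le_pow (le_pow_self hX2) (mul_le_pow ((Nat.le_succ 3).trans (four_le_pow hX2)) (mul_le_pow h3 h2))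
    have h5 := mul_le_pow (pow_le_pow_mul (k := γ) (show n + 1 ≤ (2 ^ l) ^ 1 by simpa using hX))
      (add_le_pow hX2 h1 h4)
    refine h5.trans ?_
    rw [← pow_mul, mul_comm l, hμ]
    refine Nat.pow_le_pow_right (by omega) (Nat.mul_le_mul_right l ?_)
    have h6 : 2 * j ≤ 2 ^ j := by
      obtain ⟨i, hi⟩ : ∃ i, j = i + 1 := ⟨j - 1, by omega⟩
      have := Nat.lt_two_pow_self (n := i)
      rw [hi, pow_succ]
      omega
    omega

/-! ### The resources -/

/-- The bound `log n ≤ n ^ η / η` with `η = δ / (m + 1)`; the `m + 1` instead of `m` avoids a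
division by zero. -/
theorem exists_log_pow_le (m : ℕ) {δ : ℝ} (hδ : 0 < δ) : ∃ C : ℕ, ∀ n : ℕ, 0 < n →
    ((Nat.log 2 n + 1 : ℕ) : ℝ) ^ m ≤ C * (n : ℝ) ^ δ := by
  have hm : (0 : ℝ) < m + 1 := by positivity
  set η := δ / (m + 1) with hη
  have hη0 : 0 < η := by positivity
  refine ⟨⌈(1 + 2 / η) ^ m⌉₊, fun n hn => ?_⟩
  have hn1 : (1 : ℝ) ≤ n := by exact_mod_cast hn
  have h1 : (Nat.log 2 n : ℝ) * Real.log 2 ≤ Real.log n := by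
    rw [← Real.log_pow]
    refine Real.log_le_log (by positivity) ?_
    exact_mod_cast Nat.pow_log_le_self 2 hn.ne'
  have h2 := Real.log_le_rpow_div (x := n) (by positivity) hη0
  have h3 : (Nat.log 2 n : ℝ) * (1 / 2) ≤ (Nat.log 2 n : ℝ) * Real.log 2 :=
    mul_le_mul_of_nonneg_left (by linarith [Real.log_two_gt_d9]) (by positivity)
  have h4 : (1 : ℝ) ≤ (n : ℝ) ^ η := Real.one_le_rpow hn1 hη0.le
  have h5 : ((Nat.log 2 n + 1 : ℕ) : ℝ) ≤ (1 + 2 / η) * (n : ℝ) ^ η := by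
    push_cast
    have : (1 + 2 / η) * (n : ℝ) ^ η = (n : ℝ) ^ η + 2 * ((n : ℝ) ^ η / η) := by ring
    linarith
  have h6 : ((n : ℝ) ^ η) ^ m ≤ (n : ℝ) ^ δ := by
    rw [← Real.rpow_mul_natCast (by positivity)]
    refine Real.rpow_le_rpow_of_exponent_le hn1 ?_
    rw [hη, div_mul_eq_mul_div, div_le_iff₀ hm]
    nlinarith
  calc ((Nat.log 2 n + 1 : ℕ) : ℝ) ^ m ≤ ((1 + 2 / η) * (n : ℝ) ^ η) ^ m :=
        pow_le_pow_left₀ (by positivity) h5 m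
    _ = (1 + 2 / η) ^ m * ((n : ℝ) ^ η) ^ m := mul_pow ..
    _ ≤ _ := mul_le_mul (Nat.le_ceil _) h6 (by positivity) (by positivity)

/-- The number of vertices per machine. -/
theorem exists_block_size {ε : ℝ} (h0 : 0 < ε) (h1 : ε < 1) {n : ℕ} (hn : 0 < n) :
    ∃ q : ℕ, 0 < q ∧ q ≤ n ∧ (q : ℝ) ≤ 2 * (n : ℝ) ^ (ε / 2) ∧ n ≤ q ^ ⌈2 / ε⌉₊ := by
  have hn1 : (1 : ℝ) ≤ n := by exact_mod_cast hn
  have hx : (1 : ℝ) ≤ (n : ℝ) ^ (ε / 2) := Real.one_le_rpow hn1 (by positivity)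
  -- Half of the exponent is spent on the block size; the other half absorbs the powers of `log n`
  -- in the memory per machine.
  refine ⟨⌈(n : ℝ) ^ (ε / 2)⌉₊, Nat.ceil_pos.2 (by linarith), ?_, ?_, ?_⟩
  · rw [Nat.ceil_le]
    exact (Real.rpow_le_rpow_of_exponent_le hn1 (by linarith)).trans_eq (Real.rpow_one _)
  · linarith [Nat.ceil_lt_add_one (a := (n : ℝ) ^ (ε / 2)) (by linarith)]
  · have h2 : (n : ℝ) ≤ ((n : ℝ) ^ (ε / 2)) ^ ⌈2 / ε⌉₊ := by
      rw [← Real.rpow_mul_natCast (by positivity)]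
      conv_lhs => rw [← Real.rpow_one (n : ℝ)]
      refine Real.rpow_le_rpow_of_exponent_le hn1 ?_
      calc (1 : ℝ) = ε / 2 * (2 / ε) := by field_simp
        _ ≤ _ := mul_le_mul_of_nonneg_left (Nat.le_ceil _) (by positivity)
    have h3 := h2.trans (pow_le_pow_left₀ (by linarith) (Nat.le_ceil ((n : ℝ) ^ (ε / 2))) _)
    exact_mod_cast h3

/-- With `⌈2 / ε⌉ < 2 / ε + 1` the number is below `8 / ε + 7`, and `ε < 1` bounds this by `15 / ε`,
hence by `15 / ε ^ 3`. -/
theorem rounds_le {ε : ℝ} (h0 : 0 < ε) (h1 : ε < 1) :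
    ((4 * ⌈2 / ε⌉₊ + 3 : ℕ) : ℝ) ≤ 15 / ε ^ 3 := by
  have h2 := Nat.ceil_lt_add_one (a := 2 / ε) (by positivity)
  have h3 : (1 : ℝ) ≤ 1 / ε := by rw [le_div_iff₀ h0]; linarith
  have h4 : 1 / ε ≤ 1 / ε ^ 3 := by
    refine one_div_le_one_div_of_le (by positivity) ?_
    simpa using pow_le_pow_of_le_one h0.le h1.le (show 1 ≤ 3 by norm_num)
  have e2 : 2 / ε = 2 * (1 / ε) := by ring
  have e15 : 15 / ε ^ 3 = 15 * (1 / ε ^ 3) := by ring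
  push_cast
  linarith

theorem exists_matching_algorithm {ε : ℝ} (h0 : 0 < ε) (h1 : ε < 1) (κ k₀ γ : ℕ) :
    ∃ C k : ℕ, ∀ n M : ℕ, ∃ R P S B : ℕ,
      (R : ℝ) ≤ 15 / ε ^ 3 ∧
      (S : ℝ) ≤ C * (n : ℝ) ^ ε ∧
      P * S ≤ C * n * (Nat.log 2 n + 1) ^ k ∧
      B ≤ (n + M + 1) ^ C ∧
      ∃ A : AMPC R P S B, ∀ T : DWTree n, T.DimLE κ k₀ → T.WeightLE M →
        1 - 1 / ((n : ℝ) + 1) ^ γ ≤ A.prob T.input T.Solved := by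
  obtain ⟨C₀, hC₀⟩ := exists_cfg κ k₀ γ ⌈2 / ε⌉₊
  obtain ⟨C₁, hC₁⟩ := exists_log_pow_le (k₀ + 3) (half_pos h0)
  -- The first summand serves the total memory, through `P q ≤ 3 n`, the second the memory per
  -- machine.
  refine ⟨3 * C₀ + 2 * C₀ * C₁, k₀ + 3, fun n M => ?_⟩
  rcases n.eq_zero_or_pos with rfl | hn
  -- There is no rooted tree without vertices, so any algorithm will do.
  · exact ⟨0, 0, 0, 0, by simp; positivity, by simp; positivity, by simp, by simp,
      AMPC.ofRounds [], fun T => T.root.elim0⟩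
  obtain ⟨q, hq, hqn, hq2, hnq⟩ := exists_block_size h0 h1 hn
  obtain ⟨c, τ, D, μ, hc, ok, hK, hS, hP, hB, hμ⟩ :=
    hC₀ n M q (3 * C₀ + 2 * C₀ * C₁) hn hq hqn hnq (by omega)
  have hn1 : (1 : ℝ) ≤ n := by exact_mod_cast hn
  refine ⟨_, c.P, c.S, c.B, ?_, ?_, ?_, hB.le, AMPC.ofRounds (matchingRounds c n q τ D),
    fun T hT hM => ?_⟩
  · rw [length_matchingRounds, hK]
    exact rounds_le h0 h1
  · have h2 : (c.S : ℝ) ≤ C₀ * ((Nat.log 2 n + 1 : ℕ) : ℝ) ^ (k₀ + 3) * q := by exact_mod_cast hS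
    have e : (n : ℝ) ^ ε = (n : ℝ) ^ (ε / 2) * (n : ℝ) ^ (ε / 2) := by
      rw [← Real.rpow_add (by positivity), add_halves]
    calc (c.S : ℝ) ≤ C₀ * ((Nat.log 2 n + 1 : ℕ) : ℝ) ^ (k₀ + 3) * q := h2
      _ ≤ C₀ * (C₁ * (n : ℝ) ^ (ε / 2)) * (2 * (n : ℝ) ^ (ε / 2)) := by
        gcongr
        exact hC₁ n hn
      _ = (2 * C₀ * C₁) * (n : ℝ) ^ ε := by rw [e]; ring
      _ ≤ _ := by
        push_cast
        gcongr
        linarith [show (0 : ℝ) ≤ 3 * C₀ by positivity]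
  · calc c.P * c.S ≤ c.P * (C₀ * (Nat.log 2 n + 1) ^ (k₀ + 3) * q) := Nat.mul_le_mul_left _ hS
      _ = C₀ * (c.P * q) * (Nat.log 2 n + 1) ^ (k₀ + 3) := by ring
      _ ≤ C₀ * (3 * n) * (Nat.log 2 n + 1) ^ (k₀ + 3) := by gcongr
      _ = (3 * C₀) * n * (Nat.log 2 n + 1) ^ (k₀ + 3) := by ring
      _ ≤ _ := by
        gcongr
        exact Nat.le_add_right _ _
  · refine le_trans ?_ (T.le_prob_matchingRounds hc ok hT hM)
    have hcard : Fintype.card T.Node ≤ n * (κ * (n + 1) * (Nat.log 2 n + 1) ^ k₀) := by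
      rw [Fintype.card_sigma]
      refine (Finset.sum_le_card_nsmul _ _ (κ * (n + 1) * (Nat.log 2 n + 1) ^ k₀) fun v _ => ?_).trans
        (by simp)
      rw [Fintype.card_fin]
      exact (T.length_le_of_dimLE hT v).2
    have h2 : (n + 1) ^ γ * (Fintype.card T.Node + c.K * (3 * (c.P * c.s))) ≤ 2 ^ μ := by
      rw [hK]
      exact (Nat.mul_le_mul_left _ (Nat.add_le_add_right hcard _)).trans hμ
    have h3 : ((n : ℝ) + 1) ^ γ * (Fintype.card T.Node + c.K * (3 * (c.P * c.s))) ≤ 2 ^ μ := by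
      exact_mod_cast h2
    have h4 : ((Fintype.card T.Node : ℝ) + c.K * (3 * (c.P * c.s))) * (1 / 2 ^ μ) ≤
        1 / ((n : ℝ) + 1) ^ γ := by
      rw [mul_one_div, div_le_div_iff₀ (by positivity) (by positivity)]
      linarith
    linarith

/-! ### Matchings of rooted trees -/

namespace RTree

variable {n : ℕ} (T : RTree n)

/-- The children of a vertex. -/
def kids (v : Fin n) : Finset (Fin n) := Finset.univ.filter fun u => u ≠ T.root ∧ T.par u = v

variable {T} in
theorem mem_kids {v u : Fin n} : u ∈ T.kids v ↔ u ≠ T.root ∧ T.par u = v := by simp [kids]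

open scoped Classical in
/-- The vertices of the maximal subtree rooted at `v`. -/
noncomputable def below (v : Fin n) : Finset (Fin n) := Finset.univ.filter (T.InSubtree v)

variable {T}

theorem mem_below {v u : Fin n} : u ∈ T.below v ↔ T.InSubtree v u := by simp [below]

theorem InSubtree.refl (v : Fin n) : T.InSubtree v v := ⟨0, rfl⟩

theorem InSubtree.trans {v u x : Fin n} (h : T.InSubtree v u) (h' : T.InSubtree u x) :
    T.InSubtree v x := by
  obtain ⟨k, rfl⟩ := h
  obtain ⟨k', rfl⟩ := h'
  exact ⟨k + k', Function.iterate_add_apply _ _ _ _⟩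

theorem inSubtree_par (v : Fin n) : T.InSubtree (T.par v) v := ⟨1, rfl⟩

theorem eq_root_of_inSubtree_root {v : Fin n} (h : T.InSubtree v T.root) : v = T.root := by
  obtain ⟨k, rfl⟩ := h
  exact Function.iterate_fixed T.par_root k

theorem InSubtree.le {h : Fin n → ℕ} (hh : ∀ v, v ≠ T.root → h (T.par v) < h v) {v u : Fin n}
    (hu : T.InSubtree v u) : h v ≤ h u := by
  obtain ⟨k, rfl⟩ := hu
  induction k with
  | zero => exact le_rfl
  | succ k ih =>
    rw [Function.iterate_succ_apply']
    by_cases hr : T.par^[k] u = T.root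
    · rwa [hr, T.par_root, ← hr]
    · exact (hh _ hr).le.trans ih

theorem not_inSubtree_par {v u : Fin n} (hu : u ∈ T.kids v) : ¬ T.InSubtree u v := by
  obtain ⟨h, hh⟩ := T.acyclic
  intro hs
  obtain ⟨h1, rfl⟩ := mem_kids.1 hu
  exact (hs.le hh).not_gt (hh u h1)

theorem inSubtree_iff {v x : Fin n} :
    T.InSubtree v x ↔ x = v ∨ ∃ u ∈ T.kids v, T.InSubtree u x := by
  constructor
  · rintro ⟨k, hk⟩
    induction k with
    | zero => exact Or.inl hk
    | succ k ih =>
      rw [Function.iterate_succ_apply'] at hk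
      -- The pointer of the root loops, so the step from `par^[k] x` to `v` may be void.
      by_cases hr : T.par^[k] x = T.root
      · exact ih (by rw [← hk, hr, T.par_root])
      · exact Or.inr ⟨_, mem_kids.2 ⟨hr, hk⟩, k, rfl⟩
  · rintro (rfl | ⟨u, hu, hx⟩)
    · exact .refl _
    · rw [← (mem_kids.1 hu).2]
      exact (inSubtree_par u).trans hx

/-- All ancestors of `x` are iterates of `par`. The later of two distinct children of `v` would be
reached from the earlier one through `v`, making a child of `v` an ancestor of `v`. -/
theorem kids_unique {v u u' x : Fin n} (hu : u ∈ T.kids v) (hu' : u' ∈ T.kids v)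
    (h : T.InSubtree u x) (h' : T.InSubtree u' x) : u = u' := by
  have key : ∀ {u u' : Fin n} {k k' : ℕ}, u ∈ T.kids v → u' ∈ T.kids v → T.par^[k] x = u →
      T.par^[k'] x = u' → k ≤ k' → u = u' := by
    intro u u' k k' hu hu' hk hk' hle
    obtain ⟨d, rfl⟩ := Nat.exists_eq_add_of_le' hle
    rw [Function.iterate_add_apply, hk] at hk'
    cases d with
    | zero => exact hk'
    | succ d =>
      rw [Function.iterate_succ_apply, (mem_kids.1 hu).2] at hk'
      exact (not_inSubtree_par hu' ⟨d, hk'⟩).elim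
  obtain ⟨k, hk⟩ := h
  obtain ⟨k', hk'⟩ := h'
  rcases le_total k k' with hle | hle
  · exact key hu hu' hk hk' hle
  · exact (key hu' hu hk' hk hle).symm

variable (T) in
/-- The vertices below `v` other than `v`. -/
noncomputable def strictlyBelow (v : Fin n) : Finset (Fin n) := (T.kids v).biUnion T.below

theorem mem_strictlyBelow {v x : Fin n} :
    x ∈ T.strictlyBelow v ↔ ∃ u ∈ T.kids v, T.InSubtree u x := by
  simp [strictlyBelow, mem_below]

theorem notMem_strictlyBelow (v : Fin n) : v ∉ T.strictlyBelow v := fun h => by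
  obtain ⟨u, hu, h⟩ := mem_strictlyBelow.1 h
  exact not_inSubtree_par hu h

theorem below_eq (v : Fin n) : T.below v = insert v (T.strictlyBelow v) := by
  ext x
  rw [mem_below, inSubtree_iff, Finset.mem_insert, mem_strictlyBelow]

/-- A vertex is strictly below `v` exactly if its parent edge lies in the subtree of `v`; this
translates between vertex sets and edges. -/
theorem mem_strictlyBelow_iff {v x : Fin n} :
    x ∈ T.strictlyBelow v ↔ x ≠ T.root ∧ T.InSubtree v (T.par x) := by
  constructor
  · intro h
    obtain ⟨u, hu, hx⟩ := mem_strictlyBelow.1 h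
    refine ⟨fun e => (mem_kids.1 hu).1 (eq_root_of_inSubtree_root (e ▸ hx)), ?_⟩
    obtain ⟨k, hk⟩ := hx
    cases k with
    | zero =>
      rw [show x = u from hk, (mem_kids.1 hu).2]
      exact .refl v
    | succ k => exact inSubtree_iff.2 (Or.inr ⟨u, hu, k, hk⟩)
  · rintro ⟨hr, hx⟩
    rcases inSubtree_iff.1 (hx.trans (inSubtree_par x)) with rfl | h
    · exact (not_inSubtree_par (mem_kids.2 ⟨hr, rfl⟩) hx).elim
    · exact mem_strictlyBelow.2 h

theorem sum_strictlyBelow {A : Type*} [AddCommMonoid A] (φ : Fin n → A) (v : Fin n) :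
    ∑ x ∈ T.strictlyBelow v, φ x = ∑ u ∈ T.kids v, (φ u + ∑ x ∈ T.strictlyBelow u, φ x) := by
  rw [strictlyBelow, Finset.sum_biUnion]
  · refine Finset.sum_congr rfl fun u _ => ?_
    rw [below_eq, Finset.sum_insert (notMem_strictlyBelow u)]
  · intro u hu u' hu' hne
    refine Finset.disjoint_left.2 fun x hx hx' => hne ?_
    exact kids_unique hu hu' (mem_below.1 hx) (mem_below.1 hx')

/-- Strong induction on the distance of the height function from its maximum, which decreases from a
vertex to its children. -/
theorem induction_kids {Q : Fin n → Prop} (step : ∀ v, (∀ u ∈ T.kids v, Q u) → Q v) (v : Fin n) :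
    Q v := by
  obtain ⟨h, hh⟩ := T.acyclic
  have key : ∀ m v, Finset.univ.sup h - h v = m → Q v := by
    intro m
    induction m using Nat.strong_induction_on with
    | _ m ih =>
      intro v hv
      refine step v fun u hu => ih _ ?_ u rfl
      have h1 := hh u (mem_kids.1 hu).1
      have h2 : h u ≤ Finset.univ.sup h := Finset.le_sup (Finset.mem_univ u)
      rw [(mem_kids.1 hu).2] at h1
      omega
  exact key _ v rfl

variable (T) in
/-- The edges from the vertices in `E` to their parents form a matching. -/
structure MatchingSet (E : Finset (Fin n)) : Prop where
  ne_root : ∀ u ∈ E, u ≠ T.root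
  par_notMem : ∀ u ∈ E, T.par u ∉ E
  injOn : ∀ u ∈ E, ∀ u' ∈ E, T.par u = T.par u' → u = u'

/-- Joining matchings below the children of `v`, and possibly one edge to `v`. -/
theorem matchingSet_join {v : Fin n} {F : Fin n → Finset (Fin n)} {I : Finset (Fin n)}
    (hI : I ⊆ T.kids v) (hI1 : ∀ u ∈ I, ∀ u' ∈ I, u = u')
    (hF : ∀ u ∈ T.kids v, T.MatchingSet (F u) ∧ F u ⊆ T.strictlyBelow u)
    (hIF : ∀ u ∈ I, Disjoint (F u) (T.kids u)) :
    T.MatchingSet (I ∪ (T.kids v).biUnion F) ∧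
    I ∪ (T.kids v).biUnion F ⊆ T.strictlyBelow v ∧
    ∀ u ∈ T.kids v, (u ∈ I ∪ (T.kids v).biUnion F ↔ u ∈ I) ∧
      (I ∪ (T.kids v).biUnion F) ∩ T.strictlyBelow u = F u := by
  have hpar : ∀ u ∈ T.kids v, ∀ x ∈ F u, T.InSubtree u (T.par x) := fun u hu x hx =>
    (mem_strictlyBelow_iff.1 ((hF u hu).2 hx)).2
  have hbel : ∀ u ∈ T.kids v, ∀ x ∈ F u, T.InSubtree u x := fun u hu x hx =>
    (hpar u hu x hx).trans (inSubtree_par x)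
  have hself : ∀ u ∈ T.kids v, ∀ u' ∈ T.kids v, u' ∉ F u := by
    intro u hu u' hu' h
    have := kids_unique hu hu' (hbel u hu u' h) (.refl u')
    subst this
    exact notMem_strictlyBelow _ ((hF u hu).2 h)
  have hsub : I ∪ (T.kids v).biUnion F ⊆ T.strictlyBelow v := by
    intro x hx
    rcases Finset.mem_union.1 hx with hx | hx
    · exact mem_strictlyBelow.2 ⟨x, hI hx, .refl x⟩
    · obtain ⟨u, hu, hx⟩ := Finset.mem_biUnion.1 hx
      exact mem_strictlyBelow.2 ⟨u, hu, hbel u hu x hx⟩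
  refine ⟨⟨fun u hu => (mem_strictlyBelow_iff.1 (hsub hu)).1, ?_, ?_⟩, hsub, ?_⟩
  · intro x hx hp
    rcases Finset.mem_union.1 hx with hx | hx
    · rw [(mem_kids.1 (hI hx)).2] at hp
      exact notMem_strictlyBelow v (hsub hp)
    · obtain ⟨u, hu, hx⟩ := Finset.mem_biUnion.1 hx
      rcases Finset.mem_union.1 hp with hp | hp
      · have e := kids_unique hu (hI hp) (hpar u hu x hx) (.refl _)
        rw [← e] at hp
        refine Finset.disjoint_left.1 (hIF u hp) hx (mem_kids.2 ⟨?_, e.symm⟩)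
        exact (hF u hu).1.ne_root x hx
      · obtain ⟨u', hu', hp⟩ := Finset.mem_biUnion.1 hp
        have e := kids_unique hu hu' (hpar u hu x hx) (hbel u' hu' _ hp)
        subst e
        exact (hF u hu).1.par_notMem x hx hp
  · have key : ∀ x ∈ I, ∀ u ∈ T.kids v, ∀ x' ∈ F u, T.par x ≠ T.par x' := by
      intro x hx u hu x' hx' e
      have := hpar u hu x' hx'
      rw [← e, (mem_kids.1 (hI hx)).2] at this
      exact not_inSubtree_par hu this
    intro x hx x' hx' e
    rcases Finset.mem_union.1 hx with hx | hx <;> rcases Finset.mem_union.1 hx' with hx' | hx'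
    · exact hI1 x hx x' hx'
    · obtain ⟨u, hu, hx'⟩ := Finset.mem_biUnion.1 hx'
      exact (key x hx u hu x' hx' e).elim
    · obtain ⟨u, hu, hx⟩ := Finset.mem_biUnion.1 hx
      exact (key x' hx' u hu x hx e.symm).elim
    · obtain ⟨u, hu, hx⟩ := Finset.mem_biUnion.1 hx
      obtain ⟨u', hu', hx'⟩ := Finset.mem_biUnion.1 hx'
      have e' := kids_unique hu hu' (hpar u hu x hx) (e ▸ hpar u' hu' x' hx')
      subst e'
      exact (hF u hu).1.injOn x hx x' hx' e
  · intro u hu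
    constructor
    · rw [Finset.mem_union, or_iff_left]
      intro h
      obtain ⟨u', hu', h⟩ := Finset.mem_biUnion.1 h
      exact hself u' hu' u hu h
    · ext x
      rw [Finset.mem_inter, Finset.mem_union, Finset.mem_biUnion]
      constructor
      · rintro ⟨hx, hxu⟩
        have hxu' : T.InSubtree u x :=
          ((mem_strictlyBelow_iff.1 hxu).2).trans (inSubtree_par x)
        rcases hx with hx | ⟨u', hu', hx⟩
        · have := kids_unique hu (hI hx) hxu' (.refl x)
          subst this
          exact (notMem_strictlyBelow _ hxu).elim
        · rwa [kids_unique hu hu' hxu' (hbel u' hu' x hx)]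
      · exact fun hx => ⟨Or.inr ⟨u, hu, hx⟩, (hF u hu).2 hx⟩

/-! ### Optimality of the dynamic program for ordinary matchings. -/

/-- The weight of the edges in `E` below `v`. -/
noncomputable def weightBelow (T : RTree n) (w : Fin n → ℤ) (E : Finset (Fin n)) (v : Fin n) :
    WithBot ℤ := ∑ x ∈ E ∩ T.strictlyBelow v, (w x : WithBot ℤ)

theorem weightBelow_eq (w : Fin n → ℤ) (E : Finset (Fin n)) (v : Fin n) :
    T.weightBelow w E v =
      ∑ u ∈ T.kids v, ((if u ∈ E then (w u : WithBot ℤ) else 0) + T.weightBelow w E u) := by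
  have h : ∀ v, T.weightBelow w E v =
      ∑ x ∈ T.strictlyBelow v, if x ∈ E then (w x : WithBot ℤ) else 0 := by
    intro v
    rw [weightBelow, Finset.inter_comm, ← Finset.filter_mem_eq_inter, Finset.sum_filter]
  rw [h, sum_strictlyBelow]
  simp only [h]

theorem weightBelow_eq_of_disjoint {w : Fin n → ℤ} {E : Finset (Fin n)} {v : Fin n}
    (hE : ∀ u ∈ T.kids v, u ∉ E) :
    T.weightBelow w E v = ∑ u ∈ T.kids v, T.weightBelow w E u := by
  rw [weightBelow_eq]
  refine Finset.sum_congr rfl fun u hu => ?_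
  rw [if_neg (hE u hu), zero_add]

theorem weightBelow_eq_of_mem {w : Fin n → ℤ} {E : Finset (Fin n)} {v u : Fin n}
    (hu : u ∈ T.kids v) (huE : u ∈ E) (hE : ∀ u' ∈ T.kids v, u' ∈ E → u' = u) :
    T.weightBelow w E v = (w u : WithBot ℤ) + T.weightBelow w E u +
      ∑ y ∈ (T.kids v).erase u, T.weightBelow w E y := by
  rw [weightBelow_eq, ← Finset.add_sum_erase _ _ hu, if_pos huE]
  congr 1
  refine Finset.sum_congr rfl fun y hy => ?_
  obtain ⟨h1, h2⟩ := Finset.mem_erase.1 hy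
  rw [if_neg fun h => h1 (hE y h2 h), zero_add]

variable (T) in
/-- `f` and `g` solve the dynamic program for maximum weight matchings. -/
def IsMatchingTable (w : Fin n → ℤ) (f g : Fin n → WithBot ℤ) : Prop :=
  ∀ v, g v = ∑ u ∈ T.kids v, f u ∧
    f v = max (∑ u ∈ T.kids v, f u)
      ((T.kids v).sup fun u => (w u : WithBot ℤ) + g u + ∑ y ∈ (T.kids v).erase u, f y)

/-- If no child of `v` is in `E`, the weight splits over the children. Otherwise exactly one child
`u` is matched to `v`; then no child of `u` is in `E`, so the bound with `g u` applies there. -/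
theorem IsMatchingTable.weightBelow_le {w : Fin n → ℤ} {f g : Fin n → WithBot ℤ}
    (h : T.IsMatchingTable w f g) {E : Finset (Fin n)} (hE : T.MatchingSet E) (v : Fin n) :
    T.weightBelow w E v ≤ f v ∧
      ((∀ u ∈ T.kids v, u ∉ E) → T.weightBelow w E v ≤ g v) := by
  refine induction_kids (T := T) (Q := fun v => T.weightBelow w E v ≤ f v ∧
    ((∀ u ∈ T.kids v, u ∉ E) → T.weightBelow w E v ≤ g v)) (fun v ih => ?_) v
  obtain ⟨hg, hf⟩ := h v
  have h1 : (∀ u ∈ T.kids v, u ∉ E) → T.weightBelow w E v ≤ ∑ u ∈ T.kids v, f u := by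
    intro hd
    rw [weightBelow_eq_of_disjoint hd]
    exact Finset.sum_le_sum fun u hu => (ih u hu).1
  refine ⟨?_, fun hd => hg ▸ h1 hd⟩
  rw [hf]
  by_cases hd : ∀ u ∈ T.kids v, u ∉ E
  · exact le_max_of_le_left (h1 hd)
  · push Not at hd
    obtain ⟨u, hu, huE⟩ := hd
    refine le_max_of_le_right (le_trans ?_ (Finset.le_sup hu))
    rw [weightBelow_eq_of_mem hu huE fun u' hu' h' => hE.injOn u' h' u huE
      ((mem_kids.1 hu').2.trans (mem_kids.1 hu).2.symm)]
    refine add_le_add (add_le_add le_rfl ((ih u hu).2 fun x hx hxE => ?_))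
      (Finset.sum_le_sum fun y hy => (ih y (Finset.mem_of_mem_erase hy)).1)
    exact hE.par_notMem x hxE ((mem_kids.1 hx).2 ▸ huE)

theorem IsMatchingTable.exists_matchingSet {w : Fin n → ℤ} {f g : Fin n → WithBot ℤ}
    (h : T.IsMatchingTable w f g) (v : Fin n) :
    (∃ E, T.MatchingSet E ∧ E ⊆ T.strictlyBelow v ∧ T.weightBelow w E v = f v) ∧
    ∃ E, T.MatchingSet E ∧ E ⊆ T.strictlyBelow v ∧ Disjoint E (T.kids v) ∧
      T.weightBelow w E v = g v := by
  refine induction_kids (T := T) (Q := fun v =>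
    (∃ E, T.MatchingSet E ∧ E ⊆ T.strictlyBelow v ∧ T.weightBelow w E v = f v) ∧
    ∃ E, T.MatchingSet E ∧ E ⊆ T.strictlyBelow v ∧ Disjoint E (T.kids v) ∧
      T.weightBelow w E v = g v) (fun v ih => ?_) v
  obtain ⟨hg, hf⟩ := h v
  choose! F hF using fun u hu => (ih u hu).1
  have hw : ∀ {E E' : Finset (Fin n)} {u : Fin n}, E ∩ T.strictlyBelow u = E' →
      E' ⊆ T.strictlyBelow u → T.weightBelow w E u = T.weightBelow w E' u := by
    intro E E' u h1 h2
    rw [weightBelow, weightBelow, h1, Finset.inter_eq_left.2 h2]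
  have h0 : ∃ E, T.MatchingSet E ∧ E ⊆ T.strictlyBelow v ∧ Disjoint E (T.kids v) ∧
      T.weightBelow w E v = ∑ u ∈ T.kids v, f u := by
    obtain ⟨h1, h2, h3⟩ := matchingSet_join (F := F) (Finset.empty_subset (T.kids v)) (by simp)
      (fun u hu => ⟨(hF u hu).1, (hF u hu).2.1⟩) (by simp)
    have h4 : ∀ u ∈ T.kids v, u ∉ ∅ ∪ (T.kids v).biUnion F := fun u hu h' => by
      simpa using (h3 u hu).1.1 h'
    refine ⟨_, h1, h2, Finset.disjoint_right.2 h4, ?_⟩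
    rw [weightBelow_eq_of_disjoint h4]
    refine Finset.sum_congr rfl fun u hu => ?_
    rw [hw (h3 u hu).2 (hF u hu).2.1, (hF u hu).2.2]
  refine ⟨?_, hg ▸ h0⟩
  rcases max_choice (∑ u ∈ T.kids v, f u) ((T.kids v).sup fun u =>
    (w u : WithBot ℤ) + g u + ∑ y ∈ (T.kids v).erase u, f y) with hm | hm
  · rw [hf, hm]
    obtain ⟨E, h1, h2, -, h3⟩ := h0
    exact ⟨E, h1, h2, h3⟩
  · rcases (T.kids v).eq_empty_or_nonempty with he | hne
    · rw [he, Finset.sup_empty, Finset.sum_empty] at hm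
      exact absurd hm (by simp)
    obtain ⟨u, hu, hsup⟩ := Finset.exists_mem_eq_sup _ hne fun u =>
      (w u : WithBot ℤ) + g u + ∑ y ∈ (T.kids v).erase u, f y
    obtain ⟨G, hG1, hG2, hG3, hG4⟩ := (ih u hu).2
    -- Below the child that is matched to `v`, the optimal matching is replaced by one that leaves
    -- this child unmatched.
    set F' := Function.update F u G with hF'
    have hu' : F' u = G := Function.update_self ..
    have hne' : ∀ y, y ≠ u → F' y = F y := fun y hy => Function.update_of_ne hy ..
    obtain ⟨h1, h2, h3⟩ := matchingSet_join (F := F') (v := v) (I := {u}) (by simpa using hu)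
      (by simp) (fun y hy => by
        by_cases e : y = u
        · rw [e, hu']
          exact ⟨hG1, hG2⟩
        · rw [hne' y e]
          exact ⟨(hF y hy).1, (hF y hy).2.1⟩) (by simpa [hu'] using hG3)
    refine ⟨_, h1, h2, ?_⟩
    rw [hf, hm, hsup, weightBelow_eq_of_mem hu ((h3 u hu).1.2 (by simp))
      fun y hy hyE => by simpa using (h3 y hy).1.1 hyE]
    congr 1
    · rw [hw ((h3 u hu).2.trans hu') hG2, hG4]
    · refine Finset.sum_congr rfl fun y hy => ?_
      obtain ⟨hyu, hy⟩ := Finset.mem_erase.1 hy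
      rw [hw ((h3 y hy).2.trans (hne' y hyu)) (hF y hy).2.1, (hF y hy).2.2]

/-! ### Matchings as subgraphs -/

theorem adj_iff {u v : Fin n} : T.graph.Adj u v ↔ u ≠ v ∧ (T.par u = v ∨ T.par v = u) :=
  SimpleGraph.fromRel_adj _ _ _

theorem par_par_ne {u : Fin n} (hu : u ≠ T.root) : T.par (T.par u) ≠ u := by
  intro e
  exact not_inSubtree_par (mem_kids.2 ⟨hu, rfl⟩) ⟨1, e⟩

theorem par_ne {u : Fin n} (hu : u ≠ T.root) : T.par u ≠ u := by
  intro e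
  exact not_inSubtree_par (mem_kids.2 ⟨hu, rfl⟩) ⟨0, e⟩

open scoped Classical in
-- Partners are unique: two vertices with the same parent compete for it, and a vertex matched
-- upwards cannot also be matched to a child. The loop at the root is not an edge.
theorem matchingSet_of_isMatching {H : T.graph.Subgraph} (hH : H.IsMatching) :
    T.MatchingSet (Finset.univ.filter fun u => H.Adj u (T.par u)) := by
  have hne : ∀ {u}, H.Adj u (T.par u) → u ≠ T.root := by
    rintro u hu rfl
    exact hu.ne T.par_root.symm
  refine ⟨fun u hu => hne (Finset.mem_filter.1 hu).2, fun u hu hp => ?_, fun u hu u' hu' e => ?_⟩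
  · have h1 := (Finset.mem_filter.1 hu).2
    have h2 := (Finset.mem_filter.1 hp).2
    exact par_par_ne (hne h1) (hH.eq_of_adj_left h2 h1.symm)
  · have h1 := (Finset.mem_filter.1 hu).2
    have h2 := (Finset.mem_filter.1 hu').2
    rw [← e] at h2
    exact hH.eq_of_adj_left h1.symm h2.symm

open scoped Classical in
theorem coe_weight_eq {w : Fin n → ℤ} {H : T.graph.Subgraph} {v : Fin n}
    (h : (Finset.univ.filter fun u => H.Adj u (T.par u)) ⊆ T.strictlyBelow v) :
    (T.weight w H : WithBot ℤ) =
      T.weightBelow w (Finset.univ.filter fun u => H.Adj u (T.par u)) v := by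
  rw [weightBelow, Finset.inter_eq_left.2 h, weight, WithBot.coe_sum]

/-- The subgraph with the edges from the vertices in `E` to their parents. -/
def MatchingSet.subgraph {E : Finset (Fin n)} (hE : T.MatchingSet E) : T.graph.Subgraph where
  verts := {x | x ∈ E ∨ ∃ u ∈ E, T.par u = x}
  Adj x y := (x ∈ E ∧ T.par x = y) ∨ (y ∈ E ∧ T.par y = x)
  adj_sub := by
    rintro x y (⟨hx, rfl⟩ | ⟨hy, rfl⟩)
    · exact adj_iff.2 ⟨(par_ne (hE.ne_root x hx)).symm, Or.inl rfl⟩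
    · exact adj_iff.2 ⟨par_ne (hE.ne_root y hy), Or.inr rfl⟩
  edge_vert := by
    rintro x y (⟨hx, rfl⟩ | ⟨hy, rfl⟩)
    · exact Or.inl hx
    · exact Or.inr ⟨y, hy, rfl⟩
  symm := ⟨fun _ _ h => h.symm⟩

theorem MatchingSet.isMatching_subgraph {E : Finset (Fin n)} (hE : T.MatchingSet E) :
    hE.subgraph.IsMatching := by
  rintro x (hx | ⟨u, hu, rfl⟩)
  · refine ⟨T.par x, Or.inl ⟨hx, rfl⟩, ?_⟩
    rintro y (⟨-, rfl⟩ | ⟨hy, rfl⟩)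
    · rfl
    · exact (hE.par_notMem y hy hx).elim
  · refine ⟨u, Or.inr ⟨hu, rfl⟩, ?_⟩
    rintro y (⟨hy, -⟩ | ⟨hy, e⟩)
    · exact (hE.par_notMem u hu hy).elim
    · exact hE.injOn y hy u hu e

open scoped Classical in
theorem MatchingSet.filter_adj_subgraph {E : Finset (Fin n)} (hE : T.MatchingSet E) :
    (Finset.univ.filter fun u => hE.subgraph.Adj u (T.par u)) = E := by
  ext u
  rw [Finset.mem_filter, and_iff_right (Finset.mem_univ u)]
  constructor
  · rintro (⟨h, -⟩ | ⟨h, e⟩)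
    · exact h
    · have hr : u ≠ T.root := by
        rintro rfl
        exact hE.ne_root _ h T.par_root
      exact (par_par_ne hr e).elim
  · exact fun h => Or.inl ⟨h, rfl⟩

/-- Both directions pass through the set of vertices matched to their parents. For `g`, the vertex
`v` is unmatched exactly if no child of `v` is in this set. -/
theorem IsMatchingTable.isGreatest {w : Fin n → ℤ} {f g : Fin n → WithBot ℤ}
    (h : T.IsMatchingTable w f g) (v : Fin n) :
    IsGreatest {x : WithBot ℤ | ∃ H : T.graph.Subgraph, H.IsMatching ∧
      (∀ u ∈ H.verts, T.InSubtree v u) ∧ x = (T.weight w H : WithBot ℤ)} (f v) ∧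
    IsGreatest {x : WithBot ℤ | ∃ H : T.graph.Subgraph, H.IsMatching ∧
      (∀ u ∈ H.verts, T.InSubtree v u ∧ u ≠ v) ∧ x = (T.weight w H : WithBot ℤ)} (g v) := by
  classical
  obtain ⟨⟨E, hE, hEv, hEf⟩, E', hE', hEv', hd, hEg⟩ := h.exists_matchingSet v
  have hverts : ∀ {E : Finset (Fin n)} (hE : T.MatchingSet E), E ⊆ T.strictlyBelow v →
      ∀ u ∈ hE.subgraph.verts, T.InSubtree v u := by
    rintro E hE hEv u (hu | ⟨u, hu, rfl⟩)
    · exact (mem_strictlyBelow_iff.1 (hEv hu)).2.trans (inSubtree_par u)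
    · exact (mem_strictlyBelow_iff.1 (hEv hu)).2
  have hwt : ∀ {E : Finset (Fin n)} (hE : T.MatchingSet E), E ⊆ T.strictlyBelow v →
      T.weightBelow w E v = (T.weight w hE.subgraph : WithBot ℤ) := by
    intro E hE hEv
    rw [coe_weight_eq (v := v) (by rwa [hE.filter_adj_subgraph]), hE.filter_adj_subgraph]
  have hsub : ∀ {H : T.graph.Subgraph}, H.IsMatching → (∀ u ∈ H.verts, T.InSubtree v u) →
      (Finset.univ.filter fun u => H.Adj u (T.par u)) ⊆ T.strictlyBelow v := by
    intro H hH hv u hu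
    exact mem_strictlyBelow_iff.2 ⟨(matchingSet_of_isMatching hH).ne_root u hu,
      hv _ (Finset.mem_filter.1 hu).2.snd_mem⟩
  refine ⟨⟨⟨hE.subgraph, hE.isMatching_subgraph, hverts hE hEv, ?_⟩, ?_⟩,
    ⟨⟨hE'.subgraph, hE'.isMatching_subgraph, fun u hu => ⟨hverts hE' hEv' u hu, ?_⟩, ?_⟩, ?_⟩⟩
  · rw [← hEf, hwt hE hEv]
  · rintro x ⟨H, hH, hv, rfl⟩
    rw [coe_weight_eq (hsub hH hv)]
    exact (h.weightBelow_le (matchingSet_of_isMatching hH) v).1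
  · rintro rfl
    rcases hu with hu | ⟨x, hx, rfl⟩
    · exact notMem_strictlyBelow _ (hEv' hu)
    · exact Finset.disjoint_left.1 hd hx (mem_kids.2 ⟨hE'.ne_root x hx, rfl⟩)
  · rw [← hEg, hwt hE' hEv']
  · rintro x ⟨H, hH, hv, rfl⟩
    rw [coe_weight_eq (hsub hH fun u hu => (hv u hu).1)]
    refine (h.weightBelow_le (matchingSet_of_isMatching hH) v).2 fun u hu huE => ?_
    exact (hv _ (Finset.mem_filter.1 huE).2.snd_mem).2 (mem_kids.1 hu).2

/-- The dynamic program for degree-weighted trees extends the one for matchings. -/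
theorem isMatchingTable_of_isTable {w : Fin n → ℤ} {c c' : (T.toDW w).Node → WithBot ℤ}
    (h : (T.toDW w).IsTable c c') :
    T.IsMatchingTable w (fun v => c ((T.toDW w).top v)) (fun v => c' ((T.toDW w).top v)) := by
  have htop : ∀ y : (T.toDW w).Node, (T.toDW w).top y.1 = y := by
    rintro ⟨v, i⟩
    exact congrArg (Sigma.mk v) (Fin.ext (Nat.lt_one_iff.1 i.isLt).symm)
  have hdata : ∀ y : (T.toDW w).Node, (T.toDW w).data y =
      ⟨0, 0, 0, ![(w y.1 : WithBot ℤ), ⊥, ⊥, 0]⟩ := by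
    intro y
    rw [← htop y]
    rfl
  have hinj : Function.Injective (T.toDW w).top := fun u v e => congrArg Sigma.fst e
  have hkids : ∀ v, (T.toDW w).children ((T.toDW w).top v) =
      (T.kids v).map ⟨(T.toDW w).top, hinj⟩ := by
    intro v
    ext y
    have h2 : y.2.val = 0 := Nat.lt_one_iff.1 y.2.isLt
    simp only [DWTree.children, Finset.mem_filter, Finset.mem_univ, true_and, DWTree.IsChild, h2,
      lt_irrefl, false_and, false_or, Finset.mem_map, Function.Embedding.coeFn_mk, mem_kids, hdata]
    constructor
    · rintro ⟨h3, h4, -⟩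
      exact ⟨y.1, ⟨h3, h4.symm⟩, htop y⟩
    · rintro ⟨u, ⟨h3, h4⟩, rfl⟩
      exact ⟨h3, h4.symm, rfl⟩
  have hfree : ∀ u, (T.toDW w).free c c' ((T.toDW w).top u) = c ((T.toDW w).top u) := by
    intro u
    simp [DWTree.free, hdata]
  have hused : ∀ u, (T.toDW w).used c c' ((T.toDW w).top u) =
      (w u : WithBot ℤ) + c' ((T.toDW w).top u) := by
    intro u
    simp [DWTree.used, hdata, DWTree.top]
  intro v
  obtain ⟨h1, h2⟩ := h ((T.toDW w).top v)
  have herase : ∀ u, ((T.kids v).map ⟨(T.toDW w).top, hinj⟩).erase ((T.toDW w).top u) =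
      ((T.kids v).erase u).map ⟨(T.toDW w).top, hinj⟩ := fun u => (Finset.map_erase _ _ u).symm
  simp only [hdata, hkids, Finset.sum_map, Finset.sup_map, Function.Embedding.coeFn_mk, hfree,
    WithBot.coe_zero, zero_add, max_self, Function.comp_def, hused, herase] at h1 h2
  exact ⟨h1, h2⟩

end RTree

/-! ### The main theorem. -/

theorem mainTheorem5 :
    (∃ c₀ : ℝ, ∀ ε : ℝ, 0 < ε → ε < 1 → ∀ κ k₀ γ : ℕ, ∃ C k : ℕ, ∀ n M : ℕ,
      ∃ R P S B : ℕ,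
        (R : ℝ) ≤ c₀ / ε ^ 3 ∧
        (S : ℝ) ≤ C * (n : ℝ) ^ ε ∧
        P * S ≤ C * n * (Nat.log 2 n + 1) ^ k ∧
        B ≤ (n + M + 1) ^ C ∧
        ∃ A : AMPC R P S B, ∀ T : DWTree n, T.DimLE κ k₀ → T.WeightLE M →
          1 - 1 / ((n : ℝ) + 1) ^ γ ≤ A.prob T.input T.Solved) ∧
    (∀ (n : ℕ) (T : RTree n) (w : Fin n → ℤ) (c c' : (T.toDW w).Node → WithBot ℤ),
      (T.toDW w).IsTable c c' → ∀ v : Fin n,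
        IsGreatest {x : WithBot ℤ | ∃ H : T.graph.Subgraph, H.IsMatching ∧
          (∀ u ∈ H.verts, T.InSubtree v u) ∧ x = (T.weight w H : WithBot ℤ)}
          (c ((T.toDW w).top v)) ∧
        IsGreatest {x : WithBot ℤ | ∃ H : T.graph.Subgraph, H.IsMatching ∧
          (∀ u ∈ H.verts, T.InSubtree v u ∧ u ≠ v) ∧ x = (T.weight w H : WithBot ℤ)}
          (c' ((T.toDW w).top v))) :=
  ⟨⟨15, fun _ h0 h1 κ k₀ γ => exists_matching_algorithm h0 h1 κ k₀ γ⟩,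
    fun _ _ _ _ _ h v => (RTree.isMatchingTable_of_isTable h).isGreatest v⟩
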